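/- Conventions. Graphs are finite and undirected, and edges may occur with multiplicity ($|E|$ counts multiplicities). A \emph{two-terminal graph} is a graph with two distinct nodes, its source and its sink. The \emph{series composition} of two-terminal graphs $X_1,\dots,X_k$ ($k\ge 2$) merges the sink of $X_i$ with the source of $X_{i+1}$ for $1\le i<k$, and its terminals are the source of $X_1$ and the sink of $X_k$; the \emph{parallel composition} merges all sources into the source and all sinks into the sink. A graph is \emph{series-parallel} if, for some choice of two terminals, it can be built from single edges (with their two ends as terminals) by series and parallel compositions. An \emph{SP-tree} of a series-parallel graph $G$ is a rooted ordered tree whose nodes correspond to two-terminal subgraphs of $G$ and whose root corresponds to $G$: every leaf ($L$-node) corresponds to a path with $k\ge 1$ edges (and stores its node sequence), and every inner node is an $S$-node ($P$-node), corresponding to the series (parallel) composition of the $\ge 2$ graphs of its children, for $S$-nodes in the order of the children. It is \emph{minimal} if all children of an $S$-node are $P$- or $L$-nodes, at least one of them a $P$-node, and all children of a $P$-node are $S$- or $L$-nodes. The \emph{series-parallel graph arrangement algorithm} (SPGAA) computes from a minimal SP-tree $T$ of $G=(V,E)$ a linear arrangement $\pi\colon V\to\{1,\dots,|V|\}$ (a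 bijection), by ordering recursively the nodes of the component of each tree node, with the source first and the sink second: \begin{itemize} \item a path with nodes $1,\dots,k$ is ordered $1,k,2,k-1,3,k-2,\dots$; \item a parallel component with source $u$ and sink $v$ is ordered $u,v,S_1^-,\dots,S_m^-$, where $S_1,\dots,S_m$ are its child components, numbered so that $S_m$ has a largest number of nodes, and $S_i^-$ is the computed order of $S_i$ without its two terminals; \item a series component with source $u$, sink $v$ and child components $P_1,\dots,P_m$, of which $P_a$ has a largest number of nodes, is ordered $u,v,B_1,\dots,B_{a-1},\overline{B_m},\overline{B_{m-1}},\dots,\overline{B_{a+1}},B_a$, where $B_1$ is the computed order of $P_1$ without its terminals, $B_i$ for $i\ge 2$ is the computed order of $P_i$ without its sink, and the bar denotes reversal. \end{itemize} Running times are numbers of steps of a random-access machine (assignments, addition, truncated subtraction, multiplication, integer division, indirect memory access, tests; one step each) with words of $O(\log(|E|+2))$ bits; the nodes of $G$ are $0,\dots,|V|-1$. \textbf{Theorem.} (1) There is a random-access machine program that, for every series-parallel graph $G=(V,E)$ and every minimal SP-tree $T$ of $G$, given $T$ (in postorder encoding), computes in time $O(|E|)$ a linear arrangement of $G$ that is a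 result of SPGAA on $T$. (2) There is a random-access machine program that, for every series-parallel graph $G=(V,E)$, given only $G$ (as a list of edges), computes a minimal SP-tree $T$ of $G$ and a linear arrangement of $G$ that is a result of SPGAA on $T$, in time $O(|E|\log|E|)$ (that is, at most $C\,|E|\log|E|$ steps whenever $|E|\ge 2$). The constants do not depend on $G$ or $T$. -/

import Mathlib

/-! ## Graphs and series-parallel graphs -/

/-- A finite undirected graph `(V, E)`. Edges are unordered pairs and may occur with multiplicity
(a parallel composition of two single edges is a double edge); a simple graph is the case in which
`edges` has no duplicates. -/
@[ext]
structure MGraph (α : Type) where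
  verts : Finset α
  edges : Multiset (Sym2 α)
  incidence : ∀ e ∈ edges, ∀ v ∈ e, v ∈ verts

/-- A two-terminal graph: a graph with two distinct nodes, the source and the sink. -/
@[ext]
structure TTGraph (α : Type) extends MGraph α where
  src : α
  snk : α
  src_mem : src ∈ verts
  snk_mem : snk ∈ verts
  src_ne_snk : src ≠ snk

/-- `G` consists of a single edge joining its two terminals. -/
structure IsSingleEdge {α : Type} (G : TTGraph α) : Prop where
  verts : ∀ x, x ∈ G.verts ↔ x = G.src ∨ x = G.snk
  edges : G.edges = {s(G.src, G.snk)}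

/-- `G` is the series composition of its subgraphs `Xs = [X₁, …, Xₖ]`, `k ≥ 2`: the union of
the `Xᵢ` (with edges counted with multiplicity), where the sink of `Xᵢ` is the source of `Xᵢ₊₁` and
the `Xᵢ` have no other node in common. -/
structure IsSeriesComp {α : Type} (Xs : List (TTGraph α)) (G : TTGraph α) : Prop where
  two_le : 2 ≤ Xs.length
  merge : ∀ (i : ℕ) (h : i + 1 < Xs.length), Xs[i].snk = Xs[i + 1].src
  inter : ∀ (i j : ℕ) (hij : i < j) (hj : j < Xs.length) (x : α),
    x ∈ Xs[i].verts → x ∈ Xs[j].verts → j = i + 1 ∧ x = Xs[i].snk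
  src : Xs.head?.map TTGraph.src = some G.src
  snk : Xs.getLast?.map TTGraph.snk = some G.snk
  verts : ∀ x, x ∈ G.verts ↔ ∃ X ∈ Xs, x ∈ X.verts
  edges : G.edges = (Xs.map fun X => X.edges).sum

/-- `G` is the parallel composition of its subgraphs `Xs = [X₁, …, Xₖ]`, `k ≥ 2`: the union of
the `Xᵢ` (with edges counted with multiplicity), where all `Xᵢ` have the terminals of `G` and have
no other node in common. -/
structure IsParallelComp {α : Type} (Xs : List (TTGraph α)) (G : TTGraph α) : Prop where
  two_le : 2 ≤ Xs.length
  terminals : ∀ X ∈ Xs, X.src = G.src ∧ X.snk = G.snk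
  inter : Xs.Pairwise fun X Y => ∀ x, x ∈ X.verts → x ∈ Y.verts → x = G.src ∨ x = G.snk
  verts : ∀ x, x ∈ G.verts ↔ ∃ X ∈ Xs, x ∈ X.verts
  edges : G.edges = (Xs.map fun X => X.edges).sum

/-- Two-terminal series-parallel graphs. -/
inductive IsTTSP {α : Type} : TTGraph α → Prop
  | edge (G : TTGraph α) (h : IsSingleEdge G) : IsTTSP G
  | series (Xs : List (TTGraph α)) (G : TTGraph α) (hXs : ∀ X ∈ Xs, IsTTSP X)
      (h : IsSeriesComp Xs G) : IsTTSP G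
  | parallel (Xs : List (TTGraph α)) (G : TTGraph α) (hXs : ∀ X ∈ Xs, IsTTSP X)
      (h : IsParallelComp Xs G) : IsTTSP G

/-- A graph is series-parallel if, for some choice of two terminals, it is a two-terminal
series-parallel graph. -/
def MGraph.IsSeriesParallel {α : Type} (G : MGraph α) : Prop :=
  ∃ X : TTGraph α, X.toMGraph = G ∧ IsTTSP X

/-! ## SP-trees -/

/-- Rooted ordered trees with `L`-, `S`- and `P`-nodes. A leaf carries the node sequence
`v₀, …, vₖ` of the path with `k` edges that it corresponds to. -/
inductive SPTree (α : Type) : Type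
  | leaf (path : List α) : SPTree α
  | series (children : List (SPTree α)) : SPTree α
  | parallel (children : List (SPTree α)) : SPTree α

namespace SPTree

/-- `G` is a path with at least one edge and node sequence `p`, from its source to its sink. -/
structure IsPathOf {α : Type} (p : List α) (G : TTGraph α) : Prop where
  two_le : 2 ≤ p.length
  nodup : p.Nodup
  src : p.head? = some G.src
  snk : p.getLast? = some G.snk
  verts : ∀ x, x ∈ G.verts ↔ x ∈ p
  edges : G.edges = (List.zipWith (fun u v => s(u, v)) p p.tail : List (Sym2 α))

/-- The root of the tree corresponds to the two-terminal graph `G` (and every other node to a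
two-terminal subgraph of `G`): leaves correspond to paths, `S`-nodes (`P`-nodes) to the series
(parallel) composition of the graphs of their children, in the order of the children. -/
inductive Represents {α : Type} : SPTree α → TTGraph α → Prop
  | leaf (p : List α) (G : TTGraph α) (h : IsPathOf p G) : Represents (leaf p) G
  | series (ts : List (SPTree α)) (Xs : List (TTGraph α)) (G : TTGraph α)
      (hlen : ts.length = Xs.length) (hts : ∀ q ∈ ts.zip Xs, Represents q.1 q.2)
      (h : IsSeriesComp Xs G) : Represents (series ts) G
  | parallel (ts : List (SPTree α)) (Xs : List (TTGraph α)) (G : TTGraph α)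
      (hlen : ts.length = Xs.length) (hts : ∀ q ∈ ts.zip Xs, Represents q.1 q.2)
      (h : IsParallelComp Xs G) : Represents (parallel ts) G

/-- The tree is an SP-tree of the graph `G`. -/
def IsSPTreeOf {α : Type} (T : SPTree α) (G : MGraph α) : Prop :=
  ∃ X : TTGraph α, X.toMGraph = G ∧ T.Represents X

/-- The root is an `S`-node. -/
def IsS {α : Type} (T : SPTree α) : Prop := ∃ ts, T = series ts

/-- The root is a `P`-node. -/
def IsP {α : Type} (T : SPTree α) : Prop := ∃ ts, T = parallel ts

/-- The root is an `L`-node. -/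
def IsL {α : Type} (T : SPTree α) : Prop := ∃ p, T = leaf p

/-- Minimality: all children of an `S`-node are `P`- or `L`-nodes, at least one of them a `P`-node,
and all children of a `P`-node are `S`- or `L`-nodes. -/
inductive Minimal {α : Type} : SPTree α → Prop
  | leaf (p : List α) : Minimal (leaf p)
  | series (ts : List (SPTree α)) (hts : ∀ t ∈ ts, Minimal t)
      (h : ∀ t ∈ ts, t.IsP ∨ t.IsL) (hP : ∃ t ∈ ts, t.IsP) : Minimal (series ts)
  | parallel (ts : List (SPTree α)) (hts : ∀ t ∈ ts, Minimal t)
      (h : ∀ t ∈ ts, t.IsS ∨ t.IsL) : Minimal (parallel ts)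

/-- The tree is a minimal SP-tree of the graph `G`. -/
def IsMinimalSPTreeOf {α : Type} (T : SPTree α) (G : MGraph α) : Prop :=
  T.IsSPTreeOf G ∧ T.Minimal

end SPTree

/-! ## The series-parallel graph arrangement algorithm -/

/-- A linear arrangement of `G = (V, E)`, `n = |V|`: a bijection from `V` to `{1, …, n}`. -/
abbrev LinearArrangement {α : Type} (G : MGraph α) : Type :=
  {v // v ∈ G.verts} ≃ {i // i ∈ Finset.Icc 1 G.verts.card}

/-- The order `1, k, 2, k-1, 3, k-2, …` of a sequence with entries `1, …, k`. -/
def zigzag {α : Type} : List α → List α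
  | [] => []
  | a :: l => a :: zigzag l.reverse
termination_by l => l.length

/-- The nodes that the child components `P₁, …, Pₘ` of a series component contribute, given their
arrangements (source first, sink second): `P₁` gives up both terminals, every other `Pᵢ` keeps its
source and gives up its sink. -/
def seriesBlocks {α : Type} : List (List α) → List (List α)
  | [] => []
  | x :: xs => x.drop 2 :: xs.map fun y => y.eraseIdx 1

/-- The order `B₁, …, B_{a-1}, Bₘ, …, B_{a+1}, B_a` of the blocks `B₁, …, Bₘ`, where
`Bₘ, …, B_{a+1}` are flipped. The index `a` is zero-based in the code. -/
def seriesOrder {α : Type} (B : List (List α)) (a : ℕ) : List α :=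
  (B.take a).flatten ++ ((B.drop (a + 1)).reverse.map List.reverse).flatten ++ B.getD a []

/-- `SPGAAOrder T l`: on the tree `T`, the algorithm can place the nodes in the order `l`, from left
to right. It is a relation, as the algorithm may select any biggest child component (with respect to
the number of nodes), and may take the other children of a parallel component in any order. -/
inductive SPGAAOrder {α : Type} : SPTree α → List α → Prop
  | leaf (p : List α) : SPGAAOrder (.leaf p) (zigzag p)
  | parallel (ts : List (SPTree α)) (X : TTGraph α) (hX : (SPTree.parallel ts).Represents X)
      (as : List (List α)) (hlen : ts.length = as.length)
      (has : ∀ q ∈ ts.zip as, SPGAAOrder q.1 q.2)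
      (bs : List (List α)) (b : List α) (hperm : as.Perm (bs ++ [b]))
      (hmax : ∀ x ∈ as, x.length ≤ b.length) :
      SPGAAOrder (.parallel ts)
        (X.src :: X.snk :: ((bs ++ [b]).map fun x => x.drop 2).flatten)
  | series (ts : List (SPTree α)) (X : TTGraph α) (hX : (SPTree.series ts).Represents X)
      (as : List (List α)) (hlen : ts.length = as.length)
      (has : ∀ q ∈ ts.zip as, SPGAAOrder q.1 q.2)
      (a : ℕ) (ha : a < as.length) (hmax : ∀ x ∈ as, x.length ≤ as[a].length) :
      SPGAAOrder (.series ts) (X.src :: X.snk :: seriesOrder (seriesBlocks as) a)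

/-- `π` is a linear arrangement computed by the algorithm on the tree `T`. -/
def IsSPGAAArrangement {α : Type} {G : MGraph α} (T : SPTree α) (π : LinearArrangement G) : Prop :=
  ∃ l : List α, SPGAAOrder T l ∧ l.length = G.verts.card ∧
    ∀ v : {v // v ∈ G.verts}, l[(π v : ℕ) - 1]? = some (v : α)

/-! ## Random-access machines -/

namespace RAM

/-- The arithmetic operations; `sub` is truncated at `0`, `div` rounds down. -/
inductive Op
  | add | sub | mul | div

/-- The value of an arithmetic operation. -/
def Op.eval : Op → ℕ → ℕ → ℕ
  | add, a, b => a + b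
  | sub, a, b => a - b
  | mul, a, b => a * b
  | div, a, b => a / b

/-- Programs of a random-access machine. Registers are numbered by natural numbers, and a program
mentions only finitely many of them. -/
inductive Prog
  /-- do nothing -/
  | skip : Prog
  /-- `r_x := c` -/
  | const (x c : ℕ) : Prog
  /-- `r_x := r_y o r_z` -/
  | arith (o : Op) (x y z : ℕ) : Prog
  /-- `r_x := mem[r_y]` -/
  | load (x y : ℕ) : Prog
  /-- `mem[r_x] := r_y` -/
  | store (x y : ℕ) : Prog
  /-- sequential composition -/
  | seq (p q : Prog) : Prog
  /-- if `r_x ≠ 0` then `p` else `q` -/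
  | ite (x : ℕ) (p q : Prog) : Prog
  /-- while `r_x ≠ 0` do `p` -/
  | loop (x : ℕ) (p : Prog) : Prog

/-- The contents of the registers and of the memory. -/
@[ext]
structure State where
  reg : ℕ → ℕ
  mem : ℕ → ℕ

/-- Set the register `x` to `v`. -/
def State.setReg (σ : State) (x v : ℕ) : State := { σ with reg := Function.update σ.reg x v }

/-- Set the memory cell `i` to `v`. -/
def State.setMem (σ : State) (i v : ℕ) : State := { σ with mem := Function.update σ.mem i v }

/-- `Exec W p σ t τ`: started in the state `σ`, the program `p` halts in the state `τ` after exactly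
`t` steps, and every value that it computes or accesses, including addresses, is smaller
than `W`. Every assignment, every memory access and every test is one step. -/
inductive Exec (W : ℕ) : Prog → State → ℕ → State → Prop
  | skip (σ : State) : Exec W .skip σ 1 σ
  | const (x c : ℕ) (σ : State) (h : c < W) : Exec W (.const x c) σ 1 (σ.setReg x c)
  | arith (o : Op) (x y z : ℕ) (σ : State) (h : o.eval (σ.reg y) (σ.reg z) < W) :
      Exec W (.arith o x y z) σ 1 (σ.setReg x (o.eval (σ.reg y) (σ.reg z)))
  | load (x y : ℕ) (σ : State) (ha : σ.reg y < W) (h : σ.mem (σ.reg y) < W) :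
      Exec W (.load x y) σ 1 (σ.setReg x (σ.mem (σ.reg y)))
  | store (x y : ℕ) (σ : State) (ha : σ.reg x < W) (h : σ.reg y < W) :
      Exec W (.store x y) σ 1 (σ.setMem (σ.reg x) (σ.reg y))
  | seq (p q : Prog) (σ τ υ : State) (s t : ℕ) (hp : Exec W p σ s τ) (hq : Exec W q τ t υ) :
      Exec W (.seq p q) σ (s + t) υ
  | ite_true (x : ℕ) (p q : Prog) (σ τ : State) (t : ℕ) (hx : σ.reg x ≠ 0)
      (hp : Exec W p σ t τ) : Exec W (.ite x p q) σ (t + 1) τ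
  | ite_false (x : ℕ) (p q : Prog) (σ τ : State) (t : ℕ) (hx : σ.reg x = 0)
      (hq : Exec W q σ t τ) : Exec W (.ite x p q) σ (t + 1) τ
  | loop_true (x : ℕ) (p : Prog) (σ τ υ : State) (s t : ℕ) (hx : σ.reg x ≠ 0)
      (hp : Exec W p σ s τ) (hl : Exec W (.loop x p) τ t υ) :
      Exec W (.loop x p) σ (s + t + 1) υ
  | loop_false (x : ℕ) (p : Prog) (σ : State) (hx : σ.reg x = 0) : Exec W (.loop x p) σ 1 σ

/-- The initial state: the input stands in the memory cells `0, 1, 2, …`, its length in register `0`,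
and everything else is `0`. -/
def init (input : List ℕ) : State where
  reg := fun x => if x = 0 then input.length else 0
  mem := fun i => input.getD i 0

end RAM

/-! ## Input and output -/

/-- The postorder (reverse Polish) encoding of a tree: a leaf is `0`, the number of nodes of its
path, and these nodes; an `S`-node (`P`-node) is the encodings of its children, followed by `1`
(by `2`) and the number of children. -/
def SPTree.encode : SPTree ℕ → List ℕ
  | .leaf p => 0 :: p.length :: p
  | .series ts => (ts.map fun t => t.encode).flatten ++ [1, ts.length]
  | .parallel ts => (ts.map fun t => t.encode).flatten ++ [2, ts.length]

/-- The edge list encoding of a graph with node set `{0, …, n-1}`: the numbers of nodes and edges,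
then the two ends of every edge. -/
def encodeEdgeList (n : ℕ) (es : List (ℕ × ℕ)) : List ℕ :=
  n :: es.length :: (es.map fun e => [e.1, e.2]).flatten

/-- `es` lists the edges of `G`, in any order, and the ends of every edge in any order. -/
def MGraph.IsEdgeList {α : Type} (G : MGraph α) (es : List (α × α)) : Prop :=
  G.edges = (es.map fun e => s(e.1, e.2) : List (Sym2 α))

/-- The memory holds the arrangement `π` as an array that starts at the address in
register `0`: the entry with index `v` is `π(v)`. -/
def RAM.State.HoldsArrangement (σ : RAM.State) {G : MGraph ℕ} (π : LinearArrangement G) : Prop :=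
  ∀ v : {v // v ∈ G.verts}, σ.mem (σ.reg 0 + v) = π v

/-- The memory holds the encoding of the tree `T` as an array that starts at the address in
register `1`. -/
def RAM.State.HoldsTree (σ : RAM.State) (T : SPTree ℕ) : Prop :=
  ∀ (i : ℕ) (h : i < T.encode.length), σ.mem (σ.reg 1 + i) = T.encode[i]

/-! Both parts are reduced to counting loop iterations. Programs are written in a structured
language with registers and 32 arrays, whose states carry fuel, one unit per loop iteration. By
`Imp.Run.compile`, a run becomes a run of the machine whose time is at most a constant times one
plus the number of iterations, as long as every sum and product stays below the common array length.
`Imp.Cmd.program_correct` takes `(L + 10) ^ 4` as this length, for inputs of length `L`; it is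
polynomial in `|E|`, which gives the word bound. What remains are correct programs with linearly
many iterations, verified by weakest preconditions.

Given a tree: the order of a component is source, sink, and then an inner order. `inner_leaf`,
`inner_series` and `inner_parallel` show that inner orders compose as the algorithm demands and
enumerate every node once. In postorder, the last child immediately precedes its parent and subtree
sizes lead to the other children, so a single pass over the encoding finds sizes, terminals and
biggest children (`Imp.reads_of_represents`). A second pass descends from the root with an explicit
stack. Blocks behind the biggest child are reversed; instead of reversing lists, every task carries
a direction, and a reversed component is produced by treating its children in reverse order and in
reversed directions (`Imp.exists_arranges`). No list is ever copied, so the time is linear in the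
encoding, whose length is `O(|E|)` by `Imp.elen_le`.

Given only the graph: parallel edges are merged, and nodes of degree two are replaced by edges. Both
reductions preserve the class (`SP.parallel_reduction`, `SP.series_reduction`). The second may move
a terminal, which is harmless because the terminals are not prescribed. Unless one edge is left,
some reduction applies (`SP.progress`). Every edge carries a binary decomposition tree of the
subgraph that it replaces (`Good`), so the last edge carries a tree of the whole graph. Merging
nested nodes of equal kind makes it a minimal SP-tree (`BT.toSP`).

Each reduction takes constant time. An adjacency matrix detects parallel edges; it needs no
initialisation, as memory starts with zeros. No adjacency lists are kept: every node stores its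
degree and the sums of its neighbours and of their squares. At degree two, these are `x + y` and `x²
+ y²`, and `2(x² + y²) - (x + y)² = (y - x)²`, so that a table of square roots reveals `x` and `y`.
A reduction lowers the number of edges and puts only the two neighbours on the queue of candidates,
so the queue stays linear.

The two parts of a composition may be stored with the wrong orientation. Turning them around would
be expensive, so they are stored as they are (`BT.Same`), and orientation is resolved once, when the
encoding is written (`Imp.BRep.expands`). The first program then arranges this tree. The total time
is linear, and `Imp.le_mul_log` weakens this to `|E| log |E|`. -/

set_option linter.unusedSimpArgs false
set_option linter.unnecessarySeqFocus false

/-! ## A structured language on top of the random-access machine -/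

namespace Imp

/-- Expressions over registers and arrays. -/
inductive Ex
  | lit (c : ℕ)
  | var (x : ℕ)
  | get (k : ℕ) (e : Ex)
  | bin (o : RAM.Op) (a b : Ex)

/-- States: registers, arrays, and the number of loop iterations that are still allowed. -/
structure St where
  reg : ℕ → ℕ
  arr : ℕ → ℕ → ℕ
  fuel : ℕ

/-- Set a register. -/
def St.setR (s : St) (x v : ℕ) : St := { s with reg := Function.update s.reg x v }

/-- Set an array entry. -/
def St.setA (s : St) (k i v : ℕ) : St :=
  { s with arr := Function.update s.arr k (Function.update (s.arr k) i v) }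

/-- Use up one loop iteration. -/
def St.tick (s : St) : St := { s with fuel := s.fuel - 1 }

section simps
variable (s : St) (x y v k l i : ℕ)

@[simp] theorem setR_reg_self : (s.setR x v).reg x = v := by simp [St.setR]
@[simp] theorem setR_reg_ne (h : y ≠ x) : (s.setR x v).reg y = s.reg y := by simp [St.setR, h]
@[simp] theorem setR_arr : (s.setR x v).arr = s.arr := rfl
@[simp] theorem setR_fuel : (s.setR x v).fuel = s.fuel := rfl
@[simp] theorem setA_reg : (s.setA k i v).reg = s.reg := rfl
@[simp] theorem setA_arr_self : (s.setA k i v).arr k = Function.update (s.arr k) i v := by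
  simp [St.setA]
@[simp] theorem setA_arr_ne (h : l ≠ k) : (s.setA k i v).arr l = s.arr l := by simp [St.setA, h]
@[simp] theorem setA_fuel : (s.setA k i v).fuel = s.fuel := rfl
@[simp] theorem tick_reg : s.tick.reg = s.reg := rfl
@[simp] theorem tick_arr : s.tick.arr = s.arr := rfl
@[simp] theorem tick_fuel : s.tick.fuel = s.fuel - 1 := rfl

end simps

/-- The value of an expression. -/
@[simp] def Ex.eval (s : St) : Ex → ℕ
  | lit c => c
  | var x => s.reg x
  | get k e => s.arr k (e.eval s)
  | bin o a b => o.eval (a.eval s) (b.eval s)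

/-- The result of an operation has to be checked for overflow. -/
def opOk (N : ℕ) : RAM.Op → ℕ → ℕ → Prop
  | .add, a, b => a + b < N
  | .mul, a, b => a * b < N
  | _, _, _ => True

/-- The evaluation of an expression stays below the bound `N`. -/
def Ex.Ok (N : ℕ) (s : St) : Ex → Prop
  | lit c => c < 10
  | var _ => True
  | get k e => k < 32 ∧ e.Ok N s
  | bin o a b => a.Ok N s ∧ b.Ok N s ∧ opOk N o (a.eval s) (b.eval s)

/-- Sum of two expressions. -/
abbrev Ex.plus (a b : Ex) : Ex := .bin .add a b
/-- Truncated difference of two expressions. -/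
abbrev Ex.minus (a b : Ex) : Ex := .bin .sub a b
/-- Product of two expressions. -/
abbrev Ex.times (a b : Ex) : Ex := .bin .mul a b
/-- Quotient of two expressions. -/
abbrev Ex.quot (a b : Ex) : Ex := .bin .div a b
/-- Equality test of two expressions. -/
abbrev Ex.eq (a b : Ex) : Ex := .minus (.minus (.lit 1) (.minus a b)) (.minus b a)

section simps
variable (N : ℕ) (s : St) (a b e : Ex) (c x k m n : ℕ)

@[simp] theorem eval_add : RAM.Op.eval .add m n = m + n := rfl
@[simp] theorem eval_sub : RAM.Op.eval .sub m n = m - n := rfl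
@[simp] theorem eval_mul : RAM.Op.eval .mul m n = m * n := rfl
@[simp] theorem eval_div : RAM.Op.eval .div m n = m / n := rfl
@[simp] theorem ok_lit : (Ex.lit c).Ok N s ↔ c < 10 := Iff.rfl
@[simp] theorem ok_var : (Ex.var x).Ok N s := trivial
@[simp] theorem ok_get : (Ex.get k e).Ok N s ↔ k < 32 ∧ e.Ok N s := Iff.rfl
@[simp] theorem ok_add : (Ex.bin .add a b).Ok N s ↔
    a.Ok N s ∧ b.Ok N s ∧ a.eval s + b.eval s < N := Iff.rfl
@[simp] theorem ok_mul : (Ex.bin .mul a b).Ok N s ↔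
    a.Ok N s ∧ b.Ok N s ∧ a.eval s * b.eval s < N := Iff.rfl
@[simp] theorem ok_sub : (Ex.bin .sub a b).Ok N s ↔ a.Ok N s ∧ b.Ok N s := by
  simp [Ex.Ok, opOk]
@[simp] theorem ok_div : (Ex.bin .div a b).Ok N s ↔ a.Ok N s ∧ b.Ok N s := by
  simp [Ex.Ok, opOk]
@[simp] theorem eq_test : 1 - (m - n) - (n - m) = 0 ↔ m ≠ n := by omega

end simps

/-- Commands. -/
inductive Cmd
  | skip
  | set (x : ℕ) (e : Ex)
  | put (k : ℕ) (i e : Ex)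
  | seq (p q : Cmd)
  | ite (e : Ex) (p q : Cmd)
  | while (e : Ex) (p : Cmd)

/-- Sequential composition. -/
infixr:60 " ;; " => Cmd.seq

/-- Big-step semantics. -/
inductive Run (N : ℕ) : Cmd → St → St → Prop
  | skip (s) : Run N .skip s s
  | set (x e s) (h : e.Ok N s) : Run N (.set x e) s (s.setR x (e.eval s))
  | put (k i e s) (hk : k < 32) (hi : i.Ok N s) (he : e.Ok N s) :
      Run N (.put k i e) s (s.setA k (i.eval s) (e.eval s))
  | seq (p q s t u) (hp : Run N p s t) (hq : Run N q t u) : Run N (.seq p q) s u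
  | ite_true (e p q s t) (he : e.Ok N s) (h : e.eval s ≠ 0) (hp : Run N p s t) :
      Run N (.ite e p q) s t
  | ite_false (e p q s t) (he : e.Ok N s) (h : e.eval s = 0) (hq : Run N q s t) :
      Run N (.ite e p q) s t
  | while_true (e p s t u) (he : e.Ok N s) (h : e.eval s ≠ 0) (hf : 0 < s.fuel)
      (hp : Run N p s.tick t) (hl : Run N (.while e p) t u) : Run N (.while e p) s u
  | while_false (e p s) (he : e.Ok N s) (h : e.eval s = 0) : Run N (.while e p) s s

/-- Weakest preconditions. -/
def wp (N : ℕ) (c : Cmd) (Q : St → Prop) (s : St) : Prop := ∃ t, Run N c s t ∧ Q t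

/-! ### Rules for weakest preconditions. -/

section rules
variable {N : ℕ} {Q R : St → Prop} {s : St} {e i : Ex} {x k : ℕ} {p q : Cmd}

@[simp] theorem wp_skip : wp N .skip Q s ↔ Q s :=
  ⟨fun ⟨_, h, hQ⟩ => by cases h; exact hQ, fun h => ⟨s, .skip s, h⟩⟩

@[simp] theorem wp_set : wp N (.set x e) Q s ↔ e.Ok N s ∧ Q (s.setR x (e.eval s)) :=
  ⟨fun ⟨_, h, hQ⟩ => by cases h; exact ⟨by assumption, hQ⟩,
    fun ⟨h, hQ⟩ => ⟨_, .set x e s h, hQ⟩⟩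

@[simp] theorem wp_put : wp N (.put k i e) Q s ↔
    k < 32 ∧ i.Ok N s ∧ e.Ok N s ∧ Q (s.setA k (i.eval s) (e.eval s)) :=
  ⟨fun ⟨_, h, hQ⟩ => by cases h; exact ⟨by assumption, by assumption, by assumption, hQ⟩,
    fun ⟨hk, hi, he, hQ⟩ => ⟨_, .put k i e s hk hi he, hQ⟩⟩

@[simp] theorem wp_seq : wp N (p ;; q) Q s ↔ wp N p (wp N q Q) s := by
  constructor
  · rintro ⟨_, h, hQ⟩
    cases h with
    | seq _ _ _ t _ hp hq => exact ⟨t, hp, _, hq, hQ⟩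
  · rintro ⟨t, hp, u, hq, hQ⟩
    exact ⟨u, .seq _ _ _ _ _ hp hq, hQ⟩

@[simp] theorem wp_ite : wp N (.ite e p q) Q s ↔
    e.Ok N s ∧ (e.eval s ≠ 0 → wp N p Q s) ∧ (e.eval s = 0 → wp N q Q s) := by
  constructor
  · rintro ⟨t, h, hQ⟩
    cases h with
    | ite_true _ _ _ _ _ he h hp => exact ⟨he, fun _ => ⟨t, hp, hQ⟩, fun h' => absurd h' h⟩
    | ite_false _ _ _ _ _ he h hq => exact ⟨he, fun h' => absurd h h', fun _ => ⟨t, hq, hQ⟩⟩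
  · rintro ⟨he, h1, h2⟩
    by_cases h : e.eval s = 0
    · obtain ⟨t, hq, hQ⟩ := h2 h
      exact ⟨t, .ite_false _ _ _ _ _ he h hq, hQ⟩
    · obtain ⟨t, hp, hQ⟩ := h1 h
      exact ⟨t, .ite_true _ _ _ _ _ he h hp, hQ⟩

theorem wp_while_true (he : e.Ok N s) (h : e.eval s ≠ 0) (hf : 0 < s.fuel)
    (hp : wp N p (wp N (.while e p) Q) s.tick) : wp N (.while e p) Q s := by
  obtain ⟨t, hp, u, hl, hQ⟩ := hp
  exact ⟨u, .while_true _ _ _ _ _ he h hf hp hl, hQ⟩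

theorem wp_while_false (he : e.Ok N s) (h : e.eval s = 0) (hQ : Q s) : wp N (.while e p) Q s :=
  ⟨s, .while_false _ _ _ he h, hQ⟩

/-- Every iteration uses one unit of fuel and nothing restores it, so `s.fuel - t.fuel` counts the
iterations of a run. It is the measure for termination, and later for time. -/
theorem Run.fuel_le {t : St} (h : Run N p s t) : t.fuel ≤ s.fuel := by
  induction h with
  | skip | set | put | while_false => simp
  | seq _ _ _ _ _ _ _ ih1 ih2 => exact ih2.trans ih1
  | ite_true _ _ _ _ _ _ _ _ ih => exact ih
  | ite_false _ _ _ _ _ _ _ _ ih => exact ih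
  | while_true _ _ _ _ _ _ _ _ _ _ ih1 ih2 =>
    simp only [tick_fuel] at ih1
    omega

/-- The rule for loops with an invariant: termination is ensured by the fuel. -/
theorem wp_while_inv (I : St → Prop) (hs : I s) (he : ∀ s, I s → e.Ok N s)
    (hbody : ∀ s, I s → e.eval s ≠ 0 → 0 < s.fuel ∧ wp N p I s.tick)
    (hend : ∀ s, I s → e.eval s = 0 → Q s) : wp N (.while e p) Q s := by
  induction hf : s.fuel using Nat.strong_induction_on generalizing s with
  | _ f ih =>
    by_cases h : e.eval s = 0
    · exact wp_while_false (he s hs) h (hend s hs h)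
    · obtain ⟨h1, t, hp, hI⟩ := hbody s hs h
      refine wp_while_true (he s hs) h h1 ⟨t, hp, ih t.fuel ?_ hI rfl⟩
      have := hp.fuel_le
      simp only [tick_fuel] at this
      omega

end rules

/-! ### Compilation -/

open RAM (Prog Exec State)

/-- The compiled expression puts its value into the register `2 * d + 3` and uses only registers
with odd numbers from there on. Register `1` holds the length of the arrays. -/
def Ex.comp : Ex → ℕ → Prog
  | lit c, d => .const (2 * d + 3) c
  | var x, d => .seq (.const (2 * d + 3) 0) (.arith .add (2 * d + 3) (2 * x) (2 * d + 3))
  | get k e, d => .seq (e.comp d) (.seq (.const (2 * d + 5) k)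
      (.seq (.arith .mul (2 * d + 5) (2 * d + 5) 1)
        (.seq (.arith .add (2 * d + 3) (2 * d + 5) (2 * d + 3)) (.load (2 * d + 3) (2 * d + 3)))))
  | bin o a b, d => .seq (a.comp d) (.seq (b.comp (d + 1))
      (.arith o (2 * d + 3) (2 * d + 3) (2 * d + 5)))

/-- The running time of a compiled expression. -/
def Ex.cost : Ex → ℕ
  | lit _ => 1
  | var _ => 2
  | get _ e => e.cost + 4
  | bin _ a b => a.cost + b.cost + 1

/-- The compiled command. -/
def Cmd.comp : Cmd → Prog
  | skip => .skip
  | set x e => .seq (e.comp 0) (.seq (.const 5 0) (.arith .add (2 * x) 3 5))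
  | put k i e => .seq (i.comp 0) (.seq (e.comp 1) (.seq (.const 7 k) (.seq (.arith .mul 7 7 1)
      (.seq (.arith .add 3 7 3) (.store 3 5)))))
  | seq p q => .seq p.comp q.comp
  | ite e p q => .seq (e.comp 0) (.ite 3 p.comp q.comp)
  | .while e p => .seq (e.comp 0) (.loop 3 (.seq p.comp (e.comp 0)))

/-- The running time of a compiled command, per loop iteration. -/
def Cmd.cost : Cmd → ℕ
  | skip => 1
  | set _ e => e.cost + 2
  | put _ i e => i.cost + e.cost + 4
  | seq p q => p.cost + q.cost
  | ite e p q => e.cost + 1 + p.cost + q.cost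
  | .while e p => e.cost + p.cost + 2

/-- The machine state `σ` represents the state `s`. -/
structure Rel (N : ℕ) (s : St) (σ : State) : Prop where
  reg : ∀ x, σ.reg (2 * x) = s.reg x
  len : σ.reg 1 = N
  mem : ∀ k < 32, ∀ i < N, σ.mem (k * N + i) = s.arr k i

/-- All values are smaller than `N`. -/
structure Bdd (N : ℕ) (s : St) : Prop where
  reg : ∀ x, s.reg x < N
  arr : ∀ k < 32, ∀ i < N, s.arr k i < N

variable {N W : ℕ}

/-- Only sums and products can leave the range, and `opOk` tests them; differences and quotients are
at most their first operand, and literals are below `10`. -/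
theorem Ex.eval_lt (hN : 10 ≤ N) {s : St} (hb : Bdd N s) {e : Ex} (h : e.Ok N s) :
    e.eval s < N := by
  induction e with
  | lit c => exact lt_of_lt_of_le h hN
  | var x => exact hb.reg x
  | get k e ih => exact hb.arr k h.1 _ (ih h.2)
  | bin o a b iha ihb =>
    obtain ⟨h1, h2, h3⟩ := h
    cases o with
    | add => exact h3
    | mul => exact h3
    | sub => exact lt_of_le_of_lt (Nat.sub_le _ _) (iha h1)
    | div => exact lt_of_le_of_lt (Nat.div_le_self _ _) (iha h1)

/-- The registers of the language are the even ones of the machine and register `1` holds `N`, so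
the odd registers from `3` on are scratch space. -/
theorem Rel.setReg_odd {s : St} {σ : State} (h : Rel N s σ) (x : ℕ) (v : ℕ) :
    Rel N s (σ.setReg (2 * x + 3) v) where
  reg y := by
    simp only [State.setReg]
    rw [Function.update_of_ne (by omega)]
    exact h.reg y
  len := by
    simp only [State.setReg]
    rw [Function.update_of_ne (by omega)]
    exact h.len
  mem := h.mem

/-- The 32 arrays occupy consecutive blocks of `N` cells; hence words below `32 * N` can address all
of them. -/
theorem addr_lt (k i : ℕ) (hk : k < 32) (hi : i < N) : k * N + i < 32 * N := by
  have : (k + 1) * N ≤ 32 * N := Nat.mul_le_mul_right _ hk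
  linarith

/-- The last clause carries the induction: evaluation at depth `d` spares the scratch registers of
smaller depth, so the first operand of an operation survives the evaluation of the second. -/
theorem Ex.comp_correct (hN : 10 ≤ N) (hW : 32 * N ≤ W) {s : St} (hb : Bdd N s) (e : Ex)
    (h : e.Ok N s) (d : ℕ) (σ : State) (hσ : Rel N s σ) :
    ∃ σ', Exec W (e.comp d) σ e.cost σ' ∧ Rel N s σ' ∧ σ'.reg (2 * d + 3) = e.eval s ∧
      ∀ d' < d, σ'.reg (2 * d' + 3) = σ.reg (2 * d' + 3) := by
  induction e generalizing d σ with
  | lit c =>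
    refine ⟨_, .const _ _ _ ?_, hσ.setReg_odd d c, by simp [State.setReg], ?_⟩
    · simp only [ok_lit] at h; omega
    · intro d' hd
      simp only [State.setReg]
      rw [Function.update_of_ne (by omega)]
  | var x =>
    have hx := hb.reg x
    -- The machine has no instruction that copies a register; a copy is an addition to zero.
    refine ⟨_, .seq _ _ _ _ _ _ _ (.const _ _ _ (by omega)) (.arith _ _ _ _ _ ?_),
      (hσ.setReg_odd d 0).setReg_odd d _, ?_, ?_⟩
    · simp only [State.setReg, Function.update_self]
      rw [Function.update_of_ne (by omega), hσ.reg]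
      simp only [eval_add]
      omega
    · simp only [State.setReg, Function.update_self]
      rw [Function.update_of_ne (by omega), hσ.reg]
      simp
    · intro d' hd
      simp only [State.setReg]
      rw [Function.update_of_ne (by omega), Function.update_of_ne (by omega)]
  | get k e ih =>
    obtain ⟨hk, h⟩ := h
    obtain ⟨σ₁, e₁, r₁, v₁, k₁⟩ := ih h d σ hσ
    have hlt := e.eval_lt hN hb h
    have ha := addr_lt k _ hk hlt
    have hval := hb.arr k hk _ hlt
    have hkN : k * N ≤ k * N + e.eval s := by omega
    have r₂ : Rel N s (σ₁.setReg (2 * d + 5) k) := r₁.setReg_odd (d + 1) k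
    have hm : (σ₁.setReg (2 * d + 5) k).reg (2 * d + 5) *
        (σ₁.setReg (2 * d + 5) k).reg 1 = k * N := by
      rw [r₂.len]; simp [State.setReg]
    set σ₂ := σ₁.setReg (2 * d + 5) k with hσ₂
    have r₃ : Rel N s (σ₂.setReg (2 * d + 5) (k * N)) := r₂.setReg_odd (d + 1) _
    set σ₃ := σ₂.setReg (2 * d + 5) (k * N) with hσ₃
    have hadd : σ₃.reg (2 * d + 5) + σ₃.reg (2 * d + 3) = k * N + e.eval s := by
      simp only [hσ₃, hσ₂, State.setReg, Function.update_self]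
      rw [Function.update_of_ne (by omega), Function.update_of_ne (by omega), v₁]
    have r₄ : Rel N s (σ₃.setReg (2 * d + 3) (k * N + e.eval s)) := r₃.setReg_odd d _
    set σ₄ := σ₃.setReg (2 * d + 3) (k * N + e.eval s) with hσ₄
    have hreg : σ₄.reg (2 * d + 3) = k * N + e.eval s := by simp [hσ₄, State.setReg]
    have hmem : σ₄.mem (σ₄.reg (2 * d + 3)) = s.arr k (e.eval s) := by
      rw [hreg, r₄.mem k hk _ hlt]
    refine ⟨σ₄.setReg (2 * d + 3) (s.arr k (e.eval s)), ?_, r₄.setReg_odd d _, ?_, ?_⟩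
    · refine .seq _ _ _ _ _ _ 4 e₁ (.seq _ _ _ σ₂ _ 1 3 (.const _ _ _ (by omega))
        (.seq _ _ _ σ₃ _ 1 2 ?_ (.seq _ _ _ σ₄ _ 1 1 ?_ ?_)))
      · have := Exec.arith (W := W) .mul (2 * d + 5) (2 * d + 5) 1 σ₂
          (by simp only [eval_mul]; rw [hm]; omega)
        simp only [eval_mul, hm] at this
        exact this
      · have := Exec.arith (W := W) .add (2 * d + 3) (2 * d + 5) (2 * d + 3) σ₃
          (by simp only [eval_add]; rw [hadd]; omega)
        simp only [eval_add, hadd] at this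
        exact this
      · have := Exec.load (W := W) (2 * d + 3) (2 * d + 3) σ₄ (by omega) (by omega)
        rw [hmem] at this
        exact this
    · simp [State.setReg, Ex.eval]
    · intro d' hd
      simp only [hσ₄, hσ₃, hσ₂, State.setReg]
      rw [Function.update_of_ne (by omega), Function.update_of_ne (by omega),
        Function.update_of_ne (by omega), Function.update_of_ne (by omega)]
      exact k₁ d' hd
  | bin o a b iha ihb =>
    have hlt := Ex.eval_lt hN hb h
    obtain ⟨h1, h2, h3⟩ := h
    obtain ⟨σ₁, e₁, r₁, v₁, k₁⟩ := iha h1 d σ hσ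
    obtain ⟨σ₂, e₂, r₂, v₂, k₂⟩ := ihb h2 (d + 1) σ₁ r₁
    have v₁' : σ₂.reg (2 * d + 3) = a.eval s := by rw [k₂ d (by omega), v₁]
    have v₂' : σ₂.reg (2 * d + 5) = b.eval s := v₂
    have hv : o.eval (σ₂.reg (2 * d + 3)) (σ₂.reg (2 * d + 5)) = (Ex.bin o a b).eval s := by
      rw [v₁', v₂']; rfl
    refine ⟨σ₂.setReg (2 * d + 3) ((Ex.bin o a b).eval s), ?_, r₂.setReg_odd d _, ?_, ?_⟩
    · have := Exec.arith (W := W) o (2 * d + 3) (2 * d + 3) (2 * d + 5) σ₂ (by rw [hv]; omega)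
      rw [hv] at this
      have h := Exec.seq _ _ _ _ _ _ _ e₁ (.seq _ _ _ _ _ _ _ e₂ this)
      rwa [← add_assoc] at h
    · simp [State.setReg]
    · intro d' hd
      simp only [State.setReg]
      rw [Function.update_of_ne (by omega), k₂ d' (by omega), k₁ d' hd]

theorem Rel.setR {s : St} {σ : State} (h : Rel N s σ) (x v : ℕ) :
    Rel N (s.setR x v) (σ.setReg (2 * x) v) where
  reg y := by
    by_cases hy : y = x
    · subst hy; simp [State.setReg]
    · simp only [State.setReg]
      rw [Function.update_of_ne (by omega), setR_reg_ne _ _ _ _ hy]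
      exact h.reg y
  len := by
    simp only [State.setReg]
    rw [Function.update_of_ne (by omega)]
    exact h.len
  mem := h.mem

theorem Rel.setA {s : St} {σ : State} (h : Rel N s σ) (k i v : ℕ) (hi : i < N) :
    Rel N (s.setA k i v) (σ.setMem (k * N + i) v) where
  reg := h.reg
  len := h.len
  mem l hl j hj := by
    simp only [State.setMem]
    by_cases hlk : l = k
    · subst hlk
      by_cases hji : j = i
      · subst hji; simp
      · rw [Function.update_of_ne (by omega), setA_arr_self, Function.update_of_ne hji]
        exact h.mem l hl j hj
    · rw [Function.update_of_ne, setA_arr_ne _ _ _ _ _ hlk, h.mem l hl j hj]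
      intro heq
      apply hlk
      -- Blocks of different arrays are disjoint, since division of the address by `N` recovers the
      -- number of the array.
      have h1 : (l * N + j) / N = l := by
        rw [mul_comm, Nat.mul_add_div (by omega), Nat.div_eq_of_lt hj, add_zero]
      have h2 : (k * N + i) / N = k := by
        rw [mul_comm, Nat.mul_add_div (by omega), Nat.div_eq_of_lt hi, add_zero]
      rw [← h1, heq, h2]

theorem Bdd.setR {s : St} (h : Bdd N s) (x v : ℕ) (hv : v < N) : Bdd N (s.setR x v) where
  reg y := by
    by_cases hy : y = x
    · subst hy; simpa
    · rw [setR_reg_ne _ _ _ _ hy]; exact h.reg y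
  arr := h.arr

theorem Bdd.setA {s : St} (h : Bdd N s) (k i v : ℕ) (hv : v < N) : Bdd N (s.setA k i v) where
  reg := h.reg
  arr l hl j hj := by
    by_cases hlk : l = k
    · subst hlk
      rw [setA_arr_self, Function.update_apply]
      split
      · exact hv
      · exact h.arr l hl j hj
    · rw [setA_arr_ne _ _ _ _ _ hlk]; exact h.arr l hl j hj

/-- Compiled commands simulate the commands, in time linear in the number of loop iterations. -/
theorem Run.compile (hN : 10 ≤ N) (hW : 32 * N ≤ W) {c : Cmd} {s s' : St} (h : Run N c s s')
    (hb : Bdd N s) (σ : State) (hσ : Rel N s σ) :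
    ∃ t σ', Exec W c.comp σ t σ' ∧ t ≤ c.cost * (1 + (s.fuel - s'.fuel)) ∧ Rel N s' σ' ∧
      Bdd N s' := by
  induction h generalizing σ with
  | skip s => exact ⟨1, σ, .skip σ, by simp [Cmd.cost], hσ, hb⟩
  | set x e s h =>
    obtain ⟨σ₁, e₁, r₁, v₁, -⟩ := e.comp_correct hN hW hb h 0 σ hσ
    have hlt := e.eval_lt hN hb h
    have r₂ : Rel N s (σ₁.setReg 5 0) := r₁.setReg_odd 1 0
    have hv : (σ₁.setReg 5 0).reg 3 + (σ₁.setReg 5 0).reg 5 = e.eval s := by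
      simpa [State.setReg] using v₁
    have := Exec.arith (W := W) .add (2 * x) 3 5 (σ₁.setReg 5 0)
      (by simp only [eval_add]; omega)
    simp only [eval_add, hv] at this
    exact ⟨_, _, .seq _ _ _ _ _ _ _ e₁ (.seq _ _ _ _ _ _ _ (.const _ _ _ (by omega)) this),
      by simp [Cmd.cost], r₂.setR x _, hb.setR x _ hlt⟩
  | put k i e s hk hi he =>
    obtain ⟨σ₁, e₁, r₁, v₁, -⟩ := i.comp_correct hN hW hb hi 0 σ hσ
    obtain ⟨σ₂, e₂, r₂, v₂, k₂⟩ := e.comp_correct hN hW hb he 1 σ₁ r₁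
    have hlt := e.eval_lt hN hb he
    have hlti := i.eval_lt hN hb hi
    have ha := addr_lt k _ hk hlti
    have v₁' : σ₂.reg 3 = i.eval s := by rw [← v₁]; exact k₂ 0 (by omega)
    have v₂' : σ₂.reg 5 = e.eval s := v₂
    have r₃ : Rel N s (σ₂.setReg 7 k) := r₂.setReg_odd 2 k
    have hm : (σ₂.setReg 7 k).reg 7 * (σ₂.setReg 7 k).reg 1 = k * N := by
      rw [r₃.len]; simp [State.setReg]
    have hx := Exec.arith (W := W) .mul 7 7 1 (σ₂.setReg 7 k)
      (by simp only [eval_mul]; rw [hm]; omega)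
    simp only [eval_mul, hm] at hx
    have r₄ : Rel N s ((σ₂.setReg 7 k).setReg 7 (k * N)) := r₃.setReg_odd 2 _
    set σ₄ := (σ₂.setReg 7 k).setReg 7 (k * N) with hσ₄
    have hadd : σ₄.reg 7 + σ₄.reg 3 = k * N + i.eval s := by
      simp [hσ₄, State.setReg, v₁']
    have hy := Exec.arith (W := W) .add 3 7 3 σ₄ (by simp only [eval_add]; omega)
    simp only [eval_add, hadd] at hy
    have r₅ : Rel N s (σ₄.setReg 3 (k * N + i.eval s)) := r₄.setReg_odd 0 _
    set σ₅ := σ₄.setReg 3 (k * N + i.eval s) with hσ₅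
    have h3 : σ₅.reg 3 = k * N + i.eval s := by simp [hσ₅, State.setReg]
    have h5 : σ₅.reg 5 = e.eval s := by simp [hσ₅, hσ₄, State.setReg, v₂']
    have hz := Exec.store (W := W) 3 5 σ₅ (by omega) (by omega)
    rw [h3, h5] at hz
    refine ⟨_, _, .seq _ _ _ _ _ _ _ e₁ (.seq _ _ _ _ _ _ _ e₂ (.seq _ _ _ _ _ _ _
      (.const _ _ _ (by omega)) (.seq _ _ _ _ _ _ _ hx (.seq _ _ _ _ _ _ _ hy hz)))), ?_,
      r₅.setA k _ _ hlti, hb.setA k _ _ hlt⟩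
    simp [Cmd.cost]
    omega
  | seq p q s t u hp hq ihp ihq =>
    obtain ⟨t₁, σ₁, e₁, l₁, r₁, b₁⟩ := ihp hb σ hσ
    obtain ⟨t₂, σ₂, e₂, l₂, r₂, b₂⟩ := ihq b₁ σ₁ r₁
    refine ⟨_, _, .seq _ _ _ _ _ _ _ e₁ e₂, ?_, r₂, b₂⟩
    have h1 := hp.fuel_le
    have h2 := hq.fuel_le
    -- With `a` and `b` iterations in the two parts, the bound is `p.cost * (1 + a) + q.cost * (1 +
    -- b) ≤ (p.cost + q.cost) * (1 + a + b)`.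
    obtain ⟨a, ha⟩ := Nat.exists_eq_add_of_le h1
    obtain ⟨b, hb⟩ := Nat.exists_eq_add_of_le h2
    rw [show s.fuel - t.fuel = a by omega] at l₁
    rw [show t.fuel - u.fuel = b by omega] at l₂
    rw [show s.fuel - u.fuel = a + b by omega]
    simp only [Cmd.cost]
    nlinarith
  | ite_true e p q s t he h hp ih =>
    obtain ⟨σ₁, e₁, r₁, v₁, -⟩ := e.comp_correct hN hW hb he 0 σ hσ
    obtain ⟨t₂, σ₂, e₂, l₂, r₂, b₂⟩ := ih hb σ₁ r₁
    refine ⟨_, _, .seq _ _ _ _ _ _ _ e₁ (.ite_true _ _ _ _ _ _ ?_ e₂), ?_, r₂, b₂⟩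
    · rw [show (3 : ℕ) = 2 * 0 + 3 from rfl, v₁]; exact h
    · simp only [Cmd.cost]
      nlinarith
  | ite_false e p q s t he h hp ih =>
    obtain ⟨σ₁, e₁, r₁, v₁, -⟩ := e.comp_correct hN hW hb he 0 σ hσ
    obtain ⟨t₂, σ₂, e₂, l₂, r₂, b₂⟩ := ih hb σ₁ r₁
    refine ⟨_, _, .seq _ _ _ _ _ _ _ e₁ (.ite_false _ _ _ _ _ _ ?_ e₂), ?_, r₂, b₂⟩
    · rw [show (3 : ℕ) = 2 * 0 + 3 from rfl, v₁]; exact h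
    · simp only [Cmd.cost]
      nlinarith
  | while_true e p s t u he h hf hp hl ihp ihl =>
    obtain ⟨σ₁, e₁, r₁, v₁, -⟩ := e.comp_correct hN hW hb he 0 σ hσ
    obtain ⟨t₂, σ₂, e₂, l₂, r₂, b₂⟩ := ihp ⟨hb.reg, hb.arr⟩ σ₁ ⟨r₁.reg, r₁.len, r₁.mem⟩
    obtain ⟨t₃, σ₃, e₃, l₃, r₃, b₃⟩ := ihl b₂ σ₂ r₂
    -- The condition is compiled once before the loop and again at the end of its body. The run for
    -- the remaining iterations is therefore split: its initial test becomes the end of the current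
    -- body.
    cases e₃ with
    | seq _ _ _ τ _ t₄ t₅ e₄ e₅ =>
      refine ⟨_, _, .seq _ _ _ _ _ _ _ e₁ (.loop_true _ _ _ _ _ _ _ ?_
        (.seq _ _ _ _ _ _ _ e₂ e₄) e₅), ?_, r₃, b₃⟩
      · rw [show (3 : ℕ) = 2 * 0 + 3 from rfl, v₁]; exact h
      · have h1 := hp.fuel_le
        have h2 := hl.fuel_le
        simp only [tick_fuel] at h1 l₂
        obtain ⟨a, ha⟩ := Nat.exists_eq_add_of_le h1
        obtain ⟨b, hb⟩ := Nat.exists_eq_add_of_le h2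
        rw [show s.fuel - 1 - t.fuel = a by omega] at l₂
        rw [show t.fuel - u.fuel = b by omega] at l₃
        rw [show s.fuel - u.fuel = 1 + a + b by omega]
        simp only [Cmd.cost] at l₃ ⊢
        nlinarith
  | while_false e p s he h =>
    obtain ⟨σ₁, e₁, r₁, v₁, -⟩ := e.comp_correct hN hW hb he 0 σ hσ
    refine ⟨_, _, .seq _ _ _ _ _ _ _ e₁ (.loop_false _ _ _ ?_), ?_, r₁, hb⟩
    · rw [show (3 : ℕ) = 2 * 0 + 3 from rfl, v₁]; exact h
    · simp only [Cmd.cost]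
      nlinarith

end Imp

/-! ### The complete machine program, with its input and output. -/

namespace Imp

open RAM (Prog Exec State)

/-- The initial state with a given input and a given amount of fuel. -/
def St.init (input : List ℕ) (F : ℕ) : St where
  reg := fun x => if x = 0 then input.length else 0
  arr := fun k i => if k = 0 then input.getD i 0 else 0
  fuel := F

/-- The length of the arrays for an input of length `L`. -/
def size (L : ℕ) : ℕ := (L + 10) ^ 4

theorem le_size (L : ℕ) : L + 10 ≤ size L := Nat.le_self_pow (by norm_num) _

/-- The program that computes the length of the arrays, runs the command, and finally puts the
address of the array `k` into the register `0`, and the address of the array `0` into the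
register `1`. -/
def Cmd.program (c : Cmd) (k : ℕ) : Prog :=
  .seq (.seq (.const 3 10) (.seq (.arith .add 3 0 3) (.seq (.arith .mul 1 3 3)
    (.arith .mul 1 1 1))))
    (.seq c.comp (.seq (.const 3 k) (.seq (.arith .mul 0 3 1) (.const 1 0))))

/-- Array `0` is the input itself and all other arrays start with zeros, so nothing has to be set up
except `N`, which takes two squarings. The seven extra steps are four for `N` and three for the
output addresses. -/
theorem Cmd.program_correct (c : Cmd) (k : ℕ) (hk : k < 32) (input : List ℕ) (F W : ℕ) (s' : St)
    (hW : 32 * size input.length ≤ W) (hin : ∀ x ∈ input, x < size input.length)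
    (hrun : Run (size input.length) c (St.init input F) s') :
    ∃ t σ, Exec W (c.program k) (RAM.init input) t σ ∧ t ≤ (c.cost + 7) * (1 + F) ∧
      (∀ i < size input.length, σ.mem (σ.reg 0 + i) = s'.arr k i) ∧
      (∀ i < size input.length, σ.mem (σ.reg 1 + i) = s'.arr 0 i) := by
  have hL := le_size input.length
  set N := size input.length with hN
  have hsq : (input.length + 10) * (input.length + 10) * ((input.length + 10) * (input.length + 10)) = N := by rw [hN, size]; ring
  have hsq' : (input.length + 10) * (input.length + 10) ≤ N := by rw [← hsq]; nlinarith
  let σ₁ : State := (((RAM.init input).setReg 3 10).setReg 3 (input.length + 10)).setReg 1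
    ((input.length + 10) * (input.length + 10))
  have pre : Exec W (.seq (.const 3 10) (.seq (.arith .add 3 0 3) (.seq (.arith .mul 1 3 3)
      (.arith .mul 1 1 1)))) (RAM.init input) (1 + (1 + (1 + 1))) (σ₁.setReg 1 N) := by
    refine .seq _ _ _ _ _ _ _ (.const _ _ _ (by omega)) (.seq _ _ _ _ _ _ _
      (.arith _ _ _ _ _ ?_) (.seq _ _ _ _ _ _ _ (.arith _ _ _ _ _ ?_) ?_))
    · simp [State.setReg, RAM.init]; omega
    · simp [State.setReg, RAM.init]; omega
    · have := Exec.arith (W := W) .mul 1 1 1 σ₁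
        (by simp only [σ₁, State.setReg, eval_mul, Function.update_self]; omega)
      simp only [eval_mul] at this
      rw [show σ₁.reg 1 * σ₁.reg 1 = N by simp [σ₁, State.setReg, hsq]] at this
      simpa [σ₁, State.setReg, RAM.init] using this
  have hrel : Rel N (St.init input F) (σ₁.setReg 1 N) := by
    refine ⟨fun x => ?_, by simp [State.setReg], fun k _ i hi => ?_⟩
    · simp only [σ₁, State.setReg]
      rw [Function.update_of_ne (by omega), Function.update_of_ne (by omega),
        Function.update_of_ne (by omega), Function.update_of_ne (by omega)]
      simp [RAM.init, St.init]
    · simp only [σ₁, State.setReg, RAM.init, St.init]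
      split
      · next h => simp [h]
      · next h =>
        -- The other arrays begin at addresses from `N` on, beyond the input, where memory is zero.
        have : N ≤ k * N := Nat.le_mul_of_pos_left _ (by omega)
        rw [List.getD_eq_default]
        omega
  have hb : Bdd N (St.init input F) := by
    refine ⟨fun x => ?_, fun k _ i _ => ?_⟩
    · simp only [St.init]
      split <;> omega
    · simp only [St.init]
      split
      · by_cases h : i < input.length
        · rw [List.getD_eq_getElem _ _ h]; exact hin _ (List.getElem_mem h)
        · rw [List.getD_eq_default _ _ (by omega)]; omega
      · omega
  obtain ⟨t, σ, ex, ht, r, b⟩ := hrun.compile (by omega) hW hb _ hrel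
  have hkN : k * N < W := by
    have := addr_lt (N := N) k 0 hk (by omega)
    omega
  have hm : (σ.setReg 3 k).reg 3 * (σ.setReg 3 k).reg 1 = k * N := by
    simp [State.setReg, r.len]
  have e₂ := Exec.arith (W := W) .mul 0 3 1 (σ.setReg 3 k)
    (by simp only [eval_mul]; rw [hm]; exact hkN)
  simp only [eval_mul, hm] at e₂
  refine ⟨_, _, .seq _ _ _ _ _ _ _ pre (.seq _ _ _ _ _ _ _ ex (.seq _ _ _ _ _ _ _
    (.const _ _ _ (by omega)) (.seq _ _ _ _ _ _ _ e₂ (.const _ _ _ (by omega))))), ?_, ?_, ?_⟩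
  · have : t ≤ c.cost * (1 + F) := by
      refine ht.trans (Nat.mul_le_mul_left _ ?_)
      simp [St.init]
    nlinarith
  · intro i hi
    simpa [State.setReg] using r.mem k hk i hi
  · intro i hi
    simpa [State.setReg] using r.mem 0 (by omega) i hi

end Imp

/-! ## Arrangements of series and parallel components -/

section chains
variable {α : Type}

/-- Consecutive members of the list share one terminal, and there are no other common nodes. -/
def Linked : List (TTGraph α) → Prop
  | [] => True
  | [_] => True
  | X :: Y :: Xs => X.snk = Y.src ∧ (∀ x ∈ X.verts, x ∈ Y.verts → x = X.snk) ∧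
      (∀ Z ∈ Xs, ∀ x ∈ X.verts, x ∉ Z.verts) ∧ Linked (Y :: Xs)

/-- `Linked` is the recursive form of the index conditions in `IsSeriesComp`, as needed for
inductions along a chain; `Linked.index` translates back. -/
theorem linked_of_index (Xs : List (TTGraph α))
    (merge : ∀ (i : ℕ) (h : i + 1 < Xs.length), Xs[i].snk = Xs[i + 1].src)
    (inter : ∀ (i j : ℕ) (hij : i < j) (hj : j < Xs.length) (x : α),
      x ∈ Xs[i].verts → x ∈ Xs[j].verts → j = i + 1 ∧ x = Xs[i].snk) : Linked Xs := by
  induction Xs with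
  | nil => trivial
  | cons X Xs ih =>
    have h : Linked Xs := ih (fun i h => merge (i + 1) (by simpa using h))
      (fun i j hij hj x hx hx' => by
        have := inter (i + 1) (j + 1) (by omega) (by simpa using hj) x hx hx'
        exact ⟨by omega, this.2⟩)
    cases Xs with
    | nil => trivial
    | cons Y Xs =>
      refine ⟨merge 0 (by simp), fun x hx hx' => (inter 0 1 (by omega) (by simp) x hx hx').2,
        fun Z hZ x hx hx' => ?_, h⟩
      obtain ⟨j, hj, rfl⟩ := List.getElem_of_mem hZ
      have := (inter 0 (j + 2) (by omega) (by simpa using hj) x hx hx').1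
      omega

theorem Linked.index {Xs : List (TTGraph α)} (h : Linked Xs) :
    (∀ (i : ℕ) (h : i + 1 < Xs.length), Xs[i].snk = Xs[i + 1].src) ∧
    (∀ (i j : ℕ) (hij : i < j) (hj : j < Xs.length) (x : α),
      x ∈ Xs[i].verts → x ∈ Xs[j].verts → j = i + 1 ∧ x = Xs[i].snk) := by
  induction Xs with
  | nil => exact ⟨fun i h => by simp at h, fun i j _ hj => by simp at hj⟩
  | cons X Xs ih =>
    cases Xs with
    | nil =>
      exact ⟨fun i h => by simp at h, fun i j hij hj => by simp at hj; omega⟩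
    | cons Y Xs =>
      obtain ⟨h1, h2, h3, h4⟩ := h
      obtain ⟨m, n⟩ := ih h4
      constructor
      · rintro (_ | i) hi
        · exact h1
        · exact m i (by simpa using hi)
      · rintro (_ | i) j hij hj x hx hx'
        · obtain _ | _ | j := j
          · omega
          · exact ⟨rfl, h2 x hx hx'⟩
          · exact absurd hx' (h3 _ (List.getElem_mem (by simpa using hj)) x hx)
        · obtain _ | j := j
          · omega
          · have := n i j (by omega) (by simpa using hj) x hx hx'
            exact ⟨by omega, this.2⟩

/-- The list `l` enumerates the nodes of `X` other than the terminals. -/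
structure Enumerates (X : TTGraph α) (l : List α) : Prop where
  nodup : (X.src :: X.snk :: l).Nodup
  mem : ∀ x, x ∈ X.verts ↔ x ∈ X.src :: X.snk :: l

/-- The nodes of a chain, in order. -/
theorem Linked.enumerate (Xs : List (TTGraph α)) (ls : List (List α)) (X : TTGraph α) (l : List α)
    (h : Linked (X :: Xs)) (hl : Enumerates X l) (hlen : Xs.length = ls.length)
    (hls : ∀ q ∈ Xs.zip ls, Enumerates q.1 q.2) :
    (((X.src :: l) :: List.zipWith (fun X l => X.src :: l) Xs ls).flatten ++
      [((X :: Xs).getLast (by simp)).snk]).Nodup ∧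
    ∀ x, x ∈ (((X.src :: l) :: List.zipWith (fun X l => X.src :: l) Xs ls).flatten ++
      [((X :: Xs).getLast (by simp)).snk]) ↔ ∃ Z ∈ X :: Xs, x ∈ Z.verts := by
  induction Xs generalizing X l ls with
  | nil =>
    have hp : (X.src :: (l ++ [X.snk])).Perm (X.src :: X.snk :: l) :=
      List.Perm.cons _ (List.perm_append_singleton _ _)
    simp only [List.zipWith_nil_left, List.flatten_cons, List.flatten_nil, List.append_nil,
      List.getLast_singleton, List.cons_append, List.mem_singleton, exists_eq_left]
    exact ⟨hp.nodup_iff.2 hl.nodup, fun x => by rw [hl.mem, hp.mem_iff]⟩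
  | cons Y Xs ih =>
    cases ls with
    | nil => simp at hlen
    | cons lY ls =>
      obtain ⟨h1, h2, h3, h4⟩ := h
      obtain ⟨i1, i2⟩ := ih ls Y lY h4 (hls (Y, lY) (by simp)) (by simpa using hlen)
        (fun q hq => hls q (by simp [hq]))
      have hlast : ((X :: Y :: Xs).getLast (by simp)) = (Y :: Xs).getLast (by simp) := by
        simp
      rw [hlast, List.flatten_cons, List.zipWith_cons_cons, List.append_assoc]
      have hn := hl.nodup
      simp only [List.nodup_cons, List.mem_cons, not_or] at hn
      constructor
      · refine List.nodup_append.2 ⟨?_, i1, ?_⟩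
        · simp only [List.nodup_cons]; tauto
        · intro x hx y hy hxy
          subst hxy
          have hxv : x ∈ X.verts := by
            rw [hl.mem]; simp only [List.mem_cons] at hx ⊢; tauto
          obtain ⟨Z, hZ, hxZ⟩ := (i2 x).1 hy
          -- A node that the first member shares with a later one is the sink of the first, which
          -- the block `X.src :: l` leaves out.
          rcases List.mem_cons.1 hZ with rfl | hZ
          · have := h2 x hxv hxZ
            subst this
            simp only [List.mem_cons] at hx
            rcases hx with hx | hx
            · exact hn.1.1 hx.symm
            · exact hn.2.1 hx
          · exact h3 Z hZ x hxv hxZ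
      · intro x
        rw [List.mem_append, i2]
        have hs : X.snk ∈ Y.verts := h1 ▸ Y.src_mem
        simp only [List.mem_cons, exists_eq_or_imp, hl.mem x]
        constructor
        · rintro ((h | h) | h | h) <;> simp [h]
        · rintro ((h | h | h) | h | h)
          · simp [h]
          · subst h; simp [hs]
          · simp [h]
          · simp [h]
          · right; right; exact h

/-- Blocks are only permuted and flipped, so whatever concerns enumeration may be proved for the
plain concatenation. -/
theorem seriesOrder_perm (B : List (List α)) (a : ℕ) (ha : a < B.length) :
    (seriesOrder B a).Perm B.flatten := by
  have h : B.flatten = (B.take a).flatten ++ (B[a] ++ (B.drop (a + 1)).flatten) := by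
    conv_lhs => rw [← List.take_append_drop a B, List.drop_eq_getElem_cons ha]
    rw [List.flatten_append, List.flatten_cons]
  rw [seriesOrder, h, List.getD_eq_getElem _ _ ha, List.append_assoc]
  refine List.Perm.append_left _ ?_
  rw [List.map_reverse, ← List.reverse_flatten]
  exact (List.perm_append_comm).trans ((List.reverse_perm _).append_left _)

/-- The node order of a component, without its terminals, together with the facts on it that are
needed for composing arrangements. -/
structure InnerOrder (T : SPTree α) (X : TTGraph α) (l : List α) : Prop extends Enumerates X l where
  order : SPGAAOrder T (X.src :: X.snk :: l)

/-- By `Linked.enumerate`, the sources and inner nodes of the children, followed by the last sink,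
list each node once. Moving this sink to the second place and permuting the blocks gives the order
of the algorithm. -/
theorem inner_series {ts : List (SPTree α)} {Xs : List (TTGraph α)} {X : TTGraph α}
    (hlen : ts.length = Xs.length) (hts : ∀ q ∈ ts.zip Xs, SPTree.Represents q.1 q.2)
    (h : IsSeriesComp Xs X) (ls : List (List α)) (hls : ts.length = ls.length)
    (hin : ∀ (i : ℕ) (h : i < ts.length), InnerOrder ts[i] Xs[i] ls[i])
    (a : ℕ) (ha : a < ls.length) (hmax : ∀ x ∈ ls, x.length ≤ ls[a].length) :
    InnerOrder (.series ts) X (seriesOrder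
      (seriesBlocks (List.zipWith (fun X l => X.src :: X.snk :: l) Xs ls)) a) := by
  set as := List.zipWith (fun (X : TTGraph α) l => X.src :: X.snk :: l) Xs ls with has
  have hlas : as.length = ls.length := by simp [as]; omega
  have hasi : ∀ (i : ℕ) (h : i < as.length), as[i] = Xs[i].src :: Xs[i].snk :: ls[i] := by
    intro i hi; simp [as]
  have hperm : (seriesOrder (seriesBlocks as) a).Perm (seriesBlocks as).flatten := by
    refine seriesOrder_perm _ _ ?_
    have : (seriesBlocks as).length = as.length := by
      cases as <;> simp [seriesBlocks]
    omega
  have key : (X.src :: X.snk :: (seriesBlocks as).flatten).Nodup ∧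
      ∀ x, x ∈ X.src :: X.snk :: (seriesBlocks as).flatten ↔ ∃ Z ∈ Xs, x ∈ Z.verts := by
    have h2 := h.two_le
    obtain _ | ⟨X₀, Xs'⟩ := Xs
    · simp at h2
    obtain _ | ⟨l₀, ls'⟩ := ls
    · simp at ha
    have hl := linked_of_index _ h.merge h.inter
    have hlen' : Xs'.length = ls'.length := by simp at hlen hls; omega
    have hen : ∀ q ∈ (X₀ :: Xs').zip (l₀ :: ls'), Enumerates q.1 q.2 := by
      intro q hq
      obtain ⟨i, hi, rfl⟩ := List.getElem_of_mem hq
      simp only [List.length_zip] at hi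
      rw [List.getElem_zip]
      exact (hin i (by omega)).toEnumerates
    obtain ⟨n, m⟩ := hl.enumerate Xs' ls' X₀ l₀ (hen (X₀, l₀) (by simp)) hlen'
      (fun q hq => hen q (by simp [hq]))
    have hs : X₀.src = X.src := by simpa using h.src
    have ht : ((X₀ :: Xs').getLast (by simp)).snk = X.snk := by
      have := h.snk
      rw [List.getLast?_eq_getLast_of_ne_nil (by simp)] at this
      simpa using this
    have hb : (seriesBlocks as) = l₀ :: List.zipWith (fun X l => X.src :: l) Xs' ls' := by
      simp only [has, List.zipWith_cons_cons, seriesBlocks, List.map_zipWith]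
      simp
    rw [ht] at n m
    rw [List.flatten_cons, List.cons_append, List.cons_append, hs] at n m
    rw [hb, List.flatten_cons]
    have hp := (List.perm_append_singleton X.snk
      (l₀ ++ (List.zipWith (fun X l => X.src :: l) Xs' ls').flatten)).cons X.src
    exact ⟨hp.nodup_iff.1 n, fun x => by rw [← hp.mem_iff, m]⟩
  have hp := (hperm.cons X.snk).cons X.src
  refine ⟨⟨hp.nodup_iff.2 key.1, fun x => ?_⟩, ?_⟩
  · rw [hp.mem_iff, key.2, h.verts]
  · refine .series ts X (.series ts Xs X hlen hts h) as (by omega) ?_ a (by omega) ?_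
    · intro q hq
      obtain ⟨i, hi, rfl⟩ := List.getElem_of_mem hq
      simp only [List.length_zip] at hi
      rw [List.getElem_zip]
      rw [hasi]
      exact (hin i (by omega)).order
    · intro x hx
      obtain ⟨i, hi, rfl⟩ := List.getElem_of_mem hx
      rw [hasi, hasi]
      -- Every component has two nodes more than its inner order, so comparing inner orders finds a
      -- largest component.
      have := hmax ls[i] (List.getElem_mem (by omega))
      simpa using this

/-- The children share nothing but the two terminals, so their inner orders are disjoint and may be
concatenated in any order with a longest one at the end. -/
theorem inner_parallel {ts : List (SPTree α)} {Xs : List (TTGraph α)} {X : TTGraph α}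
    (hlen : ts.length = Xs.length) (hts : ∀ q ∈ ts.zip Xs, SPTree.Represents q.1 q.2)
    (h : IsParallelComp Xs X) (ls : List (List α)) (hls : ts.length = ls.length)
    (hin : ∀ (i : ℕ) (h : i < ts.length), InnerOrder ts[i] Xs[i] ls[i])
    (bs : List (List α)) (b : List α) (hperm : ls.Perm (bs ++ [b]))
    (hmax : ∀ x ∈ ls, x.length ≤ b.length) :
    InnerOrder (.parallel ts) X (bs ++ [b]).flatten := by
  set f : List α → List α := fun l => X.src :: X.snk :: l with hf
  have hterm : ∀ (i : ℕ) (h : i < ts.length), Xs[i].src = X.src ∧ Xs[i].snk = X.snk :=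
    fun i hi => h.terminals _ (List.getElem_mem _)
  have key : (X.src :: X.snk :: ls.flatten).Nodup ∧
      ∀ x, x ∈ X.src :: X.snk :: ls.flatten ↔ ∃ Z ∈ Xs, x ∈ Z.verts := by
    have hmem : ∀ (i : ℕ) (hi : i < ts.length), ∀ x, x ∈ Xs[i].verts ↔
        x = X.src ∨ x = X.snk ∨ x ∈ ls[i] := by
      intro i hi x
      rw [(hin i hi).mem]; simp [hterm i hi]
    have hnd : ∀ (i : ℕ) (hi : i < ts.length), (X.src :: X.snk :: ls[i]).Nodup := by
      intro i hi
      have := (hin i hi).nodup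
      rwa [(hterm i hi).1, (hterm i hi).2] at this
    have hdis : ls.Pairwise List.Disjoint := by
      rw [List.pairwise_iff_getElem]
      intro i j hi hj hij x hx hx'
      have := (List.pairwise_iff_getElem.1 h.inter) i j (by omega) (by omega) hij x
        ((hmem i (by omega) x).2 (by simp [hx])) ((hmem j (by omega) x).2 (by simp [hx']))
      have hn := hnd i (by omega)
      simp only [List.nodup_cons, List.mem_cons, not_or] at hn
      rcases this with rfl | rfl
      · exact hn.1.2 hx
      · exact hn.2.1 hx
    constructor
    · simp only [List.nodup_cons, List.mem_cons, List.mem_flatten, not_or, not_exists, not_and]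
      refine ⟨⟨X.src_ne_snk, fun l hl hx => ?_⟩, fun l hl hx => ?_, ?_⟩
      · obtain ⟨i, hi, rfl⟩ := List.getElem_of_mem hl
        have hn := hnd i (by omega)
        simp only [List.nodup_cons, List.mem_cons, not_or] at hn
        exact hn.1.2 hx
      · obtain ⟨i, hi, rfl⟩ := List.getElem_of_mem hl
        have hn := hnd i (by omega)
        simp only [List.nodup_cons, List.mem_cons, not_or] at hn
        exact hn.2.1 hx
      · refine List.nodup_flatten.2 ⟨fun l hl => ?_, hdis⟩
        obtain ⟨i, hi, rfl⟩ := List.getElem_of_mem hl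
        have hn := hnd i (by omega)
        simp only [List.nodup_cons] at hn
        exact hn.2.2
    · intro x
      have h2 := h.two_le
      simp only [List.mem_cons, List.mem_flatten]
      constructor
      · rintro (hx | hx | ⟨l, hl, hx⟩)
        · exact ⟨Xs[0], List.getElem_mem _, (hmem 0 (by omega) x).2 (by simp [hx])⟩
        · exact ⟨Xs[0], List.getElem_mem _, (hmem 0 (by omega) x).2 (by simp [hx])⟩
        · obtain ⟨i, hi, rfl⟩ := List.getElem_of_mem hl
          exact ⟨Xs[i], List.getElem_mem _, (hmem i (by omega) x).2 (by simp [hx])⟩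
      · rintro ⟨Z, hZ, hx⟩
        obtain ⟨i, hi, rfl⟩ := List.getElem_of_mem hZ
        rcases (hmem i (by omega) x).1 hx with hx | hx | hx
        · simp [hx]
        · simp [hx]
        · exact Or.inr (Or.inr ⟨_, List.getElem_mem _, hx⟩)
  have hp := ((hperm.flatten).cons X.snk).cons X.src
  refine ⟨⟨hp.nodup_iff.1 key.1, fun x => ?_⟩, ?_⟩
  · rw [← hp.mem_iff, key.2, h.verts]
  · have := SPGAAOrder.parallel ts X (.parallel ts Xs X hlen hts h) (ls.map f) (by simpa using hls)
      ?_ (bs.map f) (f b) (by simpa using hperm.map f) ?_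
    · simpa [f, Function.comp_def] using this
    · intro q hq
      obtain ⟨i, hi, rfl⟩ := List.getElem_of_mem hq
      simp only [List.length_zip, List.length_map] at hi
      rw [List.getElem_zip, List.getElem_map]
      have := (hin i (by omega)).order
      rw [(hterm i (by omega)).1, (hterm i (by omega)).2] at this
      exact this
    · intro x hx
      obtain ⟨y, hy, rfl⟩ := List.mem_map.1 hx
      simpa [f] using hmax y hy

end chains

/-! ### Paths -/

section zigzag
variable {α : Type}

theorem zigzag_perm (l : List α) : (zigzag l).Perm l := by
  induction h : l.length generalizing l with
  | zero => simp [List.length_eq_zero_iff.1 h, zigzag]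
  | succ n ih =>
    cases l with
    | nil => simp at h
    | cons a l =>
      rw [zigzag]
      exact ((ih _ (by simpa using h)).trans (List.reverse_perm l)).cons a

/-- This closed form, even positions from the front and odd ones from the back, lets the machine
compute any entry of a path order directly, and thus also write it in reverse. -/
theorem zigzag_getElem? (l : List α) (j : ℕ) (hj : j < l.length) :
    (zigzag l)[j]? = if j % 2 = 0 then l[j / 2]? else l[l.length - 1 - j / 2]? := by
  induction j generalizing l with
  | zero =>
    cases l with
    | nil => simp at hj
    | cons a l => simp [zigzag]
  | succ j ih =>
    cases l with
    | nil => simp at hj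
    | cons a l =>
      simp only [List.length_cons] at hj
      rw [zigzag, List.getElem?_cons_succ, ih _ (by simpa using hj)]
      simp only [List.length_reverse, List.length_cons]
      rcases Nat.mod_two_eq_zero_or_one j with h | h
      · rw [if_pos h, if_neg (by omega), List.getElem?_reverse (by omega),
          show l.length + 1 - 1 - (j + 1) / 2 = (l.length - 1 - j / 2) + 1 by omega,
          List.getElem?_cons_succ]
      · rw [if_neg (by omega), if_pos (by omega), List.getElem?_reverse (by omega),
          show (j + 1) / 2 = (l.length - 1 - (l.length - 1 - j / 2)) + 1 by omega,
          List.getElem?_cons_succ]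

/-- The order of a path starts with its two ends and continues with the zigzag of its inner nodes;
so leaves fit the scheme of source, sink and inner order. -/
theorem zigzag_path (u v : α) (w : List α) :
    zigzag (u :: (w ++ [v])) = u :: v :: zigzag w := by
  rw [zigzag, List.reverse_append, List.reverse_singleton, List.singleton_append, zigzag,
    List.reverse_reverse]

theorem inner_leaf {p : List α} {X : TTGraph α} (h : SPTree.IsPathOf p X) :
    InnerOrder (.leaf p) X (zigzag (p.drop 1).dropLast) := by
  have h2 := h.two_le
  have hs := h.src
  have ht := h.snk
  obtain _ | ⟨u, q⟩ := p
  · simp at h2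
  have hq : q ≠ [] := by rintro rfl; simp at h2
  obtain ⟨w, v, rfl⟩ : ∃ w v, q = w ++ [v] := ⟨_, _, (List.dropLast_append_getLast hq).symm⟩
  simp only [List.head?_cons, Option.some.injEq] at hs
  rw [← List.cons_append, List.getLast?_concat] at ht
  simp only [Option.some.injEq] at ht
  subst hs ht
  have hp : (X.src :: (w ++ [X.snk])).Perm (X.src :: X.snk :: zigzag w) := by
    rw [← zigzag_path]; exact (zigzag_perm _).symm
  simp only [List.drop_succ_cons, List.drop_zero, List.dropLast_concat]
  refine ⟨⟨hp.nodup_iff.1 h.nodup, fun x => by rw [h.verts, hp.mem_iff]⟩, ?_⟩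
  rw [← zigzag_path]
  exact .leaf _

end zigzag

/-! ### Trees -/

namespace SPTree
variable {α : Type}

/-- Induction over SP-trees. -/
theorem induction {P : SPTree α → Prop} (leaf : ∀ p, P (leaf p))
    (series : ∀ ts, (∀ t ∈ ts, P t) → P (series ts))
    (parallel : ∀ ts, (∀ t ∈ ts, P t) → P (parallel ts)) (T : SPTree α) : P T :=
  SPTree.rec (motive_1 := P) (motive_2 := fun ts => ∀ t ∈ ts, P t) leaf series parallel
    (by simp) (fun t ts h1 h2 => by simpa using ⟨h1, h2⟩) T

/-- The number of nodes of the tree. -/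
def nn : SPTree α → ℕ
  | leaf _ => 1
  | series ts => (ts.map fun t => t.nn).sum + 1
  | parallel ts => (ts.map fun t => t.nn).sum + 1

/-- The number of nodes of the component other than the terminals. -/
def isz : SPTree α → ℕ
  | leaf p => p.length - 2
  | series ts => (ts.map fun t => t.isz).sum + (ts.length - 1)
  | parallel ts => (ts.map fun t => t.isz).sum

/-- Partial sums. -/
def pre (f : SPTree α → ℕ) (ts : List (SPTree α)) (j : ℕ) : ℕ := ((ts.take j).map f).sum

@[simp] theorem pre_zero (f : SPTree α → ℕ) (ts : List (SPTree α)) : pre f ts 0 = 0 := by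
  simp [pre]

theorem pre_length (f : SPTree α → ℕ) (ts : List (SPTree α)) :
    pre f ts ts.length = (ts.map f).sum := by
  simp [pre]

theorem pre_succ (f : SPTree α → ℕ) (ts : List (SPTree α)) (j : ℕ) (h : j < ts.length) :
    pre f ts (j + 1) = pre f ts j + f ts[j] := by
  rw [pre, pre, List.take_add_one, List.getElem?_eq_getElem h, List.map_append, List.sum_append]
  simp

theorem pre_cons (f : SPTree α → ℕ) (t : SPTree α) (ts : List (SPTree α)) (j : ℕ) :
    pre f (t :: ts) (j + 1) = f t + pre f ts j := by
  simp [pre]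

theorem pre_mono (f : SPTree α → ℕ) (ts : List (SPTree α)) {i j : ℕ} (h : i ≤ j) :
    pre f ts i ≤ pre f ts j := by
  have : ts.take i = (ts.take j).take i := by rw [List.take_take, min_eq_left h]
  rw [pre, this, pre]
  conv_rhs => rw [← List.take_append_drop i (ts.take j)]
  rw [List.map_append, List.sum_append]
  omega

theorem pre_le (f : SPTree α → ℕ) (ts : List (SPTree α)) (j : ℕ) :
    pre f ts j ≤ (ts.map f).sum := by
  rcases le_total j ts.length with h | h
  · rw [← pre_length]; exact pre_mono f ts h
  · simp [pre, List.take_of_length_le h]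

@[simp] theorem nn_leaf (p : List α) : (leaf p).nn = 1 := by rw [nn]
@[simp] theorem nn_series (ts : List (SPTree α)) : (series ts).nn = (ts.map nn).sum + 1 := by rw [nn]
@[simp] theorem nn_parallel (ts : List (SPTree α)) : (parallel ts).nn = (ts.map nn).sum + 1 := by
  rw [nn]
@[simp] theorem isz_leaf (p : List α) : (leaf p).isz = p.length - 2 := by rw [isz]
@[simp] theorem isz_series (ts : List (SPTree α)) :
    (series ts).isz = (ts.map isz).sum + (ts.length - 1) := by rw [isz]
@[simp] theorem isz_parallel (ts : List (SPTree α)) : (parallel ts).isz = (ts.map isz).sum := by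
  rw [isz]

theorem encode_series (ts : List (SPTree ℕ)) :
    (series ts).encode = (ts.map encode).flatten ++ [1, ts.length] := by
  rw [encode]

theorem encode_parallel (ts : List (SPTree ℕ)) :
    (parallel ts).encode = (ts.map encode).flatten ++ [2, ts.length] := by
  rw [encode]

theorem length_flatten_encode (ts : List (SPTree ℕ)) :
    (ts.map encode).flatten.length = (ts.map fun t => t.encode.length).sum := by
  rw [List.length_flatten, List.map_map]; rfl

/-- Every tree node contributes at least two tokens of its own. Hence node numbers never overtake
positions in the input, which keeps them in range. -/
theorem two_nn_le (T : SPTree ℕ) : 2 * T.nn ≤ T.encode.length := by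
  have aux : ∀ ts : List (SPTree ℕ), (∀ t ∈ ts, 2 * t.nn ≤ t.encode.length) →
      2 * (ts.map nn).sum ≤ (ts.map fun t => t.encode.length).sum := by
    intro ts h
    rw [← List.sum_map_mul_left]
    exact List.sum_le_sum h
  induction T using SPTree.induction with
  | leaf p => simp [encode]
  | series ts ih =>
    have := aux ts ih
    rw [encode_series, List.length_append, length_flatten_encode]
    simp only [List.length_cons, List.length_nil, nn_series]
    omega
  | parallel ts ih =>
    have := aux ts ih
    rw [encode_parallel, List.length_append, length_flatten_encode]
    simp only [List.length_cons, List.length_nil, nn_parallel]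
    omega

/-- The length of the encoding. -/
def elen (T : SPTree ℕ) : ℕ := T.encode.length

theorem isz_lt_elen (T : SPTree ℕ) : T.isz + 1 ≤ T.elen := by
  have aux : ∀ ts : List (SPTree ℕ), (∀ t ∈ ts, t.isz + 1 ≤ t.elen) →
      (ts.map isz).sum + ts.length ≤ (ts.map elen).sum := by
    intro ts h
    induction ts with
    | nil => simp
    | cons t ts ih =>
      have h1 := h t (by simp)
      have h2 := ih fun t ht => h t (by simp [ht])
      simp only [List.map_cons, List.sum_cons, List.length_cons]
      omega
  induction T using SPTree.induction with
  | leaf p => simp [encode, elen]; omega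
  | series ts ih =>
    have := aux ts ih
    rw [elen, encode_series, List.length_append, length_flatten_encode]
    simp only [List.length_cons, List.length_nil, isz_series]
    change _ ≤ (ts.map elen).sum + _
    omega
  | parallel ts ih =>
    have := aux ts ih
    rw [elen, encode_parallel, List.length_append, length_flatten_encode]
    simp only [List.length_cons, List.length_nil, isz_parallel]
    change _ ≤ (ts.map elen).sum + _
    omega

end SPTree

namespace Imp
open SPTree

/-- The entries of an inner node in the tables. The tables are `1`: kind, `2`: number of children or
length of the path, `3`: address of the path, `4`: size of the subtree, `5`: number of inner nodes
of the component, `6`: source, `7`: sink, `8`: index of a biggest child. -/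
structure Header (A : ℕ → ℕ → ℕ) (k : ℕ) (ts : List (SPTree ℕ)) (b : ℕ) (T : SPTree ℕ) :
    Prop where
  kind : A 1 (b + T.nn) = k
  arg : A 2 (b + T.nn) = ts.length
  cnt : A 4 (b + T.nn) = T.nn
  isz : A 5 (b + T.nn) = T.isz
  src : A 6 (b + T.nn) = A 6 (b + pre nn ts 1)
  snk : A 7 (b + T.nn) = A 7 (b + pre nn ts ts.length)
  best_lt : A 8 (b + T.nn) < ts.length
  best : ∀ t ∈ ts, t.isz ≤ (ts[A 8 (b + T.nn)]).isz

/-- The tables describe the tree, whose nodes have the numbers `b + 1, b + 2, …`, in postorder. All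
paths are stored at addresses below `L`. -/
inductive NodeRep (L : ℕ) (A : ℕ → ℕ → ℕ) : ℕ → SPTree ℕ → Prop
  | leaf (b : ℕ) (p : List ℕ) (kind : A 1 (b + 1) = 0) (arg : A 2 (b + 1) = p.length)
      (lim : A 3 (b + 1) + p.length ≤ L) (path : ∀ (j : ℕ) (h : j < p.length), A 0 (A 3 (b + 1) + j) = p[j])
      (cnt : A 4 (b + 1) = 1) (isz : A 5 (b + 1) = p.length - 2)
      (src : p.head? = some (A 6 (b + 1))) (snk : p.getLast? = some (A 7 (b + 1))) :
      NodeRep L A b (leaf p)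
  | series (b : ℕ) (ts : List (SPTree ℕ))
      (h : ∀ (j : ℕ) (hj : j < ts.length), NodeRep L A (b + pre nn ts j) ts[j])
      (hd : Header A 1 ts b (series ts)) : NodeRep L A b (series ts)
  | parallel (b : ℕ) (ts : List (SPTree ℕ))
      (h : ∀ (j : ℕ) (hj : j < ts.length), NodeRep L A (b + pre nn ts j) ts[j])
      (hd : Header A 2 ts b (parallel ts)) : NodeRep L A b (parallel ts)

theorem Header.congr {A A' : ℕ → ℕ → ℕ} {k : ℕ} {ts : List (SPTree ℕ)} {b : ℕ} {T : SPTree ℕ}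
    (h : Header A k ts b T) (hT : T.nn = (ts.map nn).sum + 1)
    (hA : ∀ l < 9, ∀ i ≤ b + T.nn, A' l i = A l i) : Header A' k ts b T := by
  have h8 : A' 8 (b + T.nn) = A 8 (b + T.nn) := hA 8 (by omega) _ le_rfl
  have h1 := pre_le nn ts 1
  have h2 := pre_le nn ts ts.length
  constructor
  · rw [hA 1 (by omega) _ le_rfl, h.kind]
  · rw [hA 2 (by omega) _ le_rfl, h.arg]
  · rw [hA 4 (by omega) _ le_rfl, h.cnt]
  · rw [hA 5 (by omega) _ le_rfl, h.isz]
  · rw [hA 6 (by omega) _ le_rfl, hA 6 (by omega) _ (by omega), h.src]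
  · rw [hA 7 (by omega) _ le_rfl, hA 7 (by omega) _ (by omega), h.snk]
  · simpa only [h8] using h.best
  · rw [h8]; exact h.best_lt

/-- The description of a subtree reads no table beyond the row of its root, the last one in
postorder, so rows that are written later do not disturb it. -/
theorem NodeRep.congr {L : ℕ} {A A' : ℕ → ℕ → ℕ} {b : ℕ} {T : SPTree ℕ} (h : NodeRep L A b T)
    (h0 : A' 0 = A 0) (hA : ∀ l < 9, ∀ i ≤ b + T.nn, A' l i = A l i) : NodeRep L A' b T := by
  have aux : ∀ (b : ℕ) (ts : List (SPTree ℕ)) (j : ℕ) (hj : j < ts.length),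
      b + pre nn ts j + ts[j].nn ≤ b + ((ts.map nn).sum + 1) := by
    intro b ts j hj
    have := pre_le nn ts (j + 1)
    rw [pre_succ _ _ _ hj] at this
    omega
  induction h with
  | leaf b p kind arg lim path cnt isz src snk =>
    simp only [nn] at hA
    have := hA 3 (by omega) _ le_rfl
    refine .leaf b p ?_ ?_ ?_ ?_ ?_ ?_ ?_ ?_
    · rw [hA 1 (by omega) _ le_rfl, kind]
    · rw [hA 2 (by omega) _ le_rfl, arg]
    · rw [this]; exact lim
    · rw [this, h0]; exact path
    · rw [hA 4 (by omega) _ le_rfl, cnt]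
    · rw [hA 5 (by omega) _ le_rfl, isz]
    · rw [hA 6 (by omega) _ le_rfl, src]
    · rw [hA 7 (by omega) _ le_rfl, snk]
  | series b ts h hd ih =>
    refine .series b ts (fun j hj => ih j hj fun l hl i hi => ?_) (hd.congr (by rw [nn]) hA)
    refine hA l hl i (hi.trans ?_)
    rw [nn]; exact aux b ts j hj
  | parallel b ts h hd ih =>
    refine .parallel b ts (fun j hj => ih j hj fun l hl i hi => ?_) (hd.congr (by rw [nn]) hA)
    refine hA l hl i (hi.trans ?_)
    rw [nn]; exact aux b ts j hj

theorem NodeRep.cnt_isz {L : ℕ} {A : ℕ → ℕ → ℕ} {b : ℕ} {T : SPTree ℕ} (h : NodeRep L A b T) :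
    A 4 (b + T.nn) = T.nn ∧ A 5 (b + T.nn) = T.isz := by
  cases h with
  | leaf _ _ _ _ _ _ cnt isz => simp only [nn_leaf, isz_leaf]; exact ⟨cnt, isz⟩
  | series _ ts _ hd => exact ⟨hd.cnt, hd.isz⟩
  | parallel _ ts _ hd => exact ⟨hd.cnt, hd.isz⟩

/-! ### The first pass: the tables -/

/-- Collect the data of the children of a node. Registers: `2` node, `3` index of the child,
`4` child, `5` sum of the sizes, `6` biggest child, `7` its size. -/
def childLoop : Cmd :=
  .while (.var 3)
    (.set 3 (.minus (.var 3) (.lit 1)) ;;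
     .put 6 (.var 2) (.get 6 (.var 4)) ;;
     .set 5 (.plus (.var 5) (.get 5 (.var 4))) ;;
     .ite (.minus (.var 7) (.get 5 (.var 4))) .skip
       (.set 6 (.var 3) ;; .set 7 (.get 5 (.var 4))) ;;
     .set 4 (.minus (.var 4) (.get 4 (.var 4))))

/-- Read a leaf. -/
def leafBody : Cmd :=
  .put 3 (.var 2) (.plus (.var 1) (.lit 2)) ;;
  .put 4 (.var 2) (.lit 1) ;;
  .put 5 (.var 2) (.minus (.get 0 (.plus (.var 1) (.lit 1))) (.lit 2)) ;;
  .put 6 (.var 2) (.get 0 (.plus (.var 1) (.lit 2))) ;;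
  .put 7 (.var 2) (.get 0 (.plus (.plus (.var 1) (.lit 1)) (.get 0 (.plus (.var 1) (.lit 1))))) ;;
  .set 1 (.plus (.plus (.var 1) (.lit 2)) (.get 0 (.plus (.var 1) (.lit 1))))

/-- Read an inner node. -/
def nodeBody : Cmd :=
  .set 3 (.get 0 (.plus (.var 1) (.lit 1))) ;;
  .set 4 (.minus (.var 2) (.lit 1)) ;;
  .set 5 (.lit 0) ;; .set 6 (.lit 0) ;; .set 7 (.lit 0) ;;
  .put 7 (.var 2) (.get 7 (.var 4)) ;;
  childLoop ;;
  .put 4 (.var 2) (.minus (.var 2) (.var 4)) ;;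
  .put 8 (.var 2) (.var 6) ;;
  .ite (.minus (.get 0 (.var 1)) (.lit 1)) .skip
    (.set 5 (.plus (.var 5) (.minus (.get 0 (.plus (.var 1) (.lit 1))) (.lit 1)))) ;;
  .put 5 (.var 2) (.var 5) ;;
  .set 1 (.plus (.var 1) (.lit 2))

/-- The first pass. Registers: `0` length of the input, `1` position, `2` node. -/
def tableLoop : Cmd :=
  .while (.minus (.var 0) (.var 1))
    (.put 1 (.var 2) (.get 0 (.var 1)) ;;
     .put 2 (.var 2) (.get 0 (.plus (.var 1) (.lit 1))) ;;
     .ite (.get 0 (.var 1)) nodeBody leafBody ;;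
     .set 2 (.plus (.var 2) (.lit 1)))

variable {N : ℕ} {Q : St → Prop}

end Imp

namespace Imp
open SPTree
variable {N : ℕ} {Q : St → Prop}

/-- The state `t` during the collection of the children `ts` of a node, started in the
state `s`. -/
structure ChildInv (ts : List (SPTree ℕ)) (b : ℕ) (s t : St) : Prop where
  le : t.reg 3 ≤ ts.length
  r0 : t.reg 0 = s.reg 0
  r1 : t.reg 1 = s.reg 1
  r2 : t.reg 2 = s.reg 2
  r4 : t.reg 4 = b + pre nn ts (t.reg 3)
  r5 : t.reg 5 + pre isz ts (t.reg 3) = (ts.map isz).sum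
  best : t.reg 3 < ts.length → ∃ h : t.reg 6 < ts.length, t.reg 7 = (ts[t.reg 6]).isz
  max : ∀ (j : ℕ) (h : j < ts.length), t.reg 3 ≤ j → (ts[j]).isz ≤ t.reg 7
  zero : t.reg 3 = ts.length → t.reg 7 = 0
  fuel : s.fuel + t.reg 3 ≤ t.fuel + ts.length
  fuel' : t.reg 3 ≤ t.fuel
  arr : ∀ k, k ≠ 6 → t.arr k = s.arr k
  arr6 : ∀ i, i ≠ s.reg 2 → t.arr 6 i = s.arr 6 i
  src : t.reg 3 < ts.length → t.arr 6 (s.reg 2) = s.arr 6 (b + pre nn ts (t.reg 3 + 1))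

/-- The last child immediately precedes the node, and subtracting the size of a child leads to the
one before, so children are visited from last to first without pointers. Each one overwrites the
source of the node; the first child, visited last, leaves the right one. -/
theorem childLoop_spec (ts : List (SPTree ℕ)) (b : ℕ) (s : St)
    (h2 : s.reg 2 = b + (ts.map nn).sum + 1) (h3 : s.reg 3 = ts.length)
    (h4 : s.reg 4 = b + (ts.map nn).sum) (h5 : s.reg 5 = 0) (h7 : s.reg 7 = 0)
    (hN : (ts.map isz).sum < N) (hf : ts.length ≤ s.fuel)
    (hc : ∀ (j : ℕ) (h : j < ts.length), s.arr 4 (b + pre nn ts (j + 1)) = ts[j].nn ∧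
      s.arr 5 (b + pre nn ts (j + 1)) = ts[j].isz)
    (hQ : ∀ t : St, t.reg 3 = 0 → ChildInv ts b s t → Q t) :
    wp N childLoop Q s := by
  refine wp_while_inv (ChildInv ts b s) ?_ (fun t _ => by simp) ?_
    (fun t ht h => hQ t (by simpa using h) ht)
  · constructor <;> simp only [h3, pre_length] <;> first | omega | simp_all
  · intro t ⟨i1, i2, i3, i4, i5, i6, i7, i8, i8', i9, i10, i11, i12, i13⟩ h
    simp only [Ex.eval] at h
    refine ⟨by omega, ?_⟩
    obtain ⟨j, hj⟩ : ∃ j, t.reg 3 = j + 1 := ⟨t.reg 3 - 1, by omega⟩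
    simp only [hj] at i1 i5 i6 i7 i8 i8' i9 i10 i13
    obtain ⟨c1, c2⟩ := hc j (by omega)
    have hp := pre_succ isz ts j (by omega)
    have hpn := pre_succ nn ts j (by omega)
    have hle := pre_le nn ts (j + 1)
    have hne : t.reg 4 ≠ s.reg 2 := by omega
    rw [← i5] at c1 c2
    simp [hj, i4, i11, c1, c2]
    refine ⟨by omega, fun hlt => ?_, fun hlt => ?_⟩
    · constructor <;> simp [hj, i4, i11, c1, c2, i12 _ hne] <;> try omega
      · intro _
        apply i7
        -- The record `t.reg 7` exceeds the size of a child, so it is positive and some child has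
        -- been visited before.
        by_contra hcon
        have := i8' (by omega)
        omega
      · intro l hl hlj
        rcases Nat.lt_or_ge j l with h' | h'
        · exact i8 l hl (by omega)
        · obtain rfl : l = j := by omega
          omega
      · intro k hk
        rw [setA_arr_ne _ _ _ _ _ hk, setR_arr, tick_arr, i11 k hk]
      · intro i hi
        rw [Function.update_of_ne hi, i12 i hi]
      · intro _
        rw [← i5]
    · have hge : t.reg 7 ≤ ts[j].isz := by omega
      constructor <;> simp [hj, i4, i11, c1, c2, i12 _ hne] <;> try omega
      · intro l hl hlj
        rcases Nat.lt_or_ge j l with h' | h'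
        · exact (i8 l hl (by omega)).trans hge
        · obtain rfl : l = j := by omega
          omega
      · intro k hk
        rw [setA_arr_ne _ _ _ _ _ hk, setR_arr, tick_arr, i11 k hk]
      · intro i hi
        rw [Function.update_of_ne hi, i12 i hi]
      · intro _
        rw [← i5]

/-- The progress that the first pass makes while it reads `len` tokens that encode
`cnt` nodes. -/
structure TablePost (s t : St) (len cnt e : ℕ) : Prop where
  arr0 : t.arr 0 = s.arr 0
  r0 : t.reg 0 = s.reg 0
  r1 : t.reg 1 = s.reg 1 + len
  r2 : t.reg 2 = s.reg 2 + cnt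
  old : ∀ k, ∀ i < s.reg 2, t.arr k i = s.arr k i
  fuel : s.fuel + e ≤ t.fuel + len

theorem setA_arr_of_ne_index (s : St) (k i v l : ℕ) {j : ℕ} (h : j ≠ i) :
    (s.setA k i v).arr l j = s.arr l j := by
  by_cases hl : l = k
  · subst hl; rw [setA_arr_self, Function.update_of_ne h]
  · rw [setA_arr_ne _ _ _ _ _ hl]

/-- Postorder guarantees that the rows of the children are complete; one iteration adds the row of
the node. An `S`-node has, besides the inner nodes of its children, one joint between any two
consecutive ones. -/
theorem tableLoop_node (k : ℕ) (ts : List (SPTree ℕ)) (b : ℕ) (T : SPTree ℕ) (s : St)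
    (hk : k = 1 ∧ T = .series ts ∨ k = 2 ∧ T = .parallel ts)
    (h2 : s.reg 2 = b + (ts.map nn).sum + 1) (hm : 0 < ts.length)
    (hrep : ∀ (j : ℕ) (hj : j < ts.length), NodeRep (s.reg 0) s.arr (b + pre nn ts j) ts[j])
    (t0 : s.arr 0 (s.reg 1) = k) (t1 : s.arr 0 (s.reg 1 + 1) = ts.length)
    (hL : s.reg 1 + 2 ≤ s.reg 0) (hN : 4 * s.reg 0 + 10 < N) (h21 : s.reg 2 ≤ s.reg 0)
    (hsz : (ts.map isz).sum + ts.length ≤ s.reg 0) (hf : ts.length + 1 ≤ s.fuel)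
    (hQ : ∀ t : St, t.arr 0 = s.arr 0 → t.reg 0 = s.reg 0 → t.reg 1 = s.reg 1 + 2 →
      t.reg 2 = s.reg 2 + 1 → (∀ k, ∀ i < s.reg 2, t.arr k i = s.arr k i) →
      s.fuel ≤ t.fuel + ts.length + 1 → NodeRep (s.reg 0) t.arr b T → wp N tableLoop Q t) :
    wp N tableLoop Q s := by
  have hk0 : k ≠ 0 := by omega
  have hTn : T.nn = (ts.map nn).sum + 1 := by
    rcases hk with ⟨-, rfl⟩ | ⟨-, rfl⟩ <;> simp
  refine wp_while_true (by simp) (by simp; omega) (by omega) ?_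
  simp only [wp_seq, wp_put, wp_ite, wp_set, nodeBody]
  simp [t0, t1, hk0]
  refine ⟨by omega, childLoop_spec ts b _ (by simp [h2]) (by simp) (by simp; omega) (by simp)
    (by simp) (by omega) (by simp; omega) ?_ ?_⟩
  · intro j hj
    have := (hrep j hj).cnt_isz
    simpa [pre_succ _ _ _ hj, add_assoc] using this
  · intro t h3 ht
    have hr0 := ht.r0
    have hr1 := ht.r1
    have hr2 := ht.r2
    have hr4 := ht.r4
    have hr5 := ht.r5
    have hfu := ht.fuel
    have ha := ht.arr
    have ha6 := ht.arr6
    have hsrc := ht.src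
    obtain ⟨hb, hb7⟩ := ht.best (by omega)
    have hmax := ht.max
    have e0 := ha 0 (by omega)
    have e1 := ha 1 (by omega)
    have e2 := ha 2 (by omega)
    have e3 := ha 3 (by omega)
    have e7 := ha 7 (by omega)
    simp [h3, hm] at hr0 hr1 hr2 hr4 hr5 hfu ha6 hsrc hmax e0 e1 e2 e3 e7
    have old : ∀ l, ∀ i, i ≠ s.reg 2 → t.arr l i = s.arr l i := by
      intro l i hi
      by_cases hl : l = 6
      · subst hl; exact ha6 i hi
      · rw [ha l hl]; simp [setA_arr_of_ne_index, hi]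
    have hroot : s.reg 2 = b + T.nn := by omega
    have hbest : ∀ t' ∈ ts, t'.isz ≤ (ts[t.reg 6]).isz := by
      intro t' ht'
      obtain ⟨j, hj, rfl⟩ := List.getElem_of_mem ht'
      rw [← hb7]; exact hmax j hj
    have hsub : ∀ A : ℕ → ℕ → ℕ, A 0 = s.arr 0 → (∀ l, ∀ i < s.reg 2, A l i = s.arr l i) →
        ∀ (j : ℕ) (hj : j < ts.length), NodeRep (s.reg 0) A (b + pre nn ts j) ts[j] := by
      intro A hA0 hA j hj
      refine (hrep j hj).congr hA0 fun l _ i hi => hA l i ?_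
      have := pre_le nn ts (j + 1)
      rw [pre_succ _ _ _ hj] at this
      omega
    have hp1 : b + pre nn ts 1 ≠ s.reg 2 := by
      have := pre_le nn ts 1
      omega
    have hp2 : b + pre nn ts ts.length ≠ s.reg 2 := by
      have := pre_le nn ts ts.length
      omega
    have hp3 : s.reg 2 - 1 = b + pre nn ts ts.length := by rw [pre_length]; omega
    simp [hr0, hr1, hr2, hr4, hr5, e0, t0, t1]
    rcases hk with ⟨rfl, rfl⟩ | ⟨rfl, rfl⟩
    · refine ⟨fun h => absurd rfl h, fun _ => ⟨by omega, by omega, by omega, ?_⟩⟩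
      refine hQ _ ?_ ?_ ?_ ?_ ?_ ?_ (.series b ts (hsub _ ?_ ?_) ?_)
      any_goals simp [e0, hr0]
      · intro l i hi
        have hi' : i ≠ s.reg 2 := by omega
        simp [setA_arr_of_ne_index, hi', old]
      · omega
      · intro l i hi
        have hi' : i ≠ s.reg 2 := by omega
        simp [setA_arr_of_ne_index, hi', old]
      · constructor <;> simp only [← hroot] <;>
          simp [e1, e2, e3, e7, hb, ha6, hp1, hp2, hp3, hsrc, hbest]
        · omega
        · omega
    · refine ⟨fun _ => ⟨by omega, by omega, ?_⟩, fun h => absurd h (by norm_num)⟩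
      refine hQ _ ?_ ?_ ?_ ?_ ?_ ?_ (.parallel b ts (hsub _ ?_ ?_) ?_)
      any_goals simp [e0, hr0]
      · intro l i hi
        have hi' : i ≠ s.reg 2 := by omega
        simp [setA_arr_of_ne_index, hi', old]
      · omega
      · intro l i hi
        have hi' : i ≠ s.reg 2 := by omega
        simp [setA_arr_of_ne_index, hi', old]
      · constructor <;> simp only [← hroot] <;>
          simp [e1, e2, e3, e7, hb, ha6, hp1, hp2, hp3, hsrc, hbest]
        · omega
        · exact hbest

theorem tableLoop_leaf (p : List ℕ) (b : ℕ) (s : St) (h2 : s.reg 2 = b + 1) (hp : 2 ≤ p.length)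
    (t0 : s.arr 0 (s.reg 1) = 0) (t1 : s.arr 0 (s.reg 1 + 1) = p.length)
    (tp : ∀ (j : ℕ) (h : j < p.length), s.arr 0 (s.reg 1 + 2 + j) = p[j])
    (hL : s.reg 1 + 2 + p.length ≤ s.reg 0) (hN : 4 * s.reg 0 + 10 < N) (h21 : s.reg 2 ≤ s.reg 0)
    (hf : 1 ≤ s.fuel)
    (hQ : ∀ t : St, TablePost s t (p.length + 2) 1 1 → NodeRep (s.reg 0) t.arr b (.leaf p) →
      wp N tableLoop Q t) :
    wp N tableLoop Q s := by
  refine wp_while_true (by simp) (by simp; omega) (by omega) ?_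
  simp only [wp_seq, wp_put, wp_ite, wp_set, leafBody]
  simp [t0, t1]
  refine ⟨by omega, by omega, by omega, by omega, by omega, by omega, by omega, hQ _ ?_ ?_⟩
  · constructor <;> simp
    · omega
    · intro k i hi
      have hi' : i ≠ s.reg 2 := by omega
      simp [setA_arr_of_ne_index, hi']
    · omega
  · refine .leaf _ _ ?_ ?_ ?_ ?_ ?_ ?_ ?_ ?_ <;> simp [h2]
    · exact hL
    · exact tp
    · rw [List.head?_eq_getElem?, List.getElem?_eq_getElem (by omega), ← tp 0 (by omega)]
    · rw [List.getLast?_eq_getElem?, List.getElem?_eq_getElem (by omega), ← tp _ (by omega)]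
      congr 2
      omega

/-- The first pass reads the encoding of the tree `T`. -/
def Reads (N : ℕ) (T : SPTree ℕ) : Prop :=
  ∀ (b : ℕ) (s : St) (Q : St → Prop), s.reg 2 = b + 1 →
    (∀ (i : ℕ) (h : i < T.encode.length), s.arr 0 (s.reg 1 + i) = T.encode[i]) →
    s.reg 1 + T.elen ≤ s.reg 0 → 4 * s.reg 0 + 10 < N → s.reg 2 ≤ s.reg 1 + 1 →
    T.elen ≤ s.fuel + 1 →
    (∀ t : St, TablePost s t T.elen T.nn 1 → NodeRep (s.reg 0) t.arr b T → wp N tableLoop Q t) →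
    wp N tableLoop Q s

/-- A tree with `len` tokens is granted `len - 1` iterations. The units saved by the children, one
each, pay for visiting them again in the loop of their parent; the two tokens of the parent pay for
its own iteration and leave one unit saved. -/
theorem reads_list (ts : List (SPTree ℕ)) (hts : ∀ t ∈ ts, Reads N t) (b : ℕ) (s : St)
    (h2 : s.reg 2 = b + 1)
    (ht : ∀ (i : ℕ) (h : i < (ts.map encode).flatten.length),
      s.arr 0 (s.reg 1 + i) = (ts.map encode).flatten[i])
    (hL : s.reg 1 + (ts.map elen).sum ≤ s.reg 0) (hN : 4 * s.reg 0 + 10 < N)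
    (h21 : s.reg 2 ≤ s.reg 1 + 1) (hf : (ts.map elen).sum ≤ s.fuel + ts.length)
    (hQ : ∀ t : St, TablePost s t (ts.map elen).sum (ts.map nn).sum ts.length →
      (∀ (j : ℕ) (hj : j < ts.length), NodeRep (s.reg 0) t.arr (b + pre nn ts j) ts[j]) →
      wp N tableLoop Q t) :
    wp N tableLoop Q s := by
  induction ts generalizing b s with
  | nil => exact hQ s ⟨rfl, rfl, by simp, by simp, fun _ _ _ => rfl, by simp⟩ (by simp)
  | cons t ts ih =>
    have hnn := two_nn_le t
    have hlen : (t.encode ++ (ts.map encode).flatten).length =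
        t.elen + (ts.map encode).flatten.length := by
      rw [List.length_append]; rfl
    simp only [List.map_cons, List.sum_cons, List.flatten_cons, List.length_cons] at *
    change 2 * t.nn ≤ t.elen at hnn
    have hlen' := length_flatten_encode ts
    have hes : ∀ ts : List (SPTree ℕ), ts.length ≤ (ts.map elen).sum := by
      intro ts
      induction ts with
      | nil => simp
      | cons t ts ih =>
        have := isz_lt_elen t
        simp only [List.length_cons, List.map_cons, List.sum_cons]
        omega
    have hes := hes ts
    refine hts t (by simp) b s Q h2 ?_ (by omega) hN h21 (by omega) ?_
    · intro i hi
      rw [ht i (by change i < t.elen at hi; omega), List.getElem_append_left hi]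
    · intro u hu hr
      have r0 := hu.r0
      have r1 := hu.r1
      have r2 := hu.r2
      have fu := hu.fuel
      refine ih (fun t ht => hts t (by simp [ht])) (b + t.nn) u (by omega) ?_ (by omega)
        (by omega) (by omega) (by omega) ?_
      · intro i hi
        rw [hu.arr0, r1, add_assoc, ht _ (by omega), List.getElem_append_right (by
          change t.elen ≤ _; omega)]
        congr 1
        change t.elen + i - t.elen = i
        omega
      · intro v hv hrs
        refine hQ v ⟨hv.arr0.trans hu.arr0, hv.r0.trans r0, by rw [hv.r1]; omega,
          by rw [hv.r2]; omega, fun k i hi => ?_, ?_⟩ ?_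
        · rw [hv.old k i (by omega), hu.old k i hi]
        · have := hv.fuel; omega
        · rintro (_ | j) hj
          · exact hr.congr hv.arr0 fun l _ i hi => hv.old l i (by omega)
          · rw [pre_cons, ← add_assoc]
            rw [r0] at hrs
            exact hrs j (by simpa using hj)

theorem sum_isz_add_length_le (ts : List (SPTree ℕ)) :
    (ts.map isz).sum + ts.length ≤ (ts.map elen).sum := by
  induction ts with
  | nil => simp
  | cons t ts ih =>
    have h1 := isz_lt_elen t
    simp only [List.map_cons, List.sum_cons, List.length_cons]
    omega

theorem reads_node (k : ℕ) (ts : List (SPTree ℕ)) (T : SPTree ℕ)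
    (hk : k = 1 ∧ T = .series ts ∨ k = 2 ∧ T = .parallel ts)
    (henc : T.encode = (ts.map encode).flatten ++ [k, ts.length]) (hm : 0 < ts.length)
    (hts : ∀ t ∈ ts, Reads N t) : Reads N T := by
  have hTn : T.nn = (ts.map nn).sum + 1 := by
    rcases hk with ⟨-, rfl⟩ | ⟨-, rfl⟩ <;> simp
  have hel : T.elen = (ts.map elen).sum + 2 := by
    rw [elen, henc, List.length_append, length_flatten_encode]; rfl
  have hfl : (ts.map encode).flatten.length = (ts.map elen).sum := length_flatten_encode ts
  have h2n : 2 * (ts.map nn).sum ≤ (ts.map elen).sum := by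
    have := two_nn_le T
    change _ ≤ T.elen at this
    omega
  have hsz := sum_isz_add_length_le ts
  intro b s Q h2 ht hL hN h21 hf hQ
  simp only [henc] at ht
  refine reads_list ts hts b s h2 (fun i hi => ?_) (by omega) hN h21 (by omega) ?_
  · rw [ht i (by rw [List.length_append]; omega), List.getElem_append_left hi]
  · intro u hu hr
    have r0 := hu.r0
    have r1 := hu.r1
    have r2 := hu.r2
    have fu := hu.fuel
    refine tableLoop_node k ts b T u hk (by omega) hm (by rw [r0]; exact hr) ?_ ?_ (by omega) (by omega) (by omega)
      (by omega) (by omega) ?_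
    · rw [hu.arr0, r1, ← hfl, ht _ (by simp)]
      simp
    · rw [hu.arr0, r1, ← hfl, add_assoc, ht _ (by simp)]
      simp
    · intro v v0 vr0 vr1 vr2 vold vf hv
      refine hQ v ⟨v0.trans hu.arr0, vr0.trans r0, by omega, by omega, fun l i hi => ?_,
        by omega⟩ (by rw [r0] at hv; exact hv)
      rw [vold l i (by omega), hu.old l i hi]

theorem reads_of_represents {T : SPTree ℕ} {X : TTGraph ℕ} (h : T.Represents X) : Reads N T := by
  have aux : ∀ (ts : List (SPTree ℕ)) (Xs : List (TTGraph ℕ)), ts.length = Xs.length →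
      (∀ q ∈ ts.zip Xs, Reads N q.1) → ∀ t ∈ ts, Reads N t := by
    intro ts Xs hlen ih t ht
    obtain ⟨i, hi, rfl⟩ := List.getElem_of_mem ht
    exact ih (ts[i], Xs[i]) (List.mem_iff_getElem.2 ⟨i, by simp; omega, by simp⟩)
  induction h with
  | leaf p G h =>
    intro b s Q h2 ht hL hN h21 hf hQ
    have hel : (SPTree.leaf p).elen = p.length + 2 := by simp [elen, encode]
    have henc : (SPTree.leaf p).encode = 0 :: p.length :: p := by rw [encode]
    simp only [henc] at ht
    rw [hel] at hL hf
    have := h.two_le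
    refine tableLoop_leaf p b s h2 h.two_le ?_ ?_ ?_ (by omega) hN (by omega) (by omega) ?_
    · simpa using ht 0 (by simp)
    · simpa using ht 1 (by simp)
    · intro j hj
      have := ht (j + 2) (by simpa using hj)
      rw [add_assoc, add_comm 2 j]
      simpa using this
    · intro t hp hr
      exact hQ t (by rw [hel, nn_leaf]; exact hp) hr
  | series ts Xs G hlen hts h ih =>
    exact reads_node 1 ts _ (.inl ⟨rfl, rfl⟩) (encode_series ts) (by have := h.two_le; omega)
      (aux ts Xs hlen ih)
  | parallel ts Xs G hlen hts h ih =>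
    exact reads_node 2 ts _ (.inr ⟨rfl, rfl⟩) (encode_parallel ts) (by have := h.two_le; omega)
      (aux ts Xs hlen ih)

/-! ### The second pass: the arrangement -/

/-- Put a task on the stack. -/
def push (i c : Ex) : Cmd :=
  .put 9 (.var 1) i ;; .put 10 (.var 1) c ;; .set 1 (.plus (.var 1) (.lit 1))

/-- Give the next position to a node. -/
def emit (v : Ex) : Cmd := .set 2 (.plus (.var 2) (.lit 1)) ;; .put 11 v (.var 2)

/-- Arrange the nodes of a path. -/
def leafEmit : Cmd :=
  .set 5 (.get 5 (.var 3)) ;;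
  .set 6 (.plus (.get 3 (.var 3)) (.lit 1)) ;;
  .set 7 (.lit 0) ;;
  .while (.minus (.var 5) (.var 7))
    (.ite (.var 4) (.set 8 (.minus (.minus (.var 5) (.lit 1)) (.var 7))) (.set 8 (.var 7)) ;;
     .set 9 (.quot (.var 8) (.lit 2)) ;;
     .ite (.minus (.minus (.var 8) (.var 9)) (.var 9))
       (.set 9 (.minus (.minus (.var 5) (.lit 1)) (.var 9))) .skip ;;
     emit (.get 0 (.plus (.var 6) (.var 9))) ;;
     .set 7 (.plus (.var 7) (.lit 1)))

/-- Compute the place of a child on the stack, and the direction in which it is arranged. -/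
def placeChild : Cmd :=
  .set 10 (.var 4) ;;
  .ite (.minus (.var 6) (.var 7))
    (.ite (.var 4) (.set 9 (.var 7)) (.set 9 (.minus (.minus (.var 5) (.lit 1)) (.var 7))))
    (.ite (.minus (.var 7) (.var 6))
      (.ite (.var 4)
        (.set 9 (.plus (.var 6) (.minus (.minus (.var 5) (.lit 1)) (.var 7))))
        (.set 9 (.minus (.var 7) (.var 6))) ;;
       .ite (.minus (.lit 2) (.get 1 (.var 3))) (.set 10 (.minus (.lit 1) (.var 4))) .skip)
      (.ite (.var 4) (.set 9 (.minus (.var 5) (.lit 1))) (.set 9 (.lit 0))))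

/-- Put the tasks for the children on the stack. -/
def taskLoop : Cmd :=
  .while (.var 7)
    (.set 7 (.minus (.var 7) (.lit 1)) ;;
     placeChild ;;
     .ite (.minus (.lit 2) (.get 1 (.var 3)))
       (.ite (.var 7) (.set 10 (.plus (.var 10) (.lit 2))) .skip) .skip ;;
     .put 9 (.plus (.var 1) (.var 9)) (.var 8) ;;
     .put 10 (.plus (.var 1) (.var 9)) (.var 10) ;;
     .set 8 (.minus (.var 8) (.get 4 (.var 8))))

/-- Replace the task for an inner node by the tasks for its children. -/
def nodeEmit : Cmd :=
  .set 5 (.get 2 (.var 3)) ;;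
  .set 6 (.get 8 (.var 3)) ;;
  .set 7 (.get 2 (.var 3)) ;;
  .set 8 (.minus (.var 3) (.lit 1)) ;;
  taskLoop ;;
  .set 1 (.plus (.var 1) (.var 5))

/-- The second pass processes a stack of tasks. The codes of the tasks for a node are `0`: the inner
order, `1`: the inner order reversed, `2`: source and inner order, `3`: this reversed,
`4`: source. -/
def emitLoop : Cmd :=
  .while (.var 1)
    (.set 1 (.minus (.var 1) (.lit 1)) ;;
     .set 3 (.get 9 (.var 1)) ;;
     .set 4 (.get 10 (.var 1)) ;;
     .ite (.minus (.var 4) (.lit 1))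
       (.ite (.minus (.var 4) (.lit 3)) (emit (.get 6 (.var 3)))
         (.ite (.minus (.var 4) (.lit 2)) (push (.var 3) (.lit 4) ;; push (.var 3) (.lit 1))
           (push (.var 3) (.lit 0) ;; push (.var 3) (.lit 4))))
       (.ite (.get 1 (.var 3)) nodeEmit leafEmit))

/-- The array of positions after the positions `c + 1, c + 2, …` were given to the nodes `l`. -/
def assign (A : ℕ → ℕ) (c : ℕ) : List ℕ → ℕ → ℕ
  | [] => A
  | v :: l => assign (Function.update A v (c + 1)) (c + 1) l

theorem assign_append (A : ℕ → ℕ) (c : ℕ) (l l' : List ℕ) :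
    assign A c (l ++ l') = assign (assign A c l) (c + l.length) l' := by
  induction l generalizing A c with
  | nil => rfl
  | cons v l ih =>
    rw [List.cons_append, assign, ih, assign, List.length_cons, add_right_comm, add_assoc]

/-- The progress that the second pass makes while it works on a task. -/
structure EmitPost (s t : St) (b : ℕ) (e : List ℕ) (w f : ℕ) : Prop where
  tab : ∀ k < 9, t.arr k = s.arr k
  r0 : t.reg 0 = s.reg 0
  sp : t.reg 1 = b
  ctr : t.reg 2 = s.reg 2 + e.length
  st9 : ∀ i < b, t.arr 9 i = s.arr 9 i
  st10 : ∀ i < b, t.arr 10 i = s.arr 10 i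
  pi : t.arr 11 = assign (s.arr 11) (s.reg 2) e
  fuel : s.fuel + f ≤ t.fuel + w

/-- With the tables `A`, the task `code` for the node `i` arranges the nodes `e`. -/
def Emits (N : ℕ) (A : ℕ → ℕ → ℕ) (i code : ℕ) (e : List ℕ) (w f : ℕ) : Prop :=
  e.length ≤ w ∧ ∀ (b : ℕ) (s : St) (Q : St → Prop), (∀ k < 9, s.arr k = A k) →
    s.reg 1 = b + 1 → s.arr 9 b = i → s.arr 10 b = code → b + w < N + f → s.reg 2 + w < N + f →
    w ≤ s.fuel + f → (∀ t, EmitPost s t b e w f → wp N emitLoop Q t) → wp N emitLoop Q s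

/-- A task: node, code, arranged nodes, and weight. -/
structure Task where
  node : ℕ
  code : ℕ
  out : List ℕ
  weight : ℕ

/-- Tasks are taken from the top, so task `r` lies `r` cells below it. In `Emits`, `w - f` bounds
the iterations: an inner order of a tree with `L` tokens may use `3 * L - 3`, and `3 * L - 1`
together with the source. The unit saved by every child pays for putting its task on the stack. -/
theorem emits_list (A : ℕ → ℕ → ℕ) (ks : List Task)
    (hk : ∀ k ∈ ks, Emits N A k.node k.code k.out k.weight 1) (hw : ∀ k ∈ ks, 0 < k.weight)
    (b : ℕ) (s : St) (hA : ∀ k < 9, s.arr k = A k) (hb : s.reg 1 = b + ks.length)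
    (h9 : ∀ (r : ℕ) (h : r < ks.length), s.arr 9 (b + (ks.length - 1 - r)) = ks[r].node)
    (h10 : ∀ (r : ℕ) (h : r < ks.length), s.arr 10 (b + (ks.length - 1 - r)) = ks[r].code)
    (hsp : b + (ks.map Task.weight).sum < N + 1)
    (hctr : s.reg 2 + (ks.map Task.weight).sum < N + 1)
    (hf : (ks.map Task.weight).sum ≤ s.fuel + ks.length)
    (hQ : ∀ t, EmitPost s t b (ks.map Task.out).flatten (ks.map Task.weight).sum ks.length →
      wp N emitLoop Q t) :
    wp N emitLoop Q s := by
  induction ks generalizing s with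
  | nil =>
    exact hQ s ⟨fun _ _ => rfl, rfl, hb, by simp, fun _ _ => rfl, fun _ _ => rfl, rfl, by simp⟩
  | cons k ks ih =>
    have hlen : ks.length ≤ (ks.map Task.weight).sum := by
      clear ih
      have : ∀ l : List Task, (∀ k ∈ l, 0 < k.weight) → l.length ≤ (l.map Task.weight).sum := by
        intro l hl
        induction l with
        | nil => simp
        | cons k l ih =>
          have h1 := hl k (by simp)
          have h2 := ih fun k hk => hl k (by simp [hk])
          simp only [List.map_cons, List.sum_cons, List.length_cons]
          omega
      exact this ks fun k hk => hw k (by simp [hk])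
    have hw0 := hw k (by simp)
    simp only [List.map_cons, List.sum_cons, List.length_cons, List.flatten_cons] at *
    obtain ⟨hlen', hem⟩ := hk k (by simp)
    refine hem (b + ks.length) s Q hA (by omega) ?_ ?_ (by omega) (by omega) (by omega) ?_
    · simpa using h9 0 (by omega)
    · simpa using h10 0 (by omega)
    · intro t ht
      have c1 := ht.ctr
      have c2 := ht.fuel
      refine ih (fun k hk' => hk k (by simp [hk'])) (fun k hk' => hw k (by simp [hk'])) t
        (fun l hl => by rw [ht.tab l hl, hA l hl]) ht.sp ?_ ?_ (by omega) (by omega) (by omega) ?_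
      · intro r hr
        have := h9 (r + 1) (by omega)
        rw [ht.st9 _ (by omega)]
        simpa [show ks.length - (r + 1) = ks.length - 1 - r by omega] using this
      · intro r hr
        have := h10 (r + 1) (by omega)
        rw [ht.st10 _ (by omega)]
        simpa [show ks.length - (r + 1) = ks.length - 1 - r by omega] using this
      · intro u hu
        have c3 := hu.fuel
        refine hQ u ⟨fun l hl => by rw [hu.tab l hl, ht.tab l hl], hu.r0.trans ht.r0, hu.sp, ?_,
          fun i hi => ?_, fun i hi => ?_, ?_, by omega⟩
        · rw [hu.ctr, c1, List.length_append, add_assoc]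
        · rw [hu.st9 i hi, ht.st9 i (by omega)]
        · rw [hu.st10 i hi, ht.st10 i (by omega)]
        · rw [hu.pi, ht.pi, c1, assign_append]

theorem emits_src (A : ℕ → ℕ → ℕ) (i : ℕ) : Emits N A i 4 [A 6 i] 2 1 := by
  refine ⟨by simp, fun b s Q hA h1 h9 h10 hb hc hf hQ => ?_⟩
  refine wp_while_true (by simp) (by simp; omega) (by omega) ?_
  simp only [wp_seq, wp_ite, wp_set, emit]
  simp [h1, h9, h10]
  refine ⟨by omega, hQ _ ?_⟩
  constructor <;> simp [assign, hA]
  · intro k hk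
    rw [setA_arr_ne _ _ _ _ _ (by omega)]
    simp [hA k hk]
  · omega

/-- The same number `w - 3` of iterations is written as `(w - 2) - 1`, which leaves weight two for
the task that emits the source. -/
theorem Emits.weaken {A : ℕ → ℕ → ℕ} {i code : ℕ} {e : List ℕ} {w : ℕ} (h : Emits N A i code e w 3)
    (he : e.length + 2 ≤ w) : Emits N A i code e (w - 2) 1 := by
  refine ⟨by omega, fun b s Q hA h1 h9 h10 hb hc hf hQ => h.2 b s Q hA h1 h9 h10 (by omega)
    (by omega) (by omega) fun t ht => hQ t ?_⟩
  have := ht.fuel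
  exact ⟨ht.tab, ht.r0, ht.sp, ht.ctr, ht.st9, ht.st10, ht.pi, by omega⟩

/-- The task is replaced by one for the source and one for the inner order; the one to be done first
is pushed last. -/
theorem emits_two (A : ℕ → ℕ → ℕ) (i : ℕ) (e : List ℕ) (w : ℕ) (hw : 4 ≤ w)
    (he : e.length + 2 ≤ w) (h : Emits N A i 0 e w 3) : Emits N A i 2 (A 6 i :: e) w 1 := by
  refine ⟨by simp; omega, fun b s Q hA h1 h9 h10 hb hc hf hQ => ?_⟩
  refine wp_while_true (by simp) (by simp; omega) (by omega) ?_
  simp only [wp_seq, wp_ite, wp_set, wp_put, push]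
  simp [h1, h9, h10]
  refine ⟨by omega, by omega, ?_⟩
  refine emits_list A [⟨i, 4, [A 6 i], 2⟩, ⟨i, 0, e, w - 2⟩]
    (by simp [emits_src, h.weaken he]) (by simp; omega) b _ ?_ (by simp) ?_ ?_ ?_ ?_ ?_ ?_
  · intro k hk
    simp [setA_arr_ne _ _ _ _ _ (show k ≠ 9 by omega),
      setA_arr_ne _ _ _ _ _ (show k ≠ 10 by omega), hA k hk]
  · intro r hr
    simp only [List.length_cons, List.length_nil] at hr
    interval_cases r <;> simp
  · intro r hr
    simp only [List.length_cons, List.length_nil] at hr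
    interval_cases r <;> simp
  · simp; omega
  · simp; omega
  · simp; omega
  · intro t ht
    refine hQ t ⟨fun k hk => ?_, by simpa using ht.r0, ht.sp, by simpa using ht.ctr,
      fun j hj => ?_, fun j hj => ?_, by simpa using ht.pi, ?_⟩
    · rw [ht.tab k hk]
      simp [setA_arr_ne _ _ _ _ _ (show k ≠ 9 by omega),
        setA_arr_ne _ _ _ _ _ (show k ≠ 10 by omega)]
    · rw [ht.st9 j hj]
      simp [Function.update_apply, show j ≠ b by omega, show j ≠ b + 1 by omega]
    · rw [ht.st10 j hj]
      simp [Function.update_apply, show j ≠ b by omega, show j ≠ b + 1 by omega]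
    · have := ht.fuel
      simp at this
      omega

theorem emits_three (A : ℕ → ℕ → ℕ) (i : ℕ) (e : List ℕ) (w : ℕ) (hw : 4 ≤ w)
    (he : e.length + 2 ≤ w) (h : Emits N A i 1 e w 3) : Emits N A i 3 (e ++ [A 6 i]) w 1 := by
  refine ⟨by simp; omega, fun b s Q hA h1 h9 h10 hb hc hf hQ => ?_⟩
  refine wp_while_true (by simp) (by simp; omega) (by omega) ?_
  simp only [wp_seq, wp_ite, wp_set, wp_put, push]
  simp [h1, h9, h10]
  refine ⟨by omega, by omega, ?_⟩
  refine emits_list A [⟨i, 1, e, w - 2⟩, ⟨i, 4, [A 6 i], 2⟩]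
    (by simp [emits_src, h.weaken he]) (by simp; omega) b _ ?_ (by simp) ?_ ?_ ?_ ?_ ?_ ?_
  · intro k hk
    simp [setA_arr_ne _ _ _ _ _ (show k ≠ 9 by omega),
      setA_arr_ne _ _ _ _ _ (show k ≠ 10 by omega), hA k hk]
  · intro r hr
    simp only [List.length_cons, List.length_nil] at hr
    interval_cases r <;> simp
  · intro r hr
    simp only [List.length_cons, List.length_nil] at hr
    interval_cases r <;> simp
  · simp; omega
  · simp; omega
  · simp; omega
  · intro t ht
    refine hQ t ⟨fun k hk => ?_, by simpa using ht.r0, ht.sp, by simpa using ht.ctr,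
      fun j hj => ?_, fun j hj => ?_, by simpa using ht.pi, ?_⟩
    · rw [ht.tab k hk]
      simp [setA_arr_ne _ _ _ _ _ (show k ≠ 9 by omega),
        setA_arr_ne _ _ _ _ _ (show k ≠ 10 by omega)]
    · rw [ht.st9 j hj]
      simp [Function.update_apply, show j ≠ b by omega, show j ≠ b + 1 by omega]
    · rw [ht.st10 j hj]
      simp [Function.update_apply, show j ≠ b by omega, show j ≠ b + 1 by omega]
    · have := ht.fuel
      simp at this
      omega

theorem assign_take_succ (A : ℕ → ℕ) (c : ℕ) (l : List ℕ) (r : ℕ) (h : r < l.length) :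
    assign A c (l.take (r + 1)) =
      Function.update (assign A c (l.take r)) l[r] (c + r + 1) := by
  rw [List.take_add_one, List.getElem?_eq_getElem h, assign_append, List.length_take,
    min_eq_left h.le]
  rfl

/-- The state `t` while a path is arranged. -/
structure LeafInv (A : ℕ → ℕ → ℕ) (ps a d : ℕ) (e : List ℕ) (s t : St) : Prop where
  r0 : t.reg 0 = s.reg 0
  r1 : t.reg 1 = a
  r5 : t.reg 5 = e.length
  r6 : t.reg 6 = ps + 1
  r4 : t.reg 4 = d
  le : t.reg 7 ≤ e.length
  ctr : t.reg 2 = s.reg 2 + t.reg 7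
  tab : ∀ k < 9, t.arr k = A k
  st9 : t.arr 9 = s.arr 9
  st10 : t.arr 10 = s.arr 10
  pi : t.arr 11 = assign (s.arr 11) (s.reg 2) (e.take (t.reg 7))
  fuel : s.fuel ≤ t.fuel + t.reg 7 + 1
  fuel' : e.length ≤ t.fuel + t.reg 7

/-- Entry `r` is fetched through the closed form of the zigzag; for the reversed direction `r` is
first replaced by its mirror image. No auxiliary list is built. -/
theorem emits_leaf (A : ℕ → ℕ → ℕ) (b d : ℕ) (p : List ℕ) (hp : 2 ≤ p.length) (hd : d ≤ 1)
    (L : ℕ) (hL : L < N)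
    (h : NodeRep L A b (.leaf p)) :
    Emits N A (b + 1) d (if d = 1 then (zigzag (p.drop 1).dropLast).reverse
      else zigzag (p.drop 1).dropLast) (3 * (SPTree.leaf p).elen) 3 := by
  have hel : (SPTree.leaf p).elen = p.length + 2 := by simp [elen, encode]
  rw [hel]
  set w := (p.drop 1).dropLast with hw
  set e := if d = 1 then (zigzag w).reverse else zigzag w with he
  obtain ⟨kind, lim, path, isz⟩ : A 1 (b + 1) = 0 ∧ A 3 (b + 1) + p.length ≤ L ∧
      (∀ (j : ℕ) (h : j < p.length), A 0 (A 3 (b + 1) + j) = p[j]) ∧ A 5 (b + 1) = p.length - 2 := by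
    cases h with
    | leaf _ _ kind _ lim path _ isz => exact ⟨kind, lim, path, isz⟩
  have hwl : w.length = p.length - 2 := by simp [hw]; omega
  have hzl : (zigzag w).length = p.length - 2 := by rw [(zigzag_perm w).length_eq, hwl]
  have hel' : e.length = p.length - 2 := by rw [he]; split <;> simp [hzl]
  -- The inner nodes of the path start one cell after its source, hence the offset `1`.
  have hz : ∀ j, (hj : j < p.length - 2) →
      A 0 (A 3 (b + 1) + 1 + (if j % 2 = 0 then j / 2 else p.length - 2 - 1 - j / 2)) =
        (zigzag w)[j] := by
    intro j hj
    have h1 := zigzag_getElem? w j (by omega)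
    rw [List.getElem?_eq_getElem (by omega), hwl] at h1
    have h2 : ∀ q, (hq : q < p.length - 2) → w[q]? = some p[q + 1] := by
      intro q hq
      rw [List.getElem?_eq_getElem (by omega)]
      simp [hw, add_comm]
    split at h1
    · next h0 =>
      rw [h2 _ (by omega)] at h1
      rw [if_pos h0, add_assoc, add_comm 1, path _ (by omega)]
      exact (Option.some.inj h1).symm
    · next h0 =>
      rw [h2 _ (by omega)] at h1
      rw [if_neg h0, add_assoc, add_comm 1, path _ (by omega)]
      exact (Option.some.inj h1).symm
  have hez : ∀ r, (hr : r < p.length - 2) →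
      e[r] = (zigzag w)[if d = 1 then p.length - 2 - 1 - r else r]'(by split <;> omega) := by
    intro r hr
    by_cases h1 : d = 1
    · simp [he, h1, hzl]
    · simp [he, h1]
  refine ⟨by omega, fun a s Q hA h1 h9 h10 hb hc hf hQ => ?_⟩
  refine wp_while_true (by simp) (by simp; omega) (by omega) ?_
  simp only [wp_seq, wp_ite, wp_set, leafEmit]
  have hA' : ∀ k, k < 9 → ∀ i, s.arr k i = A k i := fun k hk i => by rw [hA k hk]
  simp [h1, h9, h10, hA', kind, isz, show d - 1 = 0 by omega]
  refine ⟨by omega, wp_while_inv (LeafInv A (A 3 (b + 1)) a d e s) ?_ (fun t _ => by simp) ?_ ?_⟩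
  · constructor <;> simp [hA, hel', assign, h1]
    · intro k hk
      simp [hA k hk]
    · omega
    · omega
  · intro t ⟨i1, i2, i3, i4, i5, i6, i7, i8, i9, i10, i11, i12, i13⟩ h
    simp [i3] at h
    refine ⟨by omega, ?_⟩
    have hr : t.reg 7 < e.length := by omega
    have hez' := hez (t.reg 7) (by omega)
    rw [← hz _ (by split <;> omega)] at hez'
    have ha : assign (s.arr 11) (s.reg 2) (e.take (t.reg 7 + 1)) = _ :=
      assign_take_succ _ _ _ _ hr
    -- The four cases of direction and parity end in the same update, so the invariant is checked
    -- for it once.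
    have fin : ∀ u : St, u.arr = (t.setA 11 e[t.reg 7] (t.reg 2 + 1)).arr →
        u.reg 0 = t.reg 0 → u.reg 1 = t.reg 1 → u.reg 2 = t.reg 2 + 1 → u.reg 4 = t.reg 4 →
        u.reg 5 = t.reg 5 → u.reg 6 = t.reg 6 → u.reg 7 = t.reg 7 + 1 → u.fuel = t.fuel - 1 →
        LeafInv A (A 3 (b + 1)) a d e s u := by
      intro u ua u0 u1 u2 u4 u5 u6 u7 uf
      constructor
      · rw [u0, i1]
      · rw [u1, i2]
      · rw [u5, i3]
      · rw [u6, i4]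
      · rw [u4, i5]
      · omega
      · omega
      · intro k hk
        rw [ua, setA_arr_ne _ _ _ _ _ (by omega), i8 k hk]
      · rw [ua, setA_arr_ne _ _ _ _ _ (by omega), i9]
      · rw [ua, setA_arr_ne _ _ _ _ _ (by omega), i10]
      · rw [ua, setA_arr_self, i11, u7, ha, i7]
      · omega
      · omega
    have hA0 : t.arr 0 = A 0 := i8 0 (by norm_num)
    rcases Nat.mod_two_eq_zero_or_one (if d = 1 then p.length - 2 - 1 - t.reg 7 else t.reg 7)
      with hpar | hpar
    · rw [if_pos hpar] at hez'
      obtain rfl | rfl : d = 0 ∨ d = 1 := by omega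
      · simp only [zero_ne_one, if_false] at hpar hez'
        simp only [wp_seq, wp_ite, wp_set, wp_put, wp_skip, emit]
        simp [i3, i4, i5, i7, hA0, hel']
        refine ⟨fun h0 => absurd h0 (by omega), fun _ => ⟨by omega, by omega, by omega,
          fin _ ?_ ?_ ?_ ?_ ?_ ?_ ?_ ?_ ?_⟩⟩ <;> simp [i3, i4, i5, i7, ← hez', hel'] <;> rfl
      · simp only [if_true] at hpar hez'
        simp only [wp_seq, wp_ite, wp_set, wp_put, wp_skip, emit]
        simp [i3, i4, i5, i7, hA0, hel']
        refine ⟨fun h0 => absurd h0 (by omega), fun _ => ⟨by omega, by omega, by omega,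
          fin _ ?_ ?_ ?_ ?_ ?_ ?_ ?_ ?_ ?_⟩⟩ <;> simp [i3, i4, i5, i7, ← hez', hel'] <;> rfl
    · rw [if_neg (by omega)] at hez'
      obtain rfl | rfl : d = 0 ∨ d = 1 := by omega
      · simp only [zero_ne_one, if_false] at hpar hez'
        simp only [wp_seq, wp_ite, wp_set, wp_put, wp_skip, emit]
        simp [i3, i4, i5, i7, hA0, hel']
        refine ⟨fun _ => ⟨by omega, by omega, by omega,
          fin _ ?_ ?_ ?_ ?_ ?_ ?_ ?_ ?_ ?_⟩, fun h0 => absurd h0 (by omega)⟩ <;>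
          simp [i3, i4, i5, i7, ← hez', hel'] <;> rfl
      · simp only [if_true] at hpar hez'
        simp only [wp_seq, wp_ite, wp_set, wp_put, wp_skip, emit]
        simp [i3, i4, i5, i7, hA0, hel']
        refine ⟨fun _ => ⟨by omega, by omega, by omega,
          fin _ ?_ ?_ ?_ ?_ ?_ ?_ ?_ ?_ ?_⟩, fun h0 => absurd h0 (by omega)⟩ <;>
          simp [i3, i4, i5, i7, ← hez', hel'] <;> rfl
  · intro t ⟨i1, i2, i3, i4, i5, i6, i7, i8, i9, i10, i11, i12, i13⟩ h
    simp [i3] at h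
    have h7 : t.reg 7 = e.length := by omega
    refine hQ t ⟨fun k hk => by rw [i8 k hk, hA k hk], i1, i2, by omega, fun i _ => by rw [i9],
      fun i _ => by rw [i10], ?_, by omega⟩
    rw [i11, h7, List.take_length]

/-- The place of the child `j` in the order of the children, if the child `a` of `m` is a biggest
one. -/
def slot (a m j : ℕ) : ℕ := if j < a then j else if a < j then a + (m - 1 - j) else m - 1

/-- The offset of the task for the child `j` on the stack. -/
def offset (a m d j : ℕ) : ℕ := if d = 1 then slot a m j else m - 1 - slot a m j

/-- The direction in which the child `j` is arranged. -/
def childDir (k a d j : ℕ) : ℕ := if k = 1 ∧ a < j then 1 - d else d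

/-- The code of the task for the child `j`. -/
def childCode (k a d j : ℕ) : ℕ := childDir k a d j + if k = 1 ∧ 0 < j then 2 else 0

theorem slot_lt {a m j : ℕ} (hj : j < m) : slot a m j < m := by
  unfold slot; split_ifs <;> omega

theorem slot_inj {a m i j : ℕ} (ha : a < m) (hi : i < m) (hj : j < m)
    (h : slot a m i = slot a m j) : i = j := by
  unfold slot at h; split_ifs at h <;> omega

theorem offset_lt {a m d j : ℕ} (hj : j < m) : offset a m d j < m := by
  have := slot_lt (a := a) hj
  unfold offset; split_ifs <;> omega

theorem offset_inj {a m d i j : ℕ} (ha : a < m) (hi : i < m) (hj : j < m)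
    (h : offset a m d i = offset a m d j) : i = j := by
  have h1 := slot_lt (a := a) hi
  have h2 := slot_lt (a := a) hj
  refine slot_inj ha hi hj ?_
  unfold offset at h; split_ifs at h <;> omega

/-- The state `t` while the tasks for the children are put on the stack. -/
structure TaskInv (ts : List (SPTree ℕ)) (A : ℕ → ℕ → ℕ) (b k a d i sp : ℕ) (s t : St) :
    Prop where
  le : t.reg 7 ≤ ts.length
  r0 : t.reg 0 = s.reg 0
  r1 : t.reg 1 = sp
  r2 : t.reg 2 = s.reg 2
  r3 : t.reg 3 = i
  r4 : t.reg 4 = d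
  r5 : t.reg 5 = ts.length
  r6 : t.reg 6 = a
  r8 : t.reg 8 = b + pre nn ts (t.reg 7)
  tab : ∀ k < 9, t.arr k = A k
  st9 : ∀ l < sp, t.arr 9 l = s.arr 9 l
  st10 : ∀ l < sp, t.arr 10 l = s.arr 10 l
  pi : t.arr 11 = s.arr 11
  new9 : ∀ j < ts.length, t.reg 7 ≤ j →
    t.arr 9 (sp + offset a ts.length d j) = b + pre nn ts (j + 1)
  new10 : ∀ j < ts.length, t.reg 7 ≤ j →
    t.arr 10 (sp + offset a ts.length d j) = childCode k a d j
  fuel : s.fuel + t.reg 7 ≤ t.fuel + ts.length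
  fuel' : t.reg 7 ≤ t.fuel

theorem placeChild_spec (m a d k : ℕ) (s : St) (hk : k = 1 ∨ k = 2) (hd : d ≤ 1)
    (hN : m < N) (h4 : s.reg 4 = d) (h5 : s.reg 5 = m) (h6 : s.reg 6 = a) (h7 : s.reg 7 < m)
    (hA : s.arr 1 (s.reg 3) = k)
    (hQ : ∀ u : St, u.arr = s.arr → u.fuel = s.fuel → u.reg 9 = offset a m d (s.reg 7) →
      u.reg 10 = childDir k a d (s.reg 7) → (∀ x, x ≠ 9 → x ≠ 10 → u.reg x = s.reg x) → Q u) :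
    wp N placeChild Q s := by
  simp only [placeChild, wp_seq, wp_ite, wp_set, wp_skip]
  rcases lt_trichotomy (s.reg 7) a with h | h | h
  · have e1 : a - s.reg 7 ≠ 0 := by omega
    obtain rfl | rfl : d = 0 ∨ d = 1 := by omega
    · simp [h4, h5, h6, e1]
      exact hQ _ rfl rfl (by simp [offset, slot, h]) (by simp [childDir]; omega)
        (fun x h9 h10 => by simp [h9, h10])
    · simp [h4, h5, h6, e1]
      exact hQ _ rfl rfl (by simp [offset, slot, h]) (by simp [childDir]; omega)
        (fun x h9 h10 => by simp [h9, h10])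
  · obtain rfl | rfl : d = 0 ∨ d = 1 := by omega
    · simp [h4, h5, h6, h]
      exact hQ _ rfl rfl (by simp [offset, slot, h]) (by simp [childDir]; omega)
        (fun x h9 h10 => by simp [h9, h10])
    · simp [h4, h5, h6, h]
      exact hQ _ rfl rfl (by simp [offset, slot, h]) (by simp [childDir]; omega)
        (fun x h9 h10 => by simp [h9, h10])
  · have e1 : s.reg 7 - a ≠ 0 := by omega
    have e2 : a - s.reg 7 = 0 := by omega
    have e3 : ¬ s.reg 7 < a := by omega
    obtain rfl | rfl : d = 0 ∨ d = 1 := by omega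
    all_goals obtain rfl | rfl := hk
    · simp [h4, h5, h6, hA, e1, e2]
      exact hQ _ rfl rfl (by simp [offset, slot, h, e3]; omega) (by simp [childDir, h])
        (fun x h9 h10 => by simp [h9, h10])
    · simp [h4, h5, h6, hA, e1, e2]
      exact hQ _ rfl rfl (by simp [offset, slot, h, e3]; omega) (by simp [childDir, h])
        (fun x h9 h10 => by simp [h9, h10])
    · simp [h4, h5, h6, hA, e1, e2]
      exact ⟨by omega, hQ _ rfl rfl (by simp [offset, slot, h, e3]) (by simp [childDir, h])
        (fun x h9 h10 => by simp [h9, h10])⟩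
    · simp [h4, h5, h6, hA, e1, e2]
      exact ⟨by omega, hQ _ rfl rfl (by simp [offset, slot, h, e3]) (by simp [childDir, h])
        (fun x h9 h10 => by simp [h9, h10])⟩

/-- Children are visited from last to first, but every task is written directly to its final cell
above the stack pointer, which moves only afterwards. -/
theorem taskLoop_spec (ts : List (SPTree ℕ)) (A : ℕ → ℕ → ℕ) (b k a d i sp : ℕ) (s : St)
    (hk : k = 1 ∨ k = 2) (hd : d ≤ 1) (ha : a < ts.length) (hi : A 1 i = k)
    (hc : ∀ (j : ℕ) (h : j < ts.length), A 4 (b + pre nn ts (j + 1)) = ts[j].nn)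
    (hN : sp + ts.length < N) (hN' : 10 < N) (h : TaskInv ts A b k a d i sp s s)
    (h7 : s.reg 7 = ts.length)
    (hQ : ∀ t, t.reg 7 = 0 → TaskInv ts A b k a d i sp s t → Q t) : wp N taskLoop Q s := by
  refine wp_while_inv (TaskInv ts A b k a d i sp s) h (fun t _ => by simp) ?_
    (fun t ht h => hQ t (by simpa using h) ht)
  intro t ⟨le, r0, r1, r2, r3, r4, r5, r6, r8, tab, st9, st10, pi, new9, new10, fuel, fuel'⟩ h
  simp only [Ex.eval] at h
  obtain ⟨j, hj⟩ : ∃ j, t.reg 7 = j + 1 := ⟨t.reg 7 - 1, by omega⟩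
  rw [hj] at le r8 new9 new10 fuel fuel'
  have hpn := pre_succ nn ts j (by omega)
  have hcj := hc j (by omega)
  have ho := offset_lt (a := a) (d := d) (show j < ts.length by omega)
  refine ⟨by omega, ?_⟩
  have fin : ∀ u : St, u.reg 0 = t.reg 0 → u.reg 1 = t.reg 1 → u.reg 2 = t.reg 2 →
      u.reg 3 = t.reg 3 → u.reg 4 = t.reg 4 → u.reg 5 = t.reg 5 → u.reg 6 = t.reg 6 →
      u.reg 7 = j → u.reg 8 = t.reg 8 - ts[j].nn →
      u.arr = ((t.setA 9 (sp + offset a ts.length d j) (b + pre nn ts (j + 1))).setA 10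
        (sp + offset a ts.length d j) (childCode k a d j)).arr →
      u.fuel = t.fuel - 1 → TaskInv ts A b k a d i sp s u := by
    intro u u0 u1 u2 u3 u4 u5 u6 u7 u8 ua uf
    constructor
    any_goals simp only [u0, u1, u2, u3, u4, u5, u6, u7, u8, uf, ua]
    any_goals first | assumption | omega
    · intro l hl
      rw [setA_arr_ne _ _ _ _ _ (by omega), setA_arr_ne _ _ _ _ _ (by omega), tab l hl]
    · intro l hl
      simp [Function.update_of_ne (show l ≠ sp + offset a ts.length d j by omega), st9 l hl]
    · intro l hl
      simp [Function.update_of_ne (show l ≠ sp + offset a ts.length d j by omega), st10 l hl]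
    · intro l hl hjl
      by_cases h : l = j
      · subst h; simp
      -- Offsets of different children differ, so the new task overwrites none of the earlier ones.
      · have : sp + offset a ts.length d l ≠ sp + offset a ts.length d j := fun h' =>
          h (offset_inj (d := d) ha hl (by omega) (by omega))
        simp [Function.update_of_ne this, new9 l hl (by omega)]
    · intro l hl hjl
      by_cases h : l = j
      · subst h; simp
      · have : sp + offset a ts.length d l ≠ sp + offset a ts.length d j := fun h' =>
          h (offset_inj (d := d) ha hl (by omega) (by omega))
        simp [Function.update_of_ne this, new10 l hl (by omega)]
  have hA1 : t.arr 1 i = k := by rw [tab 1 (by omega), hi]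
  have hA4 : t.arr 4 = A 4 := tab 4 (by omega)
  rw [wp_seq, wp_set]
  refine ⟨by simp, ?_⟩
  rw [wp_seq]
  refine placeChild_spec ts.length a d k _ hk hd (by omega) (by simpa using r4)
    (by simpa using r5) (by simpa using r6) (by simp; omega)
    (by simpa [r3] using hA1) fun u ua uf u9 u10 ur => ?_
  have hd' : childDir k a d j < 2 := by unfold childDir; split_ifs <;> omega
  have v1 : u.reg 1 = sp := by rw [ur 1 (by omega) (by omega)]; simp [r1]
  have v3 : u.reg 3 = i := by rw [ur 3 (by omega) (by omega)]; simp [r3]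
  have v7 : u.reg 7 = j := by rw [ur 7 (by omega) (by omega)]; simp [hj]
  have v8 : u.reg 8 = b + pre nn ts (j + 1) := by rw [ur 8 (by omega) (by omega)]; simp [r8]
  simp only [setR_reg_self, Ex.eval, eval_sub, tick_reg, hj, Nat.add_sub_cancel] at u9 u10
  simp only [wp_seq, wp_ite, wp_set, wp_put, wp_skip]
  rcases hk with rfl | rfl
  · rcases Nat.eq_zero_or_pos j with rfl | h0
    · simp [v1, v3, v7, v8, ua, hA1, hA4, u9, hcj]
      refine ⟨by omega, fin _ ?_ ?_ ?_ ?_ ?_ ?_ ?_ ?_ ?_ ?_ ?_⟩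
      any_goals simp [ur, uf, v7, r8, hj]
      simp [St.setA, St.setR, ua, u10, childCode, *]
    · simp [v1, v3, v7, v8, ua, hA1, hA4, u9, hcj, h0.ne']
      refine ⟨by omega, by omega, fin _ ?_ ?_ ?_ ?_ ?_ ?_ ?_ ?_ ?_ ?_ ?_⟩
      any_goals simp [ur, uf, v7, r8, hj]
      simp [St.setA, St.setR, ua, u10, childCode, *]
  · simp [v1, v3, v7, v8, ua, hA1, hA4, u9, hcj]
    refine ⟨by omega, fin _ ?_ ?_ ?_ ?_ ?_ ?_ ?_ ?_ ?_ ?_ ?_⟩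
    any_goals simp [ur, uf, v7, r8, hj]
    simp [St.setA, St.setR, ua, u10, childCode, *]

/-- The order in which the children of a node are treated. -/
def childOrder (a m : ℕ) : List ℕ :=
  List.range a ++ ((List.range m).drop (a + 1)).reverse ++ [a]

theorem range_eq_append {a m : ℕ} (ha : a < m) :
    List.range m = List.range a ++ a :: (List.range m).drop (a + 1) := by
  have h := List.take_append_drop a (List.range m)
  rw [List.drop_eq_getElem_cons (by simpa using ha)] at h
  simpa [List.take_range, min_eq_left ha.le] using h.symm

theorem childOrder_perm {a m : ℕ} (ha : a < m) : (childOrder a m).Perm (List.range m) := by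
  rw [range_eq_append ha, childOrder, List.append_assoc]
  refine List.Perm.append_left _ ?_
  refine List.perm_append_comm.trans ?_
  simp

theorem length_childOrder {a m : ℕ} (ha : a < m) : (childOrder a m).length = m := by
  simpa using (childOrder_perm ha).length_eq

/-- `childOrder` inverts `slot`: the list used in the proofs and the arithmetic used by the machine
describe one permutation. -/
theorem slot_childOrder {a m : ℕ} (ha : a < m) (r : ℕ) (hr : r < (childOrder a m).length) :
    slot a m (childOrder a m)[r] = r := by
  have hm := length_childOrder ha
  simp only [childOrder, List.getElem_append, List.length_append, List.length_range,
    List.length_reverse, List.length_drop, List.getElem_range, List.getElem_reverse,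
    List.getElem_drop, List.getElem_singleton]
  unfold slot
  split_ifs <;> omega

/-- The order in which the children of a node are treated in the direction `d`. -/
def dirOrder (a m d : ℕ) : List ℕ := if d = 1 then (childOrder a m).reverse else childOrder a m

theorem dirOrder_perm {a m : ℕ} (ha : a < m) (d : ℕ) : (dirOrder a m d).Perm (List.range m) := by
  unfold dirOrder
  split
  · exact (List.reverse_perm _).trans (childOrder_perm ha)
  · exact childOrder_perm ha

theorem length_dirOrder {a m : ℕ} (ha : a < m) (d : ℕ) : (dirOrder a m d).length = m := by
  simpa using (dirOrder_perm ha d).length_eq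

theorem offset_dirOrder {a m : ℕ} (ha : a < m) (d r : ℕ) (hr : r < (dirOrder a m d).length) :
    offset a m d (dirOrder a m d)[r] = m - 1 - r := by
  have hm := length_childOrder ha
  have hm' := length_dirOrder ha d
  simp only [dirOrder, offset]
  split
  · simp only [List.getElem_reverse]
    rw [slot_childOrder ha, hm]
  · rw [slot_childOrder ha]

/-- The reverse of a concatenation is the concatenation of the reversed blocks in reverse order.
This is why a component can be written backwards by passing the direction on to its children. -/
theorem flatten_dirOrder {a m : ℕ} (d : ℕ) (f : ℕ → List ℕ) :
    ((dirOrder a m d).map fun j => if d = 1 then (f j).reverse else f j).flatten =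
      if d = 1 then ((childOrder a m).map f).flatten.reverse
      else ((childOrder a m).map f).flatten := by
  unfold dirOrder
  split
  · rw [List.reverse_flatten, List.map_reverse, List.map_map]; rfl
  · rfl

theorem sum_dirOrder {a : ℕ} (ts : List (SPTree ℕ)) (ha : a < ts.length) (d : ℕ)
    (f : SPTree ℕ → ℕ) :
    ((dirOrder a ts.length d).map fun j => (ts.map f).getD j 0).sum = (ts.map f).sum := by
  rw [((dirOrder_perm ha d).map _).sum_eq]
  congr 1
  refine List.ext_getElem (by simp) fun i h1 h2 => ?_
  simp at h1
  simp [h1]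

theorem Emits.mono {A : ℕ → ℕ → ℕ} {i code : ℕ} {e : List ℕ} {w : ℕ} (h : Emits N A i code e w 3) :
    Emits N A i code e w 1 := by
  refine ⟨h.1, fun b s Q hA h1 h9 h10 hb hc hf hQ => h.2 b s Q hA h1 h9 h10 (by omega)
    (by omega) (by omega) fun t ht => hQ t ?_⟩
  have := ht.fuel
  exact ⟨ht.tab, ht.r0, ht.sp, ht.ctr, ht.st9, ht.st10, ht.pi, by omega⟩

/-- One iteration for the task, one per child for the task loop, and at most `3 * elen - 1` for
every child: together at most three times the sum of the child encodings plus one. The two tokens of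
the node raise the weight by six, which leaves room to save three units. -/
theorem emits_node (A : ℕ → ℕ → ℕ) (b k d : ℕ) (ts : List (SPTree ℕ)) (T : SPTree ℕ)
    (hk : k = 1 ∨ k = 2) (hd : d ≤ 1) (hN : 10 < N) (hnn : T.nn = (ts.map nn).sum + 1)
    (hel : T.elen = (ts.map elen).sum + 2) (h : Header A k ts b T)
    (hc : ∀ (j : ℕ) (h : j < ts.length), A 4 (b + pre nn ts (j + 1)) = ts[j].nn)
    (out : ℕ → List ℕ) (e : List ℕ)
    (he : e = ((dirOrder (A 8 (b + T.nn)) ts.length d).map out).flatten)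
    (hlen : e.length ≤ 3 * T.elen)
    (ho : ∀ (j : ℕ) (h : j < ts.length), Emits N A (b + pre nn ts (j + 1))
      (childCode k (A 8 (b + T.nn)) d j) (out j) (3 * ts[j].elen) 1) :
    Emits N A (b + T.nn) d e (3 * T.elen) 3 := by
  set a := A 8 (b + T.nn) with ha
  have ham : a < ts.length := h.best_lt
  have hlm := length_dirOrder ham d
  refine ⟨hlen, fun p s Q hA h1 h9 h10 hb hctr hf hQ => ?_⟩
  have hsum : (ts.map fun t => 3 * t.elen).sum = 3 * (ts.map elen).sum :=
    List.sum_map_mul_left ..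
  have hlsum : ts.length ≤ (ts.map elen).sum := by
    have := sum_isz_add_length_le ts
    omega
  refine wp_while_true (by simp) (by simp; omega) (by omega) ?_
  have a1 := hA 1 (by omega)
  have a2 := hA 2 (by omega)
  have a8 := hA 8 (by omega)
  have hk0 : k ≠ 0 := by omega
  simp only [wp_seq, wp_ite, wp_set, nodeEmit]
  simp [h1, h9, h10, a1, a2, a8, h.kind, h.arg, ← ha, show d - 1 = 0 by omega, hk0]
  refine taskLoop_spec ts A b k a d (b + T.nn) p _ hk hd ham h.kind hc (by omega) hN ?_ (by simp) ?_
  · constructor <;> simp [hA]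
    any_goals omega
    rw [hnn, pre_length]; omega
  intro t t7 ht
  obtain ⟨le, r0, r1, r2, r3, r4, r5, r6, r8, tab, st9, st10, pi, new9, new10, fuel, fuel'⟩ := ht
  simp [t7] at r0 r1 r2 r5 fuel new9 new10 st9 st10 pi
  rw [wp_set]
  refine ⟨by simp [r1, r5]; omega, ?_⟩
  set ks : List Task := (dirOrder a ts.length d).map fun j => ⟨b + pre nn ts (j + 1),
    childCode k a d j, out j, (ts.map fun t => 3 * t.elen).getD j 0⟩ with hks
  have hksl : ks.length = ts.length := by simp [hks, hlm]
  have hkw : (ks.map Task.weight).sum = 3 * (ts.map elen).sum := by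
    rw [← hsum, ← sum_dirOrder ts ham d, hks, List.map_map]; rfl
  have hmem : ∀ j ∈ dirOrder a ts.length d, j < ts.length := fun j hj => by
    simpa using (dirOrder_perm ham d).mem_iff.1 hj
  have hko : (ks.map Task.out).flatten = e := by
    rw [he, hks, List.map_map]; rfl
  refine emits_list A ks ?_ ?_ p _ ?_ ?_ ?_ ?_ ?_ ?_ ?_ ?_
  · intro q hq
    obtain ⟨j, hj, rfl⟩ := List.mem_map.1 hq
    have hj' := hmem j hj
    simpa [hj'] using ho j hj'
  · intro q hq
    obtain ⟨j, hj, rfl⟩ := List.mem_map.1 hq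
    have hj' := hmem j hj
    have := ts[j].isz_lt_elen
    simp [hj']; omega
  · intro l hl; simp [tab l hl]
  · simp [r1, r5, hksl]
  · intro r hr
    have hr' : r < (dirOrder a ts.length d).length := by omega
    have h1 := offset_dirOrder ham d r hr'
    have h2 := new9 (dirOrder a ts.length d)[r] (hmem _ (List.getElem_mem _))
    rw [h1] at h2
    rw [hksl]
    simp only [setR_arr, h2]
    simp [hks]
  · intro r hr
    have hr' : r < (dirOrder a ts.length d).length := by omega
    have h1 := offset_dirOrder ham d r hr'
    have h2 := new10 (dirOrder a ts.length d)[r] (hmem _ (List.getElem_mem _))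
    rw [h1] at h2
    rw [hksl]
    simp only [setR_arr, h2]
    simp [hks]
  · omega
  · simp [r2]; omega
  · simp; omega
  · intro u hu
    rw [hkw, hko] at hu
    refine hQ u ⟨fun k hk => ?_, ?_, hu.sp, ?_, fun i hi => ?_, fun i hi => ?_, ?_, ?_⟩
    · rw [hu.tab k hk, hA k hk]; simp [tab k hk]
    · simpa [r0] using hu.r0
    · simpa [r2] using hu.ctr
    · rw [hu.st9 i hi]; simpa using st9 i hi
    · rw [hu.st10 i hi]; simpa using st10 i hi
    · simpa [r2, pi] using hu.pi
    · have := hu.fuel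
      simp at this
      omega

theorem emits_child (A : ℕ → ℕ → ℕ) (i k a d j : ℕ) (l : List ℕ) (w : ℕ) (hd : d ≤ 1) (hw : 4 ≤ w)
    (hl : l.length + 2 ≤ w)
    (h : ∀ x ≤ 1, Emits N A i x (if x = 1 then l.reverse else l) w 3) :
    Emits N A i (childCode k a d j) (if childDir k a d j = 1 then
      (if k = 1 ∧ 0 < j then A 6 i :: l else l).reverse
      else if k = 1 ∧ 0 < j then A 6 i :: l else l) w 1 := by
  have hx : childDir k a d j ≤ 1 := by unfold childDir; split_ifs <;> omega
  unfold childCode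
  generalize childDir k a d j = x at *
  by_cases h2 : k = 1 ∧ 0 < j
  · simp only [if_pos h2]
    obtain rfl | rfl : x = 0 ∨ x = 1 := by omega
    · exact emits_two A i l w hw hl (by simpa using h 0 (by omega))
    · rw [if_pos rfl, List.reverse_cons]
      exact emits_three A i _ w hw (by simpa using hl) (by simpa using h 1 le_rfl)
  · simp only [if_neg h2]
    exact (h x hx).mono

theorem childOrder_flatten_series {a m : ℕ} (ha : a < m) (B : List (List ℕ)) (hB : B.length = m) :
    ((childOrder a m).map fun j => if a < j then (B.getD j []).reverse else B.getD j []).flatten =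
      seriesOrder B a := by
  rw [childOrder, seriesOrder]
  simp only [List.map_append, List.map_cons, List.map_nil, List.flatten_append, lt_irrefl,
    if_false, List.flatten_cons, List.flatten_nil, List.append_nil]
  congr 3
  · refine List.ext_getElem (by simp; omega) fun i h1 h2 => ?_
    simp at h1 h2
    simp [h2, show ¬ a < i by omega]
  · rw [List.map_reverse, List.map_reverse]
    congr 1
    refine List.ext_getElem (by simp; omega) fun i h1 h2 => ?_
    simp at h1 h2
    simp [show a + 1 + i < B.length by omega, show a < a + 1 + i by omega]

theorem childOrder_flatten_perm {a m : ℕ} (ha : a < m) (ls : List (List ℕ)) (hl : ls.length = m) :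
    ls.Perm ((childOrder a m).map fun j => ls.getD j []) := by
  refine List.Perm.trans (.of_eq ?_) ((childOrder_perm ha).map _).symm
  refine List.ext_getElem (by simp; omega) fun i h1 h2 => ?_
  simp [h1]

/-- The arrangement that the second pass produces for a component. -/
def Arranges (N : ℕ) (A : ℕ → ℕ → ℕ) (i : ℕ) (T : SPTree ℕ) (X : TTGraph ℕ) (l : List ℕ) : Prop :=
  InnerOrder T X l ∧ l.length = T.isz ∧ A 6 i = X.src ∧ A 7 i = X.snk ∧
    ∀ d ≤ 1, Emits N A i d (if d = 1 then l.reverse else l) (3 * T.elen) 3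

theorem exists_arranges_list (A : ℕ → ℕ → ℕ) (ts : List (SPTree ℕ)) (Xs : List (TTGraph ℕ))
    (b : ℕ) (hlen : ts.length = Xs.length)
    (h : ∀ q ∈ ts.zip Xs, ∀ b, NodeRep L A b q.1 → ∃ l, Arranges N A (b + q.1.nn) q.1 q.2 l)
    (hr : ∀ (j : ℕ) (hj : j < ts.length), NodeRep L A (b + pre nn ts j) ts[j]) :
    ∃ (ls : List (List ℕ)) (hl : ts.length = ls.length), ∀ (j : ℕ) (hj : j < ts.length),
      Arranges N A (b + pre nn ts (j + 1)) ts[j] Xs[j] ls[j] := by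
  have : ∀ j : Fin ts.length, ∃ l, Arranges N A (b + pre nn ts (j + 1)) ts[j] Xs[j] l := by
    intro ⟨j, hj⟩
    have := h (ts[j], Xs[j]) (List.mem_iff_getElem.2 ⟨j, by simp; omega, by simp⟩) _ (hr j hj)
    rw [pre_succ nn ts j hj, ← add_assoc]
    exact this
  choose f hf using this
  exact ⟨List.ofFn f, by simp, fun j hj => by simpa using hf ⟨j, hj⟩⟩

theorem two_le_elen (T : SPTree ℕ) : 2 ≤ T.elen := by
  cases T <;> simp [elen, encode]

theorem Arranges.child {A : ℕ → ℕ → ℕ} {i : ℕ} {T : SPTree ℕ} {X : TTGraph ℕ} {l : List ℕ}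
    (h : Arranges N A i T X l) (k a d j : ℕ) (hd : d ≤ 1) :
    Emits N A i (childCode k a d j) (if childDir k a d j = 1 then
      (if k = 1 ∧ 0 < j then X.src :: l else l).reverse
      else if k = 1 ∧ 0 < j then X.src :: l else l) (3 * T.elen) 1 := by
  have h1 := two_le_elen T
  have h2 := T.isz_lt_elen
  rw [← h.2.2.1]
  exact emits_child A i k a d j l _ hd (by omega) (by rw [h.2.1]; omega) h.2.2.2.2

theorem seriesBlocks_zipWith (Xs : List (TTGraph ℕ)) (ls : List (List ℕ))
    (hl : Xs.length = ls.length) (j : ℕ) (hj : j < ls.length) :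
    (seriesBlocks (List.zipWith (fun X l => X.src :: X.snk :: l) Xs ls)).getD j [] =
      if 0 < j then Xs[j].src :: ls[j] else ls[j] := by
  cases Xs with
  | nil => simp at hl; omega
  | cons X Xs =>
    cases ls with
    | nil => simp at hl
    | cons l ls =>
      simp only [List.length_cons] at hl hj
      cases j with
      | zero => simp [seriesBlocks]
      | succ j => simp [seriesBlocks, show j < ls.length by omega, show j < Xs.length by omega]

theorem length_seriesBlocks (Xs : List (TTGraph ℕ)) (ls : List (List ℕ))
    (hl : Xs.length = ls.length) :
    (seriesBlocks (List.zipWith (fun X l => X.src :: X.snk :: l) Xs ls)).length = ls.length ∧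
    (seriesBlocks (List.zipWith (fun X l => X.src :: X.snk :: l) Xs ls)).flatten.length =
      (ls.map List.length).sum + (ls.length - 1) := by
  cases Xs with
  | nil => simp [List.length_eq_zero_iff.1 hl.symm, seriesBlocks]
  | cons X Xs =>
    cases ls with
    | nil => simp at hl
    | cons l ls =>
      simp only [List.length_cons] at hl
      simp only [List.zipWith_cons_cons, seriesBlocks, List.length_cons, List.length_map,
        List.length_zipWith, List.flatten_cons, List.length_append, List.map_cons, List.sum_cons]
      have : ∀ (Xs : List (TTGraph ℕ)) (ls : List (List ℕ)), Xs.length = ls.length →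
          ((List.zipWith (fun X l => X.src :: X.snk :: l) Xs ls).map
            fun y => y.eraseIdx 1).flatten.length = (ls.map List.length).sum + ls.length := by
        intro Xs ls h
        induction Xs generalizing ls with
        | nil => simp [List.length_eq_zero_iff.1 h.symm]
        | cons X Xs ih =>
          cases ls with
          | nil => simp at h
          | cons l ls =>
            have := ih ls (by simpa using h)
            simp only [List.zipWith_cons_cons, List.map_cons, List.flatten_cons,
              List.length_append, List.sum_cons, List.length_cons] at this ⊢
            simp only [List.eraseIdx_cons_succ, List.eraseIdx_cons_zero, List.length_cons, List.tail_cons,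
              this]
            omega
      rw [this Xs ls (by omega)]
      simp
      omega

/-- Both directions have to be treated in one induction over the tree, since children behind the
biggest one of a series component are arranged against the direction of their parent. -/
theorem exists_arranges {A : ℕ → ℕ → ℕ} {L : ℕ} {T : SPTree ℕ} {X : TTGraph ℕ} (hL : L < N)
    (hN : 10 < N) (h : T.Represents X) :
    ∀ b, NodeRep L A b T → ∃ l, Arranges N A (b + T.nn) T X l := by
  have maps : ∀ (b : ℕ) (ts : List (SPTree ℕ)) (Xs : List (TTGraph ℕ)) (ls : List (List ℕ))
      (h1 : ts.length = Xs.length) (h2 : ts.length = ls.length),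
      (∀ (j : ℕ) (hj : j < ts.length), Arranges N A (b + pre nn ts (j + 1)) ts[j] Xs[j] ls[j]) →
      ls.map List.length = ts.map isz := by
    intro b ts Xs ls h1 h2 h
    refine List.ext_getElem (by simp; omega) fun i h3 h4 => ?_
    simp at h3 h4
    simpa using (h i h4).2.1
  have best : ∀ (b a : ℕ) (ts : List (SPTree ℕ)) (ls : List (List ℕ)) (ha : a < ts.length)
      (ha' : a < ls.length), ls.map List.length = ts.map isz → (∀ t ∈ ts, t.isz ≤ (ts[a]).isz) →
      ∀ x ∈ ls, x.length ≤ ls[a].length := by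
    intro b a ts ls ha ha' h h' x hx
    have e1 : ls[a].length = ts[a].isz := by
      have := congrArg (fun l => l[a]?) h
      simpa [ha, ha'] using this
    rw [e1]
    have : x.length ∈ ts.map isz := h ▸ List.mem_map_of_mem hx
    obtain ⟨t, ht, hx⟩ := List.mem_map.1 this
    exact hx ▸ h' t ht
  induction h with
  | leaf p G h =>
    intro b hb
    refine ⟨_, inner_leaf h, ?_, ?_, ?_, fun d hd => ?_⟩
    · rw [(zigzag_perm _).length_eq]; simp; omega
    · cases hb with
      | leaf _ _ _ _ _ _ _ _ src snk => simpa [h.src] using src.symm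
    · cases hb with
      | leaf _ _ _ _ _ _ _ _ src snk => simpa [h.snk] using snk.symm
    · rw [nn_leaf]
      exact emits_leaf A b d p h.two_le hd L hL hb
  | series ts Xs G hlen hts h ih =>
    intro b hb
    obtain ⟨hr, hd⟩ : (∀ (j : ℕ) (hj : j < ts.length), NodeRep L A (b + pre nn ts j) ts[j]) ∧
        Header A 1 ts b (series ts) := by
      cases hb with
      | series _ _ h hd => exact ⟨h, hd⟩
    obtain ⟨ls, hls, hin⟩ := exists_arranges_list A ts Xs b hlen ih hr
    have hmap := maps b ts Xs ls hlen hls hin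
    have h2 := h.two_le
    have ha := hd.best_lt
    obtain ⟨hB1, hB2⟩ := length_seriesBlocks Xs ls (by omega)
    set a := A 8 (b + (series ts).nn) with hadef
    set B := seriesBlocks (List.zipWith (fun X l => X.src :: X.snk :: l) Xs ls) with hB
    have hlength : (seriesOrder B a).length = (series ts).isz := by
      rw [(seriesOrder_perm B a (by omega)).length_eq, hB2, hmap, isz_series, hls]
    have hsrc := h.src
    have hsnk := h.snk
    refine ⟨seriesOrder B a, inner_series hlen hts h ls hls (fun i hi => (hin i hi).1) a
      (by omega) (best b a ts ls ha (by omega) hmap hd.best), hlength, ?_, ?_, fun d hd' => ?_⟩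
    · rw [hd.src, (hin 0 (by omega)).2.2.1]
      simpa [List.head?_eq_getElem?, show 0 < Xs.length by omega] using hsrc
    · have := (hin (ts.length - 1) (by omega)).2.2.2.1
      rw [Nat.sub_add_cancel (by omega)] at this
      rw [hd.snk, this]
      simpa [List.getLast?_eq_getElem?, hlen, show 0 < Xs.length by omega] using hsnk
    · have hlt := (series ts).isz_lt_elen
      refine emits_node A b 1 d ts (series ts) (.inl rfl) hd' hN (by simp)
        (by rw [elen, encode_series, List.length_append, length_flatten_encode]; rfl) hd
        (fun j hj => ?_) (fun j => if d = 1 then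
          (if a < j then (B.getD j []).reverse else B.getD j []).reverse else
          if a < j then (B.getD j []).reverse else B.getD j []) _ ?_ ?_ fun j hj => ?_
      · rw [pre_succ _ _ _ hj, ← add_assoc]
        exact (hr j hj).cnt_isz.1
      · rw [flatten_dirOrder, childOrder_flatten_series ha B (by omega)]
      · have : (if d = 1 then (seriesOrder B a).reverse else seriesOrder B a).length =
          (series ts).isz := by split <;> simp [hlength]
        omega
      · have := (hin j hj).child 1 a d j hd'
        rw [hB, seriesBlocks_zipWith Xs ls (by omega) j (by omega)]
        simp only [true_and] at this
        convert this using 1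
        -- A child behind the biggest one is flipped relative to its parent; if the parent is
        -- reversed as well, the two reversals cancel.
        unfold childDir
        obtain rfl | rfl : d = 0 ∨ d = 1 := by omega
        · by_cases haj : a < j <;> simp [haj]
        · by_cases haj : a < j <;> simp [haj]
  | parallel ts Xs G hlen hts h ih =>
    intro b hb
    obtain ⟨hr, hd⟩ : (∀ (j : ℕ) (hj : j < ts.length), NodeRep L A (b + pre nn ts j) ts[j]) ∧
        Header A 2 ts b (parallel ts) := by
      cases hb with
      | parallel _ _ h hd => exact ⟨h, hd⟩
    obtain ⟨ls, hls, hin⟩ := exists_arranges_list A ts Xs b hlen ih hr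
    have hmap := maps b ts Xs ls hlen hls hin
    have h2 := h.two_le
    have ha := hd.best_lt
    set a := A 8 (b + (parallel ts).nn) with hadef
    have hperm := childOrder_flatten_perm ha ls (by omega)
    set e := ((childOrder a ts.length).map fun j => ls.getD j []).flatten with he
    have hlength : e.length = (parallel ts).isz := by
      rw [he, ← hperm.flatten.length_eq, List.length_flatten, hmap, isz_parallel]
    have hterm : ∀ (j : ℕ) (h : j < ts.length), Xs[j].src = G.src ∧ Xs[j].snk = G.snk :=
      fun j hj => h.terminals _ (List.getElem_mem _)
    have hin' : InnerOrder (.parallel ts) G e := by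
      -- The same child order serves parallel components: it places the biggest child last, and the
      -- order of the others is free.
      have := inner_parallel hlen hts h ls hls (fun i hi => (hin i hi).1)
        ((List.range a ++ ((List.range ts.length).drop (a + 1)).reverse).map fun j => ls.getD j [])
        (ls[a]) (by simpa [childOrder, show a < ls.length by omega] using hperm)
        (best b a ts ls ha (by omega) hmap hd.best)
      simpa [he, childOrder, show a < ls.length by omega] using this
    refine ⟨e, hin', hlength, ?_, ?_, fun d hd' => ?_⟩
    · rw [hd.src, (hin 0 (by omega)).2.2.1, (hterm 0 (by omega)).1]
    · have := (hin (ts.length - 1) (by omega)).2.2.2.1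
      rw [Nat.sub_add_cancel (by omega)] at this
      rw [hd.snk, this, (hterm _ (by omega)).2]
    · have hlt := (parallel ts).isz_lt_elen
      refine emits_node A b 2 d ts (parallel ts) (.inr rfl) hd' hN (by simp)
        (by rw [elen, encode_parallel, List.length_append, length_flatten_encode]; rfl) hd
        (fun j hj => ?_) (fun j => if d = 1 then (ls.getD j []).reverse else ls.getD j [])
        _ ?_ ?_ fun j hj => ?_
      · rw [pre_succ _ _ _ hj, ← add_assoc]
        exact (hr j hj).cnt_isz.1
      · rw [flatten_dirOrder]
      · have : (if d = 1 then e.reverse else e).length =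
          (parallel ts).isz := by split <;> simp [hlength]
        omega
      · have := (hin j hj).child 2 a d j hd'
        simpa [childDir, show j < ls.length by omega, -nn_parallel] using this

/-- Arrange the graph of the tree whose encoding, of length `reg 0`, is in array `0`. The result is
in array `11`. -/
def arrange : Cmd :=
  .set 1 (.lit 0) ;; .set 2 (.lit 1) ;; tableLoop ;;
  .set 3 (.minus (.var 2) (.lit 1)) ;; .set 2 (.lit 0) ;; .set 1 (.lit 0) ;;
  emit (.get 6 (.var 3)) ;; emit (.get 7 (.var 3)) ;; push (.var 3) (.lit 0) ;; emitLoop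

theorem arrange_spec {T : SPTree ℕ} {X : TTGraph ℕ} (hT : T.Represents X) (s : St)
    (h0 : s.reg 0 = T.elen) (hin : ∀ (i : ℕ) (h : i < T.encode.length), s.arr 0 i = T.encode[i])
    (hN : 4 * T.elen + 10 < N) (hf : 5 * T.elen + 5 ≤ s.fuel)
    (hQ : ∀ (t : St) (l : List ℕ) (A : ℕ → ℕ), InnerOrder T X l → t.arr 0 = s.arr 0 →
      t.arr 11 = assign A 0 (X.src :: X.snk :: l) → Q t) :
    wp N arrange Q s := by
  have h2 := two_le_elen T
  simp only [arrange, emit, push, wp_seq, wp_set, wp_put]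
  refine ⟨by simp, by simp, ?_⟩
  refine reads_of_represents hT 0 _ _ (by simp) (by simpa using hin) (by simp [h0])
    (by simpa [h0]) (by simp) (by simp; omega) fun t ht hr => ?_
  have r2 := ht.r2
  have hr0 := ht.r0
  have hr1 := ht.r1
  have hfu := ht.fuel
  simp at r2 hr0 hfu hr1
  refine wp_while_false (by simp) (by simp [hr0, hr1, h0]) ?_
  obtain ⟨l, hin, hlen, hsrc, hsnk, hem⟩ := exists_arranges (N := N) (X := X)
    (by simp [h0]; omega) (by omega) hT 0 hr
  have hlt := T.isz_lt_elen
  rw [zero_add] at hsrc hsnk hem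
  simp [r2, hsrc, hsnk, show 1 + T.nn - 1 = T.nn by omega, show 1 < N by omega,
    show 2 < N by omega]
  refine (hem 0 (by omega)).2 0 _ _ (fun k hk => ?_) (by simp) (by simp) (by simp) (by omega)
    (by simp; omega) (by simp; omega) fun u hu => wp_while_false (by simp) (by simp [hu.sp]) ?_
  · simp [setA_arr_ne _ _ _ _ _ (show k ≠ 11 by omega), setA_arr_ne _ _ _ _ _ (show k ≠ 9 by omega),
      setA_arr_ne _ _ _ _ _ (show k ≠ 10 by omega)]
  refine hQ u l (t.arr 11) hin ?_ ?_
  · simp [hu.tab 0 (by omega), ht.arr0]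
  · rw [hu.pi]
    simp [assign]

/-! ### From positions in an array to a linear arrangement. -/

theorem assign_of_notMem (A : ℕ → ℕ) (c : ℕ) (l : List ℕ) (v : ℕ) (h : v ∉ l) :
    assign A c l v = A v := by
  induction l generalizing A c with
  | nil => rfl
  | cons x l ih =>
    simp only [List.mem_cons, not_or] at h
    rw [assign, ih _ _ h.2, Function.update_of_ne h.1]

theorem assign_getElem (A : ℕ → ℕ) (c : ℕ) (l : List ℕ) (h : l.Nodup) (i : ℕ)
    (hi : i < l.length) : assign A c l l[i] = c + i + 1 := by
  induction l generalizing A c i with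
  | nil => simp at hi
  | cons x l ih =>
    rw [List.nodup_cons] at h
    cases i with
    | zero => simp [assign, assign_of_notMem _ _ _ _ h.1]
    | succ i => simp [assign, ih _ _ h.2 i (by simpa using hi)]; omega

/-- An enumeration of the nodes as a linear arrangement. -/
theorem exists_linearArrangement {G : MGraph ℕ} {l : List ℕ} (hl : l.Nodup)
    (h : ∀ v, v ∈ G.verts ↔ v ∈ l) :
    l.length = G.verts.card ∧ ∃ π : LinearArrangement G,
      ∀ v : {v // v ∈ G.verts}, ∃ i, ∃ hi : i < l.length, l[i] = v ∧ (π v : ℕ) = i + 1 := by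
  have hf : G.verts = l.toFinset := by ext v; simp [h]
  have hcard : l.length = G.verts.card := by rw [hf, List.toFinset_card_of_nodup hl]
  refine ⟨hcard, ?_⟩
  have mem : ∀ v : {v // v ∈ G.verts}, (v : ℕ) ∈ l := fun v => (h v).1 v.2
  let f : {v // v ∈ G.verts} → {i // i ∈ Finset.Icc 1 G.verts.card} := fun v =>
    ⟨l.idxOf (v : ℕ) + 1, by
      have := List.idxOf_lt_length_of_mem (mem v)
      simp; omega⟩
  have hinj : Function.Injective f := by
    intro v w hvw
    have : l.idxOf (v : ℕ) = l.idxOf (w : ℕ) := by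
      simpa [f] using hvw
    exact Subtype.ext ((List.idxOf_inj (mem v)).1 this)
  have hbij : Function.Bijective f := by
    rw [Fintype.bijective_iff_injective_and_card]
    exact ⟨hinj, by simp⟩
  refine ⟨Equiv.ofBijective f hbij, fun v => ⟨l.idxOf (v : ℕ),
    List.idxOf_lt_length_of_mem (mem v), by simp, rfl⟩⟩

theorem exists_arrangement {T : SPTree ℕ} {X : TTGraph ℕ} {l : List ℕ} (h : InnerOrder T X l)
    (A : ℕ → ℕ) : ∃ π : LinearArrangement X.toMGraph, IsSPGAAArrangement T π ∧
      ∀ v : {v // v ∈ X.verts}, assign A 0 (X.src :: X.snk :: l) v = π v := by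
  obtain ⟨hc, π, hπ⟩ := exists_linearArrangement (G := X.toMGraph) h.nodup h.mem
  refine ⟨π, ⟨_, h.order, hc, fun v => ?_⟩, fun v => ?_⟩
  · obtain ⟨i, hi, hv, hp⟩ := hπ v
    rw [hp, Nat.add_sub_cancel, List.getElem?_eq_getElem hi, hv]
  · obtain ⟨i, hi, hv, hp⟩ := hπ v
    rw [hp, ← hv, assign_getElem _ _ _ h.nodup _ hi, zero_add]

/-! ### Sizes of encodings, nodes and edges. -/

theorem card_edges_of_isPathOf {p : List ℕ} {X : TTGraph ℕ} (h : IsPathOf p X) :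
    X.edges.card + 1 = p.length := by
  have := h.two_le
  rw [h.edges]
  simp
  omega

theorem one_le_card_edges {T : SPTree ℕ} {X : TTGraph ℕ} (h : T.Represents X) :
    1 ≤ X.edges.card := by
  have aux : ∀ (ts : List (SPTree ℕ)) (Xs : List (TTGraph ℕ)), ts.length = Xs.length →
      2 ≤ Xs.length → (∀ q ∈ ts.zip Xs, 1 ≤ q.2.edges.card) →
      1 ≤ (Xs.map fun X : TTGraph ℕ => X.edges).sum.card := by
    intro ts Xs hl h2 ih
    rcases Xs with - | ⟨X, Xs⟩
    · simp at h2
    · rcases ts with - | ⟨t, ts⟩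
      · simp at hl
      · have : 1 ≤ X.edges.card := ih (t, X) (by simp)
        simp only [List.map_cons, List.sum_cons, Multiset.card_add]
        omega
  induction h with
  | leaf p G h => have := card_edges_of_isPathOf h; have := h.two_le; omega
  | series ts Xs G hlen hts h ih => rw [h.edges]; exact aux ts Xs hlen h.two_le ih
  | parallel ts Xs G hlen hts h ih => rw [h.edges]; exact aux ts Xs hlen h.two_le ih

/-- The summand `2` makes the induction work: an inner node has at least two children, and their
spare tokens pay for its own two tokens and for the two that it has to spare. -/
theorem elen_le {T : SPTree ℕ} {X : TTGraph ℕ} (h : T.Represents X) :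
    T.elen + 2 ≤ 6 * X.edges.card := by
  have aux : ∀ (ts : List (SPTree ℕ)) (Xs : List (TTGraph ℕ)), ts.length = Xs.length →
      (∀ q ∈ ts.zip Xs, q.1.elen + 2 ≤ 6 * q.2.edges.card) →
      (ts.map elen).sum + 2 * ts.length ≤ 6 * (Xs.map fun X : TTGraph ℕ => X.edges).sum.card := by
    intro ts Xs hl ih
    induction ts generalizing Xs with
    | nil => simp
    | cons t ts iht =>
      rcases Xs with - | ⟨X, Xs⟩
      · simp at hl
      · have h1 := ih (t, X) (by simp)
        have h2 := iht Xs (by simpa using hl) fun q hq => ih q (by simp [hq])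
        simp only [List.map_cons, List.sum_cons, Multiset.card_add, List.length_cons] at *
        omega
  induction h with
  | leaf p G h =>
    have := card_edges_of_isPathOf h
    have := h.two_le
    simp [elen, encode]
    omega
  | series ts Xs G hlen hts h ih =>
    have := aux ts Xs hlen ih
    have := h.two_le
    rw [h.edges, elen, encode_series, List.length_append, length_flatten_encode]
    change (ts.map elen).sum + 2 + 2 ≤ _
    omega
  | parallel ts Xs G hlen hts h ih =>
    have := aux ts Xs hlen ih
    have := h.two_le
    rw [h.edges, elen, encode_parallel, List.length_append, length_flatten_encode]
    change (ts.map elen).sum + 2 + 2 ≤ _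
    omega

/-- Tokens are graph nodes, tags or counts; all of them are small enough to be stored in a word. -/
theorem mem_encode {T : SPTree ℕ} {X : TTGraph ℕ} (h : T.Represents X) (v : ℕ) (hv : v ∈ T.encode) :
    v ∈ X.verts ∨ v ≤ T.elen := by
  have aux : ∀ (ts : List (SPTree ℕ)) (Xs : List (TTGraph ℕ)), ts.length = Xs.length →
      (∀ q ∈ ts.zip Xs, v ∈ q.1.encode → v ∈ q.2.verts ∨ v ≤ q.1.elen) →
      v ∈ (ts.map encode).flatten → (∃ X ∈ Xs, v ∈ X.verts) ∨ v ≤ (ts.map elen).sum := by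
    intro ts Xs hl ih hv
    obtain ⟨_, hm, hv⟩ := List.mem_flatten.1 hv
    obtain ⟨t, ht, rfl⟩ := List.mem_map.1 hm
    obtain ⟨i, hi, rfl⟩ := List.getElem_of_mem ht
    rcases ih (ts[i], Xs[i]) (List.mem_iff_getElem.2 ⟨i, by simp; omega, by simp⟩) hv with h | h
    · exact .inl ⟨_, List.getElem_mem _, h⟩
    · exact .inr (h.trans (List.single_le_sum (by simp) _ (List.mem_map_of_mem ht)))
  have hlen := fun ts => sum_isz_add_length_le ts
  induction h with
  | leaf p G h =>
    simp [elen, encode] at hv ⊢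
    rcases hv with rfl | rfl | hv
    · simp
    · right; omega
    · exact .inl ((h.verts v).2 hv)
  | series ts Xs G hl hts h ih =>
    have := h.two_le
    have := hlen ts
    have he : (series ts).elen = (ts.map elen).sum + 2 := by
      rw [elen, encode_series, List.length_append, length_flatten_encode]; rfl
    rw [encode_series, List.mem_append] at hv
    rcases hv with hv | hv
    · rcases aux ts Xs hl ih hv with h' | h'
      · exact .inl ((h.verts v).2 h')
      · right; omega
    · simp at hv; right; omega
  | parallel ts Xs G hl hts h ih =>
    have := h.two_le
    have := hlen ts
    have he : (parallel ts).elen = (ts.map elen).sum + 2 := by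
      rw [elen, encode_parallel, List.length_append, length_flatten_encode]; rfl
    rw [encode_parallel, List.mem_append] at hv
    rcases hv with hv | hv
    · rcases aux ts Xs hl ih hv with h' | h'
      · exact .inl ((h.verts v).2 h')
      · right; omega
    · simp at hv; right; omega

theorem card_verts_le_elen {T : SPTree ℕ} {X : TTGraph ℕ} (h : T.Represents X) :
    X.verts.card ≤ T.elen := by
  suffices hs : ∀ v ∈ X.verts, v ∈ T.encode by
    calc X.verts.card ≤ T.encode.toFinset.card :=
          Finset.card_le_card fun v hv => by simpa using hs v hv
      _ ≤ T.elen := List.toFinset_card_le _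
  have aux : ∀ (v : ℕ) (ts : List (SPTree ℕ)) (Xs : List (TTGraph ℕ)), ts.length = Xs.length →
      (∀ q ∈ ts.zip Xs, v ∈ q.2.verts → v ∈ q.1.encode) → (∃ X ∈ Xs, v ∈ X.verts) →
      v ∈ (ts.map encode).flatten := by
    intro v ts Xs hl ih hv
    obtain ⟨X, hX, hv⟩ := hv
    obtain ⟨i, hi, rfl⟩ := List.getElem_of_mem hX
    exact List.mem_flatten.2 ⟨_, List.mem_map_of_mem (List.getElem_mem (by omega)),
      ih (ts[i], Xs[i]) (List.mem_iff_getElem.2 ⟨i, by simp; omega, by simp⟩) hv⟩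
  induction h with
  | leaf p G h =>
    intro v hv
    simp [encode, (h.verts v).1 hv]
  | series ts Xs G hl hts h ih =>
    intro v hv
    rw [encode_series, List.mem_append]
    exact .inl (aux v ts Xs hl (fun q hq => ih q hq v) ((h.verts v).1 hv))
  | parallel ts Xs G hl hts h ih =>
    intro v hv
    rw [encode_parallel, List.mem_append]
    exact .inl (aux v ts Xs hl (fun q hq => ih q hq v) ((h.verts v).1 hv))

/-- The exponent comes from `32 ≤ 3 ^ 4 ≤ (m + 2) ^ 4` and `L + 10 ≤ 3 ^ 3 * (m + 2) ≤ (m + 2) ^ 4`,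
the latter to the fourth power. -/
theorem size_bound (m L : ℕ) (hm : 1 ≤ m) (hL : L ≤ 6 * m) : 32 * size L ≤ (m + 2) ^ 20 := by
  have h3 : 3 ≤ m + 2 := by omega
  calc 32 * size L ≤ 3 ^ 4 * (3 ^ 3 * (m + 2)) ^ 4 := by
        unfold size
        exact Nat.mul_le_mul (by norm_num) (Nat.pow_le_pow_left (by omega) 4)
    _ ≤ (m + 2) ^ 4 * ((m + 2) ^ 3 * (m + 2)) ^ 4 := by gcongr
    _ = (m + 2) ^ 20 := by ring

theorem exists_prog_of_tree : ∃ (prog : RAM.Prog) (C k : ℕ),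
    ∀ (n : ℕ) (G : MGraph ℕ) (T : SPTree ℕ),
      G.verts = Finset.range n → G.IsSeriesParallel → T.IsMinimalSPTreeOf G →
      ∃ (t : ℕ) (σ : RAM.State) (π : LinearArrangement G),
        RAM.Exec ((G.edges.card + 2) ^ k) prog (RAM.init T.encode) t σ ∧
        t ≤ C * G.edges.card ∧ IsSPGAAArrangement T π ∧ σ.HoldsArrangement π := by
  -- With fuel `5 * elen + 5`, the factor is `1 + (5 * elen + 5)`, which is at most `37 * |E|` by
  -- `elen_le`. The result is in array `11`.
  refine ⟨arrange.program 11, (arrange.cost + 7) * 37, 20, fun n G T hn _ ⟨⟨X, hX, hT⟩, _⟩ => ?_⟩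
  subst hX
  have h1 := elen_le hT
  have h2 := card_verts_le_elen hT
  have h3 := one_le_card_edges hT
  have h4 : T.elen + 10 ≤ size T.elen := le_size _
  have h5 : 4 * T.elen + 10 < size T.elen := by
    unfold size
    nlinarith [Nat.zero_le T.elen, Nat.pow_le_pow_left (Nat.le_add_left 10 T.elen) 3,
      pow_succ (T.elen + 10) 3]
  have hmem : ∀ v ∈ X.verts, v < n := fun v hv => by rwa [hn, Finset.mem_range] at hv
  rw [hn, Finset.card_range] at h2
  obtain ⟨s', hrun, hs'⟩ : wp (size T.elen) arrange (fun t => ∃ l A, InnerOrder T X l ∧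
      t.arr 11 = assign A 0 (X.src :: X.snk :: l)) (St.init T.encode (5 * T.elen + 5)) :=
    arrange_spec hT _ (by simp [St.init, elen]) (by intro i hi; simp [St.init, hi]) h5
      (by simp [St.init]) fun t l A hl _ ht => ⟨l, A, hl, ht⟩
  obtain ⟨l, A, hl, harr⟩ := hs'
  obtain ⟨π, hπ, hval⟩ := exists_arrangement hl A
  have hin : ∀ x ∈ T.encode, x < size T.elen := fun x hx => by
    rcases mem_encode hT x hx with h | h
    · have := hmem x h; omega
    · omega
  obtain ⟨t, σ, hex, ht, hout, -⟩ := Cmd.program_correct arrange 11 (by omega) T.encode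
    (5 * T.elen + 5) ((X.edges.card + 2) ^ 20) s' (size_bound _ _ h3 (by change T.elen ≤ _; omega))
    hin hrun
  refine ⟨t, σ, π, hex, ht.trans ?_, hπ, fun v => ?_⟩
  · rw [mul_assoc]
    exact Nat.mul_le_mul_left _ (by omega)
  · have hv := hmem v v.2
    rw [hout v (by change _ < size T.elen; omega), harr, hval]

/-! ### Reductions of series-parallel graphs -/

section reductions
variable {α : Type}

/-- The node is an end of one of the edges. -/
def Touches (E : Multiset (Sym2 α)) (v : α) : Prop := ∃ e ∈ E, v ∈ e

@[simp] theorem touches_zero (v : α) : ¬ Touches 0 v := by simp [Touches]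

@[simp] theorem touches_cons (e : Sym2 α) (E : Multiset (Sym2 α)) (v : α) :
    Touches (e ::ₘ E) v ↔ v ∈ e ∨ Touches E v := by simp [Touches]

@[simp] theorem touches_singleton (e : Sym2 α) (v : α) : Touches {e} v ↔ v ∈ e := by
  simp [Touches]

@[simp] theorem touches_add (E F : Multiset (Sym2 α)) (v : α) :
    Touches (E + F) v ↔ Touches E v ∨ Touches F v := by
  simp [Touches, or_and_right, exists_or]

/-- The edge sets of the two-terminal series-parallel graphs with given terminals, built by binary
compositions. -/
inductive SP : Multiset (Sym2 α) → α → α → Prop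
  | edge (s t : α) (h : s ≠ t) : SP {s(s, t)} s t
  | ser (E F : Multiset (Sym2 α)) (s m t : α) (hE : SP E s m) (hF : SP F m t)
      (h : ∀ v, Touches E v → Touches F v → v = m) : SP (E + F) s t
  | par (E F : Multiset (Sym2 α)) (s t : α) (hE : SP E s t) (hF : SP F s t)
      (h : ∀ v, Touches E v → Touches F v → v = s ∨ v = t) : SP (E + F) s t

variable {E F : Multiset (Sym2 α)} {s t v x y : α}

theorem SP.basic (h : SP E s t) : s ≠ t ∧ Touches E s ∧ Touches E t := by
  induction h with
  | edge s t h => simp [h]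
  | ser E F s m t hE hF h ihE ihF =>
    refine ⟨?_, by simp [ihE], by simp [ihF]⟩
    rintro rfl
    exact ihE.1 (h _ ihE.2.1 ihF.2.2)
  | par E F s t hE hF h ihE ihF => exact ⟨ihE.1, by simp [ihE], by simp [ihE]⟩

theorem SP.symm (h : SP E s t) : SP E t s := by
  induction h with
  | edge s t h => rw [Sym2.eq_swap]; exact .edge t s h.symm
  | ser E F s m t hE hF h ihE ihF =>
    rw [add_comm]; exact .ser F E t m s ihF ihE fun v h1 h2 => h v h2 h1
  | par E F s t hE hF h ihE ihF => exact .par E F t s ihE ihF fun v h1 h2 => (h v h1 h2).symm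

theorem SP.not_isDiag (h : SP E s t) : ∀ e ∈ E, ¬ e.IsDiag := by
  induction h with
  | edge s t h => simp [h]
  | ser E F s m t hE hF h ihE ihF =>
    intro e he; rcases Multiset.mem_add.1 he with he | he
    exacts [ihE e he, ihF e he]
  | par E F s t hE hF h ihE ihF =>
    intro e he; rcases Multiset.mem_add.1 he with he | he
    exacts [ihE e he, ihF e he]

theorem add_eq_cons {β : Type*} {E F G : Multiset β} {e : β} (h : E + F = e ::ₘ G) :
    (∃ E', E = e ::ₘ E' ∧ G = E' + F) ∨ ∃ F', F = e ::ₘ F' ∧ G = E + F' := by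
  have : e ∈ E + F := h ▸ Multiset.mem_cons_self e G
  rcases Multiset.mem_add.1 this with he | he
  · obtain ⟨E', rfl⟩ := Multiset.exists_cons_of_mem he
    exact .inl ⟨E', rfl, ((Multiset.cons_inj_right e).1 (by rw [← h, Multiset.cons_add])).symm⟩
  · obtain ⟨F', rfl⟩ := Multiset.exists_cons_of_mem he
    exact .inr ⟨F', rfl, ((Multiset.cons_inj_right e).1 (by rw [← h, Multiset.add_cons])).symm⟩

theorem add_eq_cons_left {E F G : Multiset (Sym2 α)} {e : Sym2 α} (h : E + F = e ::ₘ G)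
    (hv : v ∈ e) (hF : ¬ Touches F v) : ∃ E', E = e ::ₘ E' ∧ G = E' + F := by
  rcases add_eq_cons h with h | ⟨F', rfl, -⟩
  · exact h
  · exact absurd ⟨e, by simp, hv⟩ hF

/-- No edge of a series composition joins its terminals, as one end would have to be the joint. In a
parallel composition the edge lies in one part, where it is erased by induction. -/
theorem SP.erase_terminals (h : SP E s t) {E' : Multiset (Sym2 α)} (hE : E = s(s, t) ::ₘ E') :
    E' = 0 ∨ SP E' s t := by
  induction h generalizing E' with
  | edge s t h =>
    left
    exact ((Multiset.cons_inj_right _).1 hE).symm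
  | ser E F s m t hE' hF h ihE ihF =>
    exfalso
    rcases add_eq_cons hE with ⟨E1, rfl, -⟩ | ⟨F1, rfl, -⟩
    · exact hF.basic.1.symm (h t (by simp) hF.basic.2.2)
    · exact hE'.basic.1 (h s hE'.basic.2.1 (by simp))
  | par E F s t hE' hF h ihE ihF =>
    right
    rcases add_eq_cons hE with ⟨E1, rfl, rfl⟩ | ⟨F1, rfl, rfl⟩
    · rcases ihE rfl with rfl | h'
      · simpa using hF
      · exact .par _ _ _ _ h' hF fun v h1 h2 => h v (by simp [h1]) h2
    · rcases ihF rfl with rfl | h'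
      · simpa using hE'
      · exact .par _ _ _ _ hE' h' fun v h1 h2 => h v h1 (by simp [h2])

/-- Parallel reduction. -/
theorem SP.parallel_reduction (h : SP E s t) {e : Sym2 α} {E' : Multiset (Sym2 α)}
    (hE : E = e ::ₘ e ::ₘ E') : SP (e ::ₘ E') s t := by
  induction h generalizing E' with
  | edge s t h => simpa using congrArg Multiset.card hE
  | ser E F s m t hE' hF h ihE ihF =>
    rcases add_eq_cons hE with ⟨E1, rfl, h1⟩ | ⟨F1, rfl, h1⟩
    · rcases add_eq_cons h1.symm with ⟨E2, rfl, rfl⟩ | ⟨F2, rfl, rfl⟩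
      · rw [← Multiset.cons_add]
        exact .ser _ _ _ _ _ (ihE rfl) hF fun v h1 h2 => h v (by simp at h1 ⊢; tauto) h2
      -- Copies in both parts of a series composition would have both ends at the joint and thus be
      -- loops.
      · exfalso
        induction e using Sym2.ind with | _ x y
        have h1 := h x (by simp) (by simp)
        have h2 := h y (by simp) (by simp)
        exact hF.not_isDiag s(x, y) (by simp) (by simp [h1, h2])
    · rcases add_eq_cons h1.symm with ⟨E2, rfl, rfl⟩ | ⟨F2, rfl, rfl⟩
      · exfalso
        induction e using Sym2.ind with | _ x y
        have h1 := h x (by simp) (by simp)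
        have h2 := h y (by simp) (by simp)
        exact hF.not_isDiag s(x, y) (by simp) (by simp [h1, h2])
      · rw [← Multiset.add_cons]
        exact .ser _ _ _ _ _ hE' (ihF rfl) fun v h1 h2 => h v h1 (by simp at h2 ⊢; tauto)
  | par E F s t hE' hF h ihE ihF =>
    -- If each part has one copy, both ends are common to the parts; so the edge joins the
    -- terminals, and one copy can be erased.
    have both : ∀ E2 F2, E = e ::ₘ E2 → F = e ::ₘ F2 → SP (e ::ₘ (E2 + F2)) s t := by
      rintro E2 F2 rfl rfl
      have he : e = s(s, t) := by
        induction e using Sym2.ind with | _ x y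
        have h1 := h x (by simp) (by simp)
        have h2 := h y (by simp) (by simp)
        have h3 := hF.not_isDiag s(x, y) (by simp)
        simp only [Sym2.mk_isDiag_iff] at h3
        rcases h1 with rfl | rfl <;> rcases h2 with rfl | rfl
        · exact absurd rfl h3
        · rfl
        · exact Sym2.eq_swap
        · exact absurd rfl h3
      rw [← Multiset.add_cons]
      rcases hE'.erase_terminals (by rw [he]) with rfl | h'
      · simpa using hF
      · exact .par _ _ _ _ h' hF fun v h1 h2 => h v (by simp [h1]) h2
    rcases add_eq_cons hE with ⟨E1, rfl, h1⟩ | ⟨F1, rfl, h1⟩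
    · rcases add_eq_cons h1.symm with ⟨E2, rfl, rfl⟩ | ⟨F2, rfl, rfl⟩
      · rw [← Multiset.cons_add]
        exact .par _ _ _ _ (ihE rfl) hF fun v h1 h2 => h v (by simp at h1 ⊢; tauto) h2
      · exact both _ _ rfl rfl
    · rcases add_eq_cons h1.symm with ⟨E2, rfl, rfl⟩ | ⟨F2, rfl, rfl⟩
      · exact both _ _ rfl rfl
      · rw [← Multiset.add_cons]
        exact .par _ _ _ _ hE' (ihF rfl) fun v h1 h2 => h v h1 (by simp at h2 ⊢; tauto)

/-- In a parallel composition the source has degree at least two. So a source of degree one begins a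
series composition, and removing its edge moves the source to the neighbour. -/
theorem SP.pendant_source (h : SP E s t) (hE : E = s(s, x) ::ₘ F) (hF : ¬ Touches F s) :
    F = 0 ∧ x = t ∨ SP F x t := by
  induction h generalizing F with
  | edge s t h =>
    have h1 := congrArg Multiset.card hE
    have h2 : F = 0 := by simpa using h1
    subst h2
    have : s(s, t) = s(s, x) := by simpa using hE
    exact .inl ⟨rfl, (Sym2.congr_right.1 this).symm⟩
  | ser E' F' s m t hE' hF' h ihE ihF =>
    have hs : ¬ Touches F' s := fun h' => hE'.basic.1 (h s hE'.basic.2.1 h')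
    obtain ⟨E1, rfl, rfl⟩ := add_eq_cons_left hE (by simp) hs
    simp only [touches_add, not_or] at hF
    rcases ihE rfl hF.1 with ⟨rfl, rfl⟩ | h'
    · simpa using .inr hF'
    · exact .inr (.ser _ _ _ _ _ h' hF' fun v h1 h2 => h v (by simp [h1]) h2)
  | par E' F' s t hE' hF' h ihE ihF =>
    exfalso
    rcases add_eq_cons hE with ⟨E1, rfl, rfl⟩ | ⟨F1, rfl, rfl⟩
    · exact hF (by simp [hF'.basic.2.1])
    · exact hF (by simp [hE'.basic.2.1])

/-- Here `v` is the source of a parallel composition, with one edge in each part. Without these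
edges the parts lead from `x` and from `y` to `t`; the new edge followed by the first is parallel to
the second, so `y` becomes a source. If one part is a single edge, the new edge itself takes its
place. -/
theorem SP.merge_pendants {E1 F1 : Multiset (Sym2 α)} (hxy : x ≠ y) (hE : SP (s(v, x) ::ₘ E1) v t)
    (hF : SP (s(v, y) ::ₘ F1) v t) (hE1 : ¬ Touches E1 v) (hF1 : ¬ Touches F1 v)
    (h : ∀ w, Touches (s(v, x) ::ₘ E1) w → Touches (s(v, y) ::ₘ F1) w → w = v ∨ w = t) :
    ∃ s', SP (s(x, y) ::ₘ (E1 + F1)) s' t := by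
  rcases hE.pendant_source rfl hE1 with ⟨rfl, rfl⟩ | hE'
  · rcases hF.pendant_source rfl hF1 with ⟨rfl, rfl⟩ | hF'
    · exact absurd rfl hxy
    · refine ⟨y, ?_⟩
      rw [zero_add, ← Multiset.singleton_add, Sym2.eq_swap]
      exact .par _ _ _ _ (.edge _ _ hxy.symm) hF' fun w h1 _ => by simpa using h1
  · rcases hF.pendant_source rfl hF1 with ⟨rfl, rfl⟩ | hF'
    · refine ⟨x, ?_⟩
      rw [add_zero, ← Multiset.singleton_add]
      exact .par _ _ _ _ (.edge _ _ hxy) hE' fun w h1 _ => by simpa using h1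
    · refine ⟨y, ?_⟩
      have hxF : ¬ Touches F1 x := by
        intro hx
        rcases h x (by simp) (by simp [hx]) with rfl | rfl
        · exact hF1 hx
        · exact hE'.basic.1 rfl
      have hyE : ¬ Touches E1 y := by
        intro hx
        rcases h y (by simp [hx]) (by simp) with rfl | rfl
        · exact hE1 hx
        · exact hF'.basic.1 rfl
      rw [← Multiset.cons_add, ← Multiset.singleton_add, Sym2.eq_swap]
      refine .par _ _ _ _ (.ser _ _ _ x _ (.edge _ _ hxy.symm) hE' fun w h1 h2 => ?_) hF'
        fun w h1 h2 => ?_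
      · simp only [touches_singleton, Sym2.mem_iff] at h1
        rcases h1 with rfl | rfl
        · exact absurd h2 hyE
        · rfl
      · simp only [touches_add, touches_singleton, Sym2.mem_iff] at h1
        rcases h1 with (rfl | rfl) | h1
        · exact .inl rfl
        · exact absurd h2 hxF
        · rcases h w (by simp [h1]) (by simp [h2]) with rfl | rfl
          · exact absurd h1 hE1
          · exact .inr rfl

/-- Either both edges lie in the first part of a series composition, where induction applies, or
they are divided between the parts of a parallel composition. This is where a terminal disappears
and another node has to replace it. -/
theorem SP.source_reduction (h : SP E v t) (hE : E = s(x, v) ::ₘ s(v, y) ::ₘ F)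
    (hF : ¬ Touches F v) (hxy : x ≠ y) : ∃ s', SP (s(x, y) ::ₘ F) s' t := by
  induction h generalizing F with
  | edge s t h => simpa using congrArg Multiset.card hE
  | ser E' F' v m t hE' hF' h ihE ihF =>
    have hs : ¬ Touches F' v := fun h' => hE'.basic.1 (h v hE'.basic.2.1 h')
    obtain ⟨E1, rfl, h1⟩ := add_eq_cons_left hE (by simp) hs
    obtain ⟨E2, rfl, rfl⟩ := add_eq_cons_left h1.symm (by simp) hs
    simp only [touches_add, not_or] at hF
    obtain ⟨s', hs'⟩ := ihE rfl hF.1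
    refine ⟨s', ?_⟩
    rw [← Multiset.cons_add]
    exact .ser _ _ _ _ _ hs' hF' fun w h1 h2 => h w (by simp at h1 ⊢; tauto) h2
  | par E' F' v t hE' hF' h ihE ihF =>
    rcases add_eq_cons hE with ⟨E1, rfl, h1⟩ | ⟨F1, rfl, h1⟩
    · rcases add_eq_cons h1.symm with ⟨E2, rfl, rfl⟩ | ⟨F2, rfl, rfl⟩
      · exact absurd (by simp [hF'.basic.2.1]) hF
      · simp only [touches_add, not_or] at hF
        rw [Sym2.eq_swap] at hE' h
        exact hE'.merge_pendants hxy hF' hF.1 hF.2 h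
    · rcases add_eq_cons h1.symm with ⟨E2, rfl, rfl⟩ | ⟨F2, rfl, rfl⟩
      · simp only [touches_add, not_or] at hF
        rw [Sym2.eq_swap (a := x) (b := v)] at hF' h
        rw [add_comm]
        exact hF'.merge_pendants hxy hE' hF.2 hF.1 fun w h1 h2 => h w h2 h1
      · exact absurd (by simp [hE'.basic.2.1]) hF

/-- Here `m` is the joint of a series composition, with one edge in each part. What is left of the
parts leads from `s` to `x` and from `y` to `t`, and the new edge connects them in series. -/
theorem SP.join_pendants {E1 F1 : Multiset (Sym2 α)} {m : α} (hxy : x ≠ y)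
    (hE : SP (s(m, x) ::ₘ E1) m s)
    (hF : SP (s(m, y) ::ₘ F1) m t) (hE1 : ¬ Touches E1 m) (hF1 : ¬ Touches F1 m)
    (h : ∀ w, Touches (s(m, x) ::ₘ E1) w → Touches (s(m, y) ::ₘ F1) w → w = m) :
    SP (s(x, y) ::ₘ (E1 + F1)) s t := by
  rcases hE.pendant_source rfl hE1 with ⟨rfl, rfl⟩ | hE'
  · rcases hF.pendant_source rfl hF1 with ⟨rfl, rfl⟩ | hF'
    · simpa using .edge _ _ hxy
    · rw [zero_add, ← Multiset.singleton_add]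
      refine .ser _ _ _ _ _ (.edge _ _ hxy) hF' fun w h1 h2 => ?_
      simp only [touches_singleton, Sym2.mem_iff] at h1
      rcases h1 with rfl | rfl
      · exact absurd (h w (by simp) (by simp [h2])) hE.basic.1.symm
      · rfl
  · rcases hF.pendant_source rfl hF1 with ⟨rfl, rfl⟩ | hF'
    · rw [add_zero, ← Multiset.singleton_add, add_comm]
      refine .ser _ _ _ _ _ hE'.symm (.edge _ _ hxy) fun w h1 h2 => ?_
      simp only [touches_singleton, Sym2.mem_iff] at h2
      rcases h2 with rfl | rfl
      · rfl
      · exact absurd (h w (by simp [h1]) (by simp)) hF.basic.1.symm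
    · rw [← Multiset.cons_add, ← Multiset.singleton_add, add_comm {s(x, y)}]
      refine .ser _ _ _ _ _ (.ser _ _ _ _ _ hE'.symm (.edge _ _ hxy) fun w h1 h2 => ?_) hF'
        fun w h1 h2 => ?_
      · simp only [touches_singleton, Sym2.mem_iff] at h2
        rcases h2 with rfl | rfl
        · rfl
        · exact absurd (h w (by simp [h1]) (by simp) ▸ h1) hE1
      · have : ¬ Touches (s(m, x) ::ₘ E1) w := fun h' =>
          hF1 (h w h' (by simp [h2]) ▸ h2)
        simp only [touches_add, touches_singleton, Sym2.mem_iff, touches_cons, not_or] at h1 this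
        tauto

/-- A node that is no terminal either is the joint of a series composition or occurs in one part
only. In the second case, or if `v` is the joint, having both edges on one side is impossible for a
joint, as the other part touches it, too; so the joint has one edge on each side and
`SP.join_pendants` applies. -/
theorem SP.inner_reduction (h : SP E s t) (hE : E = s(x, v) ::ₘ s(v, y) ::ₘ F)
    (hF : ¬ Touches F v) (hxy : x ≠ y) (hs : v ≠ s) (ht : v ≠ t) : SP (s(x, y) ::ₘ F) s t := by
  induction h generalizing F with
  | edge s t h => simpa using congrArg Multiset.card hE
  | ser E' F' s m t hE' hF' h ihE ihF =>
    by_cases h1 : Touches F' v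
    · by_cases h2 : Touches E' v
      · obtain rfl := h v h2 h1
        rcases add_eq_cons hE with ⟨E1, rfl, h3⟩ | ⟨F1, rfl, h3⟩
        · rcases add_eq_cons h3.symm with ⟨E2, rfl, rfl⟩ | ⟨F2, rfl, rfl⟩
          · exact absurd (by simp [hF'.basic.2.1]) hF
          · simp only [touches_add, not_or] at hF
            rw [Sym2.eq_swap] at hE' h
            exact hE'.symm.join_pendants hxy hF' hF.1 hF.2 h
        · rcases add_eq_cons h3.symm with ⟨E2, rfl, rfl⟩ | ⟨F2, rfl, rfl⟩
          · simp only [touches_add, not_or] at hF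
            rw [Sym2.eq_swap (a := x) (b := v)] at hF' h
            rw [Sym2.eq_swap]
            exact hE'.symm.join_pendants hxy.symm hF' hF.1 hF.2 h
          · exact absurd (by simp [hE'.basic.2.2]) hF
      · rw [add_comm] at hE
        obtain ⟨F1, rfl, h3⟩ := add_eq_cons_left hE (by simp) h2
        obtain ⟨F2, rfl, rfl⟩ := add_eq_cons_left h3.symm (by simp) h2
        simp only [touches_add, not_or] at hF
        rw [add_comm, ← Multiset.add_cons]
        exact .ser _ _ _ _ _ hE' (ihF rfl hF.1 (fun h => h2 (h ▸ hE'.basic.2.2)) ht)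
          fun w h1 h2 => h w h1 (by simp at h2 ⊢; tauto)
    · obtain ⟨F1, rfl, h3⟩ := add_eq_cons_left hE (by simp) h1
      obtain ⟨F2, rfl, rfl⟩ := add_eq_cons_left h3.symm (by simp) h1
      simp only [touches_add, not_or] at hF
      rw [← Multiset.cons_add]
      exact .ser _ _ _ _ _ (ihE rfl hF.1 hs (fun h => h1 (h ▸ hF'.basic.2.1))) hF'
        fun w h1 h2 => h w (by simp at h1 ⊢; tauto) h2
  | par E' F' s t hE' hF' h ihE ihF =>
    by_cases h1 : Touches F' v
    · have h2 : ¬ Touches E' v := fun h2 => (h v h2 h1).elim hs ht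
      rw [add_comm] at hE
      obtain ⟨F1, rfl, h3⟩ := add_eq_cons_left hE (by simp) h2
      obtain ⟨F2, rfl, rfl⟩ := add_eq_cons_left h3.symm (by simp) h2
      simp only [touches_add, not_or] at hF
      rw [add_comm, ← Multiset.add_cons]
      exact .par _ _ _ _ hE' (ihF rfl hF.1 hs ht)
        fun w h1 h2 => h w h1 (by simp at h2 ⊢; tauto)
    · obtain ⟨F1, rfl, h3⟩ := add_eq_cons_left hE (by simp) h1
      obtain ⟨F2, rfl, rfl⟩ := add_eq_cons_left h3.symm (by simp) h1
      simp only [touches_add, not_or] at hF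
      rw [← Multiset.cons_add]
      exact .par _ _ _ _ (ihE rfl hF.1 hs ht) hF'
        fun w h1 h2 => h w (by simp at h1 ⊢; tauto) h2

/-- Series reduction. -/
theorem SP.series_reduction (h : SP E s t) (hE : E = s(x, v) ::ₘ s(v, y) ::ₘ F)
    (hF : ¬ Touches F v) (hxy : x ≠ y) : ∃ s' t', SP (s(x, y) ::ₘ F) s' t' := by
  by_cases hs : v = s
  · subst hs
    obtain ⟨s', h'⟩ := h.source_reduction hE hF hxy
    exact ⟨s', t, h'⟩
  · by_cases ht : v = t
    · subst ht
      obtain ⟨s', h'⟩ := h.symm.source_reduction hE hF hxy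
      exact ⟨s', s, h'⟩
    · exact ⟨s, t, h.inner_reduction hE hF hxy hs ht⟩

theorem SP.eq_of_card (h : SP E s t) (hc : Multiset.card E = 1) : E = {s(s, t)} := by
  obtain ⟨e, rfl⟩ := Multiset.card_eq_one.1 hc
  obtain ⟨h1, h2, h3⟩ := h.basic
  simp only [touches_singleton] at h2 h3
  rw [(Sym2.mem_and_mem_iff h1).1 ⟨h2, h3⟩]

/-- There is a reduction as long as there are at least two edges. -/
theorem SP.progress (h : SP E s t) : Multiset.card E = 1 ∨ (∃ e E', E = e ::ₘ e ::ₘ E') ∨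
    ∃ x v y F, v ≠ s ∧ v ≠ t ∧ E = s(x, v) ::ₘ s(v, y) ::ₘ F ∧ ¬ Touches F v := by
  induction h with
  | edge s t h => simp
  | ser E F s m t hE hF h ihE ihF =>
    right
    rcases ihE with h1 | ⟨e, E', rfl⟩ | ⟨x, v, y, E', hs, ht, rfl, hv⟩
    · rcases ihF with h2 | ⟨e, F', rfl⟩ | ⟨x, v, y, F', hs, ht, rfl, hv⟩
      -- For two single edges in series, the joint is a node of degree two.
      · rw [hE.eq_of_card h1, hF.eq_of_card h2]
        refine .inr ⟨s, m, t, 0, hE.basic.1.symm, hF.basic.1, by simp, by simp⟩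
      · exact .inl ⟨e, E + F', by simp⟩
      · refine .inr ⟨x, v, y, E + F', ?_, ht, by simp, ?_⟩
        · rintro rfl
          exact hs (h v hE.basic.2.1 (by simp))
        · simp only [touches_add, hv, or_false]
          exact fun h' => hs (h v h' (by simp))
    · exact .inl ⟨e, E' + F, by simp⟩
    · refine .inr ⟨x, v, y, E' + F, hs, ?_, by simp, ?_⟩
      · rintro rfl
        exact ht (h v (by simp) hF.basic.2.2)
      · simp only [touches_add, hv, false_or]
        exact fun h' => ht (h v (by simp) h')
  | par E F s t hE hF h ihE ihF =>
    right
    rcases ihE with h1 | ⟨e, E', rfl⟩ | ⟨x, v, y, E', hs, ht, rfl, hv⟩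
    · rcases ihF with h2 | ⟨e, F', rfl⟩ | ⟨x, v, y, F', hs, ht, rfl, hv⟩
      · rw [hE.eq_of_card h1, hF.eq_of_card h2]
        exact .inl ⟨_, 0, rfl⟩
      · exact .inl ⟨e, E + F', by simp⟩
      · refine .inr ⟨x, v, y, E + F', hs, ht, by simp, ?_⟩
        simp only [touches_add, hv, or_false]
        exact fun h' => (h v h' (by simp)).elim hs ht
    · exact .inl ⟨e, E' + F, by simp⟩
    · refine .inr ⟨x, v, y, E' + F, hs, ht, by simp, ?_⟩
      simp only [touches_add, hv, false_or]
      exact fun h' => (h v (by simp) h').elim hs ht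

end reductions

/-! ### From compositions of lists to binary compositions. -/

theorem touches_sum {α : Type} (Xs : List (TTGraph α)) (v : α) :
    Touches (Xs.map fun X => X.edges).sum v ↔ ∃ X ∈ Xs, Touches X.edges v := by
  induction Xs with
  | nil => simp
  | cons X Xs ih => simp [ih]

/-- The edges of a graph of the class, with the terminals of the graph, and every node is an end of an
edge. -/
def SPGraph {α : Type} (X : TTGraph α) : Prop :=
  SP X.edges X.src X.snk ∧ ∀ v ∈ X.verts, Touches X.edges v

/-- A chain is the binary series composition of its first member with the rest, which has only the
sink of this member in common with it. -/
theorem sp_of_linked {α : Type} (Xs : List (TTGraph α)) (X : TTGraph α) (h : Linked (X :: Xs))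
    (hX : ∀ Z ∈ X :: Xs, SPGraph Z) (Z : TTGraph α) (hZ : (X :: Xs).getLast? = some Z) :
    SP ((X :: Xs).map fun X => X.edges).sum X.src Z.snk := by
  induction Xs generalizing X with
  | nil =>
    obtain rfl : X = Z := by simpa using hZ
    simpa using (hX X (by simp)).1
  | cons Y Xs ih =>
    obtain ⟨h1, h2, h3, h4⟩ := h
    rw [List.map_cons, List.sum_cons]
    refine .ser _ _ _ X.snk _ (hX X (by simp)).1 ?_ fun v hv hv' => ?_
    · rw [h1]
      exact ih Y h4 (fun Z hZ => hX Z (by simp at hZ ⊢; tauto)) (by simpa using hZ)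
    · obtain ⟨e, he, hve⟩ := hv
      have hv := X.incidence e he v hve
      obtain ⟨W, hW, e', he', hve'⟩ := (touches_sum _ v).1 hv'
      have hw := W.incidence e' he' v hve'
      rcases List.mem_cons.1 hW with rfl | hW
      · exact h2 v hv hw
      · exact absurd hw (h3 W hW v hv)

theorem spGraph_of_isTTSP {α : Type} {X : TTGraph α} (h : IsTTSP X) : SPGraph X := by
  induction h with
  | edge G h =>
    refine ⟨by rw [h.edges]; exact .edge _ _ G.src_ne_snk, fun v hv => ?_⟩
    rw [h.edges]
    simpa using (h.verts v).1 hv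
  | series Xs G hXs h ih =>
    refine ⟨?_, fun v hv => ?_⟩
    · have hl := linked_of_index _ h.merge h.inter
      rcases Xs with - | ⟨X, Xs⟩
      · simpa using h.two_le
      · rw [h.edges]
        obtain ⟨Z, hZ⟩ : ∃ Z, (X :: Xs).getLast? = some Z :=
          ⟨_, List.getLast?_eq_some_getLast (by simp)⟩
        have h1 := h.src
        have h2 := h.snk
        rw [hZ] at h2
        simp only [List.head?_cons, Option.map_some, Option.some.injEq] at h1 h2
        rw [← h1, ← h2]
        exact sp_of_linked Xs X hl ih Z hZ
    · obtain ⟨X, hX, hv⟩ := (h.verts v).1 hv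
      rw [h.edges, touches_sum]
      exact ⟨X, hX, (ih X hX).2 v hv⟩
  | parallel Xs G hXs h ih =>
    refine ⟨?_, fun v hv => ?_⟩
    · rw [h.edges]
      have key : ∀ Ys : List (TTGraph α), Ys ≠ [] → (∀ X ∈ Ys, SP X.edges G.src G.snk) →
          (Ys.Pairwise fun X Y => ∀ x, x ∈ X.verts → x ∈ Y.verts → x = G.src ∨ x = G.snk) →
          SP (Ys.map fun X => X.edges).sum G.src G.snk := by
        intro Ys hne hs hp
        induction Ys with
        | nil => exact absurd rfl hne
        | cons Y Ys ihY =>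
          rcases Ys with - | ⟨Z, Ys⟩
          · simpa using hs Y (by simp)
          · rw [List.map_cons, List.sum_cons]
            rw [List.pairwise_cons] at hp
            refine .par _ _ _ _ (hs Y (by simp)) (ihY (by simp)
              (fun X hX => hs X (List.mem_cons_of_mem _ hX)) hp.2) fun v hv hv' => ?_
            obtain ⟨e, he, hve⟩ := hv
            obtain ⟨W, hW, e', he', hve'⟩ := (touches_sum _ v).1 hv'
            exact hp.1 W hW v (Y.incidence e he v hve) (W.incidence e' he' v hve')
      refine key Xs ?_ (fun X hX => ?_) h.inter
      · rintro rfl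
        simpa using h.two_le
      · rw [← (h.terminals X hX).1, ← (h.terminals X hX).2]
        exact (ih X hX).1
    · obtain ⟨X, hX, hv⟩ := (h.verts v).1 hv
      rw [h.edges, touches_sum]
      exact ⟨X, hX, (ih X hX).2 v hv⟩

/-! ### Binary decomposition trees -/

/-- Binary decomposition trees. -/
inductive BT
  | edge (u v : ℕ)
  | ser (a b : BT)
  | par (a b : BT)

namespace BT

def src : BT → ℕ
  | edge u _ => u
  | ser a _ => a.src
  | par a _ => a.src

def snk : BT → ℕ
  | edge _ v => v
  | ser _ b => b.snk
  | par a _ => a.snk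

/-- The nodes other than the terminals. -/
def int : BT → List ℕ
  | edge _ _ => []
  | ser a b => a.int ++ a.snk :: b.int
  | par a b => a.int ++ b.int

def edges : BT → Multiset (Sym2 ℕ)
  | edge u v => {s(u, v)}
  | ser a b => a.edges + b.edges
  | par a b => a.edges + b.edges

/-- The terminals of the parts fit together. -/
def Typed : BT → Prop
  | edge _ _ => True
  | ser a b => a.Typed ∧ b.Typed ∧ a.snk = b.src
  | par a b => a.Typed ∧ b.Typed ∧ a.src = b.src ∧ a.snk = b.snk

/-- The tree with source and sink exchanged. -/
def rev : BT → BT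
  | edge u v => edge v u
  | ser a b => ser b.rev a.rev
  | par a b => par a.rev b.rev

/-- All nodes. -/
def nodes (B : BT) : List ℕ := B.src :: B.snk :: B.int

/-- Distinctness of the listed nodes contains all disjointness conditions at once: within `nodes`,
the inner nodes of the parts, the joints and the terminals appear as separate entries. -/
structure WF (B : BT) : Prop where
  typed : B.Typed
  nodup : B.nodes.Nodup

theorem WF.ser_left {a b : BT} (h : (ser a b).WF) : a.WF := by
  refine ⟨h.typed.1, ?_⟩
  have := h.nodup
  simp only [nodes, src, snk, int, List.nodup_cons, List.mem_cons, List.mem_append, not_or,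
    List.nodup_append] at this ⊢
  grind

theorem WF.ser_right {a b : BT} (h : (ser a b).WF) : b.WF := by
  refine ⟨h.typed.2.1, ?_⟩
  have := h.nodup
  have := h.typed.2.2
  simp only [nodes, src, snk, int, List.nodup_cons, List.mem_cons, List.mem_append, not_or,
    List.nodup_append] at *
  grind

theorem WF.ser_inter {a b : BT} (h : (ser a b).WF) (v : ℕ) (ha : v ∈ a.nodes) (hb : v ∈ b.nodes) :
    v = a.snk := by
  have := h.nodup
  have := h.typed.2.2
  simp only [nodes, src, snk, int, List.nodup_cons, List.mem_cons, List.mem_append, not_or,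
    List.nodup_append] at *
  grind

theorem WF.par_left {a b : BT} (h : (par a b).WF) : a.WF := by
  refine ⟨h.typed.1, ?_⟩
  have := h.nodup
  simp only [nodes, src, snk, int, List.nodup_cons, List.mem_cons, List.mem_append, not_or,
    List.nodup_append] at this ⊢
  grind

theorem WF.par_right {a b : BT} (h : (par a b).WF) : b.WF := by
  refine ⟨h.typed.2.1, ?_⟩
  have := h.nodup
  have := h.typed.2.2
  simp only [nodes, src, snk, int, List.nodup_cons, List.mem_cons, List.mem_append, not_or,
    List.nodup_append] at *
  grind

theorem WF.par_inter {a b : BT} (h : (par a b).WF) (v : ℕ) (ha : v ∈ a.nodes) (hb : v ∈ b.nodes) :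
    v = a.src ∨ v = a.snk := by
  have := h.nodup
  have := h.typed.2.2
  simp only [nodes, src, snk, int, List.nodup_cons, List.mem_cons, List.mem_append, not_or,
    List.nodup_append] at *
  grind

theorem Typed.incidence {B : BT} (h : B.Typed) : ∀ e ∈ B.edges, ∀ v ∈ e, v ∈ B.nodes := by
  induction B with
  | edge u v => simp [edges, nodes, src, snk]
  | ser a b iha ihb =>
    intro e he v hv
    have h3 := h.2.2
    rcases Multiset.mem_add.1 he with he | he
    · have := iha h.1 e he v hv
      simp [nodes, src, snk, int] at *
      tauto
    · have := ihb h.2.1 e he v hv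
      simp [nodes, src, snk, int] at *
      grind
  | par a b iha ihb =>
    intro e he v hv
    have h3 := h.2.2
    rcases Multiset.mem_add.1 he with he | he
    · have := iha h.1 e he v hv
      simp [nodes, src, snk, int] at *
      tauto
    · have := ihb h.2.1 e he v hv
      simp [nodes, src, snk, int] at *
      grind

/-- The two-terminal graph of a tree. -/
def graph (B : BT) (h : B.WF) : TTGraph ℕ where
  verts := B.nodes.toFinset
  edges := B.edges
  incidence e he v hv := List.mem_toFinset.2 (h.typed.incidence e he v hv)
  src := B.src
  snk := B.snk
  src_mem := by simp [nodes]
  snk_mem := by simp [nodes]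
  src_ne_snk := by
    have := h.nodup
    simp [nodes] at this
    tauto

theorem mem_graph_verts {B : BT} (h : B.WF) (v : ℕ) : v ∈ (B.graph h).verts ↔ v ∈ B.nodes :=
  List.mem_toFinset

/-! #### Reversal -/

@[simp] theorem src_rev (B : BT) : B.rev.src = B.snk ∧ B.rev.snk = B.src := by
  induction B with
  | edge u v => exact ⟨rfl, rfl⟩
  | ser a b iha ihb => exact ⟨ihb.1, iha.2⟩
  | par a b iha ihb => exact ⟨iha.1, iha.2⟩

@[simp] theorem rev_rev (B : BT) : B.rev.rev = B := by
  induction B with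
  | edge u v => rfl
  | ser a b iha ihb => simp [rev, iha, ihb]
  | par a b iha ihb => simp [rev, iha, ihb]

@[simp] theorem edges_rev (B : BT) : B.rev.edges = B.edges := by
  induction B with
  | edge u v => simp [rev, edges, Sym2.eq_swap]
  | ser a b iha ihb => simp [rev, edges, iha, ihb, add_comm]
  | par a b iha ihb => simp [rev, edges, iha, ihb]

theorem Typed.rev {B : BT} (h : B.Typed) : B.rev.Typed := by
  induction B with
  | edge u v => trivial
  | ser a b iha ihb => exact ⟨ihb h.2.1, iha h.1, by simp [h.2.2]⟩
  | par a b iha ihb => exact ⟨iha h.1, ihb h.2.1, by simp [h.2.2]⟩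

theorem Typed.int_rev {B : BT} (h : B.Typed) : B.rev.int.Perm B.int := by
  induction B with
  | edge u v => exact .refl _
  | ser a b iha ihb =>
    simp only [BT.rev, int, src_rev, ← h.2.2]
    refine List.perm_append_comm.trans ?_
    simp only [List.cons_append]
    refine List.Perm.trans ?_ List.perm_middle.symm
    exact ((iha h.1).append (ihb h.2.1)).cons _
  | par a b iha ihb => exact (iha h.1).append (ihb h.2.1)

/-! #### The kind of a tree and its output -/

/-- `0` for a path, otherwise `1` for a series and `2` for a parallel composition. -/
def kind : BT → ℕ
  | edge _ _ => 0
  | ser a b => if a.kind + b.kind = 0 then 0 else 1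
  | par _ _ => 2

/-- The number of edges of a path, otherwise the number of children of the node of an `SP`-tree. -/
def size : BT → ℕ
  | edge _ _ => 1
  | ser a b =>
    (if a.kind = (ser a b).kind then a.size else 1) + if b.kind = (ser a b).kind then b.size else 1
  | par a b => (if a.kind = 2 then a.size else 1) + if b.kind = 2 then b.size else 1

/-- The encoding of a tree, given the output of its parts. -/
def close (B : BT) (l : List ℕ) : List ℕ :=
  if B.kind = 0 then 0 :: (B.size + 1) :: (l ++ [B.snk]) else l ++ [B.kind, B.size]

/-- The output for a part of a tree of kind `k`. -/
def embed (B : BT) (k : ℕ) (l : List ℕ) : List ℕ := if B.kind = k then l else B.close l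

/-- The output for a tree that is part of a tree of the same kind. -/
def body : BT → List ℕ
  | edge u _ => [u]
  | ser a b => a.embed (ser a b).kind a.body ++ b.embed (ser a b).kind b.body
  | par a b => a.embed 2 a.body ++ b.embed 2 b.body

/-- The nodes of a path, without the sink. -/
def path : BT → List ℕ
  | edge u _ => [u]
  | ser a b => a.path ++ b.path
  | par _ _ => []

/-- The `SP`-tree, given the children of the root. -/
def wrap (B : BT) (ks : List (SPTree ℕ)) : SPTree ℕ :=
  if B.kind = 0 then .leaf (B.path ++ [B.snk])
  else if B.kind = 1 then .series ks else .parallel ks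

/-- The subtrees that a part of a tree of kind `k` contributes. -/
def part (B : BT) (k : ℕ) (ks : List (SPTree ℕ)) : List (SPTree ℕ) :=
  if B.kind = k then ks else [B.wrap ks]

/-- The children of the root of the `SP`-tree. -/
def kids : BT → List (SPTree ℕ)
  | edge _ _ => []
  | ser a b => a.part 1 a.kids ++ b.part 1 b.kids
  | par a b => a.part 2 a.kids ++ b.part 2 b.kids

/-- The `SP`-tree. -/
def toSP (B : BT) : SPTree ℕ := B.wrap B.kids

theorem kind_rev (B : BT) : B.rev.kind = B.kind := by
  induction B with
  | edge u v => rfl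
  | ser a b iha ihb => simp [rev, kind, iha, ihb, and_comm]
  | par a b iha ihb => rfl

theorem size_rev (B : BT) : B.rev.size = B.size := by
  induction B with
  | edge u v => rfl
  | ser a b iha ihb =>
    have := kind_rev (ser a b)
    rw [rev] at this
    rw [rev, size, this, kind_rev, kind_rev, iha, ihb, size, add_comm]
  | par a b iha ihb => simp [rev, size, iha, ihb, kind_rev]

theorem kind_le (B : BT) : B.kind ≤ 2 := by
  cases B with
  | edge u v => simp [kind]
  | ser a b => rw [kind]; split <;> omega
  | par a b => simp [kind]

theorem kind_ser {a b : BT} (h : (ser a b).kind = 0) : a.kind = 0 ∧ b.kind = 0 := by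
  simpa [kind] using h

theorem kind_ser_le (a b : BT) : (ser a b).kind ≤ 1 := by
  rw [kind]; split <;> omega

theorem body_of_path {B : BT} (h : B.kind = 0) : B.body = B.path ∧ B.size = B.path.length := by
  induction B with
  | edge u v => exact ⟨rfl, rfl⟩
  | ser a b iha ihb =>
    obtain ⟨ha, hb⟩ := kind_ser h
    obtain ⟨h1, h2⟩ := iha ha
    obtain ⟨h3, h4⟩ := ihb hb
    simp [body, path, size, embed, h, ha, hb, h1, h2, h3, h4]
  | par a b iha ihb => simp [kind] at h

/-- `body` and `close` describe the tokens that the machine writes while it walks through the binary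
tree; `kids` and `wrap` describe the SP-tree. Both merge nested compositions of equal kind in the
same way. -/
theorem encode_toSP (B : BT) : (B.kind ≠ 0 → B.body = (B.kids.map encode).flatten ∧
    B.size = B.kids.length) ∧ B.toSP.encode = B.close B.body := by
  have wrap_encode : ∀ B : BT, (B.kind ≠ 0 → B.body = (B.kids.map encode).flatten ∧
      B.size = B.kids.length) → (B.wrap B.kids).encode = B.close B.body := by
    intro B h
    have := B.kind_le
    unfold wrap close
    split_ifs with h0 h1
    · obtain ⟨h2, h3⟩ := body_of_path h0
      simp [encode, h2, h3]
    · obtain ⟨h2, h3⟩ := h h0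
      rw [encode_series, h2, h3, h1]
    · obtain ⟨h2, h3⟩ := h h0
      rw [encode_parallel, h2, h3, show B.kind = 2 by omega]
  have embed_eq : ∀ (B : BT) (k : ℕ), k ≠ 0 → ((B.kind ≠ 0 → B.body = (B.kids.map encode).flatten ∧
      B.size = B.kids.length) ∧ (B.wrap B.kids).encode = B.close B.body) →
      B.embed k B.body = ((B.part k B.kids).map encode).flatten ∧
      (if B.kind = k then B.size else 1) = (B.part k B.kids).length := by
    intro B k hk h
    unfold embed part
    split_ifs with h1
    · exact h.1 (h1 ▸ hk)
    · simp [h.2]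
  rw [toSP]
  suffices hs : B.kind ≠ 0 → B.body = (B.kids.map encode).flatten ∧ B.size = B.kids.length from
    ⟨hs, wrap_encode B hs⟩
  induction B with
  | edge u v => intro h; exact absurd rfl h
  | ser a b iha ihb =>
    intro h
    have hk : (ser a b).kind = 1 := by have := kind_ser_le a b; omega
    obtain ⟨h1, h2⟩ := embed_eq a 1 (by omega) ⟨iha, wrap_encode a iha⟩
    obtain ⟨h3, h4⟩ := embed_eq b 1 (by omega) ⟨ihb, wrap_encode b ihb⟩
    simp [body, size, kids, hk, h1, h2, h3, h4]
  | par a b iha ihb =>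
    intro h
    obtain ⟨h1, h2⟩ := embed_eq a 2 (by omega) ⟨iha, wrap_encode a iha⟩
    obtain ⟨h3, h4⟩ := embed_eq b 2 (by omega) ⟨ihb, wrap_encode b ihb⟩
    simp [body, size, kids, h1, h2, h3, h4]

/-- A part of the same kind is dissolved into its children, so no child has the kind of its parent.
A series composition has kind `1` only if some part is not a path, and this part supplies the
required `P`-node. Consecutive leaves may remain; minimality permits them. -/
theorem minimal_toSP (B : BT) : B.toSP.Minimal := by
  have wrap_minimal : ∀ B : BT,
      ((B.kind = 1 → (∀ t ∈ B.kids, t.Minimal ∧ (t.IsP ∨ t.IsL)) ∧ ∃ t ∈ B.kids, t.IsP) ∧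
      (B.kind = 2 → ∀ t ∈ B.kids, t.Minimal ∧ (t.IsS ∨ t.IsL))) → (B.wrap B.kids).Minimal := by
    intro B h
    have := B.kind_le
    unfold wrap
    split_ifs with h0 h1
    · exact .leaf _
    · obtain ⟨h2, h3⟩ := h.1 h1
      exact .series _ (fun t ht => (h2 t ht).1) (fun t ht => (h2 t ht).2) h3
    · have h2 := h.2 (by omega)
      exact .parallel _ (fun t ht => (h2 t ht).1) (fun t ht => (h2 t ht).2)
  rw [toSP]
  refine wrap_minimal B ?_
  induction B with
  | edge u v => simp [kind]
  | ser a b iha ihb =>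
    refine ⟨fun h => ?_, fun h => absurd (kind_ser_le a b) (by omega)⟩
    have aux : ∀ c : BT, (((c.kind = 1 → (∀ t ∈ c.kids, t.Minimal ∧ (t.IsP ∨ t.IsL)) ∧
        ∃ t ∈ c.kids, t.IsP) ∧
        (c.kind = 2 → ∀ t ∈ c.kids, t.Minimal ∧ (t.IsS ∨ t.IsL)))) →
        (∀ t ∈ c.part 1 c.kids, t.Minimal ∧ (t.IsP ∨ t.IsL)) ∧
        (c.kind ≠ 0 → ∃ t ∈ c.part 1 c.kids, t.IsP) := by
      intro c hc
      have := c.kind_le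
      unfold part
      split_ifs with h1
      · exact ⟨(hc.1 h1).1, fun _ => (hc.1 h1).2⟩
      · have hm := wrap_minimal c hc
        by_cases h0 : c.kind = 0
        · simp only [wrap, if_pos h0] at hm ⊢
          simp [hm, h0, IsL]
        · simp only [wrap, if_neg h0, if_neg h1] at hm ⊢
          simp [hm, IsP]
    obtain ⟨h1, h2⟩ := aux a iha
    obtain ⟨h3, h4⟩ := aux b ihb
    have h0 : a.kind ≠ 0 ∨ b.kind ≠ 0 := by
      by_contra! h'
      simp [kind, h'] at h
    simp only [kids, List.mem_append]
    refine ⟨fun t ht => ht.elim (h1 t) (h3 t), ?_⟩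
    rcases h0 with h0 | h0
    · obtain ⟨t, ht, hp⟩ := h2 h0
      exact ⟨t, .inl ht, hp⟩
    · obtain ⟨t, ht, hp⟩ := h4 h0
      exact ⟨t, .inr ht, hp⟩
  | par a b iha ihb =>
    refine ⟨fun h => by simp [kind] at h, fun _ => ?_⟩
    have aux : ∀ c : BT, (((c.kind = 1 → (∀ t ∈ c.kids, t.Minimal ∧ (t.IsP ∨ t.IsL)) ∧
        ∃ t ∈ c.kids, t.IsP) ∧
        (c.kind = 2 → ∀ t ∈ c.kids, t.Minimal ∧ (t.IsS ∨ t.IsL)))) →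
        ∀ t ∈ c.part 2 c.kids, t.Minimal ∧ (t.IsS ∨ t.IsL) := by
      intro c hc
      have := c.kind_le
      unfold part
      split_ifs with h1
      · exact hc.2 h1
      · have hm := wrap_minimal c hc
        by_cases h0 : c.kind = 0
        · simp only [wrap, if_pos h0] at hm ⊢
          simp [hm, IsL]
        · simp only [wrap, show c.kind = 1 by omega, one_ne_zero, if_false, if_true] at hm ⊢
          simp [hm, IsS]
    simp only [kids, List.mem_append]
    exact fun t ht => ht.elim (aux a iha t) (aux b ihb t)

end BT

/-! ### Associativity of series and parallel composition. -/

section compositions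
variable {α : Type}

/-- `X` is composed in series of the members of the list, or is its only member. -/
structure IsChain (Xs : List (TTGraph α)) (X : TTGraph α) : Prop where
  linked : Linked Xs
  src : Xs.head?.map TTGraph.src = some X.src
  snk : Xs.getLast?.map TTGraph.snk = some X.snk
  verts : ∀ x, x ∈ X.verts ↔ ∃ Y ∈ Xs, x ∈ Y.verts
  edges : X.edges = (Xs.map fun Y => Y.edges).sum

theorem isChain_singleton (X : TTGraph α) : IsChain [X] X :=
  ⟨trivial, rfl, rfl, by simp, by simp⟩

/-- A list with one member is allowed, so that parts which are kept whole and parts which are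
dissolved can be treated alike. -/
theorem IsChain.append {Xs Ys : List (TTGraph α)} {X Y Z : TTGraph α} (hX : IsChain Xs X)
    (hY : IsChain Ys Y) (hXY : X.snk = Y.src) (hi : ∀ v ∈ X.verts, v ∈ Y.verts → v = X.snk)
    (hs : Z.src = X.src) (ht : Z.snk = Y.snk) (hv : ∀ v, v ∈ Z.verts ↔ v ∈ X.verts ∨ v ∈ Y.verts)
    (he : Z.edges = X.edges + Y.edges) : IsChain (Xs ++ Ys) Z := by
  have hs1 := hX.src
  have hs2 := hY.src
  have ht1 := hX.snk
  have ht2 := hY.snk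
  have hX0 : Xs ≠ [] := by rintro rfl; simp at hs1
  have hY0 : Ys ≠ [] := by rintro rfl; simp at hs2
  have lX : 0 < Xs.length := List.length_pos_iff.2 hX0
  have lY : 0 < Ys.length := List.length_pos_iff.2 hY0
  have e1 : Xs[Xs.length - 1].snk = X.snk := by
    rw [List.getLast?_eq_getElem?, List.getElem?_eq_getElem (by omega)] at ht1
    simpa using ht1
  have e2 : Ys[0].src = Y.src := by
    rw [List.head?_eq_getElem?, List.getElem?_eq_getElem lY] at hs2
    simpa using hs2
  obtain ⟨mX, iX⟩ := hX.linked.index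
  obtain ⟨mY, iY⟩ := hY.linked.index
  refine ⟨linked_of_index _ (fun i h => ?_) (fun i j hij hj x hx hx' => ?_), ?_, ?_, ?_, ?_⟩
  · simp only [List.length_append] at h
    rcases lt_trichotomy (i + 1) Xs.length with h1 | h1 | h1
    · rw [List.getElem_append_left (by omega), List.getElem_append_left (by omega)]
      exact mX i h1
    · rw [List.getElem_append_left (by omega), List.getElem_append_right (by omega)]
      simp only [h1, Nat.sub_self, e2, ← hXY, ← e1]
      congr 2; omega
    · rw [List.getElem_append_right (by omega), List.getElem_append_right (by omega)]
      have := mY (i - Xs.length) (by omega)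
      rw [this]
      congr 2; omega
  · simp only [List.length_append] at hj
    by_cases h1 : j < Xs.length
    · rw [List.getElem_append_left (by omega)] at hx ⊢
      rw [List.getElem_append_left (by omega)] at hx'
      exact iX i j hij h1 x hx hx'
    by_cases h2 : Xs.length ≤ i
    · rw [List.getElem_append_right (by omega)] at hx ⊢
      rw [List.getElem_append_right (by omega)] at hx'
      have := iY (i - Xs.length) (j - Xs.length) (by omega) (by omega) x hx hx'
      exact ⟨by omega, this.2⟩
    rw [List.getElem_append_left (by omega)] at hx ⊢
    rw [List.getElem_append_right (by omega)] at hx'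
    obtain rfl := hi x ((hX.verts x).2 ⟨_, List.getElem_mem _, hx⟩)
      ((hY.verts x).2 ⟨_, List.getElem_mem _, hx'⟩)
    -- The common node is the joint. In an earlier member of the first chain, it would be the sink
    -- of that member, hence both source and sink of the last one.
    have hil : i = Xs.length - 1 := by
      by_contra hne
      obtain ⟨h3, h4⟩ := iX i (Xs.length - 1) (by omega) (by omega) X.snk hx
        (e1 ▸ (Xs[Xs.length - 1]).snk_mem)
      have h5 := mX i (by omega)
      rw [← h4, ← e1] at h5
      simp only [← h3] at h5
      exact (Xs[Xs.length - 1]).src_ne_snk h5.symm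
    have hjl : j = Xs.length := by
      by_contra hne
      obtain ⟨h3, h4⟩ := iY 0 (j - Xs.length) (by omega) (by omega) X.snk
        (by rw [hXY, ← e2]; exact (Ys[0]).src_mem) hx'
      rw [hXY, ← e2] at h4
      exact (Ys[0]).src_ne_snk h4
    subst hil
    exact ⟨by omega, e1.symm⟩
  · rw [List.head?_append_of_ne_nil _ hX0, hs, hs1]
  · rw [List.getLast?_append_of_ne_nil _ hY0, ht, ht2]
  · intro x
    rw [hv, hX.verts, hY.verts]
    simp only [List.mem_append, or_and_right, exists_or]
  · rw [he, hX.edges, hY.edges, List.map_append, List.sum_append]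

theorem IsChain.isSeriesComp {Xs : List (TTGraph α)} {X : TTGraph α} (h : IsChain Xs X)
    (h2 : 2 ≤ Xs.length) : IsSeriesComp Xs X :=
  ⟨h2, h.linked.index.1, h.linked.index.2, h.src, h.snk, h.verts, h.edges⟩

/-- `X` is composed in parallel of the members of the list, or is its only member. -/
structure IsBundle (Xs : List (TTGraph α)) (X : TTGraph α) : Prop where
  terminals : ∀ Y ∈ Xs, Y.src = X.src ∧ Y.snk = X.snk
  inter : Xs.Pairwise fun Y Z => ∀ x, x ∈ Y.verts → x ∈ Z.verts → x = X.src ∨ x = X.snk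
  verts : ∀ x, x ∈ X.verts ↔ ∃ Y ∈ Xs, x ∈ Y.verts
  edges : X.edges = (Xs.map fun Y => Y.edges).sum

theorem isBundle_singleton (X : TTGraph α) : IsBundle [X] X :=
  ⟨by simp, by simp, by simp, by simp⟩

theorem IsBundle.append {Xs Ys : List (TTGraph α)} {X Y Z : TTGraph α} (hX : IsBundle Xs X)
    (hY : IsBundle Ys Y) (hs : X.src = Z.src ∧ Y.src = Z.src) (ht : X.snk = Z.snk ∧ Y.snk = Z.snk)
    (hi : ∀ v ∈ X.verts, v ∈ Y.verts → v = Z.src ∨ v = Z.snk)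
    (hv : ∀ v, v ∈ Z.verts ↔ v ∈ X.verts ∨ v ∈ Y.verts)
    (he : Z.edges = X.edges + Y.edges) : IsBundle (Xs ++ Ys) Z := by
  refine ⟨fun W hW => ?_, List.pairwise_append.2 ⟨?_, ?_, fun A hA B hB x hx hx' => ?_⟩, fun x => ?_,
    ?_⟩
  · rcases List.mem_append.1 hW with hW | hW
    · rw [← hs.1, ← ht.1]; exact hX.terminals W hW
    · rw [← hs.2, ← ht.2]; exact hY.terminals W hW
  · rw [← hs.1, ← ht.1]; exact hX.inter
  · rw [← hs.2, ← ht.2]; exact hY.inter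
  · exact hi x ((hX.verts x).2 ⟨A, hA, hx⟩) ((hY.verts x).2 ⟨B, hB, hx'⟩)
  · rw [hv, hX.verts, hY.verts]
    simp only [List.mem_append, or_and_right, exists_or]
  · rw [he, hX.edges, hY.edges, List.map_append, List.sum_append]

theorem IsBundle.isParallelComp {Xs : List (TTGraph α)} {X : TTGraph α} (h : IsBundle Xs X)
    (h2 : 2 ≤ Xs.length) : IsParallelComp Xs X :=
  ⟨h2, h.terminals, h.inter, h.verts, h.edges⟩

end compositions

/-! ### The SP-tree of a binary decomposition tree. -/

namespace BT

theorem graph_ser {a b : BT} (h : (ser a b).WF) (v : ℕ) : v ∈ ((ser a b).graph h).verts ↔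
    v ∈ (a.graph h.ser_left).verts ∨ v ∈ (b.graph h.ser_right).verts := by
  have := h.typed.2.2
  simp only [mem_graph_verts, nodes, src, snk, int, List.mem_cons, List.mem_append]
  grind

theorem graph_par {a b : BT} (h : (par a b).WF) (v : ℕ) : v ∈ ((par a b).graph h).verts ↔
    v ∈ (a.graph h.par_left).verts ∨ v ∈ (b.graph h.par_right).verts := by
  have := h.typed.2.2
  simp only [mem_graph_verts, nodes, src, snk, int, List.mem_cons, List.mem_append]
  grind

theorem path_facts {B : BT} (h : B.Typed) (hk : B.kind = 0) :
    B.path.head? = some B.src ∧ B.path.Perm (B.src :: B.int) ∧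
    B.edges = (List.zipWith (fun u v => s(u, v)) (B.path ++ [B.snk])
      (B.path ++ [B.snk]).tail : List (Sym2 ℕ)) := by
  -- The edges of a path that is cut at the node `x` are those of its two pieces, both of which
  -- contain `x`.
  have key : ∀ (l r : List ℕ) (x : ℕ), List.zipWith (fun u v => s(u, v)) (l ++ x :: r)
      (l ++ x :: r).tail = List.zipWith (fun u v => s(u, v)) (l ++ [x]) (l ++ [x]).tail ++
      List.zipWith (fun u v => s(u, v)) (x :: r) r := by
    intro l r x
    induction l with
    | nil => simp
    | cons y l ih =>
      cases l with
      | nil => simp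
      | cons z l => simpa using ih
  induction B with
  | edge u v => simp [path, src, int, edges, snk]
  | ser a b iha ihb =>
    obtain ⟨ha, hb⟩ := kind_ser hk
    obtain ⟨h1, h2, h3⟩ := iha h.1 ha
    obtain ⟨h4, h5, h6⟩ := ihb h.2.1 hb
    obtain ⟨p, hp⟩ : ∃ p, b.path = b.src :: p := by
      cases hb : b.path with
      | nil => simp [hb] at h4
      | cons x p => simp [hb] at h4; exact ⟨p, by rw [h4]⟩
    refine ⟨?_, ?_, ?_⟩
    · simp [path, src, List.head?_append, h1]
    · simp only [path, src, int]
      rw [h.2.2]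
      exact h2.append h5
    · simp only [path, snk, edges, h3, h6, hp, List.append_assoc, List.cons_append]
      rw [← h.2.2, key a.path (p ++ [b.snk]) a.snk]
      simp
  | par a b iha ihb => simp [kind] at hk

theorem isPathOf {B : BT} (h : B.WF) (hk : B.kind = 0) :
    IsPathOf (B.path ++ [B.snk]) (B.graph h) := by
  obtain ⟨h1, h2, h3⟩ := path_facts h.typed hk
  have hp : (B.path ++ [B.snk]).Perm B.nodes := by
    refine (h2.append_right [B.snk]).trans ?_
    rw [nodes]
    simp only [List.cons_append]
    refine (List.perm_append_comm.trans ?_).cons _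
    simp
  refine ⟨?_, hp.nodup_iff.2 h.nodup, ?_, ?_, fun x => ?_, h3⟩
  · rw [hp.length_eq]; simp [nodes]
  · rw [List.head?_append, h1]; rfl
  · simp [graph]
  · rw [mem_graph_verts, hp.mem_iff]

/-- The tree represents a series or parallel composition of the graphs of its children. -/
theorem exists_kids {B : BT} (h : B.WF) :
    (B.kind = 1 → ∃ Xs, List.Forall₂ Represents B.kids Xs ∧ 2 ≤ Xs.length ∧
      IsChain Xs (B.graph h)) ∧
    (B.kind = 2 → ∃ Xs, List.Forall₂ Represents B.kids Xs ∧ 2 ≤ Xs.length ∧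
      IsBundle Xs (B.graph h)) := by
  have wrap_represents : ∀ (B : BT) (h : B.WF),
      ((B.kind = 1 → ∃ Xs, List.Forall₂ Represents B.kids Xs ∧ 2 ≤ Xs.length ∧
        IsChain Xs (B.graph h)) ∧
      (B.kind = 2 → ∃ Xs, List.Forall₂ Represents B.kids Xs ∧ 2 ≤ Xs.length ∧
        IsBundle Xs (B.graph h))) → (B.wrap B.kids).Represents (B.graph h) := by
    intro B h hB
    have := B.kind_le
    unfold wrap
    split_ifs with h0 h1
    · exact .leaf _ _ (isPathOf h h0)
    · obtain ⟨Xs, h1, h2, h3⟩ := hB.1 h1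
      obtain ⟨h4, h5⟩ := List.forall₂_iff_zip.1 h1
      exact .series _ Xs _ h4 (fun q hq => h5 hq) (h3.isSeriesComp h2)
    · obtain ⟨Xs, h1, h2, h3⟩ := hB.2 (by omega)
      obtain ⟨h4, h5⟩ := List.forall₂_iff_zip.1 h1
      exact .parallel _ Xs _ h4 (fun q hq => h5 hq) (h3.isParallelComp h2)
  induction B with
  | edge u v => simp [kind]
  | ser a b iha ihb =>
    refine ⟨fun hk => ?_, fun hk => absurd (kind_ser_le a b) (by omega)⟩
    have aux : ∀ (c : BT) (hc : c.WF), (c.kind = 1 → ∃ Xs, List.Forall₂ Represents c.kids Xs ∧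
        2 ≤ Xs.length ∧ IsChain Xs (c.graph hc)) ∧ (c.kind = 2 → ∃ Xs,
        List.Forall₂ Represents c.kids Xs ∧ 2 ≤ Xs.length ∧ IsBundle Xs (c.graph hc)) →
        ∃ Xs, List.Forall₂ Represents (c.part 1 c.kids) Xs ∧ 1 ≤ Xs.length ∧
          IsChain Xs (c.graph hc) := by
      intro c hc ih
      unfold part
      split_ifs with h1
      · obtain ⟨Xs, h2, h3, h4⟩ := ih.1 h1
        exact ⟨Xs, h2, by omega, h4⟩
      · exact ⟨[c.graph hc], by simpa using wrap_represents c hc ih, le_rfl, isChain_singleton _⟩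
    obtain ⟨Xs, h1, h2, h3⟩ := aux a h.ser_left (iha _)
    obtain ⟨Ys, h4, h5, h6⟩ := aux b h.ser_right (ihb _)
    refine ⟨Xs ++ Ys, List.rel_append h1 h4, by simp; omega, h3.append h6 h.typed.2.2
      (fun v hv hv' => ?_) rfl rfl (graph_ser h) rfl⟩
    rw [mem_graph_verts] at hv hv'
    exact h.ser_inter v hv hv'
  | par a b iha ihb =>
    refine ⟨fun hk => by simp [kind] at hk, fun hk => ?_⟩
    have aux : ∀ (c : BT) (hc : c.WF), (c.kind = 1 → ∃ Xs, List.Forall₂ Represents c.kids Xs ∧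
        2 ≤ Xs.length ∧ IsChain Xs (c.graph hc)) ∧ (c.kind = 2 → ∃ Xs,
        List.Forall₂ Represents c.kids Xs ∧ 2 ≤ Xs.length ∧ IsBundle Xs (c.graph hc)) →
        ∃ Xs, List.Forall₂ Represents (c.part 2 c.kids) Xs ∧ 1 ≤ Xs.length ∧
          IsBundle Xs (c.graph hc) := by
      intro c hc ih
      unfold part
      split_ifs with h1
      · obtain ⟨Xs, h2, h3, h4⟩ := ih.2 h1
        exact ⟨Xs, h2, by omega, h4⟩
      · exact ⟨[c.graph hc], by simpa using wrap_represents c hc ih, le_rfl, isBundle_singleton _⟩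
    obtain ⟨Xs, h1, h2, h3⟩ := aux a h.par_left (iha _)
    obtain ⟨Ys, h4, h5, h6⟩ := aux b h.par_right (ihb _)
    refine ⟨Xs ++ Ys, List.rel_append h1 h4, by simp; omega, h3.append h6
      ⟨rfl, h.typed.2.2.1.symm⟩ ⟨rfl, h.typed.2.2.2.symm⟩ (fun v hv hv' => ?_) (graph_par h) rfl⟩
    rw [mem_graph_verts] at hv hv'
    exact h.par_inter v hv hv'

theorem represents_toSP {B : BT} (h : B.WF) : B.toSP.Represents (B.graph h) := by
  have hB := exists_kids h
  have := B.kind_le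
  unfold toSP wrap
  split_ifs with h0 h1
  · exact .leaf _ _ (isPathOf h h0)
  · obtain ⟨Xs, h1, h2, h3⟩ := hB.1 h1
    obtain ⟨h4, h5⟩ := List.forall₂_iff_zip.1 h1
    exact .series _ Xs _ h4 (fun q hq => h5 hq) (h3.isSeriesComp h2)
  · obtain ⟨Xs, h1, h2, h3⟩ := hB.2 (by omega)
    obtain ⟨h4, h5⟩ := List.forall₂_iff_zip.1 h1
    exact .parallel _ Xs _ h4 (fun q hq => h5 hq) (h3.isParallelComp h2)

end BT

/-! ### The multigraph in memory -/

/-- The sum of `g` over the other ends of the edges at the node `w`. -/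
def endSum (g : ℕ → ℕ) (e : ℕ → ℕ × ℕ) (live : Finset ℕ) (w : ℕ) : ℕ :=
  ∑ i ∈ live, if w = (e i).1 then g (e i).2 else if w = (e i).2 then g (e i).1 else 0

theorem endSum_insert (g : ℕ → ℕ) (e : ℕ → ℕ × ℕ) {live : Finset ℕ} {i x y : ℕ} (hi : i ∉ live)
    (he : e i = (x, y)) (hxy : x ≠ y) :
    endSum g e (insert i live) = Function.update (Function.update (endSum g e live) x
      (endSum g e live x + g y)) y (endSum g e live y + g x) := by
  ext w
  simp only [endSum, Finset.sum_insert hi, he, Function.update_apply]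
  split_ifs <;> subst_vars <;> simp_all [add_comm]

theorem endSum_erase (g : ℕ → ℕ) (e : ℕ → ℕ × ℕ) {live : Finset ℕ} {i x y : ℕ} (hi : i ∈ live)
    (he : e i = (x, y)) (hxy : x ≠ y) :
    endSum g e (live.erase i) = Function.update (Function.update (endSum g e live) x
      (endSum g e live x - g y)) y (endSum g e live y - g x) := by
  have h := endSum_insert g e (Finset.notMem_erase i live) he hxy
  rw [Finset.insert_erase hi] at h
  ext w
  simp only [h, Function.update_apply]
  split_ifs <;> subst_vars <;> simp_all

theorem endSum_le (g : ℕ → ℕ) (e : ℕ → ℕ × ℕ) (live : Finset ℕ) (w c : ℕ)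
    (h : ∀ i ∈ live, g (e i).1 ≤ c ∧ g (e i).2 ≤ c) : endSum g e live w ≤ live.card * c := by
  rw [← smul_eq_mul]
  refine Finset.sum_le_card_nsmul _ _ _ fun i hi => ?_
  have := h i hi
  split_ifs <;> omega

theorem index_inj {n u v u' v' : ℕ} (hv : v < n) (hv' : v' < n) (h : u * n + v = u' * n + v') :
    u = u' ∧ v = v' := by
  have h1 : (u * n + v) % n = v := by rw [Nat.mul_add_mod_self_right, Nat.mod_eq_of_lt hv]
  have h2 : (u' * n + v') % n = v' := by rw [Nat.mul_add_mod_self_right, Nat.mod_eq_of_lt hv']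
  have h3 : v = v' := by rw [← h1, ← h2, h]
  subst h3
  exact ⟨Nat.eq_of_mul_eq_mul_right (by omega) (Nat.add_right_cancel h), rfl⟩

/-- The arrays `12` to `15` describe the simple graph with node set `{0, …, n - 1}` and edges `live`,
where the edge `i` has the ends `e i`: adjacency matrix, degrees, and the sums of the neighbours and of
their squares. -/
structure Net (n : ℕ) (A : ℕ → ℕ → ℕ) (e : ℕ → ℕ × ℕ) (live : Finset ℕ) : Prop where
  pos : ∀ i ∈ live, i ≠ 0
  lt : ∀ i ∈ live, (e i).1 < n ∧ (e i).2 < n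
  ne : ∀ i ∈ live, (e i).1 ≠ (e i).2
  mat : ∀ i ∈ live, A 12 ((e i).1 * n + (e i).2) = i ∧ A 12 ((e i).2 * n + (e i).1) = i
  mat' : ∀ u < n, ∀ v < n, A 12 (u * n + v) ≠ 0 →
    A 12 (u * n + v) ∈ live ∧ s((e (A 12 (u * n + v))).1, (e (A 12 (u * n + v))).2) = s(u, v)
  deg : A 13 = endSum (fun _ => 1) e live
  sum : A 14 = endSum (fun x => x) e live
  sq : A 15 = endSum (fun x => x * x) e live

theorem Net.bound {n : ℕ} {A : ℕ → ℕ → ℕ} {e : ℕ → ℕ × ℕ} {live : Finset ℕ} (h : Net n A e live)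
    (w : ℕ) : A 13 w ≤ live.card ∧ A 14 w ≤ live.card * n ∧ A 15 w ≤ live.card * (n * n) := by
  rw [h.deg, h.sum, h.sq]
  refine ⟨(endSum_le _ e live w 1 (by simp)).trans (by simp), endSum_le _ e live w n fun i hi => ?_,
    endSum_le _ e live w _ fun i hi => ?_⟩
  · have := h.lt i hi; omega
  · have := h.lt i hi
    exact ⟨Nat.mul_le_mul this.1.le this.1.le, Nat.mul_le_mul this.2.le this.2.le⟩

/-- An entry `0` of the matrix means that there is no edge, which is why edges have positive
numbers. As the cell of the new edge is empty, no other edge is overwritten. -/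
theorem Net.insert {n : ℕ} {A B : ℕ → ℕ → ℕ} {e : ℕ → ℕ × ℕ} {live : Finset ℕ} (h : Net n A e live)
    {i x y : ℕ} (hi : i ∉ live) (h0 : i ≠ 0) (he : e i = (x, y)) (hx : x < n) (hy : y < n)
    (hxy : x ≠ y) (hA : A 12 (x * n + y) = 0)
    (h12 : B 12 = Function.update (Function.update (A 12) (x * n + y) i) (y * n + x) i)
    (h13 : B 13 = Function.update (Function.update (A 13) x (A 13 x + 1)) y (A 13 y + 1))
    (h14 : B 14 = Function.update (Function.update (A 14) x (A 14 x + y)) y (A 14 y + x))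
    (h15 : B 15 = Function.update (Function.update (A 15) x (A 15 x + y * y)) y
      (A 15 y + x * x)) : Net n B e (Insert.insert i live) := by
  refine ⟨?_, ?_, ?_, ?_, ?_, ?_, ?_, ?_⟩
  · intro j hj
    rcases Finset.mem_insert.1 hj with rfl | hj
    exacts [h0, h.pos j hj]
  · intro j hj
    rcases Finset.mem_insert.1 hj with rfl | hj
    exacts [by simp [he, hx, hy], h.lt j hj]
  · intro j hj
    rcases Finset.mem_insert.1 hj with rfl | hj
    exacts [by simp [he, hxy], h.ne j hj]
  · intro j hj
    rcases Finset.mem_insert.1 hj with rfl | hj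
    · simp [he, h12, Function.update_apply]
    · obtain ⟨h1, h2⟩ := h.lt j hj
      obtain ⟨h3, h4⟩ := h.mat j hj
      have hj0 := h.pos j hj
      have e1 : (e j).1 * n + (e j).2 ≠ x * n + y := fun h' => hj0 (by rw [← h3, h', hA])
      have e2 : (e j).2 * n + (e j).1 ≠ x * n + y := fun h' => hj0 (by rw [← h4, h', hA])
      have e3 : (e j).1 * n + (e j).2 ≠ y * n + x := fun h' => by
        obtain ⟨h5, h6⟩ := index_inj h2 hx h'
        exact e2 (by rw [h5, h6])
      have e4 : (e j).2 * n + (e j).1 ≠ y * n + x := fun h' => by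
        obtain ⟨h5, h6⟩ := index_inj h1 hx h'
        exact e1 (by rw [h5, h6])
      simp [h12, Function.update_apply, e1, e2, e3, e4, h3, h4]
  · intro u hu v hv hB
    by_cases e1 : u * n + v = y * n + x
    · obtain ⟨rfl, rfl⟩ := index_inj hv hx e1
      simp [h12, he, Sym2.eq_swap]
    by_cases e2 : u * n + v = x * n + y
    · obtain ⟨rfl, rfl⟩ := index_inj hv hy e2
      simp [h12, he, Function.update_apply]
    have : B 12 (u * n + v) = A 12 (u * n + v) := by simp [h12, Function.update_apply, e1, e2]
    rw [this] at hB ⊢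
    obtain ⟨h1, h2⟩ := h.mat' u hu v hv hB
    exact ⟨Finset.mem_insert_of_mem h1, h2⟩
  · rw [h13, endSum_insert _ e hi he hxy, h.deg]
  · rw [h14, endSum_insert _ e hi he hxy, h.sum]
  · rw [h15, endSum_insert _ e hi he hxy, h.sq]

theorem Net.erase {n : ℕ} {A B : ℕ → ℕ → ℕ} {e : ℕ → ℕ × ℕ} {live : Finset ℕ} (h : Net n A e live)
    {i x y : ℕ} (hi : i ∈ live) (he : e i = (x, y))
    (h12 : B 12 = Function.update (Function.update (A 12) (x * n + y) 0) (y * n + x) 0)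
    (h13 : B 13 = Function.update (Function.update (A 13) x (A 13 x - 1)) y (A 13 y - 1))
    (h14 : B 14 = Function.update (Function.update (A 14) x (A 14 x - y)) y (A 14 y - x))
    (h15 : B 15 = Function.update (Function.update (A 15) x (A 15 x - y * y)) y
      (A 15 y - x * x)) : Net n B e (live.erase i) := by
  have hxy : x ≠ y := by simpa [he] using h.ne i hi
  obtain ⟨hx, hy⟩ : x < n ∧ y < n := by simpa [he] using h.lt i hi
  have hm := h.mat i hi
  simp only [he] at hm
  refine ⟨fun j hj => h.pos j (Finset.mem_of_mem_erase hj),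
    fun j hj => h.lt j (Finset.mem_of_mem_erase hj),
    fun j hj => h.ne j (Finset.mem_of_mem_erase hj), ?_, ?_, ?_, ?_, ?_⟩
  · intro j hj
    obtain ⟨hji, hj⟩ := Finset.mem_erase.1 hj
    obtain ⟨h3, h4⟩ := h.mat j hj
    have e1 : (e j).1 * n + (e j).2 ≠ x * n + y := fun h' => hji (by rw [← h3, h', hm.1])
    have e2 : (e j).2 * n + (e j).1 ≠ x * n + y := fun h' => hji (by rw [← h4, h', hm.1])
    have e3 : (e j).1 * n + (e j).2 ≠ y * n + x := fun h' => hji (by rw [← h3, h', hm.2])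
    have e4 : (e j).2 * n + (e j).1 ≠ y * n + x := fun h' => hji (by rw [← h4, h', hm.2])
    simp [h12, Function.update_apply, e1, e2, e3, e4, h3, h4]
  · intro u hu v hv hB
    have e1 : u * n + v ≠ y * n + x := fun h' => hB (by simp [h12, h'])
    have e2 : u * n + v ≠ x * n + y := fun h' => hB (by simp [h12, h', Function.update_apply])
    have : B 12 (u * n + v) = A 12 (u * n + v) := by simp [h12, Function.update_apply, e1, e2]
    rw [this] at hB ⊢
    obtain ⟨h1, h2⟩ := h.mat' u hu v hv hB
    refine ⟨Finset.mem_erase.2 ⟨fun h' => ?_, h1⟩, h2⟩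
    rw [h', he] at h2
    rcases Sym2.eq_iff.1 h2 with ⟨h3, h4⟩ | ⟨h3, h4⟩
    · exact e2 (by rw [← h3, ← h4])
    · exact e1 (by rw [← h3, ← h4])
  · rw [h13, endSum_erase _ e hi he hxy, h.deg]
  · rw [h14, endSum_erase _ e hi he hxy, h.sum]
  · rw [h15, endSum_erase _ e hi he hxy, h.sq]

/-- The position of a pair of nodes in the adjacency matrix; register `1` holds the number of
nodes. -/
def cell (u v : ℕ) : Ex := .plus (.times (.var u) (.var 1)) (.var v)

/-- Only the record of `u` changes; an edge is inserted by the two symmetric halves. -/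
def addEnd (u v : ℕ) : Cmd :=
  .put 13 (.var u) (.plus (.get 13 (.var u)) (.lit 1)) ;;
  .put 14 (.var u) (.plus (.get 14 (.var u)) (.var v)) ;;
  .put 15 (.var u) (.plus (.get 15 (.var u)) (.times (.var v) (.var v)))

def removeEnd (u v : ℕ) : Cmd :=
  .put 13 (.var u) (.minus (.get 13 (.var u)) (.lit 1)) ;;
  .put 14 (.var u) (.minus (.get 14 (.var u)) (.var v)) ;;
  .put 15 (.var u) (.minus (.get 15 (.var u)) (.times (.var v) (.var v)))

/-- Insert the edge in register `i` between the nodes in the registers `u` and `v`. -/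
def link (u v i : ℕ) : Cmd :=
  .put 12 (cell u v) (.var i) ;; .put 12 (cell v u) (.var i) ;; addEnd u v ;; addEnd v u

/-- Remove the edge between the nodes in the registers `u` and `v`. -/
def unlink (u v : ℕ) : Cmd :=
  .put 12 (cell u v) (.lit 0) ;; .put 12 (cell v u) (.lit 0) ;; removeEnd u v ;; removeEnd v u

theorem link_spec {n : ℕ} {e : ℕ → ℕ × ℕ} {live : Finset ℕ} (u v i : ℕ) (s : St)
    (h : Net n s.arr e live) (hn : s.reg 1 = n) (hi : s.reg i ∉ live) (h0 : s.reg i ≠ 0)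
    (he : e (s.reg i) = (s.reg u, s.reg v)) (hu : s.reg u < n) (hv : s.reg v < n)
    (huv : s.reg u ≠ s.reg v) (hA : s.arr 12 (s.reg u * n + s.reg v) = 0)
    (hN : (live.card + 1) * (n * n) < N)
    (hQ : ∀ t : St, t.reg = s.reg → t.fuel = s.fuel →
      (∀ k, (k < 12 ∨ 15 < k) → t.arr k = s.arr k) →
      (∀ w, w ≠ s.reg u → w ≠ s.reg v → t.arr 13 w = s.arr 13 w) →
      Net n t.arr e (insert (s.reg i) live) → Q t) :
    wp N (link u v i) Q s := by
  have b1 := h.bound (s.reg u)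
  have b2 := h.bound (s.reg v)
  have c1 : s.reg u * n + s.reg v < n * n := by nlinarith
  have c2 : s.reg v * n + s.reg u < n * n := by nlinarith
  have c3 : s.reg u * s.reg u < n * n := by nlinarith
  have c4 : s.reg v * s.reg v < n * n := by nlinarith
  have c5 : n ≤ n * n := by nlinarith
  have c6 : live.card * n ≤ live.card * (n * n) := Nat.mul_le_mul_left _ c5
  have c7 : live.card ≤ live.card * (n * n) := Nat.le_mul_of_pos_right _ (by omega)
  rw [add_mul, one_mul] at hN
  simp only [link, addEnd, cell, wp_seq, wp_put]
  simp [hn, huv, huv.symm]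
  and_intros
  any_goals omega
  refine hQ _ (by simp) (by simp) (fun k hk => ?_) (fun w h1 h2 => by simp [h1, h2]) (h.insert hi h0 he hu hv huv hA ?_ ?_ ?_ ?_)
  · simp [show k ≠ 12 by omega, show k ≠ 13 by omega, show k ≠ 14 by omega, show k ≠ 15 by omega]
  all_goals simp [huv.symm]

theorem unlink_spec {n : ℕ} {e : ℕ → ℕ × ℕ} {live : Finset ℕ} {i : ℕ} (u v : ℕ) (s : St)
    (h : Net n s.arr e live) (hn : s.reg 1 = n) (hi : i ∈ live)
    (he : e i = (s.reg u, s.reg v) ∨ e i = (s.reg v, s.reg u)) (hN : n * n < N)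
    (hQ : ∀ t : St, t.reg = s.reg → t.fuel = s.fuel →
      (∀ k, (k < 12 ∨ 15 < k) → t.arr k = s.arr k) →
      (∀ w, w ≠ s.reg u → w ≠ s.reg v → t.arr 13 w = s.arr 13 w) →
      Net n t.arr e (live.erase i) → Q t) :
    wp N (unlink u v) Q s := by
  obtain ⟨hu, hv, huv⟩ : s.reg u < n ∧ s.reg v < n ∧ s.reg u ≠ s.reg v := by
    have h1 := h.lt i hi
    have h2 := h.ne i hi
    rcases he with he | he <;> rw [he] at h1 h2
    exacts [⟨h1.1, h1.2, h2⟩, ⟨h1.2, h1.1, h2.symm⟩]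
  have c1 : s.reg u * n + s.reg v < n * n := by nlinarith
  have c2 : s.reg v * n + s.reg u < n * n := by nlinarith
  have c3 : s.reg u * s.reg u < n * n := by nlinarith
  have c4 : s.reg v * s.reg v < n * n := by nlinarith
  simp only [unlink, removeEnd, cell, wp_seq, wp_put]
  simp [hn, huv, huv.symm]
  and_intros
  any_goals omega
  refine hQ _ (by simp) (by simp) (fun k hk => ?_) (fun w h1 h2 => by simp [h1, h2]) ?_
  · simp [show k ≠ 12 by omega, show k ≠ 13 by omega, show k ≠ 14 by omega, show k ≠ 15 by omega]
  rcases he with he | he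
  · refine h.erase hi he ?_ ?_ ?_ ?_
    all_goals simp [huv.symm]
  · refine h.erase hi he ?_ ?_ ?_ ?_
    · simp
      rw [Function.update_comm]
      exact fun h' => huv (index_inj hv hu h').1
    all_goals
      simp [huv.symm]
      rw [Function.update_comm huv]

/-! ### Decomposition trees in memory -/

namespace BT

/-- The trees are equal up to orientation. -/
def Same (S T : BT) : Prop := T = S ∨ T = S.rev

theorem Same.kind {S T : BT} (h : S.Same T) : T.kind = S.kind := by
  rcases h with rfl | rfl
  exacts [rfl, kind_rev S]

theorem Same.size {S T : BT} (h : S.Same T) : T.size = S.size := by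
  rcases h with rfl | rfl
  exacts [rfl, size_rev S]

theorem Same.edges {S T : BT} (h : S.Same T) : T.edges = S.edges := by
  rcases h with rfl | rfl
  exacts [rfl, edges_rev S]

theorem size_le (B : BT) : B.size ≤ B.edges.card ∧ 1 ≤ B.size := by
  induction B with
  | edge u v => simp [size, edges]
  | ser a b iha ihb => simp only [size, edges, Multiset.card_add]; split_ifs <;> omega
  | par a b iha ihb => simp only [size, edges, Multiset.card_add]; split_ifs <;> omega

end BT

/-- The entries of the node `i` in the tables. The tables are `18`: source, `19`: sink, `20`, `21`:
children, `22`: kind, `23`: size. -/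
structure Entry (A : ℕ → ℕ → ℕ) (i a b : ℕ) (T : BT) : Prop where
  src : A 18 i = T.src
  snk : A 19 i = T.snk
  left : A 20 i = a
  right : A 21 i = b
  kind : A 22 i = T.kind
  size : A 23 i = T.size

/-- The tables describe the tree with root `i`. -/
inductive BRep (A : ℕ → ℕ → ℕ) : ℕ → BT → Prop
  | edge (i b u v : ℕ) (h : Entry A i 0 b (.edge u v)) : BRep A i (.edge u v)
  | ser (i a b : ℕ) (Ta Tb Ta' Tb' : BT) (h : Entry A i a b (.ser Ta' Tb')) (ha : 0 < a ∧ a < i)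
      (hb : 0 < b ∧ b < i) (hTa : Ta.Same Ta') (hTb : Tb.Same Tb') (ra : BRep A a Ta)
      (rb : BRep A b Tb) : BRep A i (.ser Ta' Tb')
  | par (i a b : ℕ) (Ta Tb Ta' Tb' : BT) (h : Entry A i a b (.par Ta' Tb')) (ha : 0 < a ∧ a < i)
      (hb : 0 < b ∧ b < i) (hTa : Ta.Same Ta') (hTb : Tb.Same Tb') (ra : BRep A a Ta)
      (rb : BRep A b Tb) : BRep A i (.par Ta' Tb')

theorem BRep.entry {A : ℕ → ℕ → ℕ} {i : ℕ} {T : BT} (h : BRep A i T) :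
    A 18 i = T.src ∧ A 19 i = T.snk ∧ A 22 i = T.kind ∧ A 23 i = T.size := by
  cases h with
  | edge _ b u v h => exact ⟨h.src, h.snk, h.kind, h.size⟩
  | ser _ a b Ta Tb Ta' Tb' h => exact ⟨h.src, h.snk, h.kind, h.size⟩
  | par _ a b Ta Tb Ta' Tb' h => exact ⟨h.src, h.snk, h.kind, h.size⟩

/-- Children have smaller numbers than their parents, so the rows of nodes made later are irrelevant
for a tree. -/
theorem BRep.congr {A B : ℕ → ℕ → ℕ} {i : ℕ} {T : BT} (h : BRep A i T)
    (hB : ∀ k, 18 ≤ k → k ≤ 23 → ∀ j ≤ i, B k j = A k j) : BRep B i T := by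
  have entry : ∀ {i a b T}, Entry A i a b T → (∀ k, 18 ≤ k → k ≤ 23 → ∀ j ≤ i, B k j = A k j) →
      Entry B i a b T := by
    intro i a b T h hB
    constructor
    · rw [hB 18 (by omega) (by omega) i le_rfl, h.src]
    · rw [hB 19 (by omega) (by omega) i le_rfl, h.snk]
    · rw [hB 20 (by omega) (by omega) i le_rfl, h.left]
    · rw [hB 21 (by omega) (by omega) i le_rfl, h.right]
    · rw [hB 22 (by omega) (by omega) i le_rfl, h.kind]
    · rw [hB 23 (by omega) (by omega) i le_rfl, h.size]
  induction h with
  | edge i b u v h => exact .edge i b u v (entry h hB)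
  | ser i a b Ta Tb Ta' Tb' h ha hb hTa hTb ra rb iha ihb =>
    exact .ser i a b Ta Tb Ta' Tb' (entry h hB) ha hb hTa hTb
      (iha fun k h1 h2 j hj => hB k h1 h2 j (by omega))
      (ihb fun k h1 h2 j hj => hB k h1 h2 j (by omega))
  | par i a b Ta Tb Ta' Tb' h ha hb hTa hTb ra rb iha ihb =>
    exact .par i a b Ta Tb Ta' Tb' (entry h hB) ha hb hTa hTb
      (iha fun k h1 h2 j hj => hB k h1 h2 j (by omega))
      (ihb fun k h1 h2 j hj => hB k h1 h2 j (by omega))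

/-- Make a new node with the source, the sink, the children and the kind in the registers `7` to
`11`. Register `3` holds the number of the last node. -/
def newNode : Cmd :=
  .set 3 (.plus (.var 3) (.lit 1)) ;;
  .put 18 (.var 3) (.var 7) ;; .put 19 (.var 3) (.var 8) ;;
  .put 20 (.var 3) (.var 9) ;; .put 21 (.var 3) (.var 10) ;; .put 22 (.var 3) (.var 11) ;;
  .ite (.eq (.get 22 (.var 9)) (.var 11)) (.set 12 (.get 23 (.var 9))) (.set 12 (.lit 1)) ;;
  .ite (.eq (.get 22 (.var 10)) (.var 11)) (.set 12 (.plus (.var 12) (.get 23 (.var 10))))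
    (.set 12 (.plus (.var 12) (.lit 1))) ;;
  .put 23 (.var 3) (.var 12)

/-- Make a new node for an edge with the ends in the registers `7` and `8`. -/
def newEdge : Cmd :=
  .set 3 (.plus (.var 3) (.lit 1)) ;;
  .put 18 (.var 3) (.var 7) ;; .put 19 (.var 3) (.var 8) ;;
  .put 20 (.var 3) (.lit 0) ;; .put 22 (.var 3) (.lit 0) ;; .put 23 (.var 3) (.lit 1)

/-- The effect of making a new node. -/
structure NodePost (s t : St) (T : BT) : Prop where
  cnt : t.reg 3 = s.reg 3 + 1
  regs : ∀ k, k ≠ 3 → k ≠ 12 → t.reg k = s.reg k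
  old : ∀ k, ∀ i ≤ s.reg 3, t.arr k i = s.arr k i
  arrs : ∀ k, (k < 18 ∨ 23 < k) → t.arr k = s.arr k
  rep : BRep t.arr (t.reg 3) T
  fuel : t.fuel = s.fuel

theorem newEdge_spec (s : St) (hN : s.reg 3 + 1 < N)
    (hQ : ∀ t, NodePost s t (.edge (s.reg 7) (s.reg 8)) → Q t) : wp N newEdge Q s := by
  simp only [newEdge, wp_seq, wp_put, wp_set]
  simp [hN]
  refine hQ _ ?_
  constructor
  · simp
  · intro k h1 h2; simp [h1]
  · intro k i hi
    simp only [setA_arr_of_ne_index _ _ _ _ _ (show i ≠ s.reg 3 + 1 by omega), setR_arr]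
  · intro k hk
    simp [show k ≠ 18 by omega, show k ≠ 19 by omega, show k ≠ 20 by omega, show k ≠ 22 by omega,
      show k ≠ 23 by omega]
  · refine .edge _ _ _ _ ⟨?_, ?_, ?_, rfl, ?_, ?_⟩ <;> simp [BT.src, BT.snk, BT.kind, BT.size]
  · simp

/-- The composition needs the parts `Ta'` and `Tb'`, but memory holds `Ta` and `Tb`, which may be
turned around. The row can be filled nevertheless, because kind and size do not depend on the
orientation, and the terminals are supplied in registers. -/
theorem newNode_spec (s : St) (T Ta Tb Ta' Tb' : BT) (hT : T = .ser Ta' Tb' ∨ T = .par Ta' Tb')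
    (h7 : s.reg 7 = T.src) (h8 : s.reg 8 = T.snk) (h11 : s.reg 11 = T.kind)
    (ha : 0 < s.reg 9 ∧ s.reg 9 ≤ s.reg 3) (hb : 0 < s.reg 10 ∧ s.reg 10 ≤ s.reg 3)
    (hTa : Ta.Same Ta') (hTb : Tb.Same Tb') (ra : BRep s.arr (s.reg 9) Ta)
    (rb : BRep s.arr (s.reg 10) Tb) (hN : s.reg 3 + 1 < N) (hS : T.edges.card < N)
    (hQ : ∀ t, NodePost s t T → Q t) : wp N newNode Q s := by
  obtain ⟨-, -, ka, sa⟩ := ra.entry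
  obtain ⟨-, -, kb, sb⟩ := rb.entry
  have hsize : T.size = (if Ta.kind = T.kind then Ta.size else 1) +
      if Tb.kind = T.kind then Tb.size else 1 := by
    rcases hT with rfl | rfl
    · rw [BT.size, hTa.kind, hTb.kind, hTa.size, hTb.size]
    · rw [BT.size, hTa.kind, hTb.kind, hTa.size, hTb.size]
      rfl
  have hle := T.size_le
  have fin : ∀ t : St, t.reg 3 = s.reg 3 + 1 → (∀ k, k ≠ 3 → k ≠ 12 → t.reg k = s.reg k) →
      t.arr = ((((((s.setA 18 (s.reg 3 + 1) (s.reg 7)).setA 19 (s.reg 3 + 1) (s.reg 8)).setA 20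
        (s.reg 3 + 1) (s.reg 9)).setA 21 (s.reg 3 + 1) (s.reg 10)).setA 22 (s.reg 3 + 1)
        (s.reg 11)).setA 23 (s.reg 3 + 1) T.size).arr → t.fuel = s.fuel → Q t := by
    intro t h3 hr ht hf
    have old : ∀ k, ∀ i ≤ s.reg 3, t.arr k i = s.arr k i := by
      intro k i hi
      simp only [ht, setA_arr_of_ne_index _ _ _ _ _ (show i ≠ s.reg 3 + 1 by omega)]
    refine hQ t ⟨h3, hr, old, ?_, ?_, hf⟩
    · intro k hk
      simp [ht, show k ≠ 18 by omega, show k ≠ 19 by omega, show k ≠ 20 by omega,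
        show k ≠ 21 by omega, show k ≠ 22 by omega, show k ≠ 23 by omega]
    · have he : Entry t.arr (t.reg 3) (s.reg 9) (s.reg 10) T := by
        constructor <;> simp [ht, h3, h7, h8, h11]
      have ra' := ra.congr fun k _ _ j hj => old k j (hj.trans ha.2)
      have rb' := rb.congr fun k _ _ j hj => old k j (hj.trans hb.2)
      rcases hT with rfl | rfl
      · exact .ser _ _ _ Ta Tb _ _ he ⟨ha.1, by omega⟩ ⟨hb.1, by omega⟩ hTa hTb ra' rb'
      · exact .par _ _ _ Ta Tb _ _ he ⟨ha.1, by omega⟩ ⟨hb.1, by omega⟩ hTa hTb ra' rb'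
  simp only [newNode, wp_seq, wp_put, wp_set, wp_ite]
  have ea : s.reg 9 ≠ s.reg 3 + 1 := by omega
  have eb : s.reg 10 ≠ s.reg 3 + 1 := by omega
  simp [hN, ea, eb, h11, ka, kb, sa, sb]
  by_cases h1 : Ta.kind = T.kind <;> by_cases h2 : Tb.kind = T.kind <;>
    simp [h1, h2] at hsize ⊢
  all_goals
    refine ⟨by omega, fin _ (by simp) (fun k h1 h2 => by simp [h1, h2]) ?_ (by simp)⟩
    simp [St.setA, St.setR, hsize, h11]

/-- The trees decompose a series-parallel graph with the edges `E`, and replacing every tree by an edge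
between its terminals gives a series-parallel graph, too. -/
structure Good (E : Multiset (Sym2 ℕ)) (F : Multiset BT) : Prop where
  typed : ∀ B ∈ F, B.Typed
  edges : (F.map BT.edges).sum = E
  nodup : (F.map fun B => (B.int : Multiset ℕ)).sum.Nodup
  disj : ∀ B ∈ F, ∀ v ∈ B.int, ∀ C ∈ F, v ≠ C.src ∧ v ≠ C.snk
  sp : ∃ s t, SP (F.map fun B => s(B.src, B.snk)) s t

theorem BT.Typed.touches {B : BT} (h : B.Typed) : Touches B.edges B.src ∧ Touches B.edges B.snk := by
  induction B with
  | edge u v => simp [edges, src, snk]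
  | ser a b iha ihb => simp [edges, src, snk, iha h.1, ihb h.2.1]
  | par a b iha ihb => simp [edges, src, snk, iha h.1]

/-! ### Forests of decomposition trees under the reductions. -/

namespace Good
variable {E : Multiset (Sym2 ℕ)} {F : Multiset BT} {a b B C : BT}

theorem src_ne_snk (h : Good E F) (hB : B ∈ F) : B.src ≠ B.snk := by
  obtain ⟨s, t, h⟩ := h.sp
  simpa using h.not_isDiag _ (Multiset.mem_map_of_mem _ hB)

theorem edges_le (h : Good E F) (hB : B ∈ F) : B.edges ≤ E := by
  rw [← h.edges]
  obtain ⟨F', rfl⟩ := Multiset.exists_cons_of_mem hB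
  simp

theorem touches (h : Good E F) (hB : B ∈ F) : Touches E B.src ∧ Touches E B.snk := by
  have hle := h.edges_le hB
  obtain ⟨⟨e, he, h1⟩, ⟨f, hf, h2⟩⟩ := (h.typed B hB).touches
  exact ⟨⟨e, Multiset.mem_of_le hle he, h1⟩, ⟨f, Multiset.mem_of_le hle hf, h2⟩⟩

theorem same (h : Good E (B ::ₘ F)) (hB : B.Same C) : Good E (C ::ₘ F) := by
  rcases hB with rfl | rfl
  · exact h
  obtain ⟨typed, edges, nodup, disj, sp⟩ := h
  have hp := (typed B (by simp)).int_rev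
  refine ⟨?_, ?_, ?_, ?_, ?_⟩
  · intro C hC
    rcases Multiset.mem_cons.1 hC with rfl | hC
    exacts [(typed B (by simp)).rev, typed C (by simp [hC])]
  · simpa using edges
  · simpa [Multiset.coe_eq_coe.2 hp] using nodup
  · intro C hC v hv D hD
    have hC' : ∃ C' ∈ B ::ₘ F, v ∈ C'.int := by
      rcases Multiset.mem_cons.1 hC with rfl | hC
      exacts [⟨B, by simp, hp.mem_iff.1 hv⟩, ⟨C, by simp [hC], hv⟩]
    obtain ⟨C', hC', hv⟩ := hC'
    rcases Multiset.mem_cons.1 hD with rfl | hD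
    · simpa using (disj C' hC' v hv B (by simp)).symm
    · exact disj C' hC' v hv D (by simp [hD])
  · simpa [Sym2.eq_swap] using sp

theorem par (h : Good E (a ::ₘ b ::ₘ F)) (hs : a.src = b.src) (ht : a.snk = b.snk) :
    Good E (.par a b ::ₘ F) := by
  obtain ⟨typed, edges, nodup, disj, s, t, sp⟩ := h
  refine ⟨?_, ?_, ?_, ?_, s, t, ?_⟩
  · intro C hC
    rcases Multiset.mem_cons.1 hC with rfl | hC
    exacts [⟨typed a (by simp), typed b (by simp), hs, ht⟩, typed C (by simp [hC])]
  · simpa [BT.edges, add_assoc] using edges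
  · simpa [BT.int, ← Multiset.coe_add, add_assoc] using nodup
  · intro C hC v hv D hD
    have hC' : ∃ C' ∈ a ::ₘ b ::ₘ F, v ∈ C'.int := by
      rcases Multiset.mem_cons.1 hC with rfl | hC
      · rcases List.mem_append.1 hv with hv | hv
        exacts [⟨a, by simp, hv⟩, ⟨b, by simp, hv⟩]
      · exact ⟨C, by simp [hC], hv⟩
    obtain ⟨C', hC', hv⟩ := hC'
    rcases Multiset.mem_cons.1 hD with rfl | hD
    · exact disj C' hC' v hv a (by simp)
    · exact disj C' hC' v hv D (by simp [hD])
  · simp only [Multiset.map_cons, ← hs, ← ht] at sp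
    simpa [BT.src, BT.snk] using sp.parallel_reduction rfl

/-- The joint has degree two, so it is a terminal of no other tree and can become an inner node. The
terminals of the reduced graph may differ from those before. -/
theorem ser (h : Good E (a ::ₘ b ::ₘ F)) (hab : a.snk = b.src) (hne : a.src ≠ b.snk)
    (hF : ∀ C ∈ F, a.snk ≠ C.src ∧ a.snk ≠ C.snk) : Good E (.ser a b ::ₘ F) := by
  have ha := h.src_ne_snk (B := a) (by simp)
  have hb := h.src_ne_snk (B := b) (by simp)
  obtain ⟨typed, edges, nodup, disj, s, t, sp⟩ := h
  have hint : ∀ C ∈ a ::ₘ b ::ₘ F, a.snk ∉ C.int := fun C hC hv =>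
    (disj C hC _ hv a (by simp)).2 rfl
  refine ⟨?_, ?_, ?_, ?_, ?_⟩
  · intro C hC
    rcases Multiset.mem_cons.1 hC with rfl | hC
    exacts [⟨typed a (by simp), typed b (by simp), hab⟩, typed C (by simp [hC])]
  · simpa [BT.edges, add_assoc] using edges
  · have e : ((BT.ser a b ::ₘ F).map fun B => (B.int : Multiset ℕ)).sum =
        a.snk ::ₘ ((a ::ₘ b ::ₘ F).map fun B => (B.int : Multiset ℕ)).sum := by
      simp [BT.int, ← Multiset.coe_add, ← Multiset.cons_coe, add_assoc]
    rw [e, Multiset.nodup_cons]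
    refine ⟨fun hm => ?_, nodup⟩
    have key : ∀ G : Multiset BT, (∀ C ∈ G, a.snk ∉ C.int) →
        a.snk ∉ (G.map fun B => (B.int : Multiset ℕ)).sum := by
      intro G hG
      induction G using Multiset.induction with
      | empty => simp
      | cons C G ih =>
        simp only [Multiset.map_cons, Multiset.sum_cons, Multiset.mem_add, Multiset.mem_coe, not_or]
        exact ⟨hG C (by simp), ih fun C hC => hG C (by simp [hC])⟩
    exact key _ hint hm
  · intro C hC v hv D hD
    by_cases hva : v = a.snk
    · rcases Multiset.mem_cons.1 hD with rfl | hD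
      · rw [hva]
        exact ⟨ha.symm, hab ▸ hb⟩
      · rw [hva]; exact hF D hD
    have hC' : ∃ C' ∈ a ::ₘ b ::ₘ F, v ∈ C'.int := by
      rcases Multiset.mem_cons.1 hC with rfl | hC
      · simp only [BT.int, List.mem_append, List.mem_cons, hva, false_or] at hv
        rcases hv with hv | hv
        exacts [⟨a, by simp, hv⟩, ⟨b, by simp, hv⟩]
      · exact ⟨C, by simp [hC], hv⟩
    obtain ⟨C', hC', hv⟩ := hC'
    rcases Multiset.mem_cons.1 hD with rfl | hD
    · exact ⟨(disj C' hC' v hv a (by simp)).1, (disj C' hC' v hv b (by simp)).2⟩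
    · exact disj C' hC' v hv D (by simp [hD])
  · simp only [Multiset.map_cons, ← hab] at sp
    have := sp.series_reduction rfl (fun ⟨e, he, hv⟩ => ?_) hne
    · simpa [BT.src, BT.snk] using this
    · obtain ⟨C, hC, rfl⟩ := Multiset.mem_map.1 he
      rcases Sym2.mem_iff.1 hv with h | h
      exacts [(hF C hC).1 h, (hF C hC).2 h]

/-- Once a single tree is left, the conditions on the forest are those on a well-formed tree of the
whole graph. -/
theorem wf (h : Good E {B}) : B.WF ∧ B.edges = E := by
  refine ⟨⟨h.typed B (by simp), ?_⟩, by simpa using h.edges⟩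
  have h1 := h.src_ne_snk (B := B) (by simp)
  have h2 := h.nodup
  have h3 := h.disj B (by simp)
  simp only [Multiset.map_singleton, Multiset.sum_singleton, Multiset.coe_nodup] at h2
  simp only [BT.nodes, List.nodup_cons, List.mem_cons, not_or]
  exact ⟨⟨h1, fun hv => (h3 _ hv B (by simp)).1 rfl⟩, fun hv => (h3 _ hv B (by simp)).2 rfl, h2⟩

theorem init {es : List (ℕ × ℕ)} {s t : ℕ}
    (h : SP (es.map fun e => s(e.1, e.2) : Multiset (Sym2 ℕ)) s t) :
    Good (es.map fun e => s(e.1, e.2) : Multiset (Sym2 ℕ))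
      (es.map fun e => BT.edge e.1 e.2 : Multiset BT) := by
  have hB : ∀ B ∈ (es.map fun e => BT.edge e.1 e.2 : Multiset BT), B.Typed ∧ B.int = [] := by
    intro B hB
    obtain ⟨e, -, rfl⟩ := List.mem_map.1 (Multiset.mem_coe.1 hB)
    exact ⟨trivial, rfl⟩
  refine ⟨fun B h => (hB B h).1, ?_, ?_, fun B h v hv => ?_, s, t, ?_⟩
  · clear h hB
    induction es with
    | nil => rfl
    | cons e es ih =>
      simp only [List.map_cons, ← Multiset.cons_coe, Multiset.map_cons, Multiset.sum_cons] at ih ⊢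
      rw [ih, BT.edges, Multiset.singleton_add]
  · rw [Multiset.map_congr rfl fun B h => by rw [(hB B h).2]]
    simp [Function.comp_def]
  · simp [(hB B h).2] at hv
  · simpa [Function.comp_def, BT.src, BT.snk] using h

end Good

/-! ### The invariant of the reduction and its two basic steps. -/

theorem Net.cell_eq {n : ℕ} {A : ℕ → ℕ → ℕ} {e : ℕ → ℕ × ℕ} {live : Finset ℕ} (h : Net n A e live)
    {i u v : ℕ} (hi : i ∈ live) (he : s((e i).1, (e i).2) = s(u, v)) : A 12 (u * n + v) = i := by
  rcases Sym2.eq_iff.1 he with ⟨h1, h2⟩ | ⟨h1, h2⟩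
  · rw [← h1, ← h2]; exact (h.mat i hi).1
  · rw [← h1, ← h2]; exact (h.mat i hi).2

theorem Net.congr {n : ℕ} {A B : ℕ → ℕ → ℕ} {e f : ℕ → ℕ × ℕ} {live : Finset ℕ} (h : Net n A e live)
    (hf : ∀ i ∈ live, f i = e i) (hB : ∀ k, 12 ≤ k → k ≤ 15 → B k = A k) : Net n B f live := by
  have hsum : ∀ g, endSum g f live = endSum g e live := fun g => by
    ext w
    exact Finset.sum_congr rfl fun i hi => by rw [hf i hi]
  have h12 := hB 12 (by omega) (by omega)
  refine ⟨h.pos, fun i hi => ?_, fun i hi => ?_, fun i hi => ?_, fun u hu v hv hne => ?_, ?_, ?_, ?_⟩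
  · rw [hf i hi]; exact h.lt i hi
  · rw [hf i hi]; exact h.ne i hi
  · rw [hf i hi, h12]; exact h.mat i hi
  · rw [h12] at hne ⊢
    have := h.mat' u hu v hv hne
    rw [hf _ this.1]
    exact this
  · rw [hB 13 (by omega) (by omega), h.deg, hsum]
  · rw [hB 14 (by omega) (by omega), h.sum, hsum]
  · rw [hB 15 (by omega) (by omega), h.sq, hsum]

/-- The terminals of the trees. -/
def ends (tr : ℕ → BT) (i : ℕ) : ℕ × ℕ := ((tr i).src, (tr i).snk)

/-- The invariant of the reduction: the trees `tr i`, for `i` in `live`, and the edges `rest` that are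
still to be read decompose the graph. -/
structure Inv (n : ℕ) (E : Multiset (Sym2 ℕ)) (s : St) (live : Finset ℕ) (tr : ℕ → BT)
    (rest : Multiset BT) : Prop where
  n1 : s.reg 1 = n
  net : Net n s.arr (ends tr) live
  rep : ∀ i ∈ live, i ≤ s.reg 3 ∧ BRep s.arr i (tr i)
  good : Good E (live.val.map tr + rest)
  mass : s.reg 3 + live.card + 2 * rest.card = 2 * E.card

/-- Insert the last node, whose ends are in the registers `7` and `8`, into the multigraph, and merge
it with a parallel edge. -/
def attach : Cmd :=
  .set 9 (.get 12 (cell 7 8)) ;;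
  .ite (.var 9)
    (unlink 7 8 ;; .set 10 (.var 3) ;; .set 7 (.get 18 (.var 9)) ;; .set 8 (.get 19 (.var 9)) ;;
     .set 11 (.lit 2) ;; newNode) .skip ;;
  link 7 8 3

/-- The effect of inserting an edge. -/
structure AttachPost (n : ℕ) (E : Multiset (Sym2 ℕ)) (s t : St) (live' : Finset ℕ) (tr' : ℕ → BT)
    (rest : Multiset BT) : Prop where
  inv : Inv n E t live' tr' rest
  last : t.reg 3 ∈ live'
  ends : t.reg 7 = s.reg 7 ∧ t.reg 8 = s.reg 8 ∨ t.reg 7 = s.reg 8 ∧ t.reg 8 = s.reg 7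
  regs : ∀ k, k ≠ 3 → (k < 7 ∨ 12 < k) → t.reg k = s.reg k
  arrs : ∀ k, (k < 12 ∨ 15 < k ∧ k < 18 ∨ 23 < k) → t.arr k = s.arr k
  deg : ∀ w, w ≠ s.reg 7 → w ≠ s.reg 8 → t.arr 13 w = s.arr 13 w
  fuel : t.fuel = s.fuel

/-- This is the case in which the terminals of the new tree are not adjacent. The equation `mass`
bounds the number of tree nodes by `2 * |E|`: reading an edge raises the node counter and the number
of live trees by one and lowers `rest`; every composition raises the counter and lowers the number
of live trees. -/
theorem link_last {n : ℕ} {E : Multiset (Sym2 ℕ)} {live : Finset ℕ} {tr : ℕ → BT}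
    {rest : Multiset BT} (s : St) (T : BT) (n1 : s.reg 1 = n) (net : Net n s.arr (ends tr) live)
    (rep : ∀ i ∈ live, i < s.reg 3 ∧ BRep s.arr i (tr i)) (hT : BRep s.arr (s.reg 3) T)
    (h7 : s.reg 7 = T.src) (h8 : s.reg 8 = T.snk) (h0 : 0 < s.reg 3)
    (good : Good E (T ::ₘ (live.val.map tr + rest)))
    (mass : s.reg 3 + (live.card + 1) + 2 * rest.card = 2 * E.card)
    (hV : ∀ v, Touches E v → v < n) (hN : (2 * E.card + 2) * (n * n) < N)
    (hj : s.arr 12 (T.src * n + T.snk) = 0)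
    (hQ : ∀ t live' tr', live'.card ≤ live.card + 1 → AttachPost n E s t live' tr' rest → Q t) :
    wp N (link 7 8 3) Q s := by
  have hmul : (live.card + 1) * (n * n) ≤ (2 * E.card + 2) * (n * n) :=
    Nat.mul_le_mul_right _ (by omega)
  have hne := good.src_ne_snk (B := T) (by simp)
  have hlt := good.touches (B := T) (by simp)
  have hx : T.src < n := hV _ hlt.1
  have hy : T.snk < n := hV _ hlt.2
  have hi : s.reg 3 ∉ live := fun h => by have := (rep _ h).1; omega
  have he : ∀ i ∈ live, ends (Function.update tr (s.reg 3) T) i = ends tr i := fun i hi' => by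
    rw [ends, Function.update_of_ne (fun h => hi (by rw [← h]; exact hi'))]; rfl
  refine link_spec (live := live) (e := ends (Function.update tr (s.reg 3) T)) 7 8 3 _
    (net.congr he fun k _ _ => rfl) (by simpa using n1) (by simpa using hi)
    (by simp; omega) (by simp [ends, h7, h8]) (by simpa [h7]) (by simpa [h8])
    (by simpa [h7, h8]) (by simpa [h7, h8] using hj) (by omega) fun t tr' tf ta td tn => ?_
  simp at tr' tf ta td tn
  refine hQ t (insert (s.reg 3) live) (Function.update tr (s.reg 3) T)
    (Finset.card_insert_le _ _) ⟨⟨?_, ?_, ?_, ?_, ?_⟩, ?_, ?_, ?_, ?_, ?_, ?_⟩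
  · simp [tr', n1]
  · exact tn
  · intro i hi'
    rcases Finset.mem_insert.1 hi' with rfl | hi'
    · refine ⟨by simp [tr'], ?_⟩
      rw [Function.update_self]
      exact hT.congr fun k h1 h2 j hj => by rw [ta k (by omega)]
    · have := rep i hi'
      refine ⟨by simp [tr']; omega, ?_⟩
      rw [Function.update_of_ne (by omega)]
      exact this.2.congr fun k h1 h2 j hj => by rw [ta k (by omega)]
  · have hm : live.val.map (Function.update tr (s.reg 3) T) = live.val.map tr :=
      Multiset.map_congr rfl fun i hi' =>
        Function.update_of_ne (fun h => hi (by rw [← h]; exact hi')) _ _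
    rw [Finset.insert_val_of_notMem hi, Multiset.map_cons, Function.update_self,
      Multiset.cons_add, hm]
    exact good
  · rw [Finset.card_insert_of_notMem hi, tr']
    omega
  · simp [tr']
  · simp [tr']
  · intro k h1 h2; simp [tr']
  · intro k hk; rw [ta k (by omega)]
  · intro w h1 h2; exact td w h1 h2
  · simpa using tf

/-- A parallel edge is found by one access to the matrix. It is removed, both trees are composed,
and the result is inserted into a cell that is now empty. So the graph stays simple and one merge
suffices. -/
theorem attach_spec {n : ℕ} {E : Multiset (Sym2 ℕ)} {live : Finset ℕ} {tr : ℕ → BT}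
    {rest : Multiset BT} (s : St) (T : BT) (n1 : s.reg 1 = n) (net : Net n s.arr (ends tr) live)
    (rep : ∀ i ∈ live, i < s.reg 3 ∧ BRep s.arr i (tr i)) (hT : BRep s.arr (s.reg 3) T)
    (h7 : s.reg 7 = T.src) (h8 : s.reg 8 = T.snk) (h0 : 0 < s.reg 3)
    (good : Good E (T ::ₘ (live.val.map tr + rest)))
    (mass : s.reg 3 + (live.card + 1) + 2 * rest.card = 2 * E.card)
    (hV : ∀ v, Touches E v → v < n) (hN : (2 * E.card + 2) * (n * n) < N)
    (hN' : 2 * E.card + 2 < N)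
    (hQ : ∀ t live' tr', live'.card ≤ live.card + 1 → AttachPost n E s t live' tr' rest → Q t) :
    wp N attach Q s := by
  have hne := good.src_ne_snk (B := T) (by simp)
  have hlt := good.touches (B := T) (by simp)
  have hx : T.src < n := hV _ hlt.1
  have hy : T.snk < n := hV _ hlt.2
  have c0 : 1 * (n * n) ≤ (2 * E.card + 2) * (n * n) := Nat.mul_le_mul_right _ (by omega)
  have c1 : T.src * n + T.snk < n * n := by nlinarith
  have c2 : T.src * n ≤ T.src * n + T.snk := Nat.le_add_right _ _
  rw [attach, wp_seq, wp_set]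
  refine ⟨by simp [cell, n1, h7, h8]; omega, ?_⟩
  rw [wp_seq, wp_ite]
  simp only [Ex.eval, cell, eval_add, eval_mul, setR_reg_self, n1, h7, h8, ok_var, true_and]
  refine ⟨fun hj => ?_, fun hj => ?_⟩
  swap
  · rw [wp_skip]
    refine link_last (live := live) (tr := tr) (rest := rest) _ T (by simpa using n1) net
      (by simpa using rep) (by simpa using hT) (by simpa using h7) (by simpa using h8)
      (by simpa using h0) good (by simpa using mass) hV hN (by simpa using hj)
      fun t live' tr' hc ht => hQ t live' tr' hc ⟨ht.inv, ht.last, by simpa using ht.ends,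
        fun k h1 h2 => ?_, by simpa using ht.arrs, by simpa using ht.deg, ht.fuel⟩
    rw [ht.regs k h1 h2, setR_reg_ne _ _ _ _ (by omega)]
  obtain ⟨hjl, hends⟩ := net.mat' _ hx _ hy hj
  set j := s.arr 12 (T.src * n + T.snk) with hjdef
  have hj0 := net.pos j hjl
  obtain ⟨hj3, hjr⟩ := rep j hjl
  -- The stored tree of the parallel edge dictates the orientation: the new tree enters the
  -- composition as `S`, itself or turned around, and the registers `7` and `8` are reloaded
  -- accordingly.
  obtain ⟨S, hS, hSs, hSt⟩ : ∃ S, T.Same S ∧ (tr j).src = S.src ∧ (tr j).snk = S.snk := by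
    rcases Sym2.eq_iff.1 hends with ⟨h1, h2⟩ | ⟨h1, h2⟩
    · exact ⟨T, .inl rfl, h1, h2⟩
    · exact ⟨T.rev, .inr rfl, h1.trans T.src_rev.1.symm, h2.trans T.src_rev.2.symm⟩
  have hlive : live.val.map tr = tr j ::ₘ (live.erase j).val.map tr := by
    rw [← Multiset.map_cons, Finset.erase_val, Multiset.cons_erase hjl]
  have good' : Good E (.par (tr j) S ::ₘ ((live.erase j).val.map tr + rest)) := by
    refine Good.par ?_ hSs hSt
    have := good.same hS
    rwa [hlive, Multiset.cons_add, Multiset.cons_swap] at this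
  have hcard : (live.erase j).card + 1 = live.card := Finset.card_erase_add_one hjl
  rw [wp_seq]
  refine unlink_spec (live := live) (e := ends tr) (i := j) 7 8 _ net (by simpa using n1) hjl ?_
    (by omega) fun s1 s1r s1f s1a s1d s1n => ?_
  · rcases Sym2.eq_iff.1 hends with ⟨h1, h2⟩ | ⟨h1, h2⟩
    · left; simp [h7, h8, ← h1, ← h2]
    · right; simp [h7, h8, ← h1, ← h2]
  simp [h7, h8] at s1r s1f s1a s1d s1n
  obtain ⟨jsrc, jsnk, -, -⟩ := hjr.entry
  have h18 : s1.arr 18 = s.arr 18 := s1a 18 (by omega)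
  have h19 : s1.arr 19 = s.arr 19 := s1a 19 (by omega)
  simp only [wp_seq, wp_set]
  simp [s1r, h18, h19, jsrc, jsnk]
  have tabs : ∀ k, 18 ≤ k → k ≤ 23 → ∀ i, s1.arr k i = s.arr k i := fun k hk _ i => by
    rw [s1a k (by omega)]
  refine newNode_spec _ (.par (tr j) S) (tr j) T (tr j) S (.inr rfl) (by simp [BT.src])
    (by simp [BT.snk]) (by simp [BT.kind]) (by simp [s1r]; omega) (by simp [s1r]; omega)
    (.inl rfl) hS ?_ ?_ (by simp [s1r]; omega) ?_ fun s2 h2 => ?_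
  · simpa [s1r] using hjr.congr fun k h1 h2 i _ => tabs k h1 h2 i
  · simpa [s1r] using hT.congr fun k h1 h2 i _ => tabs k h1 h2 i
  · have := Multiset.card_le_card (good'.edges_le (B := .par (tr j) S) (by simp))
    omega
  have cnt := h2.cnt
  have regs := h2.regs
  have old := h2.old
  simp [s1r] at cnt regs old
  have arrs : ∀ k, (k < 12 ∨ 15 < k ∧ k < 18 ∨ 23 < k) → s2.arr k = s.arr k := fun k hk => by
    rw [h2.arrs k (by omega)]
    exact s1a k (by omega)
  have old' : ∀ k, 18 ≤ k → k ≤ 23 → ∀ i ≤ s.reg 3, s2.arr k i = s.arr k i := fun k h1 h2 i hi => by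
    rw [old k i hi, tabs k h1 h2]
  have hfuel : s2.fuel = s.fuel := by rw [h2.fuel]; simpa using s1f
  have s2n : Net n s2.arr (ends tr) (live.erase j) := s1n.congr (fun _ _ => rfl) fun k h3 h4 => by
    rw [h2.arrs k (by omega)]; rfl
  refine link_last (live := live.erase j) (tr := tr) (rest := rest) s2 (.par (tr j) S)
    (by simp [regs, s1r, n1]) s2n (fun i hi => ?_) h2.rep (by simp [regs, BT.src])
    (by simp [regs, BT.snk]) (by omega) good' (by omega) hV hN ?_
    fun t live' tr' hc ht => hQ t live' tr' (by omega) ⟨ht.inv, ht.last, ?_, ?_, ?_, ?_, ?_⟩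
  · obtain ⟨h3, h4⟩ := rep i (Finset.mem_of_mem_erase hi)
    exact ⟨by omega, h4.congr fun k h1 h2 l hl => old' k h1 h2 l (by omega)⟩
  -- Another edge in this cell would be equal to `j`, as the matrix determines an edge by its ends.
  · by_contra hne'
    have hm := s2n.mat' (tr j).src (net.lt j hjl).1 (tr j).snk (net.lt j hjl).2 hne'
    obtain ⟨h3, h4⟩ := Finset.mem_erase.1 hm.1
    have e1 := net.cell_eq h4 (hm.2.trans hends)
    exact h3 e1.symm
  · have := ht.ends
    simp only [regs 7 (by omega) (by omega), regs 8 (by omega) (by omega)] at this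
    simp at this
    rcases Sym2.eq_iff.1 hends with ⟨h3, h4⟩ | ⟨h3, h4⟩ <;> simp only [ends] at h3 h4 <;>
      rw [h3, h4] at this <;> omega
  · intro k h3 h4
    rw [ht.regs k h3 h4, regs k h3 (by omega)]
    simp [s1r, show k ≠ 7 by omega, show k ≠ 8 by omega, show k ≠ 9 by omega, show k ≠ 10 by omega,
      show k ≠ 11 by omega]
  · intro k hk
    rw [ht.arrs k hk, arrs k hk]
  · intro w h3 h4
    have h5 : w ≠ (tr j).src ∧ w ≠ (tr j).snk := by
      rcases Sym2.eq_iff.1 hends with ⟨h5, h6⟩ | ⟨h5, h6⟩ <;> simp only [ends] at h5 h6 <;>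
        rw [h5, h6] <;> omega
    rw [ht.deg w (by simp [regs, h5.1]) (by simp [regs, h5.2]), h2.arrs 13 (by omega)]
    simpa using s1d w (by omega) (by omega)
  · rw [ht.fuel, hfuel]

/-- All three records are sums over the incident edges. Degree two leaves two summands, so the other
records are the sum and the sum of squares of the neighbours, which differ because the graph is
simple. -/
theorem Net.exists_of_deg_eq_two {n : ℕ} {A : ℕ → ℕ → ℕ} {e : ℕ → ℕ × ℕ} {live : Finset ℕ}
    (h : Net n A e live) {v : ℕ} (hv : A 13 v = 2) : ∃ i j x y, i ∈ live ∧ j ∈ live ∧ i ≠ j ∧ x < y ∧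
      s((e i).1, (e i).2) = s(x, v) ∧ s((e j).1, (e j).2) = s(v, y) ∧ A 14 v = x + y ∧
      A 15 v = x * x + y * y ∧ ∀ k ∈ live, k ≠ i → k ≠ j → v ≠ (e k).1 ∧ v ≠ (e k).2 := by
  set p : ℕ → Prop := fun k => v = (e k).1 ∨ v = (e k).2 with hp
  set o : ℕ → ℕ := fun k => if v = (e k).1 then (e k).2 else (e k).1 with ho
  have hsum : ∀ g : ℕ → ℕ, endSum g e live v = ∑ k ∈ live with p k, g (o k) := fun g => by
    rw [Finset.sum_filter]
    refine Finset.sum_congr rfl fun k _ => ?_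
    simp only [hp, ho]
    split_ifs <;> simp_all
  have hc : (live.filter p).card = 2 := by
    rw [h.deg, hsum] at hv
    simpa using hv
  obtain ⟨a, b, hab, hf⟩ := Finset.card_eq_two.1 hc
  have mem : ∀ k, (k ∈ live ∧ p k) ↔ k = a ∨ k = b := fun k => by
    rw [← Finset.mem_filter, hf]; simp
  have hoe : ∀ k, p k → s((e k).1, (e k).2) = s(o k, v) := fun k hk => by
    simp only [hp, ho] at hk ⊢
    by_cases h1 : v = (e k).1
    · rw [if_pos h1, ← h1, Sym2.eq_swap]
    · rw [if_neg h1, ← hk.resolve_left h1]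
  have ha := (mem a).2 (.inl rfl)
  have hb := (mem b).2 (.inr rfl)
  have hne : o a ≠ o b := fun heq => by
    have h1 := h.cell_eq ha.1 (hoe a ha.2)
    have h2 := h.cell_eq hb.1 (hoe b hb.2)
    rw [heq] at h1
    exact hab (h1.symm.trans h2)
  have h14 : A 14 v = o a + o b := by rw [h.sum, hsum, hf, Finset.sum_pair hab]
  have h15 : A 15 v = o a * o a + o b * o b := by rw [h.sq, hsum, hf, Finset.sum_pair hab]
  have hk : ∀ k ∈ live, k ≠ a → k ≠ b → v ≠ (e k).1 ∧ v ≠ (e k).2 := fun k hk h1 h2 => by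
    by_contra hn
    have := (mem k).1 ⟨hk, by simp only [hp]; tauto⟩
    tauto
  rcases lt_or_gt_of_ne hne with hlt | hlt
  · exact ⟨a, b, o a, o b, ha.1, hb.1, hab, hlt, hoe a ha.2, by rw [hoe b hb.2, Sym2.eq_swap], h14,
      h15, hk⟩
  · exact ⟨b, a, o b, o a, hb.1, ha.1, hab.symm, hlt, hoe b hb.2,
      by rw [hoe a ha.2, Sym2.eq_swap], by rw [h14, add_comm], by rw [h15, add_comm],
      fun k h1 h2 h3 => hk k h1 h3 h2⟩

/-- Replace the node in register `6`, of degree two, and its two edges by an edge. -/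
def reduce : Cmd :=
  .set 9 (.get 16 (.minus (.times (.lit 2) (.get 15 (.var 6)))
    (.times (.get 14 (.var 6)) (.get 14 (.var 6))))) ;;
  .set 8 (.quot (.plus (.get 14 (.var 6)) (.var 9)) (.lit 2)) ;;
  .set 7 (.minus (.get 14 (.var 6)) (.var 8)) ;;
  .set 9 (.get 12 (cell 7 6)) ;; .set 10 (.get 12 (cell 6 8)) ;;
  unlink 7 6 ;; unlink 6 8 ;;
  .set 11 (.minus (.lit 1) (.minus (.lit 1) (.plus (.get 22 (.var 9)) (.get 22 (.var 10))))) ;;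
  newNode ;; attach

/-- The effect of removing a node of degree two. -/
structure ReducePost (n : ℕ) (E : Multiset (Sym2 ℕ)) (s t : St) (live' : Finset ℕ) (tr' : ℕ → BT) :
    Prop where
  inv : Inv n E t live' tr' 0
  last : t.reg 3 ∈ live'
  lt : t.reg 7 < n ∧ t.reg 8 < n
  regs : ∀ k, k ≠ 3 → (k < 7 ∨ 12 < k) → t.reg k = s.reg k
  arrs : ∀ k, (k < 12 ∨ 15 < k ∧ k < 18 ∨ 23 < k) → t.arr k = s.arr k
  deg : ∀ w, t.arr 13 w = 2 → w = t.reg 7 ∨ w = t.reg 8 ∨ s.arr 13 w = 2 ∧ w ≠ s.reg 6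
  fuel : t.fuel = s.fuel

theorem BT.exists_same {B : BT} {x y : ℕ} (h : s(B.src, B.snk) = s(x, y)) :
    ∃ C, B.Same C ∧ C.src = x ∧ C.snk = y := by
  rcases Sym2.eq_iff.1 h with ⟨h1, h2⟩ | ⟨h1, h2⟩
  · exact ⟨B, .inl rfl, h1, h2⟩
  · exact ⟨B.rev, .inr rfl, B.src_rev.1.trans h2, B.src_rev.2.trans h1⟩

/-- The last equation makes it possible to find the neighbours: it yields `(y - x)²` from the
records, the table of square roots gives `y - x`, and with `x + y` this determines both. The
inequalities keep the intermediate values in range. -/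
theorem reduce_bounds {n v x y : ℕ} (hxy : x < y) (hy : y < n) (hv : v < n) :
    x * n + v < n * n ∧ v * n + y < n * n ∧ (x + y) * (x + y) < 4 * (n * n) ∧
      2 * (x * x + y * y) < 4 * (n * n) ∧ n ≤ n * n ∧
      2 * (x * x + y * y) - (x + y) * (x + y) = (y - x) * (y - x) := by
  have hx : x < n := by omega
  have c1 := Nat.mul_lt_mul'' hx hx
  have c2 := Nat.mul_lt_mul'' hy hy
  have c3 : (x + y) * (x + y) < (2 * n) * (2 * n) := Nat.mul_lt_mul'' (by omega) (by omega)
  have c4 : (2 * n) * (2 * n) = 4 * (n * n) := by ring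
  have c5 : (x + 1) * n ≤ n * n := Nat.mul_le_mul_right _ hx
  have c6 : (v + 1) * n ≤ n * n := Nat.mul_le_mul_right _ hv
  rw [add_mul, one_mul] at c5 c6
  refine ⟨by omega, by omega, by omega, by omega, Nat.le_mul_self n, ?_⟩
  obtain ⟨d, rfl⟩ := Nat.exists_eq_add_of_lt hxy
  rw [show x + d + 1 - x = d + 1 by omega]
  have : 2 * (x * x + (x + d + 1) * (x + d + 1)) =
    (d + 1) * (d + 1) + (x + (x + d + 1)) * (x + (x + d + 1)) := by ring
  omega

theorem reduce_spec {n : ℕ} {E : Multiset (Sym2 ℕ)} {live : Finset ℕ} {tr : ℕ → BT} (s : St)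
    (inv : Inv n E s live tr 0) (hv : s.reg 6 < n) (hd : s.arr 13 (s.reg 6) = 2)
    (hsq : ∀ d < n, s.arr 16 (d * d) = d) (hV : ∀ v, Touches E v → v < n)
    (hN : (2 * E.card + 2) * (n * n) < N) (hN' : 2 * E.card + 2 < N)
    (hQ : ∀ t live' tr', live'.card + 1 ≤ live.card → ReducePost n E s t live' tr' → Q t) :
    wp N reduce Q s := by
  obtain ⟨n1, net, rep, good, mass⟩ := inv
  obtain ⟨i, j, x, y, hi, hj, hij, hxy, ei, ej, h14, h15, hk⟩ := net.exists_of_deg_eq_two hd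
  set v := s.reg 6 with hvdef
  obtain ⟨Ta, sa, sa1, sa2⟩ := BT.exists_same ei
  obtain ⟨Tb, sb, sb1, sb2⟩ := BT.exists_same ej
  have hj' : j ∈ live.erase i := Finset.mem_erase.2 ⟨hij.symm, hj⟩
  have hlive : live.val.map tr = tr i ::ₘ tr j ::ₘ ((live.erase i).erase j).val.map tr := by
    rw [← Multiset.map_cons, ← Multiset.map_cons, Finset.erase_val, Multiset.cons_erase hj',
      Finset.erase_val, Multiset.cons_erase hi]
  have hk' : ∀ k ∈ (live.erase i).erase j, v ≠ (tr k).src ∧ v ≠ (tr k).snk := fun k hm => by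
    simp only [Finset.mem_erase] at hm
    exact hk k hm.2.2 hm.2.1 hm.1
  have good' : Good E (.ser Ta Tb ::ₘ (((live.erase i).erase j).val.map tr + 0)) := by
    rw [add_zero] at good ⊢
    rw [hlive] at good
    have g1 := good.same sa
    rw [Multiset.cons_swap] at g1
    have g2 := g1.same sb
    rw [Multiset.cons_swap] at g2
    refine g2.ser (sa2.trans sb1.symm) (by rw [sa1, sb2]; omega) fun C hC => ?_
    obtain ⟨k, hm, rfl⟩ := Multiset.mem_map.1 hC
    rw [sa2]
    exact hk' k hm
  have hc1 : (live.erase i).card + 1 = live.card := Finset.card_erase_add_one hi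
  have hc2 : ((live.erase i).erase j).card + 1 = (live.erase i).card :=
    Finset.card_erase_add_one hj'
  simp only [Multiset.card_zero] at mass
  have hx : x < n := hV x (by simpa [BT.src, sa1] using (good'.touches (B := .ser Ta Tb) (by simp)).1)
  have hy : y < n := hV y (by simpa [BT.snk, sb2] using (good'.touches (B := .ser Ta Tb) (by simp)).2)
  have c0 : 4 * (n * n) ≤ (2 * E.card + 2) * (n * n) := Nat.mul_le_mul_right _ (by omega)
  obtain ⟨c1, c2, c3, c4, c5, hdd⟩ := reduce_bounds hxy hy hv
  have c6 : n * n < N := by omega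
  have hqy : (x + y + (y - x)) / 2 = y := by omega
  have cell1 := net.cell_eq hi ei
  have cell2 := net.cell_eq hj ej
  obtain ⟨hi3, ri⟩ := rep i hi
  obtain ⟨hj3, rj⟩ := rep j hj
  have pi := net.pos i hi
  have pj := net.pos j hj
  simp only [reduce, wp_seq, wp_set, cell]
  simp [← hvdef, h14, h15, hdd, hsq _ (show y - x < n by omega), hqy, n1, cell1, cell2]
  refine ⟨by omega, by omega, by omega, by omega, ?_⟩
  have hei : ends tr i = (x, v) ∨ ends tr i = (v, x) := by
    rcases Sym2.eq_iff.1 ei with ⟨h1, h2⟩ | ⟨h1, h2⟩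
    exacts [.inl (Prod.ext h1 h2), .inr (Prod.ext h1 h2)]
  have hej : ends tr j = (v, y) ∨ ends tr j = (y, v) := by
    rcases Sym2.eq_iff.1 ej with ⟨h1, h2⟩ | ⟨h1, h2⟩
    exacts [.inl (Prod.ext h1 h2), .inr (Prod.ext h1 h2)]
  refine unlink_spec (live := live) (e := ends tr) (i := i) 7 6 _ net (by simpa using n1) hi
    (by simpa [← hvdef] using hei) c6 fun s1 s1r s1f s1a s1d s1n => ?_
  simp [← hvdef] at s1f s1a s1d s1n
  rw [wp_seq]
  refine unlink_spec (e := ends tr) (i := j) 6 8 _ s1n (by simpa [s1r] using n1) hj'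
    (by simpa [s1r, ← hvdef] using hej) c6 fun s2 s2r s2f s2a s2d s2n => ?_
  simp [s1r, ← hvdef] at s2d
  rw [s1r] at s2r
  have arrs2 : ∀ k, k < 12 ∨ 15 < k → s2.arr k = s.arr k := fun k hk => by
    rw [s2a k hk, s1a k hk]
  have tabs : ∀ k, 18 ≤ k → k ≤ 23 → ∀ l, s2.arr k l = s.arr k l := fun k h1 _ l => by
    rw [arrs2 k (by omega)]
  obtain ⟨-, -, ki, -⟩ := ri.entry
  obtain ⟨-, -, kj, -⟩ := rj.entry
  have ki' := (tr i).kind_le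
  have kj' := (tr j).kind_le
  have hle := Multiset.card_le_card (good'.edges_le (B := .ser Ta Tb) (by simp))
  -- The double truncated difference turns any positive number into `1`: a series composition has
  -- kind `0` only if both parts do.
  have hkk : 1 - (1 - ((tr i).kind + (tr j).kind)) = (BT.ser Ta Tb).kind := by
    rw [BT.kind, sa.kind, sb.kind]
    split_ifs <;> omega
  simp [s2r, arrs2, ki, kj, hkk]
  refine ⟨by omega, ?_⟩
  refine newNode_spec _ (.ser Ta Tb) (tr i) (tr j) Ta Tb (.inl rfl) (by simp [s2r, BT.src, sa1])
    (by simp [s2r, BT.snk, sb2]) (by simp) (by simp [s2r]; omega) (by simp [s2r]; omega) sa sb ?_ ?_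
    (by simp [s2r]; omega) (by omega) fun s3 h3 => ?_
  · simpa [s2r] using ri.congr fun k h1 h2 l _ => tabs k h1 h2 l
  · simpa [s2r] using rj.congr fun k h1 h2 l _ => tabs k h1 h2 l
  have cnt := h3.cnt
  have regs := h3.regs
  have old := h3.old
  simp [s2r] at cnt regs old
  have r7 : s3.reg 7 = x := by rw [regs 7 (by omega) (by omega)]; simp [s2r]
  have r8 : s3.reg 8 = y := by rw [regs 8 (by omega) (by omega)]; simp [s2r]
  have s3n : Net n s3.arr (ends tr) ((live.erase i).erase j) :=
    s2n.congr (fun _ _ => rfl) fun k _ _ => by rw [h3.arrs k (by omega)]; rfl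
  refine attach_spec s3 (.ser Ta Tb) (by rw [regs 1 (by omega) (by omega)]; simp [s2r, n1]) s3n
    (fun k hm => ?_) h3.rep (by rw [r7, BT.src, sa1]) (by rw [r8, BT.snk, sb2]) (by omega) good'
    (by simp; omega) hV hN hN' fun t live' tr' hc ht =>
      hQ t live' tr' (by omega) ⟨ht.inv, ht.last, ?_, ?_, ?_, ?_, ?_⟩
  · have := rep k (Finset.mem_of_mem_erase (Finset.mem_of_mem_erase hm))
    refine ⟨by omega, this.2.congr fun l h1 h2 p hp => ?_⟩
    rw [old l p (by omega), tabs l h1 h2]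
  · have := ht.ends
    omega
  · intro k h1 h2
    rw [ht.regs k h1 h2, regs k h1 (by omega)]
    simp [s2r, show k ≠ 7 by omega, show k ≠ 8 by omega, show k ≠ 9 by omega, show k ≠ 10 by omega,
      show k ≠ 11 by omega]
  · intro k h1
    rw [ht.arrs k h1, h3.arrs k (by omega)]
    exact arrs2 k (by omega)
  -- Nodes other than `x`, `y` and `v` keep their degree, and `v` itself is left without edges. So
  -- only the ends of the new edge can become candidates.
  · intro w hw
    by_cases hwx : w = x
    · have := ht.ends; omega
    by_cases hwy : w = y
    · have := ht.ends; omega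
    rw [ht.deg w (by omega) (by omega)] at hw
    have h13 : s3.arr 13 = s2.arr 13 := h3.arrs 13 (by omega)
    by_cases hwv : w = v
    · rw [s3n.deg, hwv, endSum, Finset.sum_eq_zero] at hw
      · omega
      · intro k hm
        have : v ≠ (ends tr k).1 ∧ v ≠ (ends tr k).2 := hk' k hm
        rw [if_neg this.1, if_neg this.2]
    · refine .inr (.inr ⟨?_, hwv⟩)
      rw [h13, s2d w hwv hwy, s1d w hwx hwv] at hw
      exact hw
  · rw [ht.fuel, h3.fuel]
    simp [s2f, s1f]

/-- The graph is simple and has no node of degree two, so by `SP.progress` it consists of one edge,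
which must be the last one inserted. -/
theorem Inv.eq_singleton {n : ℕ} {E : Multiset (Sym2 ℕ)} {s : St} {live : Finset ℕ} {tr : ℕ → BT}
    (inv : Inv n E s live tr 0) (hl : s.reg 3 ∈ live) (hd : ∀ w < n, s.arr 13 w ≠ 2) :
    live = {s.reg 3} := by
  obtain ⟨n1, net, rep, good, mass⟩ := inv
  obtain ⟨a, b, sp⟩ := good.sp
  rw [add_zero, Multiset.map_map] at sp
  set f : ℕ → Sym2 ℕ := (fun B : BT => s(B.src, B.snk)) ∘ tr with hf
  rcases sp.progress with h | ⟨e, E', h⟩ | ⟨x, v, y, F, -, -, h, hF⟩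
  · rw [Multiset.card_map, Finset.card_val] at h
    obtain ⟨i, rfl⟩ := Finset.card_eq_one.1 h
    rw [Finset.mem_singleton.1 hl]
  -- Two live edges with the same ends would occupy the same cell of the matrix.
  · have hnd : (live.val.map f).Nodup := by
      refine Multiset.Nodup.map_on (fun i hi j hj hij => ?_) live.nodup
      exact (net.cell_eq hi hij).symm.trans (net.cell_eq hj rfl)
    rw [h] at hnd
    simp at hnd
  · exfalso
    have hv : v < n := by
      have : s(x, v) ∈ live.val.map f := by simp [h]
      obtain ⟨i, hi, he⟩ := Multiset.mem_map.1 this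
      have hlt := net.lt i hi
      have hv : v ∈ f i := by simp [he]
      rcases Sym2.mem_iff.1 hv with hv | hv <;> rw [hv]
      exacts [hlt.1, hlt.2]
    refine hd v hv ?_
    have hsum : s.arr 13 v = ((live.val.map f).map fun e => if v ∈ e then 1 else 0).sum := by
      rw [net.deg, Multiset.map_map]
      refine Finset.sum_congr rfl fun i _ => ?_
      simp only [Function.comp_apply, hf, ends, Sym2.mem_iff]
      split_ifs <;> simp_all <;> congr
    have h0 : (F.map fun e => if v ∈ e then 1 else 0).sum = 0 :=
      Multiset.sum_eq_zero fun c hc => by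
        obtain ⟨e, he, rfl⟩ := Multiset.mem_map.1 hc
        exact if_neg fun hv => hF ⟨e, he, hv⟩
    rw [hsum, h]
    simp [h0]

/-! ### Reading the edges and working off the queue. -/

theorem getD_encodeEdgeList (n : ℕ) (es : List (ℕ × ℕ)) : (encodeEdgeList n es).getD 0 0 = n ∧
    (encodeEdgeList n es).getD 1 0 = es.length ∧ ∀ (r : ℕ) (h : r < es.length),
      (encodeEdgeList n es).getD (2 * r + 2) 0 = es[r].1 ∧
      (encodeEdgeList n es).getD (2 * r + 3) 0 = es[r].2 := by
  refine ⟨rfl, rfl, fun r h => ?_⟩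
  simp only [encodeEdgeList, List.getD_cons_succ]
  induction es generalizing r with
  | nil => simp at h
  | cons e es ih =>
    cases r with
    | zero => simp
    | succ r =>
      have := ih r (by simpa using h)
      simpa [mul_add] using this

/-- Fill the queue, and the table of the square roots. -/
def fillTables : Cmd :=
  .while (.minus (.var 1) (.var 5))
    (.put 17 (.var 5) (.var 5) ;; .put 16 (.times (.var 5) (.var 5)) (.var 5) ;;
      .set 5 (.plus (.var 5) (.lit 1)))

/-- Read the edges. -/
def readEdges : Cmd :=
  .while (.var 2)
    (.set 2 (.minus (.var 2) (.lit 1)) ;;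
      .set 7 (.get 0 (.plus (.times (.lit 2) (.var 2)) (.lit 2))) ;;
      .set 8 (.get 0 (.plus (.times (.lit 2) (.var 2)) (.lit 3))) ;; newEdge ;; attach)

/-- Remove the nodes of degree two. -/
def reduceAll : Cmd :=
  .while (.minus (.var 5) (.var 4))
    (.set 6 (.get 17 (.var 4)) ;; .set 4 (.plus (.var 4) (.lit 1)) ;;
      .ite (.eq (.get 13 (.var 6)) (.lit 2))
        (reduce ;; .put 17 (.var 5) (.var 7) ;; .set 5 (.plus (.var 5) (.lit 1)) ;;
          .put 17 (.var 5) (.var 8) ;; .set 5 (.plus (.var 5) (.lit 1))) .skip)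

theorem fillTables_spec (s : St) (n : ℕ) (h1 : s.reg 1 = n) (h5 : s.reg 5 = 0) (hN : n * n < N)
    (hf : n ≤ s.fuel)
    (hQ : ∀ t : St, (∀ k, k ≠ 5 → t.reg k = s.reg k) → t.reg 5 = n →
      (∀ k, k ≠ 16 → k ≠ 17 → t.arr k = s.arr k) → (∀ i < n, t.arr 17 i = i) →
      (∀ d < n, t.arr 16 (d * d) = d) → t.fuel + n = s.fuel → Q t) : wp N fillTables Q s := by
  have hnn := Nat.le_mul_self n
  refine wp_while_inv (fun t => t.reg 5 ≤ n ∧ (∀ k, k ≠ 5 → t.reg k = s.reg k) ∧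
    (∀ k, k ≠ 16 → k ≠ 17 → t.arr k = s.arr k) ∧ (∀ i < t.reg 5, t.arr 17 i = i) ∧
      (∀ d < t.reg 5, t.arr 16 (d * d) = d) ∧ t.fuel + t.reg 5 = s.fuel) ?_ ?_ ?_ ?_
  · exact ⟨by omega, fun _ _ => rfl, fun _ _ _ => rfl, by simp [h5], by simp [h5], by omega⟩
  · simp
  · rintro t ⟨i1, i2, i3, i4, i5, i6⟩ ht
    have e1 := i2 1 (by omega)
    simp [e1, h1] at ht
    have hm : t.reg 5 * t.reg 5 ≤ n * n := Nat.mul_le_mul i1 i1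
    refine ⟨by omega, ?_⟩
    simp only [wp_seq, wp_put, wp_set]
    simp
    and_intros
    any_goals omega
    · intro k hk; simp [hk, i2]
    · intro k h2 h3; simp [h2, h3, i3]
    · intro i hi
      by_cases h : i = t.reg 5
      · simp [h]
      · rw [Function.update_of_ne h, i4 i (by omega)]
    · intro d hd
      by_cases h : d = t.reg 5
      · simp [h]
      · have h : d < t.reg 5 := by omega
        rw [Function.update_of_ne (Nat.mul_self_lt_mul_self h).ne, i5 d h]
  · rintro t ⟨i1, i2, i3, i4, i5, i6⟩ ht
    have e1 := i2 1 (by omega)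
    simp [e1, h1] at ht
    have : t.reg 5 = n := by omega
    rw [this] at i4 i5 i6
    exact hQ t i2 this i3 i4 i5 i6

/-- Edges are read from last to first, so that register `2` serves as the counter and the unread
edges form an initial segment of the list. Parallel edges are merged at once. -/
theorem readEdges_spec (s : St) (n : ℕ) (es : List (ℕ × ℕ)) (E : Multiset (Sym2 ℕ))
    (hin : ∀ (r : ℕ) (h : r < es.length), s.arr 0 (2 * r + 2) = es[r].1 ∧
      s.arr 0 (2 * r + 3) = es[r].2) (h2 : s.reg 2 = es.length) (hes : es ≠ [])
    (inv : Inv n E s ∅ (fun _ => .edge 0 0) (es.map fun e => BT.edge e.1 e.2 : List BT))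
    (hV : ∀ v, Touches E v → v < n) (hN : (2 * E.card + 2) * (n * n) < N)
    (hN' : 2 * E.card + 3 < N) (hE : E.card = es.length) (hf : es.length ≤ s.fuel)
    (hQ : ∀ t live tr, Inv n E t live tr 0 → t.reg 3 ∈ live →
      (∀ k, k ≠ 2 → k ≠ 3 → (k < 7 ∨ 12 < k) → t.reg k = s.reg k) →
      (∀ k, (k < 12 ∨ 15 < k ∧ k < 18 ∨ 23 < k) → t.arr k = s.arr k) →
      t.fuel + es.length = s.fuel → Q t) : wp N readEdges Q s := by
  obtain ⟨I, hI⟩ : ∃ I : St → Prop, I = fun t => t.reg 2 ≤ es.length ∧ ∃ live tr, Inv n E t live tr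
      ((es.take (t.reg 2)).map fun e => BT.edge e.1 e.2 : List BT) ∧
    (t.reg 2 < es.length → t.reg 3 ∈ live) ∧
    (∀ k, k ≠ 2 → k ≠ 3 → (k < 7 ∨ 12 < k) → t.reg k = s.reg k) ∧
    (∀ k, (k < 12 ∨ 15 < k ∧ k < 18 ∨ 23 < k) → t.arr k = s.arr k) ∧
      t.fuel + es.length = s.fuel + t.reg 2 := ⟨_, rfl⟩
  refine wp_while_inv I ?_ (by simp) ?_ ?_
  · rw [hI]
    refine ⟨h2.le, ∅, fun _ => .edge 0 0, ?_, by omega, fun _ _ _ _ => rfl, fun _ _ => rfl, by omega⟩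
    rw [h2, List.take_length]
    exact inv
  · intro t hIt ht
    rw [hI] at hIt
    obtain ⟨i1, live, tr, i2, i3, i4, i5, i6⟩ := hIt
    simp at ht
    obtain ⟨r, hr⟩ : ∃ r, t.reg 2 = r + 1 := ⟨t.reg 2 - 1, by omega⟩
    have hrl : r < es.length := by omega
    obtain ⟨n1, net, rep, good, mass⟩ := i2
    obtain ⟨e1, e2⟩ := hin r hrl
    have hrest : ((es.take (r + 1)).map fun e => BT.edge e.1 e.2 : List BT) =
        BT.edge es[r].1 es[r].2 ::ₘ ((es.take r).map fun e => BT.edge e.1 e.2 : Multiset BT) := by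
      rw [Multiset.cons_coe, Multiset.coe_eq_coe, List.take_succ_eq_append_getElem hrl,
        List.map_append]
      exact List.perm_append_comm
    rw [hr, hrest] at good mass
    simp only [Multiset.card_cons, Multiset.coe_card, List.length_map, List.length_take] at mass
    rw [Multiset.add_cons] at good
    refine ⟨by omega, ?_⟩
    simp only [wp_seq, wp_set]
    simp [hr, i5, e1, e2]
    refine ⟨by omega, by omega, newEdge_spec _ (by simp; omega) fun t1 h1 => ?_⟩
    have cnt := h1.cnt
    have regs := h1.regs
    have old := h1.old
    have rep1 := h1.rep
    simp at cnt regs old rep1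
    have r7 : t1.reg 7 = es[r].1 := by rw [regs 7 (by omega) (by omega)]; simp
    have r8 : t1.reg 8 = es[r].2 := by rw [regs 8 (by omega) (by omega)]; simp
    have r1 : t1.reg 1 = n := by rw [regs 1 (by omega) (by omega)]; simp [n1]
    have r2 : t1.reg 2 = r := by rw [regs 2 (by omega) (by omega)]; simp
    refine attach_spec t1 _ r1 (net.congr (fun _ _ => rfl) fun k _ _ => ?_) (fun k hm => ?_) rep1
      (by simpa [BT.src] using r7) (by simpa [BT.snk] using r8) (by omega) good
      (by simp; omega) hV hN (by omega) fun u live' tr' hc hu => ?_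
    · rw [h1.arrs k (by omega)]; rfl
    · have := rep k hm
      refine ⟨by omega, this.2.congr fun l h1 h2 p hp => ?_⟩
      rw [old l p (by omega)]
    have hu2 : u.reg 2 = r := by rw [hu.regs 2 (by omega) (by omega), r2]
    rw [hI]
    refine ⟨by omega, live', tr', ?_, fun _ => hu.last, fun k h3 h4 h5 => ?_, fun k hk => ?_, ?_⟩
    · rw [hu2]; exact hu.inv
    · rw [hu.regs k h4 h5, regs k h4 (by omega)]
      simp [h3, show k ≠ 7 by omega, show k ≠ 8 by omega, i4 k h3 h4 h5]
    · rw [hu.arrs k hk, h1.arrs k (by omega)]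
      exact i5 k hk
    · rw [hu.fuel, h1.fuel, hu2]
      simp
      omega
  · intro t hIt ht
    rw [hI] at hIt
    obtain ⟨i1, live, tr, i2, i3, i4, i5, i6⟩ := hIt
    simp at ht
    have := List.length_pos_iff.2 hes
    rw [ht] at i2 i6
    exact hQ t live tr (by simpa using i2) (i3 (by omega)) i4 i5 (by omega)

/-- The queue, in the array `17` from `reg 4` to `reg 5`, contains all nodes of degree two. -/
structure QInv (n : ℕ) (E : Multiset (Sym2 ℕ)) (K : ℕ) (s t : St) : Prop where
  inv : ∃ live tr, Inv n E t live tr 0 ∧ t.reg 3 ∈ live ∧ t.reg 5 + 2 * live.card ≤ K ∧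
    s.fuel + (t.reg 5 - t.reg 4) + 2 * live.card ≤ t.fuel + K
  le : t.reg 4 ≤ t.reg 5
  lt : ∀ i < t.reg 5, t.arr 17 i < n
  deg : ∀ w < n, t.arr 13 w = 2 → ∃ i, t.reg 4 ≤ i ∧ i < t.reg 5 ∧ t.arr 17 i = w
  sq : ∀ d < n, t.arr 16 (d * d) = d
  regs : ∀ k, 12 < k → t.reg k = s.reg k
  arrs : ∀ k, (k < 12 ∨ 23 < k) → t.arr k = s.arr k

/-- A reduction puts two nodes on the queue and lowers the number of live edges by at least one, so
the end of the queue plus twice this number stays below `K`. Every iteration takes one node from the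
queue, which bounds the iterations by `K`. -/
theorem reduceAll_spec (s : St) (n K : ℕ) (E : Multiset (Sym2 ℕ)) (h : QInv n E K s s)
    (hV : ∀ v, Touches E v → v < n) (hN : (2 * E.card + 2) * (n * n) < N)
    (hN' : 2 * E.card + 2 < N) (hK : K < N) (hf : K ≤ s.fuel)
    (hQ : ∀ t tr, Inv n E t {t.reg 3} tr 0 → (∀ k, 12 < k → t.reg k = s.reg k) →
      (∀ k, (k < 12 ∨ 23 < k) → t.arr k = s.arr k) → s.fuel ≤ t.fuel + K → Q t) :
    wp N reduceAll Q s := by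
  refine wp_while_inv (QInv n E K s) h (by simp) ?_ ?_
  · rintro t ⟨⟨live, tr, inv, last, hc, hfuel⟩, le, lt, deg, sq, regs, arrs⟩ ht
    simp at ht
    have hlive : 0 < live.card := Finset.card_pos.2 ⟨_, last⟩
    refine ⟨by omega, ?_⟩
    set v := t.arr 17 (t.reg 4) with hv
    have hvn : v < n := lt _ (by omega)
    simp only [wp_seq, wp_set, wp_ite, wp_skip]
    simp [← hv]
    refine ⟨by omega, fun hd => ?_, fun hd => ?_⟩
    · refine reduce_spec (live := live) (tr := tr) _ ⟨by simp [inv.n1], inv.net,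
        by simpa using inv.rep, inv.good, by simpa using inv.mass⟩ (by simpa using hvn)
        (by simpa using hd) sq hV hN hN' fun u live' tr' hc' hu => ?_
      obtain ⟨⟨n1, net, rep, good, mass⟩, last', lt', regs', arrs', deg', fuel'⟩ := hu
      have r4 := regs' 4 (by omega) (by omega)
      have r5 := regs' 5 (by omega) (by omega)
      have a17 := arrs' 17 (by omega)
      simp at r4 r5 a17 deg' fuel'
      simp
      and_intros
      any_goals omega
      refine ⟨⟨live', tr', ⟨by simp [n1], net.congr (fun _ _ => rfl) fun k h1 h2 => ?_,
        fun i hi => ⟨by simpa using (rep i hi).1, (rep i hi).2.congr fun k h1 h2 j hj => ?_⟩, good,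
        by simpa using mass⟩, by simpa using last', ?_, ?_⟩, ?_, ?_, ?_, ?_, ?_, ?_⟩
      · simp [show k ≠ 17 by omega]
      · simp [show k ≠ 17 by omega]
      · simp; omega
      · simp; omega
      · simp; omega
      · intro i hi
        simp at hi
        simp only [setR_arr, setA_arr_self, setR_reg_self, setA_reg, Function.update_apply, a17]
        split_ifs
        · exact lt'.2
        · exact lt'.1
        · exact lt i (by omega)
      · intro w hw hdw
        simp at hdw
        rcases deg' w hdw with h | h | ⟨h, hne⟩
        · exact ⟨u.reg 5, by simp; omega, by simp, by simp [h]⟩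
        · exact ⟨u.reg 5 + 1, by simp; omega, by simp, by simp [h]⟩
        · obtain ⟨i, h1, h2, h3⟩ := deg w hw h
          have hi : i ≠ t.reg 4 := by rintro rfl; exact hne h3.symm
          refine ⟨i, by simp; omega, by simp; omega, ?_⟩
          simp [show i ≠ u.reg 5 by omega, show i ≠ u.reg 5 + 1 by omega, a17, h3]
      · intro d hd'
        simp [arrs' 16 (by omega), sq d hd']
      · intro k hk
        simp [show k ≠ 5 by omega, regs' k (by omega) (by omega), show k ≠ 6 by omega,
          show k ≠ 4 by omega, regs k hk]
      · intro k hk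
        simp [show k ≠ 17 by omega, arrs' k (by omega), arrs k hk]
    · refine ⟨⟨live, tr, ⟨by simp [inv.n1], inv.net, by simpa using inv.rep, inv.good,
        by simpa using inv.mass⟩, by simpa using last, by simpa using hc, by simp; omega⟩,
        by simp; omega, by simpa using lt, fun w hw hdw => ?_, sq, fun k hk => ?_, arrs⟩
      · simp at hdw
        obtain ⟨i, h1, h2, h3⟩ := deg w hw hdw
        have hi : i ≠ t.reg 4 := by rintro rfl; exact hd (by rw [hv, h3]; exact hdw)
        exact ⟨i, by simp; omega, by simpa using h2, by simpa using h3⟩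
      · simp [show k ≠ 6 by omega, show k ≠ 4 by omega, regs k hk]
  · rintro t ⟨⟨live, tr, inv, last, hc, hfuel⟩, le, lt, deg, sq, regs, arrs⟩ ht
    simp at ht
    have h1 := inv.eq_singleton last fun w hw h => by
      obtain ⟨i, h1, h2, -⟩ := deg w hw h
      omega
    subst h1
    exact hQ t tr inv regs arrs (by omega)

/-- Compute a decomposition tree of the graph. -/
def decompose : Cmd :=
  .set 1 (.get 0 (.lit 0)) ;; .set 2 (.get 0 (.lit 1)) ;; fillTables ;; readEdges ;; reduceAll

/-- The iterations are `n` for the tables, `|E|` for reading and `n + 4 * |E|` for the queue, which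
starts with all nodes; the fuel `F` is left for the continuation. -/
theorem decompose_spec (n F : ℕ) (es : List (ℕ × ℕ)) {a b : ℕ}
    (sp : SP (es.map fun e => s(e.1, e.2) : List (Sym2 ℕ)) a b) (hes : es ≠ [])
    (hV : ∀ v, Touches (es.map fun e => s(e.1, e.2) : List (Sym2 ℕ)) v → v < n)
    (hN : (2 * es.length + 2) * (n * n) < N) (hN' : n + 4 * es.length + 10 < N)
    (hQ : ∀ (t : St) (B : BT), B.WF → B.edges = (es.map fun e => s(e.1, e.2) : List (Sym2 ℕ)) →
      0 < t.reg 3 → t.reg 3 ≤ 2 * es.length → BRep t.arr (t.reg 3) B → F ≤ t.fuel → Q t) :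
    wp N decompose Q (St.init (encodeEdgeList n es) (F + (2 * n + 5 * es.length))) := by
  obtain ⟨g0, g1, g⟩ := getD_encodeEdgeList n es
  set E : Multiset (Sym2 ℕ) := ((es.map fun e => s(e.1, e.2) : List (Sym2 ℕ)) : Multiset (Sym2 ℕ)) with hE
  have hcE : E.card = es.length := by simp [hE]
  have hm := List.length_pos_iff.2 hes
  rw [← hcE] at hN
  have c1 : 1 * (n * n) ≤ (2 * E.card + 2) * (n * n) := Nat.mul_le_mul_right _ (by omega)
  set s0 := St.init (encodeEdgeList n es) (F + (2 * n + 5 * es.length)) with hs0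
  have r0 : ∀ k, k ≠ 0 → s0.reg k = 0 := fun k hk => by simp [hs0, St.init, hk]
  -- All arrays but the input start with zeros, and zeros represent the empty graph, so the matrix
  -- needs no initialisation.
  have a0 : ∀ k, k ≠ 0 → s0.arr k = fun _ => 0 := fun k hk => by ext; simp [hs0, St.init, hk]
  have a1 : s0.arr 0 = fun i => (encodeEdgeList n es).getD i 0 := by ext; simp [hs0, St.init]
  have f0 : s0.fuel = F + (2 * n + 5 * es.length) := rfl
  clear_value s0
  simp only [decompose, wp_seq, wp_set]
  simp only [Ex.eval, a1, g0, g1, setR_arr]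
  refine ⟨by simp, by simp, fillTables_spec _ n (by simp) (by simp [r0]) (by omega)
    (by simp; omega) fun t1 p1 p2 p3 p4 p5 p6 => ?_⟩
  simp at p6
  have q2 : t1.reg 2 = es.length := by rw [p1 2 (by omega)]; simp
  have q3 : t1.reg 3 = 0 := by rw [p1 3 (by omega)]; simp [r0]
  rw [wp_seq]
  refine readEdges_spec t1 n es E (fun r h => ?_) q2 hes ⟨?_, ⟨?_, ?_, ?_, ?_, ?_, ?_, ?_, ?_⟩, ?_, ?_, ?_⟩ hV hN
    (by omega) hcE (by omega) fun t2 live tr inv last k1 k2 k3 => ?_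
  · rw [p3 0 (by omega) (by omega)]
    simpa [a1] using g r h
  · rw [p1 1 (by omega)]; simp
  any_goals simp
  · intro u _ v _
    rw [p3 12 (by omega) (by omega)]
    simp [a0]
  · rw [p3 13 (by omega) (by omega)]; ext; simp [a0, endSum]
  · rw [p3 14 (by omega) (by omega)]; ext; simp [a0, endSum]
  · rw [p3 15 (by omega) (by omega)]; ext; simp [a0, endSum]
  · exact Good.init sp
  · omega
  have hmass := inv.mass
  have hc : live.card ≤ 2 * es.length := by omega
  have l5 : t2.reg 5 = n := by rw [k1 5 (by omega) (by omega) (by omega), p2]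
  have l4 : t2.reg 4 = 0 := by
    rw [k1 4 (by omega) (by omega) (by omega), p1 4 (by omega)]
    simp [r0]
  have l17 := k2 17 (by omega)
  refine reduceAll_spec t2 n (n + 4 * es.length) E ⟨⟨live, tr, inv, last, by omega, by omega⟩,
    by omega, fun i hi => ?_, fun w hw _ => ⟨w, by omega, by omega, ?_⟩, fun d hd => ?_,
    fun _ _ => rfl, fun _ _ => rfl⟩ hV hN (by omega) (by omega) (by omega)
    fun t tr inv _ _ h3 => ?_
  · rw [l17, p4 i (by omega)]; omega
  · rw [l17, p4 w hw]
  · rw [k2 16 (by omega), p5 d hd]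
  · have hr := inv.rep (t.reg 3) (by simp)
    have hg := inv.good
    have hm := inv.mass
    have hp := inv.net.pos (t.reg 3) (by simp)
    simp at hg hm
    obtain ⟨wf, he⟩ := hg.wf
    exact hQ t _ wf he (by omega) (by omega) hr.2 (by omega)

/-! ### Writing the encoding of the tree -/

/-- Put a task on the stack: write the node `i` with source `w` as a part of a tree of kind `m`, or the
number `w` if `i` is zero. -/
def pushTask (i w m : Ex) : Cmd :=
  .put 24 (.var 4) i ;; .put 25 (.var 4) w ;; .put 26 (.var 4) m ;; .set 4 (.plus (.var 4) (.lit 1))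

/-- Write a number. -/
def write (v : Ex) : Cmd := .put 0 (.var 0) v ;; .set 0 (.plus (.var 0) (.lit 1))

/-- Write the start of the encoding of a node, and put its end on the stack. -/
def writeNode : Cmd :=
  .ite (.var 9)
    (pushTask (.lit 0) (.get 23 (.var 5)) (.lit 0) ;; pushTask (.lit 0) (.var 9) (.lit 0))
    (write (.lit 0) ;; write (.plus (.get 23 (.var 5)) (.lit 1)) ;;
      pushTask (.lit 0) (.minus (.plus (.get 18 (.var 5)) (.get 19 (.var 5))) (.var 6)) (.lit 0))

/-- Put the children of a node on the stack. -/
def expand : Cmd :=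
  .ite (.get 20 (.var 5))
    (.set 8 (.get 20 (.var 5)) ;; .set 10 (.get 21 (.var 5)) ;;
      .ite (.eq (.var 9) (.lit 2)) (.set 11 (.var 6))
        (.ite (.eq (.get 18 (.var 5)) (.var 6)) .skip
          (.set 8 (.get 21 (.var 5)) ;; .set 10 (.get 20 (.var 5))) ;;
        .set 11 (.minus (.plus (.get 18 (.var 8)) (.get 19 (.var 8))) (.var 6))) ;;
      pushTask (.var 10) (.var 11) (.var 9) ;; pushTask (.var 8) (.var 6) (.var 9))
    (write (.var 6))

/-- Work off the stack. -/
def writeLoop : Cmd :=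
  .while (.var 4)
    (.set 4 (.minus (.var 4) (.lit 1)) ;; .set 5 (.get 24 (.var 4)) ;; .set 6 (.get 25 (.var 4)) ;;
      .set 7 (.get 26 (.var 4)) ;;
      .ite (.var 5)
        (.set 9 (.get 22 (.var 5)) ;; .ite (.eq (.var 9) (.var 7)) .skip writeNode ;; expand)
        (write (.var 6)))

/-- The list `l` has been written, with at most `f` iterations, and the stack below `b` is
unchanged. -/
structure WritePost (s t : St) (b : ℕ) (l : List ℕ) (f : ℕ) : Prop where
  len : t.reg 0 = s.reg 0 + l.length
  new : ∀ (j : ℕ) (h : j < l.length), t.arr 0 (s.reg 0 + j) = l[j]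
  old : ∀ j < s.reg 0, t.arr 0 j = s.arr 0 j
  stk : ∀ k, 24 ≤ k → k ≤ 26 → ∀ j < b, t.arr k j = s.arr k j
  tabs : ∀ k, 18 ≤ k → k ≤ 23 → t.arr k = s.arr k
  fuel : s.fuel ≤ t.fuel + f

theorem WritePost.trans {s t u : St} {b c f g : ℕ} {l l' : List ℕ} (h : WritePost s t b l f)
    (h' : WritePost t u c l' g) (hbc : b ≤ c) : WritePost s u b (l ++ l') (f + g) := by
  refine ⟨?_, fun j hj => ?_, fun j hj => ?_, fun k h1 h2 j hj => ?_, fun k h1 h2 => ?_, ?_⟩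
  · rw [h'.len, h.len, List.length_append, add_assoc]
  · by_cases hl : j < l.length
    · rw [List.getElem_append_left hl, h'.old _ (by rw [h.len]; omega), h.new j hl]
    · rw [List.getElem_append_right (by omega), ← h'.new _ (by simp at hj; omega), h.len]
      congr 1
      omega
  · rw [h'.old j (by rw [h.len]; omega), h.old j hj]
  · rw [h'.stk k h1 h2 j (by omega), h.stk k h1 h2 j hj]
  · rw [h'.tabs k h1 h2, h.tabs k h1 h2]
  · have := h.fuel
    have := h'.fuel
    omega

theorem WritePost.mono {s t : St} {b f g : ℕ} {l : List ℕ} (h : WritePost s t b l f) (hg : f ≤ g) :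
    WritePost s t b l g :=
  ⟨h.len, h.new, h.old, h.stk, h.tabs, h.fuel.trans (by omega)⟩

/-- The task `(i, w, m)` is to write the list `l`, with at most `f` iterations. -/
def Writes (N : ℕ) (A : ℕ → ℕ → ℕ) (i w m : ℕ) (l : List ℕ) (f : ℕ) : Prop :=
  ∀ (Q : St → Prop) (s : St) (b : ℕ), (∀ k, 18 ≤ k → k ≤ 23 → s.arr k = A k) → s.reg 4 = b + 1 →
    s.arr 24 b = i → s.arr 25 b = w → s.arr 26 b = m → f ≤ s.fuel → b + 4 * f < N →
    s.reg 0 + l.length < N →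
    (∀ t, t.reg 4 = b → WritePost s t b l f → wp N writeLoop Q t) → wp N writeLoop Q s

theorem Writes.pair {A : ℕ → ℕ → ℕ} {c w m d x p f g : ℕ} {l l' : List ℕ}
    (h : Writes N A c w m l f) (h' : Writes N A d x p l' g) (s : St) (b : ℕ)
    (tabs : ∀ k, 18 ≤ k → k ≤ 23 → s.arr k = A k) (h4 : s.reg 4 = b + 2)
    (c24 : s.arr 24 (b + 1) = c) (c25 : s.arr 25 (b + 1) = w) (c26 : s.arr 26 (b + 1) = m)
    (d24 : s.arr 24 b = d) (d25 : s.arr 25 b = x) (d26 : s.arr 26 b = p) (hf : f + g ≤ s.fuel)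
    (hN : b + 1 + 4 * f < N) (hN' : b + 4 * g < N) (h0 : s.reg 0 + (l ++ l').length < N)
    (hQ : ∀ t, t.reg 4 = b → WritePost s t b (l ++ l') (f + g) → wp N writeLoop Q t) :
    wp N writeLoop Q s := by
  rw [List.length_append] at h0
  refine h Q s (b + 1) tabs h4 c24 c25 c26 (by omega) hN (by omega) fun t t4 ht => ?_
  have hfuel := ht.fuel
  refine h' Q t b (fun k h1 h2 => by rw [ht.tabs k h1 h2, tabs k h1 h2]) t4
    (by rw [ht.stk 24 (by omega) (by omega) b (by omega), d24])
    (by rw [ht.stk 25 (by omega) (by omega) b (by omega), d25])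
    (by rw [ht.stk 26 (by omega) (by omega) b (by omega), d26])
    (by omega) hN' (by rw [ht.len]; omega) fun u u4 hu => hQ u u4 ?_
  have ht' : WritePost s t b l f := ⟨ht.len, ht.new, ht.old, fun k h1 h2 j hj =>
    ht.stk k h1 h2 j (by omega), ht.tabs, ht.fuel⟩
  exact ht'.trans hu le_rfl

theorem writes_number (A : ℕ → ℕ → ℕ) (w : ℕ) : Writes N A 0 w 0 [w] 1 := by
  intro Q s b tabs h4 a24 a25 a26 hf hb h0 hQ
  simp at h0
  refine wp_while_true (by simp) (by simp [h4]) (by omega) ?_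
  simp only [write, wp_seq, wp_set, wp_put, wp_ite]
  simp [h4, a24, a25]
  refine ⟨h0, hQ _ (by simp) ?_⟩
  constructor <;> simp
  · intro j hj; rw [Function.update_of_ne (by omega)]
  · intro k h1 h2 j hj; simp [show k ≠ 0 by omega]
  · intro k h1 h2; simp [show k ≠ 0 by omega]
  · omega

/-- The node `i` with the tree `B` is expanded. -/
def Expands (N : ℕ) (A : ℕ → ℕ → ℕ) (i : ℕ) (B : BT) : Prop :=
  ∀ (Q : St → Prop) (s : St) (b : ℕ) (C : BT), B.Same C →
    (∀ k, 18 ≤ k → k ≤ 23 → s.arr k = A k) → s.reg 4 = b → s.reg 5 = i → s.reg 6 = C.src →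
    s.reg 9 = B.kind → 5 * B.edges.card - 6 ≤ s.fuel → b + 4 * (5 * B.edges.card - 6) + 4 < N →
    s.reg 0 + C.body.length < N →
    (∀ t, t.reg 4 = b → WritePost s t b C.body (5 * B.edges.card - 6) → wp N writeLoop Q t) →
    wp N expand (wp N writeLoop Q) s

theorem BT.Same.sum_ends {B C : BT} (h : B.Same C) : B.src + B.snk = C.src + C.snk := by
  rcases h with rfl | rfl
  · rfl
  · rw [B.src_rev.1, B.src_rev.2, add_comm]

theorem BT.two_le_card {B : BT} (h : B.kind ≠ 0) : 2 ≤ B.edges.card := by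
  cases B with
  | edge u v => exact absurd rfl h
  | ser a b | par a b =>
    have := a.size_le
    have := b.size_le
    rw [BT.edges, Multiset.card_add]
    omega

/-- With `e` edges, the bound is one iteration for the task, `5 * e - 6` for the expansion and at
most two for the closing numbers, together `5 * e - 3`. Two parts with these bounds add up to the `5
* e - 6` of their composition. -/
theorem Expands.writes {A : ℕ → ℕ → ℕ} {i : ℕ} {B C : BT} (h : Expands N A i B) (hr : BRep A i B)
    (hi : i ≠ 0) (hB : B.src + B.snk < N) (hC : B.Same C) (m : ℕ) :
    Writes N A i C.src m (C.embed m C.body) (5 * B.edges.card - 3) := by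
  intro Q s b tabs h4 a24 a25 a26 hf hb h0 hQ
  obtain ⟨e18, e19, e22, e23⟩ := hr.entry
  have hsize := B.size_le
  have hsum := hC.sum_ends
  rw [BT.embed, BT.close, hC.kind] at h0 hQ
  refine wp_while_true (by simp) (by simp [h4]) (by omega) ?_
  simp only [wp_seq, wp_set, wp_ite, wp_skip]
  simp [h4, a24, a25, a26, hi, tabs, e22]
  refine ⟨fun hk => ?_, fun hk => ?_⟩
  · rw [if_pos hk] at h0 hQ
    refine h Q _ b C hC (by simpa using tabs) (by simp) (by simp) (by simp) (by simp)
      (by simp; omega) (by omega) (by simpa using h0) fun t t4 ht => hQ t t4 ?_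
    refine ⟨by simpa using ht.len, by simpa using ht.new, by simpa using ht.old, by simpa using ht.stk,
      by simpa using ht.tabs, ?_⟩
    have := ht.fuel
    simp at this
    omega
  · rw [if_neg hk] at h0 hQ
    simp only [writeNode, write, pushTask, wp_seq, wp_set, wp_ite, wp_put]
    simp [tabs, e18, e19, e23]
    refine ⟨fun hk0 => ?_, fun hk0 => ?_⟩
    · rw [if_neg hk0] at h0 hQ
      simp at h0
      -- Two closing numbers occur only for trees that are not paths. These have at least two edges,
      -- so `5 * e - 6` is not truncated; for a single edge it is `0`.
      have h2 := BT.two_le_card hk0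
      rw [hC.size] at hQ
      refine ⟨by omega, by omega, ?_⟩
      refine h Q _ (b + 2) C hC (fun k h1 h2 => ?_) (by simp) (by simp) (by simp) (by simp)
        (by simp; omega) (by omega) (by simp; omega) fun t t4 ht => ?_
      · simp [show k ≠ 24 by omega, show k ≠ 25 by omega, show k ≠ 26 by omega, tabs k h1 h2]
      have hfuel := ht.fuel
      have hlen := ht.len
      have hstk := ht.stk
      simp at hfuel hlen
      refine Writes.pair (writes_number A B.kind) (writes_number A B.size) t b (fun k h1 h2 => ?_)
        t4 ?_ ?_ ?_ ?_ ?_ ?_ (by omega) (by omega) (by omega) (by simp; omega) fun u u4 hu =>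
          hQ u u4 ?_
      · rw [ht.tabs k h1 h2]
        simp [show k ≠ 24 by omega, show k ≠ 25 by omega, show k ≠ 26 by omega, tabs k h1 h2]
      any_goals rw [hstk _ (by omega) (by omega) _ (by omega)]; simp
      refine WritePost.mono (WritePost.trans (b := b) (c := b) (f := 5 * B.edges.card - 6 + 1)
        (g := 1 + 1) ⟨?_, ?_, ?_, ?_, ?_, ?_⟩ hu le_rfl) (by omega)
      · exact hlen
      · simpa using ht.new
      · simpa using ht.old
      · intro k h1 h2 j hj
        rw [ht.stk k h1 h2 j (by omega)]
        simp only [setA_arr_of_ne_index _ _ _ _ _ (show j ≠ b + 1 by omega),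
          setA_arr_of_ne_index _ _ _ _ _ (show j ≠ b by omega), setR_arr, tick_arr]
      · intro k h1 h2
        rw [ht.tabs k h1 h2]
        simp [show k ≠ 24 by omega, show k ≠ 25 by omega, show k ≠ 26 by omega]
      · omega
    · rw [if_pos hk0] at h0 hQ
      simp at h0
      rw [hC.size] at hQ
      -- The wanted source is known from the task; the sum of both terminals does not depend on the
      -- orientation, so a subtraction gives the sink.
      have hsnk : B.src + B.snk - C.src = C.snk := by omega
      simp [hsnk]
      and_intros
      any_goals omega
      refine h Q _ (b + 1) C hC (fun k h1 h2 => ?_) (by simp) (by simp) (by simp) (by simp)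
        (by simp; omega) (by omega) (by simp; omega) fun t t4 ht => ?_
      · simp [show k ≠ 24 by omega, show k ≠ 25 by omega, show k ≠ 26 by omega,
          show k ≠ 0 by omega, tabs k h1 h2]
      have hfuel := ht.fuel
      have hlen := ht.len
      have hstk := ht.stk
      have hnew := ht.new
      have hold := ht.old
      simp at hfuel hlen hnew hold
      refine writes_number A C.snk Q t b (fun k h1 h2 => ?_) t4 ?_ ?_ ?_ (by omega) (by omega)
        (by simp; omega) fun u u4 hu => hQ u u4 ?_
      · rw [ht.tabs k h1 h2]
        simp [show k ≠ 24 by omega, show k ≠ 25 by omega, show k ≠ 26 by omega,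
          show k ≠ 0 by omega, tabs k h1 h2]
      any_goals rw [hstk _ (by omega) (by omega) _ (by omega)]; simp
      refine WritePost.mono (WritePost.trans (b := b) (c := b) (f := 5 * B.edges.card - 6 + 1)
        (g := 1) (l := 0 :: (B.size + 1) :: C.body) ⟨?_, ?_, ?_, ?_, ?_, ?_⟩ hu le_rfl) (by omega)
      · simp; omega
      · intro j hj
        rcases j with - | - | j
        · simp [hold (s.reg 0) (by omega)]
        · simp [hold (s.reg 0 + 1) (by omega)]
        · simp at hj
          have := hnew j (by omega)
          simp
          rw [← this]
          congr 1
          omega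
      · intro j hj
        rw [hold j (by omega), Function.update_of_ne (by omega), Function.update_of_ne (by omega)]
      · intro k h1 h2 j hj
        rw [ht.stk k h1 h2 j (by omega)]
        simp only [setA_arr_of_ne_index _ _ _ _ _ (show j ≠ b by omega), setR_arr, tick_arr,
          setA_arr_ne _ _ _ _ _ (show k ≠ 0 by omega), setA_reg, setR_reg_self]
      · intro k h1 h2
        rw [ht.tabs k h1 h2]
        simp [show k ≠ 24 by omega, show k ≠ 25 by omega, show k ≠ 26 by omega, show k ≠ 0 by omega]
      · omega

theorem expands_edge (A : ℕ → ℕ → ℕ) (i b u v : ℕ) (h : Entry A i 0 b (.edge u v)) :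
    Expands N A i (.edge u v) := by
  intro Q s b C hC tabs r4 r5 r6 r9 hf hb h0 hQ
  obtain ⟨x, y, rfl⟩ : ∃ x y, C = .edge x y := by
    rcases hC with rfl | rfl
    exacts [⟨_, _, rfl⟩, ⟨_, _, rfl⟩]
  simp [BT.body] at h0 hQ
  simp only [expand, write, wp_ite, wp_seq, wp_put, wp_set]
  simp [r5, tabs, h.left, r6, BT.src]
  refine ⟨h0, hQ _ (by simpa using r4) ?_⟩
  constructor <;> simp
  · intro j hj; rw [Function.update_of_ne (by omega)]
  · intro k h1 h2 j hj; simp [show k ≠ 0 by omega]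
  · intro k h1 h2; simp [show k ≠ 0 by omega]

theorem expands_pair {A : ℕ → ℕ → ℕ} {B : BT} (s s1 : St) (b c w d x k : ℕ) (D E : BT)
    (hs : s1.arr = s.arr ∧ s1.fuel = s.fuel ∧ s1.reg 0 = s.reg 0) (h4 : s1.reg 4 = b)
    (h6 : s1.reg 6 = w) (h8 : s1.reg 8 = c) (h9 : s1.reg 9 = k) (h10 : s1.reg 10 = d)
    (h11 : s1.reg 11 = x) (tabs : ∀ k, 18 ≤ k → k ≤ 23 → s.arr k = A k)
    (hc : Writes N A c w k (D.embed k D.body) (5 * D.edges.card - 3))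
    (hd : Writes N A d x k (E.embed k E.body) (5 * E.edges.card - 3))
    (hB : B.edges.card = D.edges.card + E.edges.card)
    (hf : 5 * B.edges.card - 6 ≤ s.fuel) (hN : b + 4 * (5 * B.edges.card - 6) + 4 < N)
    (h0 : s.reg 0 + (D.embed k D.body ++ E.embed k E.body).length < N)
    (hQ : ∀ t, t.reg 4 = b → WritePost s t b (D.embed k D.body ++ E.embed k E.body)
      (5 * B.edges.card - 6) → wp N writeLoop Q t) :
    wp N (pushTask (.var 10) (.var 11) (.var 9))
      (wp N (pushTask (.var 8) (.var 6) (.var 9)) (wp N writeLoop Q)) s1 := by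
  have hD := D.size_le
  have hE := E.size_le
  obtain ⟨ha, hfuel, hr0⟩ := hs
  simp only [pushTask, wp_seq, wp_put, wp_set]
  simp [h4, h6, h8, h9, h10, h11, ha]
  refine ⟨by omega, by omega, ?_⟩
  refine hc.pair hd _ b (fun k h1 h2 => ?_) (by simp) (by simp) (by simp) (by simp) (by simp)
    (by simp) (by simp) (by simp; omega) (by omega) (by omega) (by simpa [hr0] using h0)
    fun t t4 ht => hQ t t4 ?_
  · simp [show k ≠ 24 by omega, show k ≠ 25 by omega, show k ≠ 26 by omega, ha, tabs k h1 h2]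
  refine ⟨by simpa [hr0] using ht.len, by simpa [hr0] using ht.new,
    by simpa [hr0, ha] using ht.old, fun k h1 h2 j hj => ?_, fun k h1 h2 => ?_, ?_⟩
  · rw [ht.stk k h1 h2 j hj]
    simp only [setA_arr_of_ne_index _ _ _ _ _ (show j ≠ b + 1 by omega),
      setA_arr_of_ne_index _ _ _ _ _ (show j ≠ b by omega), setR_arr, ha]
  · rw [ht.tabs k h1 h2]
    simp [show k ≠ 24 by omega, show k ≠ 25 by omega, show k ≠ 26 by omega, ha]
  · have := ht.fuel
    simp [hfuel] at this
    omega

theorem BT.WF.rev {B : BT} (h : B.WF) : B.rev.WF := by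
  refine ⟨h.typed.rev, ?_⟩
  have := h.nodup
  rw [nodes, B.src_rev.1, B.src_rev.2]
  refine List.Perm.nodup ?_ this
  exact (List.Perm.swap _ _ _).trans ((h.typed.int_rev.symm.cons _).cons _)

theorem BT.Same.symm {B C : BT} (h : B.Same C) : C.Same B := by
  rcases h with rfl | rfl
  exacts [.inl rfl, .inr (B.rev_rev.symm)]

theorem BT.Same.wf {B C : BT} (h : B.Same C) (hB : B.WF) : C.WF := by
  rcases h with rfl | rfl
  exacts [hB, hB.rev]

theorem BT.Same.trans_rev {B C : BT} (h : B.Same C) : B.Same C.rev := by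
  rcases h with rfl | rfl
  exacts [.inr rfl, .inl B.rev_rev]

theorem BT.WF.src_ne_snk {B : BT} (h : B.WF) : B.src ≠ B.snk := by
  have := h.nodup
  simp [nodes] at this
  tauto

theorem BT.WF.sum_ends_lt {B : BT} (h : B.WF) (hN : ∀ v, Touches B.edges v → 2 * v < N) :
    B.src + B.snk < N := by
  have h1 := hN _ h.typed.touches.1
  have h2 := hN _ h.typed.touches.2
  omega

/-- Orientation is resolved here. Comparing the stored source with the wanted one shows whether a
series composition is to be turned around, which swaps its parts; the second part starts at the sink
of the first, found as the sum of the terminals minus the source. For a parallel composition both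
parts simply inherit the source. -/
theorem BRep.expands {A : ℕ → ℕ → ℕ} {i : ℕ} {B : BT} (h : BRep A i B) (hB : B.WF)
    (hN : ∀ v, Touches B.edges v → 2 * v < N) : Expands N A i B := by
  induction h with
  | edge i b u v h => exact expands_edge A i b u v h
  | ser i a b Ta Tb Ta' Tb' h ha hb hTa hTb ra rb iha ihb =>
    have wa := hTa.symm.wf hB.ser_left
    have wb := hTb.symm.wf hB.ser_right
    have na : ∀ v, Touches Ta.edges v → 2 * v < N := fun v hv =>
      hN v (by rw [BT.edges, hTa.edges, touches_add]; exact .inl hv)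
    have nb : ∀ v, Touches Tb.edges v → 2 * v < N := fun v hv =>
      hN v (by rw [BT.edges, hTb.edges, touches_add]; exact .inr hv)
    have wra := fun C hC => (iha wa na).writes (C := C) ra (by omega) (wa.sum_ends_lt na) hC
    have wrb := fun C hC => (ihb wb nb).writes (C := C) rb (by omega) (wb.sum_ends_lt nb) hC
    obtain ⟨a18, a19, -, -⟩ := ra.entry
    obtain ⟨b18, b19, -, -⟩ := rb.entry
    have ea := hTa.sum_ends
    have eb := hTb.sum_ends
    have sa := wa.sum_ends_lt na
    have sb := wb.sum_ends_lt nb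
    have hne := hB.src_ne_snk
    have hmid := hB.typed.2.2
    have hk := BT.kind_ser_le Ta' Tb'
    have hcard : (BT.ser Ta' Tb').edges.card = Ta.edges.card + Tb.edges.card := by
      rw [BT.edges, Multiset.card_add, hTa.edges, hTb.edges]
    intro Q s p C hC tabs r4 r5 r6 r9 hf hb' h0 hQ
    simp only [expand, wp_ite, wp_seq, wp_set, wp_skip]
    simp [r5, tabs, h.left, h.right, h.src, show a ≠ 0 by omega, r9,
      show (BT.ser Ta' Tb').kind ≠ 2 by omega, r6]
    rcases hC with rfl | rfl
    · simp only [BT.src, BT.body] at h0 hQ r6 ⊢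
      have e1 : Ta.src + Ta.snk - Ta'.src = Tb'.src := by omega
      simp [tabs, a18, a19, e1, sa]
      have h1 := wra Ta' hTa (BT.ser Ta' Tb').kind
      have h2 := wrb Tb' hTb (BT.ser Ta' Tb').kind
      rw [← hTa.edges] at h1
      rw [← hTb.edges] at h2
      refine expands_pair s _ p a Ta'.src b Tb'.src _ Ta' Tb' (by simp) (by simpa using r4)
        (by simpa using r6) (by simp) (by simpa using r9) (by simp) (by simp) tabs h1 h2
        (by rw [hcard, hTa.edges, hTb.edges]) hf hb' h0 hQ
    · have hk' : (BT.ser Tb'.rev Ta'.rev).kind = (BT.ser Ta' Tb').kind :=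
        BT.kind_rev (.ser Ta' Tb')
      -- The comparison of sources is reliable because source and sink differ.
      have hsr : Tb'.snk ≠ Ta'.src := fun h => hne h.symm
      simp only [BT.rev, BT.src, BT.body, hk', BT.src_rev] at h0 hQ r6 ⊢
      have e1 : Tb.src + Tb.snk - Tb'.snk = Ta'.snk := by omega
      simp [tabs, b18, b19, e1, sb, hsr, hsr.symm]
      have h1 := wrb Tb'.rev hTb.trans_rev (BT.ser Ta' Tb').kind
      have h2 := wra Ta'.rev hTa.trans_rev (BT.ser Ta' Tb').kind
      rw [← hTb.edges, ← BT.edges_rev, (BT.src_rev _).1] at h1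
      rw [← hTa.edges, ← BT.edges_rev, (BT.src_rev _).1] at h2
      refine expands_pair s _ p b Tb'.snk a Ta'.snk _ Tb'.rev Ta'.rev (by simp)
        (by simpa using r4) (by simpa using r6) (by simp) (by simpa using r9) (by simp) (by simp)
        tabs h1 h2
        (by rw [hcard, BT.edges_rev, BT.edges_rev, hTa.edges, hTb.edges, add_comm]) hf hb' h0 hQ
  | par i a b Ta Tb Ta' Tb' h ha hb hTa hTb ra rb iha ihb =>
    have wa := hTa.symm.wf hB.par_left
    have wb := hTb.symm.wf hB.par_right
    have na : ∀ v, Touches Ta.edges v → 2 * v < N := fun v hv =>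
      hN v (by rw [BT.edges, hTa.edges, touches_add]; exact .inl hv)
    have nb : ∀ v, Touches Tb.edges v → 2 * v < N := fun v hv =>
      hN v (by rw [BT.edges, hTb.edges, touches_add]; exact .inr hv)
    have wra := fun C hC => (iha wa na).writes (C := C) ra (by omega) (wa.sum_ends_lt na) hC
    have wrb := fun C hC => (ihb wb nb).writes (C := C) rb (by omega) (wb.sum_ends_lt nb) hC
    have hsrc := hB.typed.2.2
    have hcard : (BT.par Ta' Tb').edges.card = Ta.edges.card + Tb.edges.card := by
      rw [BT.edges, Multiset.card_add, hTa.edges, hTb.edges]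
    intro Q s p C hC tabs r4 r5 r6 r9 hf hb' h0 hQ
    obtain ⟨D, E, rfl, hD, hE, hDE⟩ : ∃ D E, C = .par D E ∧ Ta.Same D ∧ Tb.Same E ∧
        D.src = E.src := by
      rcases hC with rfl | rfl
      · exact ⟨_, _, rfl, hTa, hTb, hsrc.1⟩
      · exact ⟨_, _, rfl, hTa.trans_rev, hTb.trans_rev, by
          rw [(BT.src_rev _).1, (BT.src_rev _).1, hsrc.2]⟩
    simp only [BT.src, BT.body] at h0 hQ r6
    simp only [expand, wp_ite, wp_seq, wp_set, wp_skip]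
    simp [r5, tabs, h.left, h.right, show a ≠ 0 by omega, r9, BT.kind]
    have h1 := wra D hD 2
    have h2 := wrb E hE 2
    rw [← hD.edges] at h1
    rw [← hE.edges] at h2
    refine expands_pair s _ p a D.src b E.src 2 D E (by simp) (by simpa using r4)
      (by simpa using r6) (by simp) (by simpa [BT.kind] using r9) (by simp) (by simp [r6, hDE]) tabs h1 h2
      (by rw [hcard, hD.edges, hE.edges]) hf hb' h0 hQ

/-- Compute an `SP`-tree and an arrangement of a graph. -/
def treeAndArrangement : Cmd :=
  decompose ;; .set 0 (.lit 0) ;; .set 4 (.lit 0) ;;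
    pushTask (.var 3) (.get 18 (.var 3)) (.lit 3) ;; writeLoop ;; arrange

/-- Of the fuel `40 * |E|` left after the decomposition, writing uses at most `5 * |E| - 3`, and the
arrangement asks for `5 * elen + 5`, where `elen + 2 ≤ 6 * |E|`. -/
theorem treeAndArrangement_spec (n : ℕ) (es : List (ℕ × ℕ)) {a b : ℕ}
    (sp : SP (es.map fun e => s(e.1, e.2) : List (Sym2 ℕ)) a b) (hes : es ≠ [])
    (hV : ∀ v, Touches (es.map fun e => s(e.1, e.2) : List (Sym2 ℕ)) v → v < n)
    (hn : n ≤ 2 * es.length) (hN : (2 * es.length + 2) * (n * n) < N)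
    (hN' : 24 * es.length + 20 < N)
    (hQ : ∀ (t : St) (B : BT) (hB : B.WF) (l : List ℕ) (A : ℕ → ℕ),
      B.edges = (es.map fun e => s(e.1, e.2) : List (Sym2 ℕ)) →
      InnerOrder B.toSP (B.graph hB) l →
      (∀ (i : ℕ) (h : i < B.toSP.encode.length), t.arr 0 i = B.toSP.encode[i]) →
      t.arr 11 = assign A 0 ((B.graph hB).src :: (B.graph hB).snk :: l) → Q t) :
    wp N treeAndArrangement Q
      (St.init (encodeEdgeList n es) (40 * es.length + (2 * n + 5 * es.length))) := by
  rw [treeAndArrangement, wp_seq]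
  refine decompose_spec n (40 * es.length) es sp hes hV hN (by omega) fun t B wf hE h3 h3' rep hf => ?_
  have hcE : B.edges.card = es.length := by simp [hE]
  have hT := BT.represents_toSP wf
  have hel := elen_le hT
  -- No tree has kind `3`, so the task for the root writes a complete encoding.
  have henc : B.toSP.encode = B.embed 3 B.body := by
    rw [B.encode_toSP.2, BT.embed, if_neg (by have := B.kind_le; omega)]
  have hlen : (B.embed 3 B.body).length + 2 ≤ 6 * es.length := by
    rw [← henc, ← hcE]; exact hel
  have hw : ∀ v, Touches B.edges v → 2 * v < N := fun v hv => by
    rw [hE] at hv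
    have := hV v hv
    omega
  have hwr := (rep.expands wf hw).writes rep (by omega) (wf.sum_ends_lt hw) (.inl rfl) 3
  obtain ⟨e18, -, -, -⟩ := rep.entry
  rw [hcE] at hwr
  simp only [pushTask, wp_seq, wp_set, wp_put]
  simp [e18]
  refine ⟨by omega, hwr _ _ 0 (fun k h1 h2 => ?_) (by simp) (by simp) (by simp) (by simp)
    (by simp; omega) (by omega) (by simp; omega) fun u u4 hu => ?_⟩
  · simp [show k ≠ 24 by omega, show k ≠ 25 by omega, show k ≠ 26 by omega]
  rw [writeLoop]
  refine wp_while_false (by simp) (by simp [u4]) ?_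
  have hnew := hu.new
  have hlen' := hu.len
  have hfuel := hu.fuel
  simp at hnew hlen' hfuel
  have hin : ∀ (i : ℕ) (h : i < B.toSP.encode.length), u.arr 0 i = B.toSP.encode[i] := by
    rw [henc]; exact hnew
  have hel' : B.toSP.elen = (B.embed 3 B.body).length := by rw [elen, henc]
  refine arrange_spec hT u (by rw [hlen', hel']) hin (by omega) (by omega) fun v l A hl h0 h11 => ?_
  exact hQ v B wf l A hE hl (by rw [h0]; exact hin) h11

/-! ### Bounds for the second program. -/

theorem BT.Typed.touches_of_mem {B : BT} (h : B.Typed) {v : ℕ} (hv : v ∈ B.nodes) :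
    Touches B.edges v := by
  induction B with
  | edge x y => simpa [nodes, src, snk, int, edges] using hv
  | ser a b iha ihb =>
    have h1 := iha h.1
    have h2 := ihb h.2.1
    simp only [nodes, src, snk, int, List.mem_cons, List.mem_append, edges, touches_add] at *
    tauto
  | par a b iha ihb =>
    have h1 := iha h.1
    have h2 := ihb h.2.1
    simp only [nodes, src, snk, int, List.mem_cons, List.mem_append, edges, touches_add] at *
    tauto

theorem card_le_of_touches (E : Multiset (Sym2 ℕ)) (V : Finset ℕ) (h : ∀ v ∈ V, Touches E v) :
    V.card ≤ 2 * E.card := by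
  classical
  induction E using Multiset.induction generalizing V with
  | empty =>
    rw [Finset.eq_empty_of_forall_notMem fun v hv => touches_zero v (h v hv)]
    simp
  | cons e E ih =>
    obtain ⟨x, y⟩ := e
    have hsub : V ⊆ V.filter (Touches E) ∪ {x, y} := fun v hv => by
      have := h v hv
      rw [touches_cons] at this
      simp only [Finset.mem_union, Finset.mem_filter, Finset.mem_insert, Finset.mem_singleton]
      rcases this with h1 | h1
      · exact .inr (Sym2.mem_iff.1 h1)
      · exact .inl ⟨hv, h1⟩
    have h1 := ih (V.filter (Touches E)) fun v hv => (Finset.mem_filter.1 hv).2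
    have h2 := (Finset.card_le_card hsub).trans (Finset.card_union_le _ _)
    have h3 : ({x, y} : Finset ℕ).card ≤ 2 := Finset.card_le_two
    rw [Multiset.card_cons]
    omega

/-- The largest values are sums of squares of neighbours, of order `|E| * n²`. Since `n ≤ 2 * |E|`,
this is cubic, and arrays of length `(L + 10) ^ 4` suffice. -/
theorem graph_size_bounds (m n L : ℕ) (hn : n ≤ 2 * m) (hL : L = 2 * m + 2) :
    (2 * m + 2) * (n * n) < size L ∧ 24 * m + 20 < size L := by
  subst hL
  have h1 : (2 * m + 2) * (n * n) ≤ (2 * m + 2) * ((2 * m) * (2 * m)) :=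
    Nat.mul_le_mul_left _ (Nat.mul_le_mul hn hn)
  have h2 : size (2 * m + 2) = (2 * m + 12) * ((2 * m + 12) * ((2 * m + 12) * (2 * m + 12))) := by
    unfold size; ring
  have h3 : 12 * ((2 * m + 12) * ((2 * m + 12) * (2 * m + 12))) ≤ size (2 * m + 2) := by
    rw [h2]; exact Nat.mul_le_mul_right _ (by omega)
  have h4 : 12 * (12 * (2 * m + 12)) ≤ (2 * m + 12) * ((2 * m + 12) * (2 * m + 12)) :=
    Nat.mul_le_mul (by omega) (Nat.mul_le_mul (by omega) le_rfl)
  have h5 : (2 * m + 2) * ((2 * m) * (2 * m)) ≤ (2 * m + 12) * ((2 * m + 12) * (2 * m + 12)) :=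
    Nat.mul_le_mul (by omega) (Nat.mul_le_mul (by omega) (by omega))
  omega

/-- The program runs in linear time; the logarithm enters only through `log m ≥ log 2 > 1 / 2`. -/
theorem le_mul_log (m : ℕ) (hm : 2 ≤ m) : (m : ℝ) ≤ 2 * (m * Real.log m) := by
  have h1 : Real.log 2 ≤ Real.log m := Real.log_le_log (by norm_num) (by exact_mod_cast hm)
  have h2 := Real.log_two_gt_d9
  have h3 : (0 : ℝ) ≤ m := Nat.cast_nonneg _
  nlinarith

theorem length_encodeEdgeList (n : ℕ) (es : List (ℕ × ℕ)) :
    (encodeEdgeList n es).length = 2 * es.length + 2 := by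
  have : (es.map fun e => [e.1, e.2]).flatten.length = 2 * es.length := by
    induction es with
    | nil => rfl
    | cons e es ih => simp [ih]; omega
  simp [encodeEdgeList, this]

theorem exists_prog_of_graph : ∃ (prog : RAM.Prog) (C k : ℕ),
    ∀ (n : ℕ) (G : MGraph ℕ) (es : List (ℕ × ℕ)),
      G.verts = Finset.range n → G.IsSeriesParallel → G.IsEdgeList es →
      ∃ (t : ℕ) (σ : RAM.State) (T : SPTree ℕ) (π : LinearArrangement G),
        RAM.Exec ((G.edges.card + 2) ^ k) prog (RAM.init (encodeEdgeList n es)) t σ ∧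
        (2 ≤ G.edges.card → (t : ℝ) ≤ C * (G.edges.card * Real.log G.edges.card)) ∧
        T.IsMinimalSPTreeOf G ∧ σ.HoldsTree T ∧
        IsSPGAAArrangement T π ∧ σ.HoldsArrangement π := by
  -- As `n ≤ 2 * |E|`, one plus the fuel `40 * |E| + (2 * n + 5 * |E|)` is at most `50 * |E|`; the
  -- factor `2` comes from `le_mul_log`.
  refine ⟨treeAndArrangement.program 11, (treeAndArrangement.cost + 7) * 50 * 2, 20,
    fun n G es hn ⟨X, hX, hXsp⟩ hes => ?_⟩
  obtain ⟨sp, touch⟩ := spGraph_of_isTTSP hXsp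
  rw [hX] at sp touch
  have hE : G.edges = (es.map fun e => s(e.1, e.2) : List (Sym2 ℕ)) := hes
  have hm : G.edges.card = es.length := by rw [hE]; simp
  have hmem : ∀ v, v < n ↔ v ∈ G.verts := fun v => by rw [hn, Finset.mem_range]
  have hV : ∀ v, Touches G.edges v → v < n := fun v ⟨e, he, hv⟩ => (hmem v).2 (G.incidence e he v hv)
  have hn' : n ≤ 2 * es.length := by
    have := card_le_of_touches _ _ touch
    rwa [hn, Finset.card_range, hm] at this
  have hne : es ≠ [] := by
    rintro rfl
    obtain ⟨-, ⟨e, he, -⟩, -⟩ := sp.basic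
    rw [hE] at he
    simp at he
  have hlen := length_encodeEdgeList n es
  have hpos := List.length_pos_iff.2 hne
  obtain ⟨b1, b2⟩ := graph_size_bounds es.length n _ hn' hlen
  rw [hE] at sp hV
  obtain ⟨s', hrun, B, wf, l, A, hB, hl, henc, harr⟩ :
      wp (size (encodeEdgeList n es).length) treeAndArrangement (fun t => ∃ (B : BT) (wf : B.WF) (l : List ℕ) (A : ℕ → ℕ),
        B.edges = (es.map fun e => s(e.1, e.2) : List (Sym2 ℕ)) ∧
        InnerOrder B.toSP (B.graph wf) l ∧
        (∀ (i : ℕ) (h : i < B.toSP.encode.length), t.arr 0 i = B.toSP.encode[i]) ∧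
        t.arr 11 = assign A 0 ((B.graph wf).src :: (B.graph wf).snk :: l))
      (St.init (encodeEdgeList n es) (40 * es.length + (2 * n + 5 * es.length))) :=
    treeAndArrangement_spec n es sp hne hV hn' b1 b2
      fun t B wf l A h1 h2 h3 h4 => ⟨B, wf, l, A, h1, h2, h3, h4⟩
  -- Equal edges suffice: in both graphs every node is an end of some edge.
  have hG : (B.graph wf).toMGraph = G := by
    refine MGraph.ext ?_ (hB.trans hE.symm)
    ext v
    rw [BT.mem_graph_verts]
    refine ⟨fun hv => (hmem v).1 (hV v ?_), fun hv => ?_⟩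
    · rw [← hB]; exact wf.typed.touches_of_mem hv
    · obtain ⟨e, he, hve⟩ := touch v hv
      rw [hE, ← hB] at he
      exact wf.typed.incidence e he v hve
  have hel := elen_le (BT.represents_toSP wf)
  rw [hG, hm] at hel
  have hin : ∀ x ∈ encodeEdgeList n es, x < size (encodeEdgeList n es).length := by
    intro x hx
    simp only [encodeEdgeList, List.mem_cons, List.mem_flatten, List.mem_map] at hx
    rcases hx with rfl | rfl | ⟨_, ⟨e, he, rfl⟩, hx⟩
    · omega
    · omega
    · have hlt : x < n := by
        refine hV x ⟨s(e.1, e.2), ?_, ?_⟩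
        · exact List.mem_map_of_mem he
        · simpa using hx
      omega
  obtain ⟨t, σ, hex, ht, hout, htree⟩ := Cmd.program_correct treeAndArrangement 11 (by omega)
    (encodeEdgeList n es) _ ((G.edges.card + 2) ^ 20) s'
    (size_bound _ _ (by omega) (by omega)) hin hrun
  subst hG
  obtain ⟨π, hπ, hval⟩ := exists_arrangement hl A
  refine ⟨t, σ, B.toSP, π, hex, fun h2 => ?_, ⟨⟨_, rfl, BT.represents_toSP wf⟩, B.minimal_toSP⟩,
    fun i hi => ?_, hπ, fun v => ?_⟩
  · have h3 : t ≤ (treeAndArrangement.cost + 7) * 50 * (B.graph wf).edges.card := by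
      rw [mul_assoc]
      exact ht.trans (Nat.mul_le_mul_left _ (by omega))
    have h4 : (t : ℝ) ≤ ((treeAndArrangement.cost + 7) * 50 : ℕ) * (B.graph wf).edges.card := by
      exact_mod_cast h3
    have h5 := le_mul_log _ h2
    refine h4.trans ?_
    rw [Nat.cast_mul _ 2, mul_assoc]
    exact mul_le_mul_of_nonneg_left (by simpa using h5) (Nat.cast_nonneg _)
  · rw [htree i (by change i < B.toSP.elen at hi; omega), henc]
  · have hv := (hmem v).2 v.2
    rw [hout v (by omega), harr, hval]

end Imp

theorem mainTheorem4 :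
    -- A minimal SP-tree `T` of `G` is given: time `O(|E|)`.
    (∃ (prog : RAM.Prog) (C k : ℕ),
      ∀ (n : ℕ) (G : MGraph ℕ) (T : SPTree ℕ),
        G.verts = Finset.range n → G.IsSeriesParallel → T.IsMinimalSPTreeOf G →
        ∃ (t : ℕ) (σ : RAM.State) (π : LinearArrangement G),
          RAM.Exec ((G.edges.card + 2) ^ k) prog (RAM.init T.encode) t σ ∧
          t ≤ C * G.edges.card ∧
          IsSPGAAArrangement T π ∧ σ.HoldsArrangement π) ∧
    -- Only `G` is given: time `O(|E| log |E|)`, including the computation of a minimal SP-tree.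
    (∃ (prog : RAM.Prog) (C k : ℕ),
      ∀ (n : ℕ) (G : MGraph ℕ) (es : List (ℕ × ℕ)),
        G.verts = Finset.range n → G.IsSeriesParallel → G.IsEdgeList es →
        ∃ (t : ℕ) (σ : RAM.State) (T : SPTree ℕ) (π : LinearArrangement G),
          RAM.Exec ((G.edges.card + 2) ^ k) prog (RAM.init (encodeEdgeList n es)) t σ ∧
          (2 ≤ G.edges.card → (t : ℝ) ≤ C * (G.edges.card * Real.log G.edges.card)) ∧
          T.IsMinimalSPTreeOf G ∧ σ.HoldsTree T ∧
          IsSPGAAArrangement T π ∧ σ.HoldsArrangement π) := by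
  exact ⟨Imp.exists_prog_of_tree, Imp.exists_prog_of_graph⟩
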